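/- **Setting.** For multi-indices, $|\alpha|=\sum_i\alpha_i$ and $\alpha!=\prod_i\alpha_i!$. For $s_1,s_2,\sigma_1,\sigma_2>0$ let $\mathcal S^{\sigma_1,\sigma_2}_{s_1,s_2}(\mathbf R^{d_1+d_2})$ (respectively $\Sigma^{\sigma_1,\sigma_2}_{s_1,s_2}(\mathbf R^{d_1+d_2})$) be the space of all $F\in C^\infty(\mathbf R^{d_1+d_2})$ such that for some $h>0$ (respectively for every $h>0$) $$\sup\frac{|x_1^{\alpha_1}x_2^{\alpha_2}\partial_{x_1}^{\beta_1}\partial_{x_2}^{\beta_2}F(x_1,x_2)|}{h^{|\alpha_1|+|\alpha_2|+|\beta_1|+|\beta_2|}\,\alpha_1!^{s_1}\alpha_2!^{s_2}\beta_1!^{\sigma_1}\beta_2!^{\sigma_2}}<\infty ,$$ with the inductive (respectively projective) limit topology in $h$; the topological duals are denoted by a prime. $\mathcal S_t^\tau(\mathbf R^d)$ and $\Sigma_t^\tau(\mathbf R^d)$ are the corresponding one-variable spaces. If $a\in(\mathcal S^{\tau,t}_{t,\tau})'(\mathbf R^{2d})$ and $A$ is a real $d\times d$ matrix, then $\operatorname{Op}_A(a)$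 is the operator from $\mathcal S_t^\tau(\mathbf R^d)$ to $(\mathcal S_t^\tau)'(\mathbf R^d)$ with distribution kernel $$K_{a,A}(x,y)=(2\pi)^{-d}\int_{\mathbf R^d}a(x-A(x-y),\xi)\,e^{i\langle x-y,\xi\rangle}\,d\xi$$ (interpreted by duality), and similarly with $\Sigma$ in place of $\mathcal S$. For $f\in C^\infty(\mathbf R^{2d})$ and a positive function $\omega$ on $\mathbf R^{2d}$ put $$\|f\|_{h,\omega}=\sup_{\alpha,\beta,x,\xi}\frac{|\partial_x^\alpha\partial_\xi^\beta f(x,\xi)|}{h^{|\alpha|+|\beta|}\alpha!^{\sigma}\beta!^{s}\,\omega(x,\xi)},\qquad \omega_r(x,\xi)=e^{r(|x|^{1/s}+|\xi|^{1/\sigma})}.$$ Then $\Gamma^{\sigma,s}_{s,\sigma;0}$ is the set of $f\in C^\infty(\mathbf R^{2d})$ such that, for some $h>0$, $\|f\|_{h,\omega_r}<\infty$ for every $r>0$; $\Gamma^{\sigma,s;0}_{s,\sigma}$ the set of those such that, for some $r>0$, $\|f\|_{h,\omega_r}<\infty$ for every $h>0$; $\Gamma^{\sigma,s;0}_{s,\sigma;0}$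 the set of those with $\|f\|_{h,\omega_r}<\infty$ for all $h,r>0$; and $\Gamma^{\sigma,s;0}_{(\omega)}$ the set of those with $\|f\|_{h,\omega}<\infty$ for every $h>0$. Finally, $\mathscr P_{s,\sigma}(\mathbf R^{2d})$ is the set of all everywhere positive $\omega$ with $\omega,1/\omega\in L^\infty_{\rm loc}$ which are even, satisfy $\omega(X+Y)\le C\omega(X)\omega(Y)$ for some constant $C$, and satisfy $C^{-1}\omega_{-r}\le\omega\le C\,\omega_r$ for some $C,r>0$. **Theorem.** Let $s,s_1,s_2,\sigma,\sigma_1,\sigma_2>0$ be such that $$s+\sigma\ge1,\quad s_1+\sigma_1\ge1,\quad s_2+\sigma_2\ge1,\quad s_2\le s_1,\quad \sigma_1\le\sigma_2,$$ let $A,B$ be real $d\times d$ matrices and $\omega\in\mathscr P_{s,\sigma}(\mathbf R^{2d})$. Let $t,\tau>0$ with $t+\tau\ge1$, let $E$ be one of the spaces $\mathcal S^{\tau,t}_{t,\tau}(\mathbf R^{2d})$ and $\Sigma^{\tau,t}_{t,\tau}(\mathbf R^{2d})$, and let $a,b\in E'$ be such that $\operatorname{Op}_A(a)=\operatorname{Op}_B(b)$.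 Here $a$ is said to belong to a set of functions if it is given by integration against some function $f$ of the set (with $fg\in L^1$ for every $g\in E$), and to belong to the dual $F'$ of another Gelfand–Shilov space $F$ if some element of $F'$ coincides with $a$ on $E\cap F$. Then: 1. $a\in\mathcal S^{\sigma_1,s_2}_{s_1,\sigma_2}(\mathbf R^{2d})$ if and only if $b\in\mathcal S^{\sigma_1,s_2}_{s_1,\sigma_2}(\mathbf R^{2d})$, and $a\in(\mathcal S^{\sigma_1,s_2}_{s_1,\sigma_2})'(\mathbf R^{2d})$ if and only if $b\in(\mathcal S^{\sigma_1,s_2}_{s_1,\sigma_2})'(\mathbf R^{2d})$; 2. $a\in\Sigma^{\sigma_1,s_2}_{s_1,\sigma_2}(\mathbf R^{2d})$ if and only if $b\in\Sigma^{\sigma_1,s_2}_{s_1,\sigma_2}(\mathbf R^{2d})$, and $a\in(\Sigma^{\sigma_1,s_2}_{s_1,\sigma_2})'(\mathbf R^{2d})$ if and only if $b\in(\Sigma^{\sigma_1,s_2}_{s_1,\sigma_2})'(\mathbf R^{2d})$; 3. if $E\subseteq\mathcal S^{\sigma,s}_{s,\sigma}(\mathbf R^{2d})$, then $a\in\Gamma^{\sigma,s}_{s,\sigma;0}$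 if and only if $b\in\Gamma^{\sigma,s}_{s,\sigma;0}$, and, if in addition $(s,\sigma)\ne(\frac12,\frac12)$, then $a\in\Gamma^{\sigma,s;0}_{s,\sigma;0}$ if and only if $b\in\Gamma^{\sigma,s;0}_{s,\sigma;0}$; if $(s,\sigma)\ne(\frac12,\frac12)$ and either $E\subseteq\Sigma^{\sigma,s}_{s,\sigma}(\mathbf R^{2d})$ or $E=\mathcal S^{\sigma,s}_{s,\sigma}(\mathbf R^{2d})$, then $a\in\Gamma^{\sigma,s;0}_{s,\sigma}$ if and only if $b\in\Gamma^{\sigma,s;0}_{s,\sigma}$; 4. if $E\subseteq\Sigma^{\sigma,s}_{s,\sigma}(\mathbf R^{2d})$ or $E=\mathcal S^{\sigma,s}_{s,\sigma}(\mathbf R^{2d})$, then $a\in\Gamma^{\sigma,s;0}_{(\omega)}$ if and only if $b\in\Gamma^{\sigma,s;0}_{(\omega)}$. -/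

import Mathlib

open MeasureTheory
open scoped ContDiff ENNReal NNReal

noncomputable section

namespace GelfandShilov

/-- The Euclidean space `ℝ^d`. -/
abbrev V (d : ℕ) : Type := EuclideanSpace ℝ (Fin d)

/-- The standard basis vectors of `ℝ^d`. -/
def stdVec {d : ℕ} (i : Fin d) : V d := EuclideanSpace.single i 1

/-- Length `|α|` of a multi-index. -/
def mlen {d : ℕ} (α : Fin d → ℕ) : ℕ := ∑ i, α i

/-- Factorial `α!` of a multi-index, as a real number. -/
def mfact {d : ℕ} (α : Fin d → ℕ) : ℝ := ∏ i, ((α i).factorial : ℝ)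

/-- The monomial `x^α`. -/
def mpow {d : ℕ} (x : V d) (α : Fin d → ℕ) : ℝ := ∏ i, x i ^ α i

section Derivatives

variable {X : Type*} [NormedAddCommGroup X] [NormedSpace ℝ X]

/-- The derivative of `f` in the direction `v`. -/
def dirDeriv (v : X) (f : X → ℂ) : X → ℂ := fun x => fderiv ℝ f x v

/-- The iterated derivative `∂_{e 0}^{α 0} ⋯ ∂_{e (d-1)}^{α (d-1)} f`. -/
def multiDeriv {d : ℕ} (e : Fin d → X) (α : Fin d → ℕ) (f : X → ℂ) : X → ℂ :=
  (List.finRange d).foldr (fun i g => (dirDeriv (e i))^[α i] g) f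

theorem dirDeriv_smooth {v : X} {f : X → ℂ} (hf : ContDiff ℝ ∞ f) :
    ContDiff ℝ ∞ (dirDeriv v f) :=
  (hf.fderiv_right (m := ∞) (by simp)).clm_apply contDiff_const

theorem dirDeriv_add {v : X} {f g : X → ℂ} (hf : ContDiff ℝ ∞ f) (hg : ContDiff ℝ ∞ g) :
    dirDeriv v (f + g) = dirDeriv v f + dirDeriv v g := by
  funext x
  simp [dirDeriv, fderiv_add (hf.differentiable (by simp) x) (hg.differentiable (by simp) x)]

theorem dirDeriv_smul {v : X} {f : X → ℂ} (c : ℂ) (hf : ContDiff ℝ ∞ f) :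
    dirDeriv v (c • f) = c • dirDeriv v f := by
  funext x
  simp [dirDeriv, fderiv_const_smul (hf.differentiable (by simp) x) c]

theorem iterDeriv_smooth {v : X} {f : X → ℂ} (hf : ContDiff ℝ ∞ f) (n : ℕ) :
    ContDiff ℝ ∞ ((dirDeriv v)^[n] f) := by
  induction n with
  | zero => simpa using hf
  | succ n ih => rw [Function.iterate_succ_apply']; exact dirDeriv_smooth ih

theorem iterDeriv_add {v : X} {f g : X → ℂ} (hf : ContDiff ℝ ∞ f) (hg : ContDiff ℝ ∞ g)
    (n : ℕ) : (dirDeriv v)^[n] (f + g) = (dirDeriv v)^[n] f + (dirDeriv v)^[n] g := by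
  induction n with
  | zero => simp
  | succ n ih =>
    simp only [Function.iterate_succ_apply', ih]
    exact dirDeriv_add (iterDeriv_smooth hf n) (iterDeriv_smooth hg n)

theorem iterDeriv_smul {v : X} {f : X → ℂ} (c : ℂ) (hf : ContDiff ℝ ∞ f) (n : ℕ) :
    (dirDeriv v)^[n] (c • f) = c • (dirDeriv v)^[n] f := by
  induction n with
  | zero => simp
  | succ n ih =>
    simp only [Function.iterate_succ_apply', ih]
    exact dirDeriv_smul c (iterDeriv_smooth hf n)

theorem multiDeriv_smooth {d : ℕ} (e : Fin d → X) (α : Fin d → ℕ) {f : X → ℂ}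
    (hf : ContDiff ℝ ∞ f) : ContDiff ℝ ∞ (multiDeriv e α f) := by
  unfold multiDeriv
  induction List.finRange d with
  | nil => simpa using hf
  | cons i l ih => exact iterDeriv_smooth ih _

theorem multiDeriv_add {d : ℕ} (e : Fin d → X) (α : Fin d → ℕ) {f g : X → ℂ}
    (hf : ContDiff ℝ ∞ f) (hg : ContDiff ℝ ∞ g) :
    multiDeriv e α (f + g) = multiDeriv e α f + multiDeriv e α g := by
  have key : ∀ l : List (Fin d), ∀ u : X → ℂ, ContDiff ℝ ∞ u → ContDiff ℝ ∞
      (l.foldr (fun i g => (dirDeriv (e i))^[α i] g) u) := by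
    intro l u hu
    induction l with
    | nil => simpa using hu
    | cons i l ih => exact iterDeriv_smooth ih _
  unfold multiDeriv
  induction List.finRange d with
  | nil => simp
  | cons i l ih =>
    simp only [List.foldr_cons, ih]
    exact iterDeriv_add (key l f hf) (key l g hg) _

theorem multiDeriv_smul {d : ℕ} (e : Fin d → X) (α : Fin d → ℕ) {f : X → ℂ} (c : ℂ)
    (hf : ContDiff ℝ ∞ f) : multiDeriv e α (c • f) = c • multiDeriv e α f := by
  have key : ∀ l : List (Fin d), ∀ u : X → ℂ, ContDiff ℝ ∞ u → ContDiff ℝ ∞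
      (l.foldr (fun i g => (dirDeriv (e i))^[α i] g) u) := by
    intro l u hu
    induction l with
    | nil => simpa using hu
    | cons i l ih => exact iterDeriv_smooth ih _
  unfold multiDeriv
  induction List.finRange d with
  | nil => simp
  | cons i l ih =>
    simp only [List.foldr_cons, ih]
    exact iterDeriv_smul c (key l f hf) _

end Derivatives

/-- `∂^β f` for functions on `ℝ^d`. -/
def deriv₁ {d : ℕ} (β : Fin d → ℕ) (f : V d → ℂ) : V d → ℂ := multiDeriv stdVec β f

/-- `∂_{x₁}^{β₁} ∂_{x₂}^{β₂} F` for functions on `ℝ^{d₁} × ℝ^{d₂}`. -/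
def deriv₂ {d₁ d₂ : ℕ} (β₁ : Fin d₁ → ℕ) (β₂ : Fin d₂ → ℕ) (F : V d₁ × V d₂ → ℂ) :
    V d₁ × V d₂ → ℂ :=
  multiDeriv (fun i => (stdVec i, 0)) β₁ (multiDeriv (fun j => (0, stdVec j)) β₂ F)

theorem deriv₂_add {d₁ d₂ : ℕ} (β₁ : Fin d₁ → ℕ) (β₂ : Fin d₂ → ℕ) {F G : V d₁ × V d₂ → ℂ}
    (hF : ContDiff ℝ ∞ F) (hG : ContDiff ℝ ∞ G) :
    deriv₂ β₁ β₂ (F + G) = deriv₂ β₁ β₂ F + deriv₂ β₁ β₂ G := by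
  unfold deriv₂
  rw [multiDeriv_add _ _ hF hG,
    multiDeriv_add _ _ (multiDeriv_smooth _ _ hF) (multiDeriv_smooth _ _ hG)]

theorem deriv₂_smul {d₁ d₂ : ℕ} (β₁ : Fin d₁ → ℕ) (β₂ : Fin d₂ → ℕ) (c : ℂ)
    {F : V d₁ × V d₂ → ℂ} (hF : ContDiff ℝ ∞ F) :
    deriv₂ β₁ β₂ (c • F) = c • deriv₂ β₁ β₂ F := by
  unfold deriv₂
  rw [multiDeriv_smul _ _ c hF, multiDeriv_smul _ _ c (multiDeriv_smooth _ _ hF)]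

/-- The norm of the Banach space `𝒮_{s;h}^σ(ℝ^d)`, with values in `[0, ∞]`:
`sup |x^α ∂^β f(x)| / (h^{|α|+|β|} α!^s β!^σ)`. -/
def gsNorm₁ {d : ℕ} (s σ h : ℝ) (f : V d → ℂ) : ℝ≥0∞ :=
  ⨆ (α : Fin d → ℕ) (β : Fin d → ℕ) (x : V d),
    ENNReal.ofReal (|mpow x α| * ‖deriv₁ β f x‖ /
      (h ^ (mlen α + mlen β) * mfact α ^ s * mfact β ^ σ))

/-- The norm, with values in `[0, ∞]`, of the Banach spaces defining the two-variable
Gelfand-Shilov spaces `𝒮_{s₁,s₂}^{σ₁,σ₂}(ℝ^{d₁+d₂})` and `Σ_{s₁,s₂}^{σ₁,σ₂}(ℝ^{d₁+d₂})`. -/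
def gsNorm₂ {d₁ d₂ : ℕ} (s₁ s₂ σ₁ σ₂ h : ℝ) (F : V d₁ × V d₂ → ℂ) : ℝ≥0∞ :=
  ⨆ (α₁ : Fin d₁ → ℕ) (α₂ : Fin d₂ → ℕ) (β₁ : Fin d₁ → ℕ) (β₂ : Fin d₂ → ℕ)
    (x : V d₁ × V d₂),
    ENNReal.ofReal (|mpow x.1 α₁ * mpow x.2 α₂| * ‖deriv₂ β₁ β₂ F x‖ /
      (h ^ (mlen α₁ + mlen α₂ + mlen β₁ + mlen β₂) *
        mfact α₁ ^ s₁ * mfact α₂ ^ s₂ * mfact β₁ ^ σ₁ * mfact β₂ ^ σ₂))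

theorem mfact_pos {d : ℕ} (α : Fin d → ℕ) : 0 < mfact α :=
  Finset.prod_pos fun i _ => by exact_mod_cast (α i).factorial_pos

theorem ofReal_quot_add_le {m D : ℝ} (hm : 0 ≤ m) (hD : 0 ≤ D) (z w : ℂ) :
    ENNReal.ofReal (m * ‖z + w‖ / D) ≤
      ENNReal.ofReal (m * ‖z‖ / D) + ENNReal.ofReal (m * ‖w‖ / D) := by
  rw [← ENNReal.ofReal_add (by positivity) (by positivity), ← add_div, ← mul_add]
  exact ENNReal.ofReal_le_ofReal (by gcongr; exact norm_add_le z w)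

theorem ofReal_quot_smul_le {m D : ℝ} (c z : ℂ) :
    ENNReal.ofReal (m * ‖c • z‖ / D) ≤ ‖c‖ₑ * ENNReal.ofReal (m * ‖z‖ / D) := by
  rw [← ofReal_norm c, ← ENNReal.ofReal_mul (norm_nonneg c), norm_smul]
  exact ENNReal.ofReal_le_ofReal (le_of_eq (by ring))

theorem gsNorm₁_add_le {d : ℕ} {s σ h : ℝ} (hh : 0 < h) {f g : V d → ℂ}
    (hf : ContDiff ℝ ∞ f) (hg : ContDiff ℝ ∞ g) :
    gsNorm₁ s σ h (f + g) ≤ gsNorm₁ s σ h f + gsNorm₁ s σ h g := by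
  refine iSup_le fun α => iSup_le fun β => iSup_le fun x => ?_
  have h1 := mfact_pos α
  have h2 := mfact_pos β
  have e : deriv₁ β (f + g) x = deriv₁ β f x + deriv₁ β g x := by
    simp [deriv₁, multiDeriv_add _ _ hf hg]
  rw [e]
  refine (ofReal_quot_add_le (abs_nonneg _) (by positivity) _ _).trans (add_le_add ?_ ?_)
  · exact le_iSup_of_le α (le_iSup_of_le β (le_iSup_of_le x le_rfl))
  · exact le_iSup_of_le α (le_iSup_of_le β (le_iSup_of_le x le_rfl))

theorem gsNorm₁_smul_le {d : ℕ} {s σ h : ℝ} (c : ℂ) {f : V d → ℂ} (hf : ContDiff ℝ ∞ f) :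
    gsNorm₁ s σ h (c • f) ≤ ‖c‖ₑ * gsNorm₁ s σ h f := by
  refine iSup_le fun α => iSup_le fun β => iSup_le fun x => ?_
  have e : deriv₁ β (c • f) x = c • deriv₁ β f x := by
    simp [deriv₁, multiDeriv_smul _ _ c hf]
  rw [e]
  refine (ofReal_quot_smul_le _ _).trans (mul_le_mul_right ?_ _)
  exact le_iSup_of_le α (le_iSup_of_le β (le_iSup_of_le x le_rfl))

theorem gsNorm₂_add_le {d₁ d₂ : ℕ} {s₁ s₂ σ₁ σ₂ h : ℝ} (hh : 0 < h) {F G : V d₁ × V d₂ → ℂ}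
    (hF : ContDiff ℝ ∞ F) (hG : ContDiff ℝ ∞ G) :
    gsNorm₂ s₁ s₂ σ₁ σ₂ h (F + G) ≤ gsNorm₂ s₁ s₂ σ₁ σ₂ h F + gsNorm₂ s₁ s₂ σ₁ σ₂ h G := by
  refine iSup_le fun α₁ => iSup_le fun α₂ => iSup_le fun β₁ => iSup_le fun β₂ =>
    iSup_le fun x => ?_
  have h1 := mfact_pos α₁
  have h2 := mfact_pos α₂
  have h3 := mfact_pos β₁
  have h4 := mfact_pos β₂
  rw [deriv₂_add _ _ hF hG, Pi.add_apply]
  refine (ofReal_quot_add_le (abs_nonneg _) (by positivity) _ _).trans (add_le_add ?_ ?_)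
  · exact le_iSup_of_le α₁ (le_iSup_of_le α₂ (le_iSup_of_le β₁ (le_iSup_of_le β₂
      (le_iSup_of_le x le_rfl))))
  · exact le_iSup_of_le α₁ (le_iSup_of_le α₂ (le_iSup_of_le β₁ (le_iSup_of_le β₂
      (le_iSup_of_le x le_rfl))))

theorem gsNorm₂_smul_le {d₁ d₂ : ℕ} {s₁ s₂ σ₁ σ₂ h : ℝ} (c : ℂ) {F : V d₁ × V d₂ → ℂ}
    (hF : ContDiff ℝ ∞ F) :
    gsNorm₂ s₁ s₂ σ₁ σ₂ h (c • F) ≤ ‖c‖ₑ * gsNorm₂ s₁ s₂ σ₁ σ₂ h F := by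
  refine iSup_le fun α₁ => iSup_le fun α₂ => iSup_le fun β₁ => iSup_le fun β₂ =>
    iSup_le fun x => ?_
  rw [deriv₂_smul _ _ c hF, Pi.smul_apply]
  refine (ofReal_quot_smul_le _ _).trans (mul_le_mul_right ?_ _)
  exact le_iSup_of_le α₁ (le_iSup_of_le α₂ (le_iSup_of_le β₁ (le_iSup_of_le β₂
      (le_iSup_of_le x le_rfl))))

theorem gsNorm₁_mono {d : ℕ} {s σ h k : ℝ} (hh : 0 < h) (hk : h ≤ k) (f : V d → ℂ) :
    gsNorm₁ s σ k f ≤ gsNorm₁ s σ h f := by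
  refine iSup_mono fun α => iSup_mono fun β => iSup_mono fun x => ?_
  have h1 := mfact_pos α
  have h2 := mfact_pos β
  exact ENNReal.ofReal_le_ofReal (by gcongr)

theorem gsNorm₂_mono {d₁ d₂ : ℕ} {s₁ s₂ σ₁ σ₂ h k : ℝ} (hh : 0 < h) (hk : h ≤ k)
    (F : V d₁ × V d₂ → ℂ) : gsNorm₂ s₁ s₂ σ₁ σ₂ k F ≤ gsNorm₂ s₁ s₂ σ₁ σ₂ h F := by
  refine iSup_mono fun α₁ => iSup_mono fun α₂ => iSup_mono fun β₁ => iSup_mono fun β₂ =>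
    iSup_mono fun x => ?_
  have h1 := mfact_pos α₁
  have h2 := mfact_pos α₂
  have h3 := mfact_pos β₁
  have h4 := mfact_pos β₂
  exact ENNReal.ofReal_le_ofReal (by gcongr)

theorem gsNorm₁_zero {d : ℕ} (s σ h : ℝ) : gsNorm₁ s σ h (0 : V d → ℂ) = 0 := by
  have := gsNorm₁_smul_le (s := s) (σ := σ) (h := h) 0 (f := (0 : V d → ℂ)) contDiff_const
  simpa using this

theorem gsNorm₂_zero {d₁ d₂ : ℕ} (s₁ s₂ σ₁ σ₂ h : ℝ) :
    gsNorm₂ s₁ s₂ σ₁ σ₂ h (0 : V d₁ × V d₂ → ℂ) = 0 := by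
  have := gsNorm₂_smul_le (s₁ := s₁) (s₂ := s₂) (σ₁ := σ₁) (σ₂ := σ₂) (h := h) 0
    (F := (0 : V d₁ × V d₂ → ℂ)) contDiff_const
  simpa using this

/-- The two kinds of Gelfand-Shilov spaces: `roumieu` for the spaces `𝒮` (estimates for some
`h > 0`), `beurling` for the spaces `Σ` (estimates for every `h > 0`). -/
inductive Kind
  | roumieu
  | beurling

/-- The Gelfand-Shilov spaces `𝒮_s^σ(ℝ^d)` (`roumieu`) and `Σ_s^σ(ℝ^d)` (`beurling`). -/
def GS₁ (κ : Kind) (s σ : ℝ) (d : ℕ) : Submodule ℂ (V d → ℂ) where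
  carrier := {f | ContDiff ℝ ∞ f ∧ match κ with
    | .roumieu => ∃ h : ℝ, 0 < h ∧ gsNorm₁ s σ h f < ⊤
    | .beurling => ∀ h : ℝ, 0 < h → gsNorm₁ s σ h f < ⊤}
  zero_mem' := by
    refine ⟨contDiff_const, ?_⟩
    cases κ
    · exact ⟨1, one_pos, by simp [gsNorm₁_zero]⟩
    · exact fun h _ => by simp [gsNorm₁_zero]
  add_mem' := by
    rintro f g ⟨hf, hf'⟩ ⟨hg, hg'⟩
    refine ⟨hf.add hg, ?_⟩
    cases κ
    · obtain ⟨h, hh, H⟩ := hf'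
      obtain ⟨k, hk, K⟩ := hg'
      refine ⟨max h k, by positivity, (gsNorm₁_add_le (by positivity) hf hg).trans_lt ?_⟩
      exact ENNReal.add_lt_top.2 ⟨(gsNorm₁_mono hh (le_max_left _ _) f).trans_lt H,
        (gsNorm₁_mono hk (le_max_right _ _) g).trans_lt K⟩
    · exact fun h hh => (gsNorm₁_add_le hh hf hg).trans_lt
        (ENNReal.add_lt_top.2 ⟨hf' h hh, hg' h hh⟩)
  smul_mem' := by
    rintro c f ⟨hf, hf'⟩
    refine ⟨hf.const_smul c, ?_⟩
    cases κ
    · obtain ⟨h, hh, H⟩ := hf'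
      exact ⟨h, hh, (gsNorm₁_smul_le c hf).trans_lt (ENNReal.mul_lt_top enorm_lt_top H)⟩
    · exact fun h hh => (gsNorm₁_smul_le c hf).trans_lt
        (ENNReal.mul_lt_top enorm_lt_top (hf' h hh))

/-- The Gelfand-Shilov spaces `𝒮_{s₁,s₂}^{σ₁,σ₂}(ℝ^{d₁+d₂})` (`roumieu`) and
`Σ_{s₁,s₂}^{σ₁,σ₂}(ℝ^{d₁+d₂})` (`beurling`). The lower indices come first. -/
def GS₂ (κ : Kind) (s₁ s₂ σ₁ σ₂ : ℝ) (d₁ d₂ : ℕ) : Submodule ℂ (V d₁ × V d₂ → ℂ) where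
  carrier := {F | ContDiff ℝ ∞ F ∧ match κ with
    | .roumieu => ∃ h : ℝ, 0 < h ∧ gsNorm₂ s₁ s₂ σ₁ σ₂ h F < ⊤
    | .beurling => ∀ h : ℝ, 0 < h → gsNorm₂ s₁ s₂ σ₁ σ₂ h F < ⊤}
  zero_mem' := by
    refine ⟨contDiff_const, ?_⟩
    cases κ
    · exact ⟨1, one_pos, by simp [gsNorm₂_zero]⟩
    · exact fun h _ => by simp [gsNorm₂_zero]
  add_mem' := by
    rintro f g ⟨hf, hf'⟩ ⟨hg, hg'⟩
    refine ⟨hf.add hg, ?_⟩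
    cases κ
    · obtain ⟨h, hh, H⟩ := hf'
      obtain ⟨k, hk, K⟩ := hg'
      refine ⟨max h k, by positivity, (gsNorm₂_add_le (by positivity) hf hg).trans_lt ?_⟩
      exact ENNReal.add_lt_top.2 ⟨(gsNorm₂_mono hh (le_max_left _ _) f).trans_lt H,
        (gsNorm₂_mono hk (le_max_right _ _) g).trans_lt K⟩
    · exact fun h hh => (gsNorm₂_add_le hh hf hg).trans_lt
        (ENNReal.add_lt_top.2 ⟨hf' h hh, hg' h hh⟩)
  smul_mem' := by
    rintro c f ⟨hf, hf'⟩
    refine ⟨hf.const_smul c, ?_⟩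
    cases κ
    · obtain ⟨h, hh, H⟩ := hf'
      exact ⟨h, hh, (gsNorm₂_smul_le c hf).trans_lt (ENNReal.mul_lt_top enorm_lt_top H)⟩
    · exact fun h hh => (gsNorm₂_smul_le c hf).trans_lt
        (ENNReal.mul_lt_top enorm_lt_top (hf' h hh))

/-- Continuity of a linear form on a two-variable Gelfand-Shilov space. On the inductive limit
`𝒮` it means boundedness on each of the Banach spaces with parameter `h`; on the projective
limit `Σ` it means boundedness with respect to one of the norms. -/
def IsContinuousForm (κ : Kind) {s₁ s₂ σ₁ σ₂ : ℝ} {d₁ d₂ : ℕ}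
    (u : GS₂ κ s₁ s₂ σ₁ σ₂ d₁ d₂ →ₗ[ℂ] ℂ) : Prop :=
  match κ with
  | .roumieu => ∀ h : ℝ, 0 < h → ∃ M : ℝ≥0, ∀ F : GS₂ .roumieu s₁ s₂ σ₁ σ₂ d₁ d₂,
      gsNorm₂ s₁ s₂ σ₁ σ₂ h (F : V d₁ × V d₂ → ℂ) < ⊤ →
        ‖u F‖ₑ ≤ M * gsNorm₂ s₁ s₂ σ₁ σ₂ h (F : V d₁ × V d₂ → ℂ)
  | .beurling => ∃ h : ℝ, 0 < h ∧ ∃ M : ℝ≥0, ∀ F : GS₂ .beurling s₁ s₂ σ₁ σ₂ d₁ d₂,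
        ‖u F‖ₑ ≤ M * gsNorm₂ s₁ s₂ σ₁ σ₂ h (F : V d₁ × V d₂ → ℂ)

/-- The Gelfand-Shilov distribution spaces `(𝒮_{s₁,s₂}^{σ₁,σ₂})'(ℝ^{d₁+d₂})` and
`(Σ_{s₁,s₂}^{σ₁,σ₂})'(ℝ^{d₁+d₂})`. -/
def GSDual (κ : Kind) (s₁ s₂ σ₁ σ₂ : ℝ) (d₁ d₂ : ℕ) : Type :=
  {u : GS₂ κ s₁ s₂ σ₁ σ₂ d₁ d₂ →ₗ[ℂ] ℂ // IsContinuousForm κ u}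

section Operators

variable {κ : Kind} {t τ : ℝ} {d : ℕ}

open Classical in
/-- The value of a distribution at a function, which is meant to be a test function. -/
def GSDual.pair {s₁ s₂ σ₁ σ₂ : ℝ} {d₁ d₂ : ℕ} (a : GSDual κ s₁ s₂ σ₁ σ₂ d₁ d₂)
    (F : V d₁ × V d₂ → ℂ) : ℂ :=
  if hF : F ∈ GS₂ κ s₁ s₂ σ₁ σ₂ d₁ d₂ then a.1 ⟨F, hF⟩ else 0

/-- The transpose of the map `a ↦ K_{a,A}`, where
`K_{a,A}(x, y) = (2π)^{-d} ∫ a(x - A(x - y), ξ) e^{i⟨x - y, ξ⟩} dξ`. After the substitution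
`u = x - A(x - y)`, `v = x - y`, whose Jacobian is `1` in absolute value, it sends `Φ(x, y)` to
`(u, ξ) ↦ (2π)^{-d} ∫ Φ(u + Av, u + Av - v) e^{i⟨v, ξ⟩} dv`.
It maps `𝒮_t^τ(ℝ^{2d})` into `𝒮_{t,τ}^{τ,t}(ℝ^{2d})`, and likewise for `Σ`. -/
def kernelTranspose (A : Matrix (Fin d) (Fin d) ℝ) (Φ : V d × V d → ℂ) : V d × V d → ℂ :=
  fun p => ((2 * Real.pi : ℝ) : ℂ)⁻¹ ^ d *
    ∫ v : V d, Φ (p.1 + Matrix.toEuclideanLin A v, p.1 + Matrix.toEuclideanLin A v - v) *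
      Complex.exp (Complex.I * ((inner ℝ v p.2 : ℝ) : ℂ))

/-- The kernel `K_{a,A}` of `Op_A(a)`, as a distribution on `ℝ^{2d}`. -/
def kernel (A : Matrix (Fin d) (Fin d) ℝ) (a : GSDual κ t τ τ t d d)
    (Φ : V d × V d → ℂ) : ℂ :=
  a.pair (kernelTranspose A Φ)

/-- The pseudo-differential operator `Op_A(a)` with symbol `a` in `(𝒮_{t,τ}^{τ,t})'(ℝ^{2d})`
(or `(Σ_{t,τ}^{τ,t})'(ℝ^{2d})`). It maps `f` in `𝒮_t^τ(ℝ^d)` (or `Σ_t^τ(ℝ^d)`) to the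
distribution `g ↦ ⟨K_{a,A}, g ⊗ f⟩` on the same test function space. -/
def Op (A : Matrix (Fin d) (Fin d) ℝ) (a : GSDual κ t τ τ t d d) :
    GS₁ κ t τ d → GS₁ κ t τ d → ℂ :=
  fun f g => kernel A a fun p => (g : V d → ℂ) p.1 * (f : V d → ℂ) p.2

end Operators

section Symbols

variable {d₁ d₂ : ℕ}

/-- `sup |∂_{x₁}^{α₁} ∂_{x₂}^{α₂} f(x₁,x₂)| / (h^{|α₁|+|α₂|} α₁!^{σ₁} α₂!^{σ₂} w(x₁,x₂))`,
with values in `[0, ∞]`. -/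
def symbolNorm (σ₁ σ₂ h : ℝ) (w : V d₁ × V d₂ → ℝ) (f : V d₁ × V d₂ → ℂ) : ℝ≥0∞ :=
  ⨆ (α₁ : Fin d₁ → ℕ) (α₂ : Fin d₂ → ℕ) (x : V d₁ × V d₂),
    ENNReal.ofReal (‖deriv₂ α₁ α₂ f x‖ /
      (h ^ (mlen α₁ + mlen α₂) * mfact α₁ ^ σ₁ * mfact α₂ ^ σ₂ * w x))

/-- The function `e^{r(|x₁|^{1/s₁} + |x₂|^{1/s₂})}`. -/
def expWeight (s₁ s₂ r : ℝ) (x : V d₁ × V d₂) : ℝ :=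
  Real.exp (r * (‖x.1‖ ^ (1 / s₁) + ‖x.2‖ ^ (1 / s₂)))

/-- `Γ_{s₁,s₂;0}^{σ₁,σ₂}`: for some `h > 0`, finite norm for every `r > 0`. -/
def GammaLow (s₁ s₂ σ₁ σ₂ : ℝ) (d₁ d₂ : ℕ) : Set (V d₁ × V d₂ → ℂ) :=
  {f | ContDiff ℝ ∞ f ∧ ∃ h : ℝ, 0 < h ∧ ∀ r : ℝ, 0 < r →
    symbolNorm σ₁ σ₂ h (expWeight s₁ s₂ r) f < ⊤}

/-- `Γ_{s₁,s₂}^{σ₁,σ₂;0}`: for some `r > 0`, finite norm for every `h > 0`. -/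
def GammaUp (s₁ s₂ σ₁ σ₂ : ℝ) (d₁ d₂ : ℕ) : Set (V d₁ × V d₂ → ℂ) :=
  {f | ContDiff ℝ ∞ f ∧ ∃ r : ℝ, 0 < r ∧ ∀ h : ℝ, 0 < h →
    symbolNorm σ₁ σ₂ h (expWeight s₁ s₂ r) f < ⊤}

/-- `Γ_{s₁,s₂;0}^{σ₁,σ₂;0}`: finite norm for every `h > 0` and every `r > 0`. -/
def GammaLowUp (s₁ s₂ σ₁ σ₂ : ℝ) (d₁ d₂ : ℕ) : Set (V d₁ × V d₂ → ℂ) :=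
  {f | ContDiff ℝ ∞ f ∧ ∀ h : ℝ, 0 < h → ∀ r : ℝ, 0 < r →
    symbolNorm σ₁ σ₂ h (expWeight s₁ s₂ r) f < ⊤}

/-- `Γ_{(w)}^{σ,s;0}(ℝ^{2d})`. -/
def GammaWeight {d : ℕ} (w : V d × V d → ℝ) (σ s : ℝ) : Set (V d × V d → ℂ) :=
  {f | ContDiff ℝ ∞ f ∧ ∀ h : ℝ, 0 < h → symbolNorm σ s h w f < ⊤}

/-- Weight functions: `w` is positive everywhere and `w, 1/w` belong to `L^∞_loc`. -/
structure IsWeight (w : V d₁ × V d₂ → ℝ) : Prop where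
  pos : ∀ x, 0 < w x
  memLp : ∀ K : Set (V d₁ × V d₂), IsCompact K → MemLp w ⊤ (volume.restrict K)
  memLp_inv : ∀ K : Set (V d₁ × V d₂), IsCompact K →
    MemLp (fun x => 1 / w x) ⊤ (volume.restrict K)

/-- Submultiplicativity, up to a constant, of an even function. -/
structure IsSubmultiplicative (w : V d₁ × V d₂ → ℝ) : Prop where
  even : ∀ x, w (-x) = w x
  submul : ∃ C : ℝ, ∀ x y, w (x + y) ≤ C * (w x * w y)

/-- The class `𝒫_{s,σ}(ℝ^{2d})` of submultiplicative weights. -/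
structure IsPWeight {d : ℕ} (s σ : ℝ) (w : V d × V d → ℝ) : Prop where
  isWeight : IsWeight w
  isSubmultiplicative : IsSubmultiplicative w
  bounds : ∃ r C : ℝ, 0 < r ∧ 0 < C ∧
    ∀ x, C⁻¹ * expWeight s σ (-r) x ≤ w x ∧ w x ≤ C * expWeight s σ r x

end Symbols

section Membership

variable {κ : Kind} {s₁ s₂ σ₁ σ₂ : ℝ} {d₁ d₂ : ℕ}

/-- The distribution `a` is given by the function `f`. -/
def GSDual.IsGivenBy (a : GSDual κ s₁ s₂ σ₁ σ₂ d₁ d₂) (f : V d₁ × V d₂ → ℂ) : Prop :=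
  ∀ g : GS₂ κ s₁ s₂ σ₁ σ₂ d₁ d₂,
    Integrable (fun x => f x * (g : V d₁ × V d₂ → ℂ) x) ∧
      a.1 g = ∫ x, f x * (g : V d₁ × V d₂ → ℂ) x

/-- The distribution `a` is an element of the set `S` of functions. -/
def GSDual.MemFun (a : GSDual κ s₁ s₂ σ₁ σ₂ d₁ d₂) (S : Set (V d₁ × V d₂ → ℂ)) : Prop :=
  ∃ f ∈ S, a.IsGivenBy f

/-- The distribution `a` is an element of another Gelfand-Shilov distribution space: there is a
continuous linear form on the other test function space which coincides with `a` on the common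
test functions. -/
def GSDual.MemDual (a : GSDual κ s₁ s₂ σ₁ σ₂ d₁ d₂) (κ' : Kind) (s₁' s₂' σ₁' σ₂' : ℝ) : Prop :=
  ∃ u : GSDual κ' s₁' s₂' σ₁' σ₂' d₁ d₂, ∀ (g : V d₁ × V d₂ → ℂ)
    (hg : g ∈ GS₂ κ s₁ s₂ σ₁ σ₂ d₁ d₂) (hg' : g ∈ GS₂ κ' s₁' s₂' σ₁' σ₂' d₁ d₂),
    u.1 ⟨g, hg'⟩ = a.1 ⟨g, hg⟩

end Membership

end GelfandShilov

end

noncomputable section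

namespace GelfandShilov

section ListDerivatives

variable {X Y : Type*} [NormedAddCommGroup X] [NormedSpace ℝ X]
  [NormedAddCommGroup Y] [NormedSpace ℝ Y]

/-- The iterated derivative along a list of directions. -/
def listDeriv (l : List X) (F : X → ℂ) : X → ℂ := l.foldr dirDeriv F

@[simp] theorem listDeriv_nil (F : X → ℂ) : listDeriv [] F = F := rfl

@[simp] theorem listDeriv_cons (v : X) (l : List X) (F : X → ℂ) :
    listDeriv (v :: l) F = dirDeriv v (listDeriv l F) := rfl

theorem listDeriv_append (l l' : List X) (F : X → ℂ) :
    listDeriv (l ++ l') F = listDeriv l (listDeriv l' F) := by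
  simp [listDeriv, List.foldr_append]

theorem listDeriv_smooth (l : List X) {F : X → ℂ} (hF : ContDiff ℝ ∞ F) :
    ContDiff ℝ ∞ (listDeriv l F) := by
  induction l with
  | nil => exact hF
  | cons v l ih => exact dirDeriv_smooth ih

theorem dirDeriv_comm {F : X → ℂ} (hF : ContDiff ℝ ∞ F) (v w : X) :
    dirDeriv v (dirDeriv w F) = dirDeriv w (dirDeriv v F) := by
  have key : ∀ a b : X, ∀ x, dirDeriv a (dirDeriv b F) x = fderiv ℝ (fderiv ℝ F) x a b := by
    intro a b x
    have h1 : DifferentiableAt ℝ (fderiv ℝ F) x :=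
      (hF.fderiv_right (m := ∞) (by simp)).differentiable (by simp) x
    unfold dirDeriv
    rw [fderiv_clm_apply h1 (differentiableAt_const b)]
    simp
  funext x
  rw [key, key]
  exact (hF.contDiffAt.isSymmSndFDerivAt (by
    rw [minSmoothness_of_isRCLikeNormedField]; exact WithTop.coe_le_coe.2 le_top)) v w

theorem listDeriv_perm {l l' : List X} (h : l.Perm l') {F : X → ℂ} (hF : ContDiff ℝ ∞ F) :
    listDeriv l F = listDeriv l' F := by
  induction h with
  | nil => rfl
  | cons v _ ih => simp [ih]
  | swap v w l => simp [dirDeriv_comm (listDeriv_smooth l hF) w v]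
  | trans _ _ ih1 ih2 => rw [ih1, ih2]

theorem listDeriv_cons' (v : X) (l : List X) {F : X → ℂ} (hF : ContDiff ℝ ∞ F) :
    listDeriv (v :: l) F = listDeriv l (dirDeriv v F) := by
  rw [listDeriv_perm (l' := l ++ [v]) (by simpa using (List.perm_append_singleton v l).symm) hF,
    listDeriv_append]
  rfl

theorem listDeriv_add (l : List X) {F G : X → ℂ} (hF : ContDiff ℝ ∞ F) (hG : ContDiff ℝ ∞ G) :
    listDeriv l (F + G) = listDeriv l F + listDeriv l G := by
  induction l with
  | nil => rfl
  | cons v l ih =>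
    simp [ih, dirDeriv_add (listDeriv_smooth l hF) (listDeriv_smooth l hG)]

theorem listDeriv_smul (l : List X) (c : ℂ) {F : X → ℂ} (hF : ContDiff ℝ ∞ F) :
    listDeriv l (c • F) = c • listDeriv l F := by
  induction l with
  | nil => rfl
  | cons v l ih => simp [ih, dirDeriv_smul c (listDeriv_smooth l hF)]

theorem dirDeriv_add_vec (v w : X) (F : X → ℂ) :
    dirDeriv (v + w) F = dirDeriv v F + dirDeriv w F := by
  funext x; simp [dirDeriv]

theorem dirDeriv_smul_vec (c : ℝ) (v : X) (F : X → ℂ) :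
    dirDeriv (c • v) F = (c : ℂ) • dirDeriv v F := by
  funext x; simp [dirDeriv]

theorem dirDeriv_zero_vec (F : X → ℂ) : dirDeriv 0 F = 0 := by
  funext x; simp [dirDeriv]

theorem dirDeriv_comp_affine (L : Y →L[ℝ] X) (c : X) (v : Y) {F : X → ℂ}
    (hF : ContDiff ℝ ∞ F) :
    dirDeriv v (fun y => F (L y + c)) = fun y => dirDeriv (L v) F (L y + c) := by
  funext y
  have h1 : HasFDerivAt F (fderiv ℝ F (L y + c)) (L y + c) :=
    (hF.differentiable (by simp) _).hasFDerivAt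
  have h2 : HasFDerivAt (fun y => L y + c) L y := L.hasFDerivAt.add_const c
  have h3 := HasFDerivAt.comp y h1 h2
  unfold dirDeriv
  have h4 : fderiv ℝ (fun y => F (L y + c)) y = (fderiv ℝ F (L y + c)).comp L := h3.fderiv
  rw [h4]; rfl

theorem contDiff_comp_affine (L : Y →L[ℝ] X) (c : X) {F : X → ℂ} (hF : ContDiff ℝ ∞ F) :
    ContDiff ℝ ∞ (fun y => F (L y + c)) :=
  hF.comp (L.contDiff.add contDiff_const)

theorem listDeriv_comp_affine (L : Y →L[ℝ] X) (c : X) (l : List Y) {F : X → ℂ}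
    (hF : ContDiff ℝ ∞ F) :
    listDeriv l (fun y => F (L y + c)) = fun y => listDeriv (l.map L) F (L y + c) := by
  induction l with
  | nil => rfl
  | cons v l ih =>
    rw [listDeriv_cons, ih, dirDeriv_comp_affine L c v (listDeriv_smooth _ hF)]; rfl

theorem contDiff_pi_mul {F G : X → ℂ} (hF : ContDiff ℝ ∞ F) (hG : ContDiff ℝ ∞ G) :
    ContDiff ℝ ∞ (F * G) := hF.mul hG

theorem dirDeriv_mul (v : X) {F G : X → ℂ} (hF : ContDiff ℝ ∞ F) (hG : ContDiff ℝ ∞ G) :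
    dirDeriv v (F * G) = dirDeriv v F * G + F * dirDeriv v G := by
  funext x
  have := fderiv_mul (hF.differentiable (by simp) x) (hG.differentiable (by simp) x)
  simp only [dirDeriv, this, Pi.add_apply, Pi.mul_apply]
  simp; ring

theorem listDeriv_conj (l : List X) {F : X → ℂ} (hF : ContDiff ℝ ∞ F) :
    listDeriv l (fun x => (starRingEnd ℂ) (F x)) = fun x => (starRingEnd ℂ) (listDeriv l F x) := by
  induction l with
  | nil => rfl
  | cons v l ih =>
    rw [listDeriv_cons, ih]
    funext x
    have h1 : HasFDerivAt (listDeriv l F) (fderiv ℝ (listDeriv l F) x) x :=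
      ((listDeriv_smooth l hF).differentiable (by simp) _).hasFDerivAt
    have h3 := HasFDerivAt.comp x (Complex.conjCLE.toContinuousLinearMap.hasFDerivAt) h1
    have h4 : fderiv ℝ (fun x => (starRingEnd ℂ) (listDeriv l F x)) x =
      (Complex.conjCLE.toContinuousLinearMap).comp (fderiv ℝ (listDeriv l F) x) := h3.fderiv
    unfold dirDeriv
    rw [h4]; rfl

end ListDerivatives

section Bounds

variable {d₁ d₂ : ℕ}

/-- The list of directions made of `l₁` in the first and `l₂` in the second variable. -/
def dirList (l₁ : List (V d₁)) (l₂ : List (V d₂)) : List (V d₁ × V d₂) :=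
  l₁.map (fun v => (v, 0)) ++ l₂.map (fun w => (0, w))

theorem dirList_cons_left (v : V d₁) (l₁ : List (V d₁)) (l₂ : List (V d₂)) :
    dirList (v :: l₁) l₂ = (v, 0) :: dirList l₁ l₂ := rfl

theorem dirList_cons_right (w : V d₂) (l₁ : List (V d₁)) (l₂ : List (V d₂)) :
    (dirList l₁ (w :: l₂)).Perm ((0, w) :: dirList l₁ l₂) := by
  simp [dirList]

@[simp] theorem dirList_nil : dirList ([] : List (V d₁)) ([] : List (V d₂)) = [] := rfl

/-- All vectors of the list have norm at most one. -/
def UnitList {E : Type*} [Norm E] (l : List E) : Prop := ∀ v ∈ l, ‖v‖ ≤ 1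

theorem UnitList.nil {E : Type*} [Norm E] : UnitList ([] : List E) := by simp [UnitList]

theorem UnitList.cons {E : Type*} [Norm E] {v : E} {l : List E} (hv : ‖v‖ ≤ 1)
    (hl : UnitList l) : UnitList (v :: l) := by
  intro w hw
  rcases List.mem_cons.1 hw with rfl | h
  · exact hv
  · exact hl w h

theorem UnitList.head {E : Type*} [Norm E] {v : E} {l : List E} (h : UnitList (v :: l)) :
    ‖v‖ ≤ 1 := h v (by simp)

theorem UnitList.tail {E : Type*} [Norm E] {v : E} {l : List E} (h : UnitList (v :: l)) :
    UnitList l := fun w hw => h w (by simp [hw])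

/-- The derivatives of `F` of order `m` in the first and `n` in the second variable are bounded
by `a m n * W`. -/
structure DerivBound (a : ℕ → ℕ → ℝ) (W : V d₁ × V d₂ → ℝ) (F : V d₁ × V d₂ → ℂ) : Prop where
  smooth : ContDiff ℝ ∞ F
  bound : ∀ (l₁ : List (V d₁)) (l₂ : List (V d₂)), UnitList l₁ → UnitList l₂ → ∀ x,
    ‖listDeriv (dirList l₁ l₂) F x‖ ≤ a l₁.length l₂.length * W x

/-- The Gevrey sequence `h^{m+n} m!^{σ₁} n!^{σ₂}`. -/
def gevrey (σ₁ σ₂ h : ℝ) (m n : ℕ) : ℝ :=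
  h ^ (m + n) * (m.factorial : ℝ) ^ σ₁ * (n.factorial : ℝ) ^ σ₂

theorem gevrey_pos {σ₁ σ₂ h : ℝ} (hh : 0 < h) (m n : ℕ) : 0 < gevrey σ₁ σ₂ h m n := by
  have := m.factorial_pos
  have := n.factorial_pos
  unfold gevrey; positivity

theorem gevrey_zero (σ₁ σ₂ h : ℝ) : gevrey σ₁ σ₂ h 0 0 = 1 := by simp [gevrey]

theorem gevrey_mono (σ₁ σ₂ : ℝ) {h k : ℝ} (hh : 0 ≤ h) (hk : h ≤ k) (m n : ℕ) :
    gevrey σ₁ σ₂ h m n ≤ gevrey σ₁ σ₂ k m n := by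
  unfold gevrey; gcongr

/-- Gevrey bounds for the derivatives of `F`. -/
abbrev GevreyBound (σ₁ σ₂ h : ℝ) (W : V d₁ × V d₂ → ℝ) (F : V d₁ × V d₂ → ℂ) : Prop :=
  DerivBound (gevrey σ₁ σ₂ h) W F

variable {a b : ℕ → ℕ → ℝ} {W W' : V d₁ × V d₂ → ℝ} {F G : V d₁ × V d₂ → ℂ}

theorem GevreyBound.norm_le {σ₁ σ₂ h : ℝ} (H : GevreyBound σ₁ σ₂ h W F) (x : V d₁ × V d₂) :
    ‖F x‖ ≤ W x := by
  have := H.bound [] [] UnitList.nil UnitList.nil x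
  simpa [gevrey_zero] using this

theorem GevreyBound.weight_nonneg {σ₁ σ₂ h : ℝ} (H : GevreyBound σ₁ σ₂ h W F)
    (x : V d₁ × V d₂) : 0 ≤ W x := (norm_nonneg _).trans (H.norm_le x)

theorem DerivBound.mono (H : DerivBound a W F)
    (hab : ∀ m n x, a m n * W x ≤ b m n * W' x) : DerivBound b W' F :=
  ⟨H.smooth, fun l₁ l₂ h₁ h₂ x => (H.bound l₁ l₂ h₁ h₂ x).trans (hab _ _ _)⟩

theorem GevreyBound.mono_weight {σ₁ σ₂ h : ℝ} (hh : 0 < h) (H : GevreyBound σ₁ σ₂ h W F)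
    (hW : ∀ x, W x ≤ W' x) : GevreyBound σ₁ σ₂ h W' F :=
  DerivBound.mono H fun m n x => mul_le_mul_of_nonneg_left (hW x) (gevrey_pos hh m n).le

theorem GevreyBound.mono_rate {σ₁ σ₂ h k : ℝ} (hh : 0 ≤ h) (hk : h ≤ k)
    (H : GevreyBound σ₁ σ₂ h W F) : GevreyBound σ₁ σ₂ k W F :=
  DerivBound.mono H fun m n x => mul_le_mul_of_nonneg_right (gevrey_mono _ _ hh hk m n)
    (H.weight_nonneg x)

theorem DerivBound.add (hF : DerivBound a W F) (hG : DerivBound a W' G) :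
    DerivBound a (fun x => W x + W' x) (F + G) :=
  ⟨hF.smooth.add hG.smooth, fun l₁ l₂ h₁ h₂ x => by
    rw [listDeriv_add _ hF.smooth hG.smooth, mul_add]
    exact (norm_add_le _ _).trans (add_le_add (hF.bound l₁ l₂ h₁ h₂ x) (hG.bound l₁ l₂ h₁ h₂ x))⟩

theorem DerivBound.smul (c : ℂ) (hF : DerivBound a W F) :
    DerivBound a (fun x => ‖c‖ * W x) (c • F) :=
  ⟨hF.smooth.const_smul c, fun l₁ l₂ h₁ h₂ x => by
    rw [listDeriv_smul _ c hF.smooth, Pi.smul_apply, norm_smul]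
    calc _ ≤ ‖c‖ * (a l₁.length l₂.length * W x) :=
          mul_le_mul_of_nonneg_left (hF.bound l₁ l₂ h₁ h₂ x) (norm_nonneg _)
      _ = _ := by ring⟩

theorem listDeriv_zero (l : List (V d₁ × V d₂)) :
    listDeriv l (0 : V d₁ × V d₂ → ℂ) = 0 := by
  have := listDeriv_smul l 0 (F := (0 : V d₁ × V d₂ → ℂ)) contDiff_const
  simpa using this

theorem DerivBound.zero (h : ∀ m n x, 0 ≤ a m n * W x) :
    DerivBound a W (0 : V d₁ × V d₂ → ℂ) :=
  ⟨contDiff_const, fun l₁ l₂ _ _ x => by rw [listDeriv_zero]; simpa using h _ _ x⟩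

theorem DerivBound.conj (hF : DerivBound a W F) :
    DerivBound a W (fun x => (starRingEnd ℂ) (F x)) :=
  ⟨Complex.conjCLE.contDiff.comp hF.smooth, fun l₁ l₂ h₁ h₂ x => by
    rw [listDeriv_conj _ hF.smooth, RCLike.norm_conj]
    exact hF.bound l₁ l₂ h₁ h₂ x⟩

theorem DerivBound.translate (hF : DerivBound a W F) (y : V d₁ × V d₂) :
    DerivBound a (fun x => W (x + y)) (fun x => F (x + y)) :=
  ⟨contDiff_comp_affine (.id ℝ _) y hF.smooth, fun l₁ l₂ h₁ h₂ x => by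
    have := listDeriv_comp_affine (.id ℝ _) y (dirList l₁ l₂) hF.smooth
    simp only [ContinuousLinearMap.coe_id', id_eq, List.map_id_fun] at this
    rw [this]
    exact hF.bound l₁ l₂ h₁ h₂ _⟩

theorem listDeriv_smul_list (c : ℝ) (l : List (V d₁ × V d₂)) (hF : ContDiff ℝ ∞ F) :
    listDeriv (l.map (c • ·)) F = ((c : ℂ) ^ l.length) • listDeriv l F := by
  induction l with
  | nil => simp
  | cons v l ih =>
    rw [List.map_cons, listDeriv_cons, ih, dirDeriv_smul_vec,
      dirDeriv_smul _ (listDeriv_smooth _ hF), smul_smul, listDeriv_cons, List.length_cons, pow_succ']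

/-- The dilation `(x, y) ↦ (p x, q y)`. -/
def dilation (p q : ℝ) : (V d₁ × V d₂) →L[ℝ] (V d₁ × V d₂) :=
  (p • ContinuousLinearMap.id ℝ _).prodMap (q • ContinuousLinearMap.id ℝ _)

@[simp] theorem dilation_apply (p q : ℝ) (x : V d₁ × V d₂) :
    dilation p q x = (p • x.1, q • x.2) := rfl

theorem DerivBound.dilate (hF : DerivBound a W F) (p q : ℝ) :
    DerivBound (fun m n => |p| ^ m * |q| ^ n * a m n) (fun x => W (dilation p q x))
      (fun x => F (dilation p q x)) := by
  have e := contDiff_comp_affine (dilation p q) 0 hF.smooth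
  simp only [add_zero] at e
  refine ⟨e, fun l₁ l₂ h₁ h₂ x => ?_⟩
  have := listDeriv_comp_affine (dilation p q) 0 (dirList l₁ l₂) hF.smooth
  simp only [add_zero] at this
  rw [this]
  have e2 : (dirList l₁ l₂).map (dilation p q) =
      (l₁.map (fun v => ((v, 0) : V d₁ × V d₂))).map (p • ·) ++
      (l₂.map (fun w => ((0, w) : V d₁ × V d₂))).map (q • ·) := by
    simp [dirList, Function.comp_def]
  rw [e2, listDeriv_append, listDeriv_smul_list _ _ (listDeriv_smooth _ hF.smooth),
    listDeriv_smul_list _ _ hF.smooth, listDeriv_smul _ _ (listDeriv_smooth _ hF.smooth),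
    smul_smul, ← listDeriv_append]
  simp only [Pi.smul_apply, norm_smul, List.length_map, norm_mul, norm_pow, Complex.norm_real, Real.norm_eq_abs]
  rw [mul_assoc (|p| ^ _ * |q| ^ _)]
  exact mul_le_mul_of_nonneg_left (hF.bound l₁ l₂ h₁ h₂ _) (by positivity)

theorem DerivBound.dirDeriv_left (hF : DerivBound a W F) {v : V d₁} (hv : ‖v‖ ≤ 1) :
    DerivBound (fun m n => a (m + 1) n) W (dirDeriv (v, 0) F) :=
  ⟨dirDeriv_smooth hF.smooth, fun l₁ l₂ h₁ h₂ x => by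
    rw [← listDeriv_cons' _ _ hF.smooth, ← dirList_cons_left]
    exact hF.bound (v :: l₁) l₂ (h₁.cons hv) h₂ x⟩

theorem DerivBound.dirDeriv_right (hF : DerivBound a W F) {w : V d₂} (hw : ‖w‖ ≤ 1) :
    DerivBound (fun m n => a m (n + 1)) W (dirDeriv (0, w) F) :=
  ⟨dirDeriv_smooth hF.smooth, fun l₁ l₂ h₁ h₂ x => by
    rw [← listDeriv_cons' _ _ hF.smooth, ← listDeriv_perm (dirList_cons_right w l₁ l₂) hF.smooth]
    exact hF.bound l₁ (w :: l₂) h₁ (h₂.cons hw) x⟩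

theorem exists_unit_smul {E : Type*} [NormedAddCommGroup E] [NormedSpace ℝ E] (v : E) :
    ∃ u : E, ‖u‖ ≤ 1 ∧ v = ‖v‖ • u := by
  by_cases hv : v = 0
  · exact ⟨0, by simp, by simp [hv]⟩
  · have : ‖v‖ ≠ 0 := norm_ne_zero_iff.2 hv
    exact ⟨‖v‖⁻¹ • v, by simp [norm_smul, this], by simp [smul_smul, this]⟩

/-- Derivatives along arbitrary directions are controlled by the weight. -/
theorem DerivBound.exists_listDeriv_le (l : List (V d₁ × V d₂)) : ∀ a : ℕ → ℕ → ℝ, ∃ c : ℝ,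
    ∀ (W : V d₁ × V d₂ → ℝ) (F : V d₁ × V d₂ → ℂ), DerivBound a W F →
      ∀ x, ‖listDeriv l F x‖ ≤ c * W x := by
  induction l with
  | nil =>
    intro a
    exact ⟨a 0 0, fun W F H x => by simpa using H.bound [] [] UnitList.nil UnitList.nil x⟩
  | cons z l ih =>
    intro a
    obtain ⟨c₁, h₁⟩ := ih (fun m n => a (m + 1) n)
    obtain ⟨c₂, h₂⟩ := ih (fun m n => a m (n + 1))
    refine ⟨‖z.1‖ * c₁ + ‖z.2‖ * c₂, fun W F H x => ?_⟩
    obtain ⟨u, hu, hu'⟩ := exists_unit_smul z.1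
    obtain ⟨w, hw, hw'⟩ := exists_unit_smul z.2
    have e : z = ‖z.1‖ • ((u, 0) : V d₁ × V d₂) + ‖z.2‖ • ((0, w) : V d₁ × V d₂) := by
      ext1 <;> simp [← hu', ← hw']
    have su := dirDeriv_smooth (v := ((u, 0) : V d₁ × V d₂)) H.smooth
    have sw := dirDeriv_smooth (v := ((0, w) : V d₁ × V d₂)) H.smooth
    have e3 : dirDeriv z F = (‖z.1‖ : ℂ) • dirDeriv ((u, 0) : V d₁ × V d₂) F +
        (‖z.2‖ : ℂ) • dirDeriv ((0, w) : V d₁ × V d₂) F := by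
      rw [← dirDeriv_smul_vec, ← dirDeriv_smul_vec, ← dirDeriv_add_vec, ← e]
    have e4 := listDeriv_add l (su.const_smul (‖z.1‖ : ℂ)) (sw.const_smul (‖z.2‖ : ℂ))
    have e5 : listDeriv (z :: l) F = (‖z.1‖ : ℂ) • listDeriv l (dirDeriv ((u, 0) : V d₁ × V d₂) F) +
        (‖z.2‖ : ℂ) • listDeriv l (dirDeriv ((0, w) : V d₁ × V d₂) F) := by
      rw [← listDeriv_smul _ _ su, ← listDeriv_smul _ _ sw, listDeriv_cons' _ _ H.smooth, e3]
      exact e4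
    rw [e5, Pi.add_apply, Pi.smul_apply, Pi.smul_apply]
    refine (norm_add_le _ _).trans ?_
    rw [norm_smul, norm_smul, add_mul, mul_assoc, mul_assoc]
    simp only [Complex.norm_real, norm_norm]
    exact add_le_add
      (mul_le_mul_of_nonneg_left (h₁ _ _ (H.dirDeriv_left hu) x) (norm_nonneg _))
      (mul_le_mul_of_nonneg_left (h₂ _ _ (H.dirDeriv_right hw) x) (norm_nonneg _))

theorem listDeriv_mul_le (x : V d₁ × V d₂) (l₁ : List (V d₁)) (l₂ : List (V d₂))
    (h₁ : UnitList l₁) (h₂ : UnitList l₂) : ∀ (a b : ℕ → ℕ → ℝ) (F G : V d₁ × V d₂ → ℂ),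
    ContDiff ℝ ∞ F → ContDiff ℝ ∞ G →
    (∀ (k₁ : List (V d₁)) (k₂ : List (V d₂)), UnitList k₁ → UnitList k₂ →
      ‖listDeriv (dirList k₁ k₂) F x‖ ≤ a k₁.length k₂.length) →
    (∀ (k₁ : List (V d₁)) (k₂ : List (V d₂)), UnitList k₁ → UnitList k₂ →
      ‖listDeriv (dirList k₁ k₂) G x‖ ≤ b k₁.length k₂.length) →
    ‖listDeriv (dirList l₁ l₂) (F * G) x‖ ≤
      ∑ p ∈ Finset.HasAntidiagonal.antidiagonal l₁.length, (l₁.length.choose p.1 : ℝ) *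
        ∑ q ∈ Finset.HasAntidiagonal.antidiagonal l₂.length, (l₂.length.choose q.1 : ℝ) *
          (a p.1 q.1 * b p.2 q.2) := by
  induction l₁ with
  | nil =>
    induction l₂ with
    | nil =>
      intro a b F G hF hG ha hb
      have h1 := ha [] [] UnitList.nil UnitList.nil
      have h2 := hb [] [] UnitList.nil UnitList.nil
      simpa using mul_le_mul h1 h2 (norm_nonneg _) ((norm_nonneg _).trans h1)
    | cons w l₂ ih =>
      intro a b F G hF hG ha hb
      have hw := h₂.head
      rw [listDeriv_perm (dirList_cons_right w [] l₂) (contDiff_pi_mul hF hG),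
        listDeriv_cons' _ _ (contDiff_pi_mul hF hG), dirDeriv_mul _ hF hG,
        listDeriv_add _ (contDiff_pi_mul (dirDeriv_smooth hF) hG)
          (contDiff_pi_mul hF (dirDeriv_smooth hG)), Pi.add_apply]
      refine (norm_add_le _ _).trans ?_
      have i1 := ih h₂.tail (fun m n => a m (n + 1)) b (dirDeriv (0, w) F) G
        (dirDeriv_smooth hF) hG
        (fun k₁ k₂ u₁ u₂ => by
          rw [← listDeriv_cons' _ _ hF, ← listDeriv_perm (dirList_cons_right w k₁ k₂) hF]
          exact ha k₁ (w :: k₂) u₁ (u₂.cons hw)) hb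
      have i2 := ih h₂.tail a (fun m n => b m (n + 1)) F (dirDeriv (0, w) G)
        hF (dirDeriv_smooth hG) ha
        (fun k₁ k₂ u₁ u₂ => by
          rw [← listDeriv_cons' _ _ hG, ← listDeriv_perm (dirList_cons_right w k₁ k₂) hG]
          exact hb k₁ (w :: k₂) u₁ (u₂.cons hw))
      refine (add_le_add i1 i2).trans (le_of_eq ?_)
      simp only [List.length_nil, List.length_cons, Finset.Nat.antidiagonal_zero,
        Finset.sum_singleton, Nat.choose_self, Nat.cast_one, one_mul]
      rw [Finset.sum_antidiagonal_choose_succ_mul (fun i j => a 0 i * b 0 j), add_comm]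
      congr 1
      refine Finset.sum_congr rfl fun q hq => ?_
      rw [Nat.choose_symm_of_eq_add (Finset.HasAntidiagonal.mem_antidiagonal.1 hq).symm]
  | cons v l₁ ih =>
    intro a b F G hF hG ha hb
    have hv := h₁.head
    rw [dirList_cons_left, listDeriv_cons' _ _ (contDiff_pi_mul hF hG), dirDeriv_mul _ hF hG,
      listDeriv_add _ (contDiff_pi_mul (dirDeriv_smooth hF) hG)
          (contDiff_pi_mul hF (dirDeriv_smooth hG)), Pi.add_apply]
    refine (norm_add_le _ _).trans ?_
    have i1 := ih h₁.tail (fun m n => a (m + 1) n) b (dirDeriv (v, 0) F) G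
      (dirDeriv_smooth hF) hG
      (fun k₁ k₂ u₁ u₂ => by
        rw [← listDeriv_cons' _ _ hF, ← dirList_cons_left]
        exact ha (v :: k₁) k₂ (u₁.cons hv) u₂) hb
    have i2 := ih h₁.tail a (fun m n => b (m + 1) n) F (dirDeriv (v, 0) G)
      hF (dirDeriv_smooth hG) ha
      (fun k₁ k₂ u₁ u₂ => by
        rw [← listDeriv_cons' _ _ hG, ← dirList_cons_left]
        exact hb (v :: k₁) k₂ (u₁.cons hv) u₂)
    refine (add_le_add i1 i2).trans (le_of_eq ?_)
    rw [List.length_cons, Finset.sum_antidiagonal_choose_succ_mul (fun i j =>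
      ∑ q ∈ Finset.HasAntidiagonal.antidiagonal l₂.length, (l₂.length.choose q.1 : ℝ) *
          (a i q.1 * b j q.2)), add_comm]
    congr 1
    refine Finset.sum_congr rfl fun q hq => ?_
    rw [Nat.choose_symm_of_eq_add (Finset.HasAntidiagonal.mem_antidiagonal.1 hq).symm]

theorem DerivBound.mul (hF : DerivBound a W F) (hG : DerivBound b W' G) :
    DerivBound (fun m n => ∑ p ∈ Finset.HasAntidiagonal.antidiagonal m, (m.choose p.1 : ℝ) *
        ∑ q ∈ Finset.HasAntidiagonal.antidiagonal n, (n.choose q.1 : ℝ) * (a p.1 q.1 * b p.2 q.2))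
      (fun x => W x * W' x) (F * G) := by
  refine ⟨hF.smooth.mul hG.smooth, fun l₁ l₂ h₁ h₂ x => ?_⟩
  refine (listDeriv_mul_le x l₁ l₂ h₁ h₂ (fun m n => a m n * W x) (fun m n => b m n * W' x) F G
    hF.smooth hG.smooth (fun k₁ k₂ u₁ u₂ => hF.bound k₁ k₂ u₁ u₂ x)
    (fun k₁ k₂ u₁ u₂ => hG.bound k₁ k₂ u₁ u₂ x)).trans (le_of_eq ?_)
  rw [Finset.sum_mul]
  refine Finset.sum_congr rfl fun p _ => ?_
  rw [mul_assoc, Finset.sum_mul]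
  congr 1
  refine Finset.sum_congr rfl fun q _ => ?_
  ring

theorem factorial_rpow_mul_le {σ : ℝ} (hσ : 0 ≤ σ) {m : ℕ} {p : ℕ × ℕ}
    (hp : p ∈ Finset.HasAntidiagonal.antidiagonal m) :
    (p.1.factorial : ℝ) ^ σ * (p.2.factorial : ℝ) ^ σ ≤ (m.factorial : ℝ) ^ σ := by
  rw [← Real.mul_rpow (by positivity) (by positivity)]
  refine Real.rpow_le_rpow (by positivity) ?_ hσ
  rw [← Finset.HasAntidiagonal.mem_antidiagonal.1 hp]
  exact_mod_cast Nat.le_of_dvd (Nat.factorial_pos _) (Nat.factorial_mul_factorial_dvd_factorial_add _ _)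

theorem GevreyBound.mul {σ₁ σ₂ h k : ℝ} (hσ₁ : 0 ≤ σ₁) (hσ₂ : 0 ≤ σ₂) (hh : 0 ≤ h) (hk : 0 ≤ k)
    (hF : GevreyBound σ₁ σ₂ h W F) (hG : GevreyBound σ₁ σ₂ k W' G) :
    GevreyBound σ₁ σ₂ (h + k) (fun x => W x * W' x) (F * G) := by
  refine (DerivBound.mul hF hG).mono fun m n x => ?_
  refine mul_le_mul_of_nonneg_right ?_ (mul_nonneg (hF.weight_nonneg x) (hG.weight_nonneg x))
  have e : gevrey σ₁ σ₂ (h + k) m n =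
      ∑ p ∈ Finset.HasAntidiagonal.antidiagonal m, (m.choose p.1 : ℝ) *
        ∑ q ∈ Finset.HasAntidiagonal.antidiagonal n, (n.choose q.1 : ℝ) *
          ((h ^ p.1 * k ^ p.2) * (h ^ q.1 * k ^ q.2) *
            ((m.factorial : ℝ) ^ σ₁ * (n.factorial : ℝ) ^ σ₂)) := by
    unfold gevrey
    rw [pow_add, (Commute.all h k).add_pow', (Commute.all h k).add_pow']
    simp only [nsmul_eq_mul, Finset.sum_mul, Finset.mul_sum]
    rw [Finset.sum_comm]
    refine Finset.sum_congr rfl fun p _ => Finset.sum_congr rfl fun q _ => ?_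
    ring
  rw [e]
  refine Finset.sum_le_sum fun p hp => mul_le_mul_of_nonneg_left ?_ (by positivity)
  refine Finset.sum_le_sum fun q hq => mul_le_mul_of_nonneg_left ?_ (by positivity)
  unfold gevrey
  calc _ = (h ^ p.1 * k ^ p.2) * (h ^ q.1 * k ^ q.2) *
      (((p.1.factorial : ℝ) ^ σ₁ * (p.2.factorial : ℝ) ^ σ₁) *
        ((q.1.factorial : ℝ) ^ σ₂ * (q.2.factorial : ℝ) ^ σ₂)) := by ring
    _ ≤ _ := by
      gcongr
      · exact factorial_rpow_mul_le hσ₁ hp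
      · exact factorial_rpow_mul_le hσ₂ hq

/-- The shear `(x, y) ↦ (x + C y, y)`. -/
def shear (C : V d₂ →L[ℝ] V d₁) : (V d₁ × V d₂) →L[ℝ] (V d₁ × V d₂) :=
  (ContinuousLinearMap.fst ℝ _ _ + C.comp (ContinuousLinearMap.snd ℝ _ _)).prod
    (ContinuousLinearMap.snd ℝ _ _)

@[simp] theorem shear_apply (C : V d₂ →L[ℝ] V d₁) (x : V d₁ × V d₂) :
    shear C x = (x.1 + C x.2, x.2) := rfl

theorem listDeriv_shear_le (C : V d₂ →L[ℝ] V d₁) {c : ℝ} (hC : ‖C‖ ≤ c)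
    (x : V d₁ × V d₂) (hF : ContDiff ℝ ∞ F)
    (ha : ∀ (k₁ : List (V d₁)) (k₂ : List (V d₂)), UnitList k₁ → UnitList k₂ →
      ‖listDeriv (dirList k₁ k₂) F x‖ ≤ a k₁.length k₂.length) (l₃ : List (V d₂)) (B : ℝ)
    (h₃ : UnitList l₃) : ∀ (l₁ : List (V d₁)) (l₂ : List (V d₂)), UnitList l₁ → UnitList l₂ →
    (∀ i j, i + j = l₃.length → a (l₁.length + i) (l₂.length + j) ≤ B) →
    ‖listDeriv (dirList l₁ l₂ ++ l₃.map (fun w => ((C w, w) : V d₁ × V d₂))) F x‖ ≤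
      (1 + c) ^ l₃.length * B := by
  have hc : 0 ≤ c := (norm_nonneg _).trans hC
  induction l₃ with
  | nil =>
    intro l₁ l₂ h₁ h₂ hB
    simpa using (ha l₁ l₂ h₁ h₂).trans (by simpa using hB 0 0 rfl)
  | cons w l₃ ih =>
    intro l₁ l₂ h₁ h₂ hB
    have hw := h₃.head
    obtain ⟨u, hu, hu'⟩ := exists_unit_smul (C w)
    have e : ((C w, w) : V d₁ × V d₂) = ‖C w‖ • ((u, 0) : V d₁ × V d₂) + ((0, w) : V d₁ × V d₂) := by
      ext1 <;> simp [← hu']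
    have hCw : ‖C w‖ ≤ c := (C.le_opNorm w).trans
      ((mul_le_of_le_one_right (norm_nonneg _) hw).trans hC)
    rw [List.map_cons, listDeriv_perm (List.perm_middle) hF, listDeriv_cons, e, dirDeriv_add_vec,
      dirDeriv_smul_vec, Pi.add_apply, Pi.smul_apply]
    refine (norm_add_le _ _).trans ?_
    have i1 := ih h₃.tail (u :: l₁) l₂ (h₁.cons hu) h₂ (fun i j hij => by
      have := hB (i + 1) j (by simp; omega)
      simpa [add_assoc, add_comm 1 i] using this)
    have i2 := ih h₃.tail l₁ (w :: l₂) h₁ (h₂.cons hw) (fun i j hij => by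
      have := hB i (j + 1) (by simp; omega)
      simpa [add_assoc, add_comm 1 j] using this)
    have e2 : listDeriv (dirList l₁ (w :: l₂) ++ l₃.map (fun w => ((C w, w) : V d₁ × V d₂))) F =
        listDeriv (((0, w) : V d₁ × V d₂) ::
          (dirList l₁ l₂ ++ l₃.map (fun w => ((C w, w) : V d₁ × V d₂)))) F :=
      listDeriv_perm ((dirList_cons_right w l₁ l₂).append_right _) hF
    rw [e2] at i2
    rw [norm_smul, Complex.norm_real, norm_norm, List.length_cons, pow_succ']
    calc _ ≤ c * ((1 + c) ^ l₃.length * B) + (1 + c) ^ l₃.length * B := by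
          refine add_le_add ?_ i2
          exact mul_le_mul hCw i1 (norm_nonneg _) hc
      _ = _ := by ring

theorem GevreyBound.shear {σ₁ σ₂ h c : ℝ} (hσ₁ : 0 ≤ σ₁) (hσ : σ₁ ≤ σ₂) (hh : 0 < h)
    (hF : GevreyBound σ₁ σ₂ h W F) (C : V d₂ →L[ℝ] V d₁) (hC : ‖C‖ ≤ c) :
    GevreyBound σ₁ σ₂ ((1 + c) * 2 ^ σ₁ * h) (fun x => W (shear C x))
      (fun x => F (shear C x)) := by
  have hc : 0 ≤ c := (norm_nonneg _).trans hC
  have e := contDiff_comp_affine (GelfandShilov.shear C) 0 hF.smooth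
  simp only [add_zero] at e
  refine ⟨e, fun l₁ l₂ h₁ h₂ x => ?_⟩
  have := listDeriv_comp_affine (GelfandShilov.shear C) 0 (dirList l₁ l₂) hF.smooth
  simp only [add_zero] at this
  rw [this]
  have e2 : (dirList l₁ l₂).map (GelfandShilov.shear C) =
      dirList l₁ [] ++ l₂.map (fun w => ((C w, w) : V d₁ × V d₂)) := by
    simp [dirList, Function.comp_def]
  set y := GelfandShilov.shear C x
  have hW := hF.weight_nonneg y
  set B : ℝ := h ^ (l₁.length + l₂.length) * (2 ^ (l₁.length + l₂.length)) ^ σ₁ *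
    (l₁.length.factorial : ℝ) ^ σ₁ * (l₂.length.factorial : ℝ) ^ σ₂ * W y with hBdef
  have key := listDeriv_shear_le C hC y hF.smooth (fun k₁ k₂ u₁ u₂ => hF.bound k₁ k₂ u₁ u₂ y) l₂
    B h₂ l₁ [] h₁ UnitList.nil (a := fun m n => gevrey σ₁ σ₂ h m n * W y) (by
      intro i j hij
      simp only [List.length_nil, zero_add, hBdef]
      refine mul_le_mul_of_nonneg_right ?_ hW
      unfold gevrey
      rw [add_assoc, hij]
      have f1 : ((l₁.length + i).factorial : ℝ) ≤
          2 ^ (l₁.length + l₂.length) * l₁.length.factorial * i.factorial := by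
        have h1 := Nat.add_choose_mul_factorial_mul_factorial l₁.length i
        have h2 := Nat.choose_le_two_pow (l₁.length + i) l₁.length
        have h3 : (2 : ℕ) ^ (l₁.length + i) ≤ 2 ^ (l₁.length + l₂.length) :=
          Nat.pow_le_pow_right (by norm_num) (by omega)
        have : (l₁.length + i).factorial ≤
            2 ^ (l₁.length + l₂.length) * l₁.length.factorial * i.factorial := by
          rw [← h1]
          gcongr ?_ * _ * _
          rw [Nat.choose_symm_add] at h2
          exact h2.trans h3
        exact_mod_cast this
      have f2 : ((l₁.length + i).factorial : ℝ) ^ σ₁ ≤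
          (2 ^ (l₁.length + l₂.length)) ^ σ₁ * (l₁.length.factorial : ℝ) ^ σ₁ *
            (i.factorial : ℝ) ^ σ₁ := by
        rw [← Real.mul_rpow (by positivity) (by positivity),
          ← Real.mul_rpow (by positivity) (by positivity)]
        exact Real.rpow_le_rpow (by positivity) f1 hσ₁
      have f3 : (i.factorial : ℝ) ^ σ₁ * (j.factorial : ℝ) ^ σ₂ ≤ (l₂.length.factorial : ℝ) ^ σ₂ := by
        refine le_trans ?_ (factorial_rpow_mul_le (hσ₁.trans hσ) (p := (i, j)) (by simpa using hij))
        refine mul_le_mul_of_nonneg_right ?_ (by positivity)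
        exact Real.rpow_le_rpow_of_exponent_le (by exact_mod_cast i.factorial_pos) hσ
      calc _ ≤ h ^ (l₁.length + l₂.length) * ((2 ^ (l₁.length + l₂.length)) ^ σ₁ *
            (l₁.length.factorial : ℝ) ^ σ₁ * (i.factorial : ℝ) ^ σ₁) * (j.factorial : ℝ) ^ σ₂ := by
            gcongr
        _ = h ^ (l₁.length + l₂.length) * ((2 ^ (l₁.length + l₂.length)) ^ σ₁ *
            (l₁.length.factorial : ℝ) ^ σ₁) * ((i.factorial : ℝ) ^ σ₁ * (j.factorial : ℝ) ^ σ₂) := by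
            ring
        _ ≤ h ^ (l₁.length + l₂.length) * ((2 ^ (l₁.length + l₂.length)) ^ σ₁ *
            (l₁.length.factorial : ℝ) ^ σ₁) * (l₂.length.factorial : ℝ) ^ σ₂ := by gcongr
        _ = _ := by ring)
  rw [e2]
  refine key.trans ?_
  have hB0 : 0 ≤ B := by positivity
  calc (1 + c) ^ l₂.length * B ≤ (1 + c) ^ (l₁.length + l₂.length) * B :=
        mul_le_mul_of_nonneg_right (pow_le_pow_right₀ (by linarith) (by omega)) hB0
    _ = gevrey σ₁ σ₂ ((1 + c) * 2 ^ σ₁ * h) l₁.length l₂.length * W y := by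
        have : (2 ^ (l₁.length + l₂.length) : ℝ) ^ σ₁ = (2 ^ σ₁) ^ (l₁.length + l₂.length) := by
          rw [← Real.rpow_natCast, ← Real.rpow_natCast, ← Real.rpow_mul (by norm_num),
            ← Real.rpow_mul (by norm_num), mul_comm]
        rw [hBdef, this, gevrey, mul_pow, mul_pow]
        ring

end Bounds

section Weights

theorem pow_le_exp_rpow {s c r : ℝ} (hs : 0 < s) (hc : 0 < c) (hr : 0 ≤ r) (k : ℕ) :
    r ^ k ≤ ((s / c) ^ s) ^ k * (k.factorial : ℝ) ^ s * Real.exp (c * r ^ (1 / s)) := by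
  set t : ℝ := c / s * r ^ (1 / s) with ht
  have ht0 : 0 ≤ t := by positivity
  have h1 := Real.pow_div_factorial_le_exp t ht0 k
  have h2 := Real.rpow_le_rpow (by positivity) h1 hs.le
  rw [← Real.exp_mul, Real.div_rpow (by positivity) (by positivity)] at h2
  have e1 : t * s = c * r ^ (1 / s) := by rw [ht]; field_simp
  have e2 : (t ^ k) ^ s = ((c / s) ^ s) ^ k * r ^ k := by
    rw [← Real.rpow_natCast, ← Real.rpow_mul ht0, mul_comm (k : ℝ) s, Real.rpow_mul ht0,
      Real.rpow_natCast, ht, Real.mul_rpow (by positivity) (by positivity), ← Real.rpow_mul hr,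
      one_div_mul_cancel hs.ne', Real.rpow_one, mul_pow]
  rw [e1, e2, div_le_iff₀ (by positivity)] at h2
  have e3 : ((s / c) ^ s) ^ k * ((c / s) ^ s) ^ k = 1 := by
    rw [← mul_pow, ← Real.mul_rpow (by positivity) (by positivity)]
    have : s / c * (c / s) = 1 := by field_simp
    rw [this]; simp
  calc r ^ k = ((s / c) ^ s) ^ k * (((c / s) ^ s) ^ k * r ^ k) := by rw [← mul_assoc, e3, one_mul]
    _ ≤ ((s / c) ^ s) ^ k * (Real.exp (c * r ^ (1 / s)) * (k.factorial : ℝ) ^ s) := by gcongr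
    _ = _ := by ring

theorem le_exp_of_forall_pow {s K r A M : ℝ} (hs : 0 < s) (hK : 0 < K) (hr : 0 ≤ r) (hA : 0 ≤ A)
    (hM : 0 ≤ M) (h : ∀ k : ℕ, A * r ^ k ≤ M * K ^ k * (k.factorial : ℝ) ^ s) :
    A ≤ 2 ^ s * M * Real.exp (-(s / 2 * K⁻¹ ^ (1 / s)) * r ^ (1 / s)) := by
  set y : ℝ := (r / K) ^ (1 / s) with hy
  have hy0 : 0 ≤ y := by positivity
  have h1 : ∀ k : ℕ, A ^ (1 / s) * ((y / 2) ^ k / k.factorial) ≤ M ^ (1 / s) * (1 / 2) ^ k := by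
    intro k
    have h2 : A * (r / K) ^ k ≤ M * (k.factorial : ℝ) ^ s := by
      rw [div_pow, mul_div_assoc', div_le_iff₀ (by positivity)]
      linarith [h k]
    have h3 := Real.rpow_le_rpow (by positivity) h2 (by positivity : 0 ≤ 1 / s)
    rw [Real.mul_rpow hA (by positivity), Real.mul_rpow hM (by positivity),
      ← Real.rpow_mul (by positivity : (0 : ℝ) ≤ (k.factorial : ℝ)), mul_one_div_cancel hs.ne',
      Real.rpow_one, ← Real.rpow_natCast, ← Real.rpow_mul (by positivity), mul_comm (k : ℝ),
      Real.rpow_mul (by positivity), Real.rpow_natCast, ← hy] at h3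
    have hf : (0 : ℝ) < k.factorial := by exact_mod_cast k.factorial_pos
    calc A ^ (1 / s) * ((y / 2) ^ k / k.factorial) = A ^ (1 / s) * y ^ k / k.factorial * (1 / 2) ^ k := by
          rw [div_pow, div_pow]; ring
      _ ≤ M ^ (1 / s) * (1 / 2) ^ k := by
          refine mul_le_mul_of_nonneg_right ?_ (by positivity)
          rw [div_le_iff₀ hf]; exact h3
  have h4 : A ^ (1 / s) * Real.exp (y / 2) ≤ M ^ (1 / s) * 2 := by
    have e1 : HasSum (fun k : ℕ => (y / 2) ^ k / (k.factorial : ℝ)) (Real.exp (y / 2)) := by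
      rw [Real.exp_eq_exp_ℝ]; exact NormedSpace.expSeries_div_hasSum_exp (y / 2)
    exact hasSum_le h1 (e1.mul_left _) (hasSum_geometric_two.mul_left _)
  have h5 := Real.rpow_le_rpow (by positivity) h4 hs.le
  rw [Real.mul_rpow (by positivity) (by positivity), Real.mul_rpow (by positivity) (by positivity),
    ← Real.rpow_mul hA, ← Real.rpow_mul hM, one_div_mul_cancel hs.ne', Real.rpow_one, Real.rpow_one,
    ← Real.exp_mul] at h5
  have e6 : -(s / 2 * K⁻¹ ^ (1 / s)) * r ^ (1 / s) = -(y / 2 * s) := by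
    rw [hy, div_eq_mul_inv r K, Real.mul_rpow hr (by positivity)]; ring
  rw [e6, Real.exp_neg, ← div_eq_mul_inv, le_div_iff₀ (Real.exp_pos _)]
  linarith

variable {d₁ d₂ : ℕ}

theorem expWeight_pos (s₁ s₂ r : ℝ) (x : V d₁ × V d₂) : 0 < expWeight s₁ s₂ r x := Real.exp_pos _

theorem expWeight_add (s₁ s₂ r q : ℝ) (x : V d₁ × V d₂) :
    expWeight s₁ s₂ (r + q) x = expWeight s₁ s₂ r x * expWeight s₁ s₂ q x := by
  rw [expWeight, expWeight, expWeight, ← Real.exp_add]; ring_nf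

theorem expWeight_mono {s₁ s₂ r q : ℝ} (h : r ≤ q) (x : V d₁ × V d₂) :
    expWeight s₁ s₂ r x ≤ expWeight s₁ s₂ q x :=
  Real.exp_le_exp.2 (mul_le_mul_of_nonneg_right h (by positivity))

end Weights

section MultiIndex

variable {d d₁ d₂ : ℕ}

theorem mfact_le_factorial (α : Fin d → ℕ) : mfact α ≤ (mlen α).factorial := by
  unfold mfact mlen
  exact_mod_cast Nat.le_of_dvd (Nat.factorial_pos _) (Nat.prod_factorial_dvd_factorial_sum _ _)

theorem factorial_le_mfact (α : Fin d → ℕ) :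
    ((mlen α).factorial : ℝ) ≤ (d : ℝ) ^ mlen α * mfact α := by
  have h1 := Nat.multinomial_spec Finset.univ α
  have h2 : Nat.multinomial Finset.univ α ≤ d ^ mlen α := by
    have := Finset.sum_pow_eq_sum_piAntidiag (R := ℕ) (Finset.univ : Finset (Fin d)) (fun _ => 1)
      (mlen α)
    simp only [Finset.sum_const, Finset.card_univ, Fintype.card_fin, smul_eq_mul, mul_one, one_pow,
      Finset.prod_const_one, Nat.cast_id] at this
    rw [this]
    exact Finset.single_le_sum (f := fun k => Nat.multinomial Finset.univ k) (fun _ _ => Nat.zero_le _)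
      (by simp [mlen])
  have h3 : (mlen α).factorial ≤ d ^ mlen α * ∏ i, (α i).factorial := by
    unfold mlen at *
    rw [← h1, mul_comm]
    exact Nat.mul_le_mul_right _ h2
  unfold mfact
  exact_mod_cast h3

theorem abs_mpow_le (x : V d) (α : Fin d → ℕ) : |mpow x α| ≤ ‖x‖ ^ mlen α := by
  unfold mpow mlen
  rw [Finset.abs_prod, ← Finset.prod_pow_eq_pow_sum]
  refine Finset.prod_le_prod (fun _ _ => abs_nonneg _) fun i _ => ?_
  rw [abs_pow]
  exact pow_le_pow_left₀ (abs_nonneg _) (by simpa using PiLp.norm_apply_le x i) _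

theorem stdVec_norm (i : Fin d) : ‖(stdVec i : V d)‖ = 1 := by simp [stdVec]

theorem vec_eq_sum (v : V d) : v = ∑ j, v j • (stdVec j : V d) := by
  ext k; simp [stdVec, Finset.sum_apply, Pi.single_apply]

theorem exists_mpow (x : V d) (k : ℕ) (hk : k = 0 ∨ x ≠ 0) : ∃ α : Fin d → ℕ, mlen α = k ∧
    mfact α = k.factorial ∧ ‖x‖ ^ k ≤ (d : ℝ) ^ k * |mpow x α| := by
  rcases hk with rfl | hx
  · exact ⟨0, by simp [mlen], by simp [mfact], by simp [mpow]⟩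
  · have hne : Nonempty (Fin d) := by
      by_contra h
      rw [not_nonempty_iff] at h
      exact hx (Subsingleton.elim _ _)
    obtain ⟨i, hi⟩ := Finite.exists_max (fun i => |x i|)
    refine ⟨Pi.single i k, by simp [mlen], ?_, ?_⟩
    · unfold mfact
      rw [Finset.prod_eq_single i]
      · simp
      · intro j _ hj; simp [hj]
      · simp
    · have e : mpow x (Pi.single i k) = x i ^ k := by
        unfold mpow
        rw [Finset.prod_eq_single i]
        · simp
        · intro j _ hj; simp [hj]
        · simp
      rw [e, abs_pow, ← mul_pow]
      refine pow_le_pow_left₀ (norm_nonneg _) ?_ _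
      calc ‖x‖ = ‖∑ j, x j • (stdVec j : V d)‖ := by rw [← vec_eq_sum]
        _ ≤ ∑ j, ‖x j • (stdVec j : V d)‖ := norm_sum_le _ _
        _ ≤ ∑ _j : Fin d, |x i| := Finset.sum_le_sum fun j _ => by
            simpa [norm_smul, stdVec_norm] using hi j
        _ = d * |x i| := by simp

/-- The list of directions which contains the `i`-th one `α i` times. -/
def multiList {X : Type*} (e : Fin d → X) (α : Fin d → ℕ) : List X :=
  (List.finRange d).flatMap fun i => List.replicate (α i) (e i)

theorem multiDeriv_eq_listDeriv {X : Type*} [NormedAddCommGroup X] [NormedSpace ℝ X]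
    (e : Fin d → X) (α : Fin d → ℕ) (f : X → ℂ) :
    multiDeriv e α f = listDeriv (multiList e α) f := by
  have h1 : ∀ (v : X) (n : ℕ) (g : X → ℂ), (dirDeriv v)^[n] g = listDeriv (List.replicate n v) g := by
    intro v n g
    induction n with
    | zero => rfl
    | succ n ih => rw [Function.iterate_succ_apply', ih]; rfl
  unfold multiDeriv multiList
  induction List.finRange d with
  | nil => rfl
  | cons i l ih => rw [List.foldr_cons, ih, h1, List.flatMap_cons, listDeriv_append]

theorem multiList_length {X : Type*} (e : Fin d → X) (α : Fin d → ℕ) :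
    (multiList e α).length = mlen α := by
  simp [multiList, List.length_flatMap, mlen, ← List.ofFn_eq_map, List.sum_ofFn]

theorem multiList_map {X Y : Type*} (g : X → Y) (e : Fin d → X) (α : Fin d → ℕ) :
    (multiList e α).map g = multiList (fun i => g (e i)) α := by
  simp [multiList, List.map_flatMap]

theorem multiList_count (l : List (Fin d)) : l.Perm (multiList id fun i => l.count i) := by
  rw [List.perm_iff_count]
  intro i
  rw [multiList, List.count_flatMap]
  simp only [Function.comp_def, id, List.count_replicate]
  rw [← List.ofFn_eq_map, List.sum_ofFn, Finset.sum_eq_single i]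
  · simp
  · intro j _ hj; simp [hj]
  · simp

theorem unitList_multiList (α : Fin d → ℕ) : UnitList (multiList (stdVec : Fin d → V d) α) := by
  intro v hv
  simp only [multiList, List.mem_flatMap, List.mem_replicate] at hv
  obtain ⟨i, _, _, rfl⟩ := hv
  exact (stdVec_norm i).le

theorem deriv₂_eq_listDeriv (β₁ : Fin d₁ → ℕ) (β₂ : Fin d₂ → ℕ) (F : V d₁ × V d₂ → ℂ) :
    deriv₂ β₁ β₂ F = listDeriv (dirList (multiList stdVec β₁) (multiList stdVec β₂)) F := by
  rw [deriv₂, multiDeriv_eq_listDeriv, multiDeriv_eq_listDeriv, ← listDeriv_append, dirList,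
    multiList_map, multiList_map]

theorem listDeriv_basis (c : List (Fin d₁)) (e : List (Fin d₂)) {F : V d₁ × V d₂ → ℂ}
    (hF : ContDiff ℝ ∞ F) : listDeriv (dirList (c.map stdVec) (e.map stdVec)) F =
      deriv₂ (fun i => c.count i) (fun i => e.count i) F := by
  rw [deriv₂_eq_listDeriv]
  refine listDeriv_perm ?_ hF
  have h1 := (multiList_count c).map (stdVec : Fin d₁ → V d₁)
  have h2 := (multiList_count e).map (stdVec : Fin d₂ → V d₂)
  rw [multiList_map] at h1 h2
  exact (h1.map _).append (h2.map _)

theorem mlen_count (c : List (Fin d)) : mlen (fun i => c.count i) = c.length := by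
  rw [(multiList_count c).length_eq, multiList_length]

theorem listDeriv_le_of_deriv₂ {F : V d₁ × V d₂ → ℂ} (hF : ContDiff ℝ ∞ F) {q : ℝ} (hq : 0 ≤ q)
    {a : ℕ → ℕ → ℝ} (x : V d₁ × V d₂)
    (h : ∀ β₁ β₂, q * ‖deriv₂ β₁ β₂ F x‖ ≤ a (mlen β₁) (mlen β₂))
    (l₁ : List (V d₁)) (l₂ : List (V d₂)) (h₁ : UnitList l₁) (h₂ : UnitList l₂) :
    ∀ (c : List (Fin d₁)) (e : List (Fin d₂)),
    q * ‖listDeriv (dirList l₁ l₂ ++ dirList (c.map stdVec) (e.map stdVec)) F x‖ ≤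
      (d₁ : ℝ) ^ l₁.length * (d₂ : ℝ) ^ l₂.length *
        a (l₁.length + c.length) (l₂.length + e.length) := by
  induction l₁ with
  | nil =>
    induction l₂ with
    | nil =>
      intro c e
      have := h (fun i => c.count i) (fun i => e.count i)
      rw [mlen_count, mlen_count] at this
      simpa [listDeriv_basis c e hF] using this
    | cons w l₂ ih =>
      intro c e
      have hw := h₂.head
      have e1 : dirDeriv ((0, w) : V d₁ × V d₂) (listDeriv (dirList [] l₂ ++
          dirList (c.map stdVec) (e.map stdVec)) F) x = ∑ j, (w j : ℂ) *
          listDeriv (dirList [] l₂ ++ dirList (c.map stdVec) ((j :: e).map stdVec)) F x := by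
        have e2 : ((0, w) : V d₁ × V d₂) = ∑ j, w j • ((0, stdVec j) : V d₁ × V d₂) := by
          ext1
          · simp [Prod.fst_sum]
          · simpa [Prod.snd_sum] using vec_eq_sum w
        rw [e2]
        unfold dirDeriv
        rw [map_sum]
        refine Finset.sum_congr rfl fun j _ => ?_
        rw [map_smul, Complex.real_smul]
        congr 1
        rw [List.map_cons, listDeriv_perm ((dirList_cons_right _ _ _).append_left _) hF,
          listDeriv_perm List.perm_middle hF]
        rfl
      have e3 : listDeriv (dirList ([] : List (V d₁)) (w :: l₂) ++
          dirList (c.map stdVec) (e.map stdVec)) F = dirDeriv ((0, w) : V d₁ × V d₂) (listDeriv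
          (dirList [] l₂ ++ dirList (c.map stdVec) (e.map stdVec)) F) :=
        listDeriv_perm ((dirList_cons_right _ _ _).append_right _) hF
      rw [e3, e1]
      calc _ ≤ q * ∑ j, ‖(w j : ℂ) *
          listDeriv (dirList [] l₂ ++ dirList (c.map stdVec) ((j :: e).map stdVec)) F x‖ :=
            mul_le_mul_of_nonneg_left (norm_sum_le _ _) hq
        _ ≤ ∑ _j : Fin d₂, ((d₁ : ℝ) ^ ([] : List (V d₁)).length * (d₂ : ℝ) ^ l₂.length *
            a (([] : List (V d₁)).length + c.length) ((w :: l₂).length + e.length)) := by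
            rw [Finset.mul_sum]
            refine Finset.sum_le_sum fun j _ => ?_
            have h5 := ih h₂.tail c (j :: e)
            have h6 : ‖(w j : ℂ)‖ ≤ 1 := by
              rw [Complex.norm_real]; exact (PiLp.norm_apply_le w j).trans hw
            rw [norm_mul]
            refine le_trans (mul_le_mul_of_nonneg_left
              (mul_le_of_le_one_left (norm_nonneg _) h6) hq) (h5.trans (le_of_eq ?_))
            simp only [List.length_cons]
            congr 2
            omega
        _ = _ := by simp [pow_succ]; ring
  | cons v l₁ ih =>
    intro c e
    have hv := h₁.head
    have e1 : dirDeriv ((v, 0) : V d₁ × V d₂) (listDeriv (dirList l₁ l₂ ++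
        dirList (c.map stdVec) (e.map stdVec)) F) x = ∑ j, (v j : ℂ) *
        listDeriv (dirList l₁ l₂ ++ dirList ((j :: c).map stdVec) (e.map stdVec)) F x := by
      have e2 : ((v, 0) : V d₁ × V d₂) = ∑ j, v j • ((stdVec j, 0) : V d₁ × V d₂) := by
        ext1
        · simpa [Prod.fst_sum] using vec_eq_sum v
        · simp [Prod.snd_sum]
      rw [e2]
      unfold dirDeriv
      rw [map_sum]
      refine Finset.sum_congr rfl fun j _ => ?_
      rw [map_smul, Complex.real_smul]
      congr 1
      rw [List.map_cons, dirList_cons_left, listDeriv_perm List.perm_middle hF]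
      rfl
    have e3 : listDeriv (dirList (v :: l₁) l₂ ++
        dirList (c.map stdVec) (e.map stdVec)) F = dirDeriv ((v, 0) : V d₁ × V d₂) (listDeriv
        (dirList l₁ l₂ ++ dirList (c.map stdVec) (e.map stdVec)) F) := rfl
    rw [e3, e1]
    calc _ ≤ q * ∑ j, ‖(v j : ℂ) *
        listDeriv (dirList l₁ l₂ ++ dirList ((j :: c).map stdVec) (e.map stdVec)) F x‖ :=
          mul_le_mul_of_nonneg_left (norm_sum_le _ _) hq
      _ ≤ ∑ _j : Fin d₁, ((d₁ : ℝ) ^ l₁.length * (d₂ : ℝ) ^ l₂.length *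
          a ((v :: l₁).length + c.length) (l₂.length + e.length)) := by
          rw [Finset.mul_sum]
          refine Finset.sum_le_sum fun j _ => ?_
          have h5 := ih h₁.tail (j :: c) e
          have h6 : ‖(v j : ℂ)‖ ≤ 1 := by
            rw [Complex.norm_real]; exact (PiLp.norm_apply_le v j).trans hv
          rw [norm_mul]
          refine le_trans (mul_le_mul_of_nonneg_left
            (mul_le_of_le_one_left (norm_nonneg _) h6) hq) (h5.trans (le_of_eq ?_))
          simp only [List.length_cons]
          congr 2
          omega
      _ = _ := by simp [pow_succ]; ring

end MultiIndex

section Conversion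

variable {d₁ d₂ : ℕ} {s₁ s₂ σ₁ σ₂ : ℝ} {F : V d₁ × V d₂ → ℂ}

/-- A bound for the dimensions which is at least one. -/
def dimConst (d₁ d₂ : ℕ) : ℝ := d₁ + d₂ + 1

theorem one_le_dimConst (d₁ d₂ : ℕ) : 1 ≤ dimConst d₁ d₂ := by
  have h1 : (0 : ℝ) ≤ d₁ := by positivity
  have h2 : (0 : ℝ) ≤ d₂ := by positivity
  unfold dimConst; linarith

theorem left_le_dimConst (d₁ d₂ : ℕ) : (d₁ : ℝ) ≤ dimConst d₁ d₂ := by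
  have h2 : (0 : ℝ) ≤ d₂ := by positivity
  unfold dimConst; linarith

theorem right_le_dimConst (d₁ d₂ : ℕ) : (d₂ : ℝ) ≤ dimConst d₁ d₂ := by
  have h2 : (0 : ℝ) ≤ d₁ := by positivity
  unfold dimConst; linarith

theorem gsNorm₂_le_iff {h M : ℝ} (hh : 0 < h) (hM : 0 ≤ M) :
    gsNorm₂ s₁ s₂ σ₁ σ₂ h F ≤ ENNReal.ofReal M ↔ ∀ α₁ α₂ β₁ β₂ x,
      |mpow x.1 α₁ * mpow x.2 α₂| * ‖deriv₂ β₁ β₂ F x‖ ≤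
        M * (h ^ (mlen α₁ + mlen α₂ + mlen β₁ + mlen β₂) *
          mfact α₁ ^ s₁ * mfact α₂ ^ s₂ * mfact β₁ ^ σ₁ * mfact β₂ ^ σ₂) := by
  unfold gsNorm₂
  simp only [iSup_le_iff]
  refine forall_congr' fun α₁ => forall_congr' fun α₂ => forall_congr' fun β₁ =>
    forall_congr' fun β₂ => forall_congr' fun x => ?_
  have h1 := mfact_pos α₁
  have h2 := mfact_pos α₂
  have h3 := mfact_pos β₁
  have h4 := mfact_pos β₂
  rw [ENNReal.ofReal_le_ofReal_iff hM, div_le_iff₀ (by positivity)]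

/-- The rate of decay which belongs to the parameter `h` of a Gelfand-Shilov norm. -/
def decayRate (s₁ s₂ K : ℝ) : ℝ := min (s₁ / 2 * K⁻¹ ^ (1 / s₁)) (s₂ / 2 * K⁻¹ ^ (1 / s₂))

theorem decayRate_pos {K : ℝ} (hs₁ : 0 < s₁) (hs₂ : 0 < s₂) (hK : 0 < K) :
    0 < decayRate s₁ s₂ K := by
  unfold decayRate; exact lt_min (by positivity) (by positivity)

theorem le_expWeight_of_forall_pow {K A M : ℝ} (hs₁ : 0 < s₁) (hs₂ : 0 < s₂) (hK : 0 < K)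
    (hA : 0 ≤ A) (hM : 0 ≤ M) (x : V d₁ × V d₂)
    (h : ∀ k l : ℕ, A * ‖x.1‖ ^ k * ‖x.2‖ ^ l ≤
      M * K ^ k * (k.factorial : ℝ) ^ s₁ * (K ^ l * (l.factorial : ℝ) ^ s₂)) :
    A ≤ 2 ^ s₁ * 2 ^ s₂ * M * expWeight s₁ s₂ (-decayRate s₁ s₂ K) x := by
  have h1 : ∀ l : ℕ, A * ‖x.2‖ ^ l ≤ 2 ^ s₁ * (M * (K ^ l * (l.factorial : ℝ) ^ s₂)) *
      Real.exp (-(s₁ / 2 * K⁻¹ ^ (1 / s₁)) * ‖x.1‖ ^ (1 / s₁)) := fun l =>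
    le_exp_of_forall_pow hs₁ hK (norm_nonneg _) (by positivity) (by positivity) fun k => by
      calc _ = A * ‖x.1‖ ^ k * ‖x.2‖ ^ l := by ring
        _ ≤ _ := h k l
        _ = _ := by ring
  have h2 := le_exp_of_forall_pow hs₂ hK (norm_nonneg x.2) hA (M := 2 ^ s₁ * M *
      Real.exp (-(s₁ / 2 * K⁻¹ ^ (1 / s₁)) * ‖x.1‖ ^ (1 / s₁))) (by positivity) fun l => by
    calc _ ≤ _ := h1 l
      _ = _ := by ring
  refine h2.trans ?_
  have e1 : Real.exp (-(s₁ / 2 * K⁻¹ ^ (1 / s₁)) * ‖x.1‖ ^ (1 / s₁)) *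
      Real.exp (-(s₂ / 2 * K⁻¹ ^ (1 / s₂)) * ‖x.2‖ ^ (1 / s₂)) ≤
      expWeight s₁ s₂ (-decayRate s₁ s₂ K) x := by
    unfold expWeight
    rw [← Real.exp_add, Real.exp_le_exp, mul_add]
    refine add_le_add ?_ ?_
    · exact mul_le_mul_of_nonneg_right (neg_le_neg (min_le_left _ _)) (by positivity)
    · exact mul_le_mul_of_nonneg_right (neg_le_neg (min_le_right _ _)) (by positivity)
  calc _ = 2 ^ s₁ * 2 ^ s₂ * M * (Real.exp (-(s₁ / 2 * K⁻¹ ^ (1 / s₁)) * ‖x.1‖ ^ (1 / s₁)) *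
      Real.exp (-(s₂ / 2 * K⁻¹ ^ (1 / s₂)) * ‖x.2‖ ^ (1 / s₂))) := by ring
    _ ≤ _ := by gcongr

theorem gevreyBound_of_gsNorm₂ {h M : ℝ} (hs₁ : 0 < s₁) (hs₂ : 0 < s₂) (hσ₁ : 0 ≤ σ₁)
    (hσ₂ : 0 ≤ σ₂) (hh : 0 < h) (hM : 0 ≤ M) (hF : ContDiff ℝ ∞ F)
    (hn : gsNorm₂ s₁ s₂ σ₁ σ₂ h F ≤ ENNReal.ofReal M) :
    GevreyBound σ₁ σ₂ (dimConst d₁ d₂ * h) (fun x => 2 ^ s₁ * 2 ^ s₂ * M *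
      expWeight s₁ s₂ (-decayRate s₁ s₂ (dimConst d₁ d₂ * h)) x) F := by
  rw [gsNorm₂_le_iff hh hM] at hn
  refine ⟨hF, fun l₁ l₂ u₁ u₂ x => ?_⟩
  have hD := one_le_dimConst d₁ d₂
  set D := dimConst d₁ d₂
  have hK : 0 < D * h := by positivity
  have key := le_expWeight_of_forall_pow hs₁ hs₂ hK
    (norm_nonneg (listDeriv (dirList l₁ l₂) F x)) (M := M * gevrey σ₁ σ₂ (D * h) l₁.length l₂.length)
    (mul_nonneg hM (gevrey_pos hK _ _).le) x (by
      intro k l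
      have hg := gevrey_pos (σ₁ := σ₁) (σ₂ := σ₂) hK l₁.length l₂.length
      by_cases h1 : k = 0 ∨ x.1 ≠ 0
      · by_cases h2 : l = 0 ∨ x.2 ≠ 0
        · obtain ⟨α₁, a1, a2, a3⟩ := exists_mpow x.1 k h1
          obtain ⟨α₂, b1, b2, b3⟩ := exists_mpow x.2 l h2
          have h3 := listDeriv_le_of_deriv₂ hF (abs_nonneg (mpow x.1 α₁ * mpow x.2 α₂)) x
            (a := fun m n => M * (h ^ (k + l) * (k.factorial : ℝ) ^ s₁ * (l.factorial : ℝ) ^ s₂ *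
              gevrey σ₁ σ₂ h m n)) (by
              intro β₁ β₂
              refine (hn α₁ α₂ β₁ β₂ x).trans ?_
              rw [a1, a2, b1, b2, gevrey, add_assoc (k + l), pow_add h (k + l)]
              have c1 := mfact_pos β₁
              have c2 := mfact_pos β₂
              have c3 : mfact β₁ ^ σ₁ ≤ ((mlen β₁).factorial : ℝ) ^ σ₁ :=
                Real.rpow_le_rpow c1.le (mfact_le_factorial β₁) hσ₁
              have c4 : mfact β₂ ^ σ₂ ≤ ((mlen β₂).factorial : ℝ) ^ σ₂ :=
                Real.rpow_le_rpow c2.le (mfact_le_factorial β₂) hσ₂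
              calc _ = M * (h ^ (k + l) * h ^ (mlen β₁ + mlen β₂) * (k.factorial : ℝ) ^ s₁ *
                    (l.factorial : ℝ) ^ s₂ * (mfact β₁ ^ σ₁ * mfact β₂ ^ σ₂)) := by ring
                _ ≤ M * (h ^ (k + l) * h ^ (mlen β₁ + mlen β₂) * (k.factorial : ℝ) ^ s₁ *
                    (l.factorial : ℝ) ^ s₂ * (((mlen β₁).factorial : ℝ) ^ σ₁ *
                      ((mlen β₂).factorial : ℝ) ^ σ₂)) := by gcongr
                _ = _ := by ring) l₁ l₂ u₁ u₂ [] []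
          simp only [List.map_nil, dirList_nil, List.append_nil, List.length_nil, add_zero] at h3
          have hD1 : (d₁ : ℝ) ≤ D := left_le_dimConst d₁ d₂
          have hD2 : (d₂ : ℝ) ≤ D := right_le_dimConst d₁ d₂
          calc ‖listDeriv (dirList l₁ l₂) F x‖ * ‖x.1‖ ^ k * ‖x.2‖ ^ l
              ≤ ‖listDeriv (dirList l₁ l₂) F x‖ * ((d₁ : ℝ) ^ k * |mpow x.1 α₁|) *
                ((d₂ : ℝ) ^ l * |mpow x.2 α₂|) := by gcongr
            _ = (d₁ : ℝ) ^ k * (d₂ : ℝ) ^ l * (|mpow x.1 α₁ * mpow x.2 α₂| *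
                ‖listDeriv (dirList l₁ l₂) F x‖) := by rw [abs_mul]; ring
            _ ≤ D ^ k * D ^ l * (D ^ l₁.length * D ^ l₂.length *
                (M * (h ^ (k + l) * (k.factorial : ℝ) ^ s₁ * (l.factorial : ℝ) ^ s₂ *
                  gevrey σ₁ σ₂ h l₁.length l₂.length))) := by
                have := gevrey_pos (σ₁ := σ₁) (σ₂ := σ₂) hh l₁.length l₂.length
                refine mul_le_mul (by gcongr) (h3.trans ?_) (by positivity) (by positivity)
                gcongr
            _ = _ := by unfold gevrey; rw [mul_pow, mul_pow, mul_pow]; ring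
        · push Not at h2
          rw [h2.2, norm_zero, zero_pow h2.1, mul_zero]
          positivity
      · push Not at h1
        rw [h1.2, norm_zero, zero_pow h1.1, mul_zero, zero_mul]
        positivity)
  refine key.trans (le_of_eq ?_)
  ring

/-- The parameter of the Gelfand-Shilov norm which controls Gevrey bounds of rate `h` with a
weight of decay rate `R`. -/
def normRate (d₁ d₂ : ℕ) (s₁ s₂ σ₁ σ₂ h R : ℝ) : ℝ :=
  dimConst d₁ d₂ ^ (s₁ + s₂ + σ₁ + σ₂) * (h + (s₁ / R) ^ s₁ + (s₂ / R) ^ s₂)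

theorem normRate_pos {h R : ℝ} (hh : 0 < h) (hs₁ : 0 < s₁) (hs₂ : 0 < s₂) (hR : 0 < R) :
    0 < normRate d₁ d₂ s₁ s₂ σ₁ σ₂ h R := by
  have := one_le_dimConst d₁ d₂
  unfold normRate; positivity

theorem factorial_rpow_le {d : ℕ} {D p σ : ℝ} (hD : 1 ≤ D) (hd : (d : ℝ) ≤ D) (hσ : 0 ≤ σ)
    (hp : σ ≤ p) (α : Fin d → ℕ) :
    ((mlen α).factorial : ℝ) ^ σ ≤ (D ^ p) ^ mlen α * mfact α ^ σ := by
  have h1 := factorial_le_mfact α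
  have h2 := mfact_pos α
  have h3 : (d : ℝ) ^ mlen α ≤ D ^ mlen α := pow_le_pow_left₀ (by positivity) hd _
  calc ((mlen α).factorial : ℝ) ^ σ ≤ (D ^ mlen α * mfact α) ^ σ :=
        Real.rpow_le_rpow (by positivity) (h1.trans (by gcongr)) hσ
    _ = (D ^ mlen α) ^ σ * mfact α ^ σ := Real.mul_rpow (by positivity) h2.le
    _ = (D ^ σ) ^ mlen α * mfact α ^ σ := by
        rw [← Real.rpow_natCast, ← Real.rpow_natCast, ← Real.rpow_mul (by positivity),
          ← Real.rpow_mul (by positivity), mul_comm σ]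
    _ ≤ _ := by gcongr

theorem gsNorm₂_le_of_gevreyBound {h R M : ℝ} (hs₁ : 0 < s₁) (hs₂ : 0 < s₂) (hσ₁ : 0 ≤ σ₁)
    (hσ₂ : 0 ≤ σ₂) (hh : 0 < h) (hR : 0 < R) (hM : 0 ≤ M)
    (hF : GevreyBound σ₁ σ₂ h (fun x => M * expWeight s₁ s₂ (-R) x) F) :
    gsNorm₂ s₁ s₂ σ₁ σ₂ (normRate d₁ d₂ s₁ s₂ σ₁ σ₂ h R) F ≤ ENNReal.ofReal M := by
  rw [gsNorm₂_le_iff (normRate_pos hh hs₁ hs₂ hR) hM]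
  intro α₁ α₂ β₁ β₂ x
  have hb := hF.bound _ _ (unitList_multiList β₁) (unitList_multiList β₂) x
  rw [← deriv₂_eq_listDeriv, multiList_length, multiList_length] at hb
  have hD := one_le_dimConst d₁ d₂
  have hD1 : (d₁ : ℝ) ≤ dimConst d₁ d₂ := left_le_dimConst d₁ d₂
  have hD2 : (d₂ : ℝ) ≤ dimConst d₁ d₂ := right_le_dimConst d₁ d₂
  have p1 := pow_le_exp_rpow hs₁ hR (norm_nonneg x.1) (mlen α₁)
  have p2 := pow_le_exp_rpow hs₂ hR (norm_nonneg x.2) (mlen α₂)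
  unfold normRate
  set D := dimConst d₁ d₂
  set p := s₁ + s₂ + σ₁ + σ₂
  have f1 := factorial_rpow_le hD hD1 hs₁.le (p := p) (by simp only [p]; linarith) α₁
  have f2 := factorial_rpow_le hD hD2 hs₂.le (p := p) (by simp only [p]; linarith) α₂
  have f3 := factorial_rpow_le hD hD1 hσ₁ (p := p) (by simp only [p]; linarith) β₁
  have f4 := factorial_rpow_le hD hD2 hσ₂ (p := p) (by simp only [p]; linarith) β₂
  set H₁ := (s₁ / R) ^ s₁
  set H₂ := (s₂ / R) ^ s₂
  have hH₁ : 0 < H₁ := by positivity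
  have hH₂ : 0 < H₂ := by positivity
  have m1 := mfact_pos α₁
  have m2 := mfact_pos α₂
  have m3 := mfact_pos β₁
  have m4 := mfact_pos β₂
  have e1 : expWeight s₁ s₂ (-R) x =
      (Real.exp (R * ‖x.1‖ ^ (1 / s₁)))⁻¹ * (Real.exp (R * ‖x.2‖ ^ (1 / s₂)))⁻¹ := by
    rw [expWeight, ← Real.exp_neg, ← Real.exp_neg, ← Real.exp_add]; ring_nf
  set E₁ := Real.exp (R * ‖x.1‖ ^ (1 / s₁))
  set E₂ := Real.exp (R * ‖x.2‖ ^ (1 / s₂))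
  have hE₁ : 0 < E₁ := Real.exp_pos _
  have hE₂ : 0 < E₂ := Real.exp_pos _
  set T := h + H₁ + H₂
  rw [abs_mul]
  calc |mpow x.1 α₁| * |mpow x.2 α₂| * ‖deriv₂ β₁ β₂ F x‖
      ≤ (H₁ ^ mlen α₁ * ((mlen α₁).factorial : ℝ) ^ s₁ * E₁) *
        (H₂ ^ mlen α₂ * ((mlen α₂).factorial : ℝ) ^ s₂ * E₂) *
        (gevrey σ₁ σ₂ h (mlen β₁) (mlen β₂) * (M * (E₁⁻¹ * E₂⁻¹))) := by
        rw [e1] at hb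
        gcongr
        · exact (abs_mpow_le _ _).trans p1
        · exact (abs_mpow_le _ _).trans p2
    _ = M * (H₁ ^ mlen α₁ * H₂ ^ mlen α₂ * h ^ mlen β₁ * h ^ mlen β₂) *
        (((mlen α₁).factorial : ℝ) ^ s₁ * ((mlen α₂).factorial : ℝ) ^ s₂ *
        (((mlen β₁).factorial : ℝ) ^ σ₁ * ((mlen β₂).factorial : ℝ) ^ σ₂)) := by
        unfold gevrey; field_simp; ring
    _ ≤ M * (T ^ mlen α₁ * T ^ mlen α₂ * T ^ mlen β₁ * T ^ mlen β₂) *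
        (((D ^ p) ^ mlen α₁ * mfact α₁ ^ s₁) * ((D ^ p) ^ mlen α₂ * mfact α₂ ^ s₂) *
        (((D ^ p) ^ mlen β₁ * mfact β₁ ^ σ₁) * ((D ^ p) ^ mlen β₂ * mfact β₂ ^ σ₂))) := by
        have t1 : H₁ ≤ T := by simp only [T]; linarith
        have t2 : H₂ ≤ T := by simp only [T]; linarith
        have t3 : h ≤ T := by simp only [T]; linarith
        gcongr
    _ = _ := by simp only [mul_pow, pow_add]; ring

theorem symbolNorm_le_iff {h M : ℝ} {w : V d₁ × V d₂ → ℝ} (hw : ∀ x, 0 < w x) (hh : 0 < h)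
    (hM : 0 ≤ M) :
    symbolNorm σ₁ σ₂ h w F ≤ ENNReal.ofReal M ↔ ∀ β₁ β₂ x, ‖deriv₂ β₁ β₂ F x‖ ≤
        M * (h ^ (mlen β₁ + mlen β₂) * mfact β₁ ^ σ₁ * mfact β₂ ^ σ₂ * w x) := by
  unfold symbolNorm
  simp only [iSup_le_iff]
  refine forall_congr' fun β₁ => forall_congr' fun β₂ => forall_congr' fun x => ?_
  have h3 := mfact_pos β₁
  have h4 := mfact_pos β₂
  have h5 := hw x
  rw [ENNReal.ofReal_le_ofReal_iff hM, div_le_iff₀ (by positivity)]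

theorem gevreyBound_of_symbolNorm {h M : ℝ} {w : V d₁ × V d₂ → ℝ} (hw : ∀ x, 0 < w x)
    (hσ₁ : 0 ≤ σ₁) (hσ₂ : 0 ≤ σ₂) (hh : 0 < h) (hM : 0 ≤ M) (hF : ContDiff ℝ ∞ F)
    (hn : symbolNorm σ₁ σ₂ h w F ≤ ENNReal.ofReal M) :
    GevreyBound σ₁ σ₂ (dimConst d₁ d₂ * h) (fun x => M * w x) F := by
  rw [symbolNorm_le_iff hw hh hM] at hn
  refine ⟨hF, fun l₁ l₂ u₁ u₂ x => ?_⟩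
  have hD := one_le_dimConst d₁ d₂
  have hD1 : (d₁ : ℝ) ≤ dimConst d₁ d₂ := left_le_dimConst d₁ d₂
  have hD2 : (d₂ : ℝ) ≤ dimConst d₁ d₂ := right_le_dimConst d₁ d₂
  set D := dimConst d₁ d₂
  have hwx := hw x
  have h3 := listDeriv_le_of_deriv₂ hF zero_le_one x
    (a := fun m n => gevrey σ₁ σ₂ h m n * (M * w x)) (by
      intro β₁ β₂
      rw [one_mul]
      refine (hn β₁ β₂ x).trans ?_
      rw [gevrey]
      have c1 := mfact_pos β₁
      have c2 := mfact_pos β₂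
      have c3 : mfact β₁ ^ σ₁ ≤ ((mlen β₁).factorial : ℝ) ^ σ₁ :=
        Real.rpow_le_rpow c1.le (mfact_le_factorial β₁) hσ₁
      have c4 : mfact β₂ ^ σ₂ ≤ ((mlen β₂).factorial : ℝ) ^ σ₂ :=
        Real.rpow_le_rpow c2.le (mfact_le_factorial β₂) hσ₂
      calc _ = (h ^ (mlen β₁ + mlen β₂) * mfact β₁ ^ σ₁ * mfact β₂ ^ σ₂) * (M * w x) := by ring
        _ ≤ _ := by gcongr) l₁ l₂ u₁ u₂ [] []
  simp only [List.map_nil, dirList_nil, List.append_nil, List.length_nil, add_zero, one_mul] at h3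
  refine h3.trans ?_
  calc _ ≤ D ^ l₁.length * D ^ l₂.length * (gevrey σ₁ σ₂ h l₁.length l₂.length * (M * w x)) := by
        have := gevrey_pos (σ₁ := σ₁) (σ₂ := σ₂) hh l₁.length l₂.length
        gcongr
    _ = _ := by unfold gevrey; rw [mul_pow, pow_add D]; ring

theorem symbolNorm_le_of_gevreyBound {h M : ℝ} {w : V d₁ × V d₂ → ℝ} (hw : ∀ x, 0 < w x)
    (hσ₁ : 0 ≤ σ₁) (hσ₂ : 0 ≤ σ₂) (hh : 0 < h) (hM : 0 ≤ M)
    (hF : GevreyBound σ₁ σ₂ h (fun x => M * w x) F) :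
    symbolNorm σ₁ σ₂ (dimConst d₁ d₂ ^ (σ₁ + σ₂) * h) w F ≤ ENNReal.ofReal M := by
  have hD := one_le_dimConst d₁ d₂
  have hD1 : (d₁ : ℝ) ≤ dimConst d₁ d₂ := left_le_dimConst d₁ d₂
  have hD2 : (d₂ : ℝ) ≤ dimConst d₁ d₂ := right_le_dimConst d₁ d₂
  rw [symbolNorm_le_iff hw (by positivity) hM]
  intro β₁ β₂ x
  have hb := hF.bound _ _ (unitList_multiList β₁) (unitList_multiList β₂) x
  rw [← deriv₂_eq_listDeriv, multiList_length, multiList_length] at hb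
  set D := dimConst d₁ d₂
  have f3 := factorial_rpow_le hD hD1 hσ₁ (p := σ₁ + σ₂) (by linarith) β₁
  have f4 := factorial_rpow_le hD hD2 hσ₂ (p := σ₁ + σ₂) (by linarith) β₂
  have hwx := hw x
  have m3 := mfact_pos β₁
  have m4 := mfact_pos β₂
  refine hb.trans ?_
  unfold gevrey
  calc _ ≤ h ^ (mlen β₁ + mlen β₂) * ((D ^ (σ₁ + σ₂)) ^ mlen β₁ * mfact β₁ ^ σ₁) *
        ((D ^ (σ₁ + σ₂)) ^ mlen β₂ * mfact β₂ ^ σ₂) * (M * w x) := by gcongr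
    _ = _ := by rw [mul_pow, pow_add (D ^ (σ₁ + σ₂))]; ring

end Conversion

section ParametricIntegral

variable {Z X : Type*} [MeasurableSpace Z] {μ : Measure Z}
  [NormedAddCommGroup X] [NormedSpace ℝ X]

/-- A family of smooth functions whose derivatives are locally dominated by integrable
functions of the parameter. -/
structure DominatedFamily (μ : Measure Z) (G : Z → X → ℂ) : Prop where
  smooth : ∀ z, ContDiff ℝ ∞ (G z)
  meas : ∀ x, AEStronglyMeasurable (fun z => G z x) μ
  bound : ∀ (l : List X) (x₀ : X), ∃ b : Z → ℝ, Integrable b μ ∧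
    ∀ z, ∀ x ∈ Metric.ball x₀ 1, ‖listDeriv l (G z) x‖ ≤ b z

variable {G : Z → X → ℂ}

theorem DominatedFamily.dir (H : DominatedFamily μ G) (v : X) :
    DominatedFamily μ (fun z => dirDeriv v (G z)) := by
  refine ⟨fun z => dirDeriv_smooth (H.smooth z), fun x => ?_, fun l x₀ => ?_⟩
  · have h1 : ∀ n : ℕ, AEStronglyMeasurable
        (fun z => (n : ℝ) • (G z (x + (n : ℝ)⁻¹ • v) - G z x)) μ := fun n =>
      ((H.meas (x + (n : ℝ)⁻¹ • v)).sub (H.meas x)).const_smul (n : ℝ)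
    refine aestronglyMeasurable_of_tendsto_ae Filter.atTop h1 (Filter.Eventually.of_forall ?_)
    intro z
    have h2 : HasFDerivAt (G z) (fderiv ℝ (G z) x) x :=
      ((H.smooth z).differentiable (by simp) x).hasFDerivAt
    exact h2.lim v (by simpa using tendsto_natCast_atTop_atTop)
  · obtain ⟨b, hb, hb'⟩ := H.bound (l ++ [v]) x₀
    refine ⟨b, hb, fun z x hx => ?_⟩
    have := hb' z x hx
    rwa [listDeriv_append] at this

theorem DominatedFamily.list (H : DominatedFamily μ G) (l : List X) :
    DominatedFamily μ (fun z => listDeriv l (G z)) := by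
  induction l with
  | nil => exact H
  | cons v l ih => exact ih.dir v

theorem DominatedFamily.integrable (H : DominatedFamily μ G) (x : X) :
    Integrable (fun z => G z x) μ := by
  obtain ⟨b, hb, hb'⟩ := H.bound [] x
  exact hb.mono' (H.meas x) (Filter.Eventually.of_forall fun z =>
    hb' z x (Metric.mem_ball_self one_pos))

variable [FiniteDimensional ℝ X]

theorem DominatedFamily.hasFDerivAt (H : DominatedFamily μ G) (x₀ : X) :
    Integrable (fun z => fderiv ℝ (G z) x₀) μ ∧
    HasFDerivAt (fun x => ∫ z, G z x ∂μ) (∫ z, fderiv ℝ (G z) x₀ ∂μ) x₀ := by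
  classical
  set e := Module.finBasis ℝ X
  obtain ⟨C, hC, hC'⟩ := e.exists_opNorm_le (F := ℂ)
  choose b hb hb' using fun i => H.bound [e i] x₀
  have hbd : ∀ z, ∀ x ∈ Metric.ball x₀ 1, ‖fderiv ℝ (G z) x‖ ≤ C * ∑ i, b i z := by
    intro z x hx
    have h0 : ∀ i, 0 ≤ b i z := fun i => (norm_nonneg _).trans (hb' i z x hx)
    refine hC' (Finset.sum_nonneg fun i _ => h0 i) fun i => ?_
    refine (hb' i z x hx).trans (Finset.single_le_sum (fun j _ => h0 j) (Finset.mem_univ i))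
  have hmeas : AEStronglyMeasurable (fun z => fderiv ℝ (G z) x₀) μ := by
    have e1 : (fun z => fderiv ℝ (G z) x₀) = fun z => ∑ i,
        (LinearMap.toContinuousLinearMap (e.coord i)).smulRight (fderiv ℝ (G z) x₀ (e i)) := by
      funext z
      ext x
      conv_lhs => rw [← e.sum_repr x, map_sum]
      simp
    rw [e1]
    refine Finset.aestronglyMeasurable_fun_sum _ fun i _ => ?_
    exact ((ContinuousLinearMap.smulRightL ℝ X ℂ
      (LinearMap.toContinuousLinearMap (e.coord i))).continuous.comp_aestronglyMeasurable
        ((H.dir (e i)).meas x₀))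
  have hint : Integrable (fun z => C * ∑ i, b i z) μ :=
    (integrable_finsetSum _ fun i _ => hb i).const_mul C
  refine ⟨hint.mono' hmeas (Filter.Eventually.of_forall fun z =>
    hbd z x₀ (Metric.mem_ball_self one_pos)), ?_⟩
  exact hasFDerivAt_integral_of_dominated_of_fderiv_le (F := fun x z => G z x)
    (F' := fun x z => fderiv ℝ (G z) x) (Metric.ball_mem_nhds x₀ one_pos)
    (Filter.Eventually.of_forall H.meas) (H.integrable x₀) hmeas
    (Filter.Eventually.of_forall hbd) hint
    (Filter.Eventually.of_forall fun z x _ =>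
      ((H.smooth z).differentiable (by simp) x).hasFDerivAt)

theorem DominatedFamily.dirDeriv_integral (H : DominatedFamily μ G) (v : X) :
    dirDeriv v (fun x => ∫ z, G z x ∂μ) =
      fun x => ∫ z, dirDeriv v (G z) x ∂μ := by
  funext x
  obtain ⟨h1, h2⟩ := H.hasFDerivAt x
  unfold dirDeriv
  rw [h2.fderiv, ContinuousLinearMap.integral_apply h1]

theorem DominatedFamily.contDiff (H : DominatedFamily μ G) :
    ContDiff ℝ ∞ (fun x => ∫ z, G z x ∂μ) := by
  rw [contDiff_infty]
  intro n
  induction n generalizing G with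
  | zero =>
    refine contDiff_zero.2 (continuous_iff_continuousAt.2 fun x => ?_)
    exact (H.hasFDerivAt x).2.continuousAt
  | succ n ih =>
    have := (contDiff_succ_iff_fderiv_apply (𝕜 := ℝ) (n := n) (f := fun x => ∫ z, G z x ∂μ)).2
      ⟨fun x => (H.hasFDerivAt x).2.differentiableAt, fun h => by simp at h, fun v => by
        have h1 := ih (H.dir v)
        rwa [← H.dirDeriv_integral v] at h1⟩
    exact_mod_cast this

theorem DominatedFamily.listDeriv_integral (H : DominatedFamily μ G) (l : List X) :
    listDeriv l (fun x => ∫ z, G z x ∂μ) = fun x => ∫ z, listDeriv l (G z) x ∂μ := by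
  induction l generalizing G with
  | nil => rfl
  | cons v l ih =>
    rw [listDeriv_cons' _ _ H.contDiff, H.dirDeriv_integral v, ih (H.dir v)]
    funext x
    refine integral_congr_ae (Filter.Eventually.of_forall fun z => ?_)
    simp only [← listDeriv_cons' v l (H.smooth z)]

end ParametricIntegral

section Rapid

instance (d₁ d₂ : ℕ) : (volume : Measure (V d₁ × V d₂)).IsAddHaarMeasure :=
  inferInstanceAs ((volume : Measure (V d₁)).prod (volume : Measure (V d₂))).IsAddHaarMeasure

/-- Functions all of whose derivatives decay rapidly. -/
structure Rapid {X : Type*} [NormedAddCommGroup X] [NormedSpace ℝ X] (f : X → ℂ) : Prop where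
  smooth : ContDiff ℝ ∞ f
  decay : ∀ (l : List X) (k : ℕ), ∃ C : ℝ, ∀ x, (1 + ‖x‖) ^ k * ‖listDeriv l f x‖ ≤ C

section General

variable {X : Type*} [NormedAddCommGroup X] [NormedSpace ℝ X] {f g : X → ℂ}

theorem Rapid.dir (hf : Rapid f) (v : X) : Rapid (dirDeriv v f) :=
  ⟨dirDeriv_smooth hf.smooth, fun l k => by
    rw [← listDeriv_cons' _ _ hf.smooth]; exact hf.decay _ k⟩

theorem Rapid.list (hf : Rapid f) (l : List X) : Rapid (listDeriv l f) := by
  induction l with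
  | nil => exact hf
  | cons v l ih => exact ih.dir v

theorem Rapid.add (hf : Rapid f) (hg : Rapid g) : Rapid (f + g) :=
  ⟨hf.smooth.add hg.smooth, fun l k => by
    obtain ⟨C, hC⟩ := hf.decay l k
    obtain ⟨D, hD⟩ := hg.decay l k
    refine ⟨C + D, fun x => ?_⟩
    rw [listDeriv_add l hf.smooth hg.smooth]
    calc _ ≤ (1 + ‖x‖) ^ k * (‖listDeriv l f x‖ + ‖listDeriv l g x‖) := by
          gcongr; exact norm_add_le _ _
      _ ≤ _ := by rw [mul_add]; exact add_le_add (hC x) (hD x)⟩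

theorem Rapid.smul (c : ℂ) (hf : Rapid f) : Rapid (c • f) :=
  ⟨hf.smooth.const_smul c, fun l k => by
    obtain ⟨C, hC⟩ := hf.decay l k
    refine ⟨‖c‖ * C, fun x => ?_⟩
    rw [listDeriv_smul l c hf.smooth, Pi.smul_apply, norm_smul]
    calc _ = ‖c‖ * ((1 + ‖x‖) ^ k * ‖listDeriv l f x‖) := by ring
      _ ≤ _ := mul_le_mul_of_nonneg_left (hC x) (norm_nonneg _)⟩

theorem contDiff_linear_mul (L : X →L[ℝ] ℝ) (hf : ContDiff ℝ ∞ f) :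
    ContDiff ℝ ∞ (fun x => (L x : ℂ) * f x) :=
  (Complex.ofRealCLM.contDiff.comp L.contDiff).mul hf

theorem dirDeriv_linear (L : X →L[ℝ] ℝ) (v : X) :
    dirDeriv v (fun x => (L x : ℂ)) = fun _ => (L v : ℂ) := by
  funext x
  have : HasFDerivAt (fun x => (L x : ℂ)) (Complex.ofRealCLM.comp L) x :=
    (Complex.ofRealCLM.comp L).hasFDerivAt
  unfold dirDeriv
  rw [this.fderiv]; rfl

theorem dirDeriv_linear_mul (L : X →L[ℝ] ℝ) (v : X) (hf : ContDiff ℝ ∞ f) :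
    dirDeriv v (fun x => (L x : ℂ) * f x) =
      (L v : ℂ) • f + fun x => (L x : ℂ) * dirDeriv v f x := by
  have h := dirDeriv_mul v (F := fun x => (L x : ℂ)) (G := f)
    (Complex.ofRealCLM.contDiff.comp L.contDiff) hf
  have e : (fun x => (L x : ℂ)) * f = fun x => (L x : ℂ) * f x := rfl
  rw [e, dirDeriv_linear] at h
  rw [h]; rfl

theorem Rapid.linear_mul (hf : Rapid f) (L : X →L[ℝ] ℝ) :
    Rapid (fun x => (L x : ℂ) * f x) := by
  refine ⟨contDiff_linear_mul L hf.smooth, fun l => ?_⟩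
  induction l generalizing f with
  | nil =>
    intro k
    obtain ⟨C, hC⟩ := hf.decay [] (k + 1)
    refine ⟨‖L‖ * C, fun x => ?_⟩
    simp only [listDeriv_nil, norm_mul, Complex.norm_real] at hC ⊢
    calc (1 + ‖x‖) ^ k * (‖L x‖ * ‖f x‖) ≤ (1 + ‖x‖) ^ k * ((‖L‖ * (1 + ‖x‖)) * ‖f x‖) := by
          gcongr
          exact (L.le_opNorm x).trans (by gcongr; linarith)
      _ = ‖L‖ * ((1 + ‖x‖) ^ (k + 1) * ‖f x‖) := by ring
      _ ≤ _ := mul_le_mul_of_nonneg_left (hC x) (norm_nonneg _)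
  | cons v l ih =>
    intro k
    obtain ⟨C, hC⟩ := (hf.smul (L v : ℂ)).decay l k
    obtain ⟨D, hD⟩ := ih (hf.dir v) k
    refine ⟨C + D, fun x => ?_⟩
    have hs : ContDiff ℝ ∞ ((L v : ℂ) • f) := (hf.smul _).smooth
    rw [listDeriv_cons' _ _ (contDiff_linear_mul L hf.smooth), dirDeriv_linear_mul L v hf.smooth,
      listDeriv_add l hs (contDiff_linear_mul L (dirDeriv_smooth hf.smooth))]
    refine (mul_le_mul_of_nonneg_left (norm_add_le _ _) (by positivity)).trans ?_
    rw [mul_add]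
    exact add_le_add (hC x) (hD x)

end General

variable {d₁ d₂ : ℕ} {f g : V d₁ × V d₂ → ℂ}

theorem Rapid.exists_norm_le (hf : Rapid f) : ∃ C : ℝ, 0 ≤ C ∧ ∀ x,
    ‖f x‖ ≤ C * ((1 + ‖x.1‖) ^ (-((d₁ : ℝ) + 1)) * (1 + ‖x.2‖) ^ (-((d₂ : ℝ) + 1))) := by
  obtain ⟨C, hC⟩ := hf.decay [] (d₁ + 1 + (d₂ + 1))
  simp only [listDeriv_nil] at hC
  refine ⟨C, le_trans (by positivity) (hC 0), fun x => ?_⟩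
  have h1 : ∀ (n : ℕ) (t : ℝ), 0 ≤ t → (1 + t) ^ (-((n : ℝ) + 1)) = ((1 + t) ^ (n + 1))⁻¹ := by
    intro n t ht
    rw [Real.rpow_neg (by positivity)]
    congr 1
    exact_mod_cast Real.rpow_natCast (1 + t) (n + 1)
  rw [h1 _ _ (norm_nonneg _), h1 _ _ (norm_nonneg _), ← mul_inv, ← div_eq_mul_inv,
    le_div_iff₀ (by positivity)]
  refine le_trans ?_ (hC x)
  rw [pow_add (1 + ‖x‖) (d₁ + 1), mul_comm ‖f x‖]
  have e1 := norm_fst_le x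
  have e2 := norm_snd_le x
  exact mul_le_mul_of_nonneg_right (mul_le_mul (by gcongr) (by gcongr) (by positivity)
    (by positivity)) (norm_nonneg _)

theorem integrable_decay (d : ℕ) :
    Integrable (fun x : V d => (1 + ‖x‖) ^ (-((d : ℝ) + 1))) :=
  integrable_one_add_norm (by simp)

theorem Rapid.integrable (hf : Rapid f) : Integrable f := by
  obtain ⟨C, hC, h⟩ := hf.exists_norm_le
  have h1 : Integrable (fun x : V d₁ × V d₂ => (1 + ‖x.1‖) ^ (-((d₁ : ℝ) + 1)) *
      (1 + ‖x.2‖) ^ (-((d₂ : ℝ) + 1))) := (integrable_decay d₁).mul_prod (integrable_decay d₂)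
  exact (h1.const_mul C).mono' hf.smooth.continuous.aestronglyMeasurable
    (Filter.Eventually.of_forall h)

theorem Rapid.exists_norm_le_right (hf : Rapid f) : ∃ C : ℝ, 0 ≤ C ∧ ∀ x v,
    ‖f (x, v)‖ ≤ C * (1 + ‖v‖) ^ (-((d₂ : ℝ) + 1)) := by
  obtain ⟨C, hC, h⟩ := hf.exists_norm_le
  refine ⟨C, hC, fun x v => (h (x, v)).trans (mul_le_mul_of_nonneg_left ?_ hC)⟩
  refine mul_le_of_le_one_left (by positivity) ?_
  exact Real.rpow_le_one_of_one_le_of_nonpos (by linarith [norm_nonneg x]) (by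
    have : (0 : ℝ) ≤ d₁ := by positivity
    linarith)

theorem Rapid.integrable_right (hf : Rapid f) (x : V d₁) : Integrable (fun v => f (x, v)) := by
  obtain ⟨C, hC, h⟩ := hf.exists_norm_le_right
  exact ((integrable_decay d₂).const_mul C).mono'
    (hf.smooth.continuous.comp (by fun_prop)).aestronglyMeasurable
    (Filter.Eventually.of_forall fun v => h x v)

end Rapid

section PartialFourier

variable {d₁ d₂ : ℕ} {f g : V d₁ × V d₂ → ℂ}

/-- The character `v ↦ e^{i⟨v, ξ⟩}`. -/
def char {d : ℕ} (v ξ : V d) : ℂ := Complex.exp (Complex.I * ((inner ℝ v ξ : ℝ) : ℂ))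

theorem norm_char {d : ℕ} (v ξ : V d) : ‖char v ξ‖ = 1 := by
  rw [char, mul_comm, Complex.norm_exp_ofReal_mul_I]

theorem continuous_char {d : ℕ} : Continuous (fun p : V d × V d => char p.1 p.2) := by
  unfold char; fun_prop

/-- The (unnormalized, inverse) Fourier transform in the second variable. -/
def partialFourier (f : V d₁ × V d₂ → ℂ) : V d₁ × V d₂ → ℂ :=
  fun p => ∫ v : V d₂, f (p.1, v) * char v p.2

/-- The function `x ↦ ⟨x.2, w⟩` as a linear form. -/
def sndInner (d₁ : ℕ) (w : V d₂) : (V d₁ × V d₂) →L[ℝ] ℝ :=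
  (innerSL ℝ w).comp (ContinuousLinearMap.snd ℝ (V d₁) (V d₂))

theorem sndInner_apply (w : V d₂) (x : V d₁ × V d₂) : sndInner d₁ w x = inner ℝ x.2 w := by
  simp [sndInner, real_inner_comm]

theorem contDiff_char_right (v : V d₂) : ContDiff ℝ ∞ (fun p : V d₁ × V d₂ => char v p.2) := by
  unfold char
  refine Complex.contDiff_exp.comp (contDiff_const.mul ?_)
  exact Complex.ofRealCLM.contDiff.comp ((innerSL ℝ v).contDiff.comp contDiff_snd)

theorem contDiff_modulated (hf : ContDiff ℝ ∞ f) (v : V d₂) :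
    ContDiff ℝ ∞ (fun p : V d₁ × V d₂ => f (p.1, v) * char v p.2) := by
  have h1 : ContDiff ℝ ∞ (fun p : V d₁ × V d₂ => f (p.1, v)) :=
    hf.comp (contDiff_fst.prodMk contDiff_const)
  exact h1.mul (contDiff_char_right v)

/-- The effect of a derivative of the Fourier transform on the function. -/
def fourierStep (z : V d₁ × V d₂) (f : V d₁ × V d₂ → ℂ) : V d₁ × V d₂ → ℂ :=
  dirDeriv (z.1, 0) f + Complex.I • fun x => (sndInner d₁ z.2 x : ℂ) * f x

theorem Rapid.step (hf : Rapid f) (z : V d₁ × V d₂) : Rapid (fourierStep z f) :=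
  (hf.dir _).add ((hf.linear_mul _).smul _)

theorem hasFDerivAt_char_right (v : V d₂) (p : V d₁ × V d₂) :
    HasFDerivAt (fun p : V d₁ × V d₂ => char v p.2)
      (char v p.2 • (Complex.I • Complex.ofRealCLM.comp (sndInner d₁ v))) p := by
  have h1 : HasFDerivAt (fun p : V d₁ × V d₂ => Complex.I • (Complex.ofRealCLM.comp (sndInner d₁ v)) p)
      (Complex.I • Complex.ofRealCLM.comp (sndInner d₁ v)) p :=
    (ContinuousLinearMap.hasFDerivAt _).const_smul Complex.I
  have h2 := h1.cexp
  have e : ∀ p : V d₁ × V d₂,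
      Complex.exp (Complex.I • (Complex.ofRealCLM.comp (sndInner d₁ v)) p) = char v p.2 := by
    intro p
    simp [char, sndInner_apply, real_inner_comm]
  simp only [e] at h2
  exact h2

theorem dirDeriv_modulated (hf : ContDiff ℝ ∞ f) (v : V d₂) (z : V d₁ × V d₂) :
    dirDeriv z (fun p : V d₁ × V d₂ => f (p.1, v) * char v p.2) =
      fun p => fourierStep z f (p.1, v) * char v p.2 := by
  have s1 : ContDiff ℝ ∞ (fun p : V d₁ × V d₂ => f (p.1, v)) :=
    hf.comp (contDiff_fst.prodMk contDiff_const)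
  have s2 : ContDiff ℝ ∞ (fun p : V d₁ × V d₂ => char v p.2) := contDiff_char_right v
  have h1 := dirDeriv_mul z s1 s2
  have e1 : (fun p : V d₁ × V d₂ => f (p.1, v)) * (fun p : V d₁ × V d₂ => char v p.2) =
    fun p : V d₁ × V d₂ => f (p.1, v) * char v p.2 := rfl
  have e2 : dirDeriv z (fun p : V d₁ × V d₂ => f (p.1, v)) =
      fun p => dirDeriv (z.1, 0) f (p.1, v) := by
    have h := dirDeriv_comp_affine (F := f) ((ContinuousLinearMap.fst ℝ (V d₁) (V d₂)).prod
      (0 : (V d₁ × V d₂) →L[ℝ] V d₂)) (0, v) z hf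
    have e : ∀ p : V d₁ × V d₂, ((ContinuousLinearMap.fst ℝ (V d₁) (V d₂)).prod
      (0 : (V d₁ × V d₂) →L[ℝ] V d₂)) p + (0, v) = (p.1, v) := fun p => by
      ext1 <;> simp
    simp only [e] at h
    exact h
  have e3 : dirDeriv z (fun p : V d₁ × V d₂ => char v p.2) =
      fun p => char v p.2 * (Complex.I * ((inner ℝ v z.2 : ℝ) : ℂ)) := by
    funext p
    unfold dirDeriv
    rw [(hasFDerivAt_char_right v p).fderiv]
    simp [sndInner_apply, real_inner_comm]
  rw [e1, e2, e3] at h1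
  rw [h1]
  funext p
  simp only [fourierStep, Pi.add_apply, Pi.mul_apply, Pi.smul_apply, smul_eq_mul, sndInner_apply]
  ring

/-- The function whose Fourier transform is the given derivative of the transform of `f`. -/
def fourierList (l : List (V d₁ × V d₂)) (f : V d₁ × V d₂ → ℂ) : V d₁ × V d₂ → ℂ :=
  l.foldr fourierStep f

theorem Rapid.steps (hf : Rapid f) (l : List (V d₁ × V d₂)) : Rapid (fourierList l f) := by
  induction l with
  | nil => exact hf
  | cons z l ih => exact ih.step z

theorem listDeriv_modulated (hf : Rapid f) (v : V d₂) (l : List (V d₁ × V d₂)) :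
    listDeriv l (fun p : V d₁ × V d₂ => f (p.1, v) * char v p.2) =
      fun p => fourierList l f (p.1, v) * char v p.2 := by
  induction l with
  | nil => rfl
  | cons z l ih => rw [listDeriv_cons, ih, dirDeriv_modulated (hf.steps l).smooth]; rfl

theorem Rapid.dominatedFamily (hf : Rapid f) :
    DominatedFamily (volume : Measure (V d₂))
      (fun v (p : V d₁ × V d₂) => f (p.1, v) * char v p.2) := by
  refine ⟨fun v => contDiff_modulated hf.smooth v, fun x => ?_, fun l x₀ => ?_⟩
  · have h1 : Continuous fun v => f (x.1, v) :=
      hf.smooth.continuous.comp (Continuous.prodMk_right x.1)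
    have h2 : Continuous fun v : V d₂ => char v x.2 := by unfold char; fun_prop
    exact (h1.mul h2).aestronglyMeasurable
  · obtain ⟨C, hC, h⟩ := (hf.steps l).exists_norm_le_right
    refine ⟨_, (integrable_decay d₂).const_mul C, fun v x _ => ?_⟩
    rw [listDeriv_modulated hf, norm_mul, norm_char, mul_one]
    exact h x.1 v

theorem Rapid.contDiff_partialFourier (hf : Rapid f) : ContDiff ℝ ∞ (partialFourier f) :=
  hf.dominatedFamily.contDiff

theorem Rapid.listDeriv_partialFourier (hf : Rapid f) (l : List (V d₁ × V d₂)) :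
    listDeriv l (partialFourier f) = partialFourier (fourierList l f) := by
  have := hf.dominatedFamily.listDeriv_integral l
  unfold partialFourier
  rw [this]
  funext p
  simp only [listDeriv_modulated hf]

theorem norm_partialFourier_le (f : V d₁ × V d₂ → ℂ) (p : V d₁ × V d₂) :
    ‖partialFourier f p‖ ≤ ∫ v, ‖f (p.1, v)‖ := by
  refine (norm_integral_le_integral_norm _).trans (le_of_eq ?_)
  simp only [norm_mul, norm_char, mul_one]

theorem Rapid.integrable_modulated (hf : Rapid f) (p : V d₁ × V d₂) :
    Integrable (fun v => f (p.1, v) * char v p.2) := hf.dominatedFamily.integrable p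

/-- Integration by parts. -/
theorem Rapid.partialFourier_dirDeriv (hf : Rapid f) (e : V d₂) (p : V d₁ × V d₂) :
    partialFourier (dirDeriv (0, e) f) p =
      -(Complex.I * ((inner ℝ e p.2 : ℝ) : ℂ)) * partialFourier f p := by
  have h0 : ∀ v, HasFDerivAt (fun v => f (p.1, v))
      ((fderiv ℝ f (p.1, v)).comp (ContinuousLinearMap.inr ℝ (V d₁) (V d₂))) v := fun v =>
    (hf.smooth.differentiable (by simp) (p.1, v)).hasFDerivAt.comp v
      (hasFDerivAt_prodMk_right p.1 v)
  have hc : ∀ v, HasFDerivAt (fun v : V d₂ => char v p.2)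
      (char v p.2 • (Complex.I • Complex.ofRealCLM.comp (innerSL ℝ p.2))) v := by
    intro v
    have h4 : HasFDerivAt (fun v : V d₂ => Complex.I * ((inner ℝ v p.2 : ℝ) : ℂ))
        (Complex.I • Complex.ofRealCLM.comp (innerSL ℝ p.2)) v := by
      have h1 : HasFDerivAt (fun v : V d₂ => Complex.I • (Complex.ofRealCLM.comp (innerSL ℝ p.2)) v)
          (Complex.I • Complex.ofRealCLM.comp (innerSL ℝ p.2)) v :=
        (ContinuousLinearMap.hasFDerivAt _).const_smul Complex.I
      have e : ∀ v : V d₂, Complex.I • (Complex.ofRealCLM.comp (innerSL ℝ p.2)) v =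
          Complex.I * ((inner ℝ v p.2 : ℝ) : ℂ) := fun v => by
        simp [real_inner_comm]
      simp only [e] at h1
      exact h1
    exact h4.cexp
  have d1 : ∀ v, fderiv ℝ (fun v => f (p.1, v)) v e = dirDeriv (0, e) f (p.1, v) := by
    intro v; rw [(h0 v).fderiv]; simp [dirDeriv]
  have d2 : ∀ v, fderiv ℝ (fun v : V d₂ => char v p.2) v e =
      Complex.I * ((inner ℝ e p.2 : ℝ) : ℂ) * char v p.2 := by
    intro v; rw [(hc v).fderiv]; simp [real_inner_comm]; ring
  have key := integral_mul_fderiv_eq_neg_fderiv_mul_of_integrable (μ := (volume : Measure (V d₂)))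
    (f := fun v => f (p.1, v)) (g := fun v => char v p.2) (v := e)
    (by simp only [d1]; exact (hf.dir (0, e)).integrable_modulated p)
    (by
      simp only [d2]
      refine ((hf.integrable_modulated p).const_mul (Complex.I * ((inner ℝ e p.2 : ℝ) : ℂ))).congr
        (Filter.Eventually.of_forall fun v => ?_)
      simp only; ring)
    (hf.integrable_modulated p)
    (fun v _ => (h0 v).differentiableAt) (fun v _ => (hc v).differentiableAt)
  simp only [d1, d2] at key
  unfold partialFourier
  rw [← neg_eq_iff_eq_neg.2 key, neg_mul, ← integral_const_mul]
  congr 1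
  refine integral_congr_ae (Filter.Eventually.of_forall fun v => ?_)
  simp only; ring

end PartialFourier

section DecayEstimates

variable {d d₁ d₂ : ℕ}

theorem exists_pow_mul_exp_le {s c : ℝ} (hs : 0 < s) (hc : 0 < c) (k : ℕ) :
    ∃ C : ℝ, 0 ≤ C ∧ ∀ r : ℝ, 0 ≤ r → (1 + r) ^ k * Real.exp (-(c * r ^ (1 / s))) ≤ C := by
  refine ⟨2 ^ k * (1 + ((s / c) ^ s) ^ k * (k.factorial : ℝ) ^ s), by positivity, fun r hr => ?_⟩
  have h1 := pow_le_exp_rpow hs hc hr k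
  have h2 : (1 + r) ^ k ≤ 2 ^ k * (1 + r ^ k) := by
    calc (1 + r) ^ k ≤ (2 * max 1 r) ^ k := by
          gcongr; rcases le_total 1 r with h | h <;> simp [h] <;> linarith
      _ = 2 ^ k * (max 1 r) ^ k := mul_pow _ _ _
      _ ≤ _ := by
          gcongr
          rcases le_total 1 r with h | h
          · rw [max_eq_right h]; linarith
          · rw [max_eq_left h]; simp; positivity
  have h3 : 1 + r ^ k ≤ (1 + ((s / c) ^ s) ^ k * (k.factorial : ℝ) ^ s) *
      Real.exp (c * r ^ (1 / s)) := by
    have : 1 ≤ Real.exp (c * r ^ (1 / s)) := Real.one_le_exp (by positivity)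
    rw [add_mul, one_mul]
    exact add_le_add this h1
  calc (1 + r) ^ k * Real.exp (-(c * r ^ (1 / s)))
      ≤ 2 ^ k * ((1 + ((s / c) ^ s) ^ k * (k.factorial : ℝ) ^ s) * Real.exp (c * r ^ (1 / s))) *
          Real.exp (-(c * r ^ (1 / s))) := by
        gcongr; exact h2.trans (by gcongr)
    _ = 2 ^ k * (1 + ((s / c) ^ s) ^ k * (k.factorial : ℝ) ^ s) *
          (Real.exp (c * r ^ (1 / s)) * Real.exp (-(c * r ^ (1 / s)))) := by ring
    _ = _ := by rw [← Real.exp_add]; simp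

theorem integrable_exp_neg_rpow (d : ℕ) {s c : ℝ} (hs : 0 < s) (hc : 0 < c) :
    Integrable (fun v : V d => Real.exp (-(c * ‖v‖ ^ (1 / s)))) := by
  obtain ⟨C, hC, h⟩ := exists_pow_mul_exp_le hs hc (d + 1)
  have hcont : Continuous (fun v : V d => Real.exp (-(c * ‖v‖ ^ (1 / s)))) := by
    refine Real.continuous_exp.comp (continuous_const.mul ?_).neg
    exact continuous_norm.rpow_const fun v => Or.inr (by positivity)
  refine ((integrable_decay d).const_mul C).mono' hcont.aestronglyMeasurable
    (Filter.Eventually.of_forall fun v => ?_)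
  have h1 : (1 + ‖v‖) ^ (-((d : ℝ) + 1)) = ((1 + ‖v‖) ^ (d + 1))⁻¹ := by
    rw [Real.rpow_neg (by positivity)]
    congr 1
    exact_mod_cast Real.rpow_natCast (1 + ‖v‖) (d + 1)
  rw [Real.norm_of_nonneg (Real.exp_pos _).le, h1, ← div_eq_mul_inv, le_div_iff₀ (by positivity),
    mul_comm]
  exact h _ (norm_nonneg v)

theorem continuous_expWeight {s₁ s₂ : ℝ} (hs₁ : 0 < s₁) (hs₂ : 0 < s₂) (r : ℝ) :
    Continuous (expWeight s₁ s₂ r : V d₁ × V d₂ → ℝ) := by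
  unfold expWeight
  refine Real.continuous_exp.comp (continuous_const.mul (Continuous.add ?_ ?_))
  · exact (continuous_norm.comp continuous_fst).rpow_const fun v => Or.inr (by positivity)
  · exact (continuous_norm.comp continuous_snd).rpow_const fun v => Or.inr (by positivity)

theorem expWeight_neg_eq (s₁ s₂ r : ℝ) (x : V d₁ × V d₂) : expWeight s₁ s₂ (-r) x =
    Real.exp (-(r * ‖x.1‖ ^ (1 / s₁))) * Real.exp (-(r * ‖x.2‖ ^ (1 / s₂))) := by
  rw [expWeight, ← Real.exp_add]; congr 1; ring

theorem integrable_expWeight {s₁ s₂ r : ℝ} (hs₁ : 0 < s₁) (hs₂ : 0 < s₂) (hr : 0 < r) :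
    Integrable (expWeight s₁ s₂ (-r) : V d₁ × V d₂ → ℝ) := by
  have := (integrable_exp_neg_rpow d₁ hs₁ hr).mul_prod (integrable_exp_neg_rpow d₂ hs₂ hr)
  refine this.congr (Filter.Eventually.of_forall fun x => ?_)
  simp only [expWeight_neg_eq]

theorem GevreyBound.rapid {σ₁ σ₂ h M s₁ s₂ R : ℝ} {f : V d₁ × V d₂ → ℂ} (hs₁ : 0 < s₁)
    (hs₂ : 0 < s₂) (hR : 0 < R)
    (hf : GevreyBound σ₁ σ₂ h (fun x => M * expWeight s₁ s₂ (-R) x) f) : Rapid f := by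
  refine ⟨hf.smooth, fun l k => ?_⟩
  obtain ⟨c, hc⟩ := DerivBound.exists_listDeriv_le l (gevrey σ₁ σ₂ h)
  obtain ⟨C₁, hC₁, h₁⟩ := exists_pow_mul_exp_le hs₁ hR k
  obtain ⟨C₂, hC₂, h₂⟩ := exists_pow_mul_exp_le hs₂ hR k
  refine ⟨|c * M| * (C₁ * C₂), fun x => ?_⟩
  have h3 := hc _ _ hf x
  have h4 : (1 + ‖x‖) ^ k ≤ (1 + ‖x.1‖) ^ k * (1 + ‖x.2‖) ^ k := by
    rw [← mul_pow]
    gcongr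
    rw [Prod.norm_def]
    have e1 := norm_nonneg x.1
    have e2 := norm_nonneg x.2
    have : max ‖x.1‖ ‖x.2‖ ≤ ‖x.1‖ + ‖x.2‖ := max_le (by linarith) (by linarith)
    nlinarith
  calc (1 + ‖x‖) ^ k * ‖listDeriv l f x‖
      ≤ ((1 + ‖x.1‖) ^ k * (1 + ‖x.2‖) ^ k) * (|c * M| * expWeight s₁ s₂ (-R) x) := by
        gcongr
        refine h3.trans ?_
        rw [← mul_assoc]
        exact mul_le_mul_of_nonneg_right (le_abs_self _) (Real.exp_pos _).le
    _ = |c * M| * (((1 + ‖x.1‖) ^ k * Real.exp (-(R * ‖x.1‖ ^ (1 / s₁)))) *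
          ((1 + ‖x.2‖) ^ k * Real.exp (-(R * ‖x.2‖ ^ (1 / s₂))))) := by
        rw [expWeight_neg_eq]; ring
    _ ≤ _ := by
        refine mul_le_mul_of_nonneg_left ?_ (abs_nonneg _)
        exact mul_le_mul (h₁ _ (norm_nonneg _)) (h₂ _ (norm_nonneg _)) (by positivity) hC₁

end DecayEstimates

section Polynomial

variable {d₁ d₂ : ℕ} {f g : V d₁ × V d₂ → ℂ}

/-- Multiplication by the linear forms `x ↦ ⟨x.2, w⟩`, `w ∈ l`. -/
def mulList (l : List (V d₂)) (f : V d₁ × V d₂ → ℂ) : V d₁ × V d₂ → ℂ :=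
  l.foldr (fun w g x => (sndInner d₁ w x : ℂ) * g x) f

theorem mulList_smooth (l : List (V d₂)) (hf : ContDiff ℝ ∞ f) : ContDiff ℝ ∞ (mulList l f) := by
  induction l with
  | nil => exact hf
  | cons w l ih => exact contDiff_linear_mul _ ih

theorem Rapid.mul_list (hf : Rapid f) (l : List (V d₂)) : Rapid (mulList l f) := by
  induction l with
  | nil => exact hf
  | cons w l ih => exact ih.linear_mul _

theorem mulList_eq_mul (l : List (V d₂)) (f : V d₁ × V d₂ → ℂ) :
    mulList l f = mulList l (fun _ => 1) * f := by
  induction l with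
  | nil => funext x; simp [mulList]
  | cons w l ih =>
    have : mulList (w :: l) f = fun x => (sndInner d₁ w x : ℂ) * mulList l f x := rfl
    rw [this, ih]
    funext x
    simp [mulList, mul_assoc]

theorem listDeriv_linear_mul_le (x : V d₁ × V d₂) {w : V d₂} (hw : ‖w‖ ≤ 1) (k₁ : List (V d₁))
    (h₁ : UnitList k₁) (k₂ : List (V d₂)) (h₂ : UnitList k₂) : ∀ (b : ℕ → ℝ)
    (F : V d₁ × V d₂ → ℂ), ContDiff ℝ ∞ F →
    (∀ (k₁ : List (V d₁)) (k₂ : List (V d₂)), UnitList k₁ → UnitList k₂ →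
      ‖listDeriv (dirList k₁ k₂) F x‖ ≤ b k₂.length) →
    ‖listDeriv (dirList k₁ k₂) (fun x => (sndInner d₁ w x : ℂ) * F x) x‖ ≤
      ‖x.2‖ * b k₂.length + k₂.length * b (k₂.length - 1) := by
  induction k₁ with
  | nil =>
    induction k₂ with
    | nil =>
      intro b F hF hb
      simp only [dirList_nil, listDeriv_nil, norm_mul, Complex.norm_real, List.length_nil,
        Nat.cast_zero, zero_mul, add_zero]
      refine mul_le_mul ?_ (by simpa using hb [] [] .nil .nil) (norm_nonneg _) (norm_nonneg _)
      rw [sndInner_apply]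
      exact (norm_inner_le_norm _ _).trans (mul_le_of_le_one_right (norm_nonneg _) hw)
    | cons e k₂ ih =>
      intro b F hF hb
      have hs : ContDiff ℝ ∞ ((sndInner d₁ w (0, e) : ℂ) • F) := contDiff_const.smul hF
      have hp := contDiff_linear_mul (sndInner d₁ w) (dirDeriv_smooth (v := (0, e)) hF)
      rw [listDeriv_perm (dirList_cons_right e [] k₂) (contDiff_linear_mul _ hF),
        listDeriv_cons' _ _ (contDiff_linear_mul _ hF), dirDeriv_linear_mul _ _ hF,
        listDeriv_add _ hs hp, listDeriv_smul _ _ hF]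
      refine (norm_add_le _ _).trans ?_
      have i1 : ‖((sndInner d₁ w (0, e) : ℂ) • listDeriv (dirList [] k₂) F) x‖ ≤
          b k₂.length := by
        rw [Pi.smul_apply, norm_smul, Complex.norm_real]
        refine (mul_le_of_le_one_left (norm_nonneg _) ?_).trans (hb [] k₂ .nil h₂.tail)
        rw [sndInner_apply]
        exact (norm_inner_le_norm _ _).trans (mul_le_one₀ h₂.head (norm_nonneg _) hw)
      have i2 := ih h₂.tail (fun n => b (n + 1)) (dirDeriv (0, e) F) (dirDeriv_smooth hF)
        (fun l₁ l₂ u₁ u₂ => by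
          rw [← listDeriv_cons' _ _ hF, ← listDeriv_perm (dirList_cons_right e l₁ l₂) hF]
          exact hb l₁ (e :: l₂) u₁ (u₂.cons h₂.head))
      refine (add_le_add i1 i2).trans (le_of_eq ?_)
      simp only [List.length_cons, Nat.add_sub_cancel]
      rcases k₂.length.eq_zero_or_pos with h0 | h0
      · simp [h0]; ring
      · rw [Nat.sub_add_cancel h0]; push_cast; ring
  | cons v k₁ ih =>
    intro b F hF hb
    have hs : ContDiff ℝ ∞ ((sndInner d₁ w (v, 0) : ℂ) • F) := contDiff_const.smul hF
    have hp := contDiff_linear_mul (sndInner d₁ w) (dirDeriv_smooth (v := (v, 0)) hF)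
    rw [dirList_cons_left, listDeriv_cons' _ _ (contDiff_linear_mul _ hF),
      dirDeriv_linear_mul _ _ hF, listDeriv_add _ hs hp, listDeriv_smul _ _ hF, sndInner_apply]
    simp only [inner_zero_left, Complex.ofReal_zero, zero_smul, zero_add]
    exact ih h₁.tail b _ (dirDeriv_smooth hF) fun l₁ l₂ u₁ u₂ => by
      rw [← listDeriv_cons' _ _ hF, ← dirList_cons_left]
      exact hb (v :: l₁) l₂ (u₁.cons h₁.head) u₂

theorem listDeriv_mulList_one_le (x : V d₁ × V d₂) (l : List (V d₂)) (hl : UnitList l)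
    (k₁ : List (V d₁)) (k₂ : List (V d₂)) (h₁ : UnitList k₁) (h₂ : UnitList k₂) :
    ‖listDeriv (dirList k₁ k₂) (mulList l (fun _ => 1)) x‖ ≤
      (l.length.descFactorial k₂.length : ℝ) * ‖x.2‖ ^ (l.length - k₂.length) := by
  induction l generalizing k₁ k₂ with
  | nil =>
    cases k₁ with
    | cons v k₁ =>
      have : listDeriv (dirList (v :: k₁) k₂) (mulList [] (fun _ => 1)) x = 0 := by
        have h0 : dirDeriv ((v, 0) : V d₁ × V d₂) (fun _ => (1 : ℂ)) = 0 := by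
          funext y; simp [dirDeriv]
        rw [dirList_cons_left, mulList, List.foldr_nil, listDeriv_cons' _ _ contDiff_const, h0,
          listDeriv_zero]
        rfl
      rw [this, norm_zero]; positivity
    | nil =>
      cases k₂ with
      | nil => simp [mulList]
      | cons e k₂ =>
        have : listDeriv (dirList ([] : List (V d₁)) (e :: k₂)) (mulList [] (fun _ => 1)) x = 0 := by
          have h0 : dirDeriv ((0, e) : V d₁ × V d₂) (fun _ => (1 : ℂ)) = 0 := by
            funext y; simp [dirDeriv]
          rw [listDeriv_perm (dirList_cons_right e [] k₂) (mulList_smooth _ contDiff_const),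
            mulList, List.foldr_nil, listDeriv_cons' _ _ contDiff_const, h0, listDeriv_zero]
          rfl
        rw [this, norm_zero]; positivity
  | cons w l ih =>
    have := listDeriv_linear_mul_le x hl.head k₁ h₁ k₂ h₂
      (fun n => (l.length.descFactorial n : ℝ) * ‖x.2‖ ^ (l.length - n))
      (mulList l (fun _ => 1)) (mulList_smooth _ contDiff_const) (fun l₁ l₂ u₁ u₂ =>
        ih hl.tail l₁ l₂ u₁ u₂)
    refine this.trans (le_of_eq ?_)
    generalize k₂.length = n
    generalize hN : l.length = N
    rw [List.length_cons, hN]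
    rcases n with _ | n
    · simp [pow_succ']
    · simp only [Nat.add_sub_cancel, Nat.add_sub_add_right]
      rcases lt_trichotomy N n with h | h | h
      · rw [Nat.descFactorial_of_lt (show N < n + 1 by omega), Nat.descFactorial_of_lt h,
          Nat.descFactorial_of_lt (show N + 1 < n + 1 by omega)]
        simp
      · subst h
        rw [Nat.descFactorial_of_lt (Nat.lt_succ_self N), Nat.succ_descFactorial_succ]
        push_cast; ring
      · have e1 : N - n = N - (n + 1) + 1 := by omega
        rw [Nat.succ_descFactorial_succ, Nat.descFactorial_succ, e1, pow_succ]
        have e2 : ((N - (n + 1) : ℕ) : ℝ) + 1 = N - n := by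
          rw [Nat.cast_sub h]; push_cast; ring
        push_cast
        rw [e2]; ring

theorem sum_choose_descFactorial_le {s σ ε C r E H h M : ℝ} (hs : 0 ≤ s) (hσ : 0 ≤ σ) (hr : 0 ≤ r)
    (hε : 0 ≤ ε) (hC : 0 ≤ C) (hE : 0 ≤ E) (hH : 0 ≤ H) (hh : 0 ≤ h) (hM : 0 ≤ M)
    (hfac : ∀ i : ℕ, (i.factorial : ℝ) ≤ C * (ε ^ i * ε ^ i *
      ((i.factorial : ℝ) ^ s * (i.factorial : ℝ) ^ σ)))
    (hpow : ∀ i : ℕ, r ^ i ≤ H ^ i * (i.factorial : ℝ) ^ s * E) (N k : ℕ) :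
    ∑ q ∈ Finset.HasAntidiagonal.antidiagonal k, (k.choose q.1 : ℝ) *
      (((N.descFactorial q.1 : ℝ) * r ^ (N - q.1)) *
        (h ^ q.2 * (q.2.factorial : ℝ) ^ σ * M)) ≤
      C * (N.factorial : ℝ) ^ s * (k.factorial : ℝ) ^ σ * (ε + H) ^ N * (ε + h) ^ k * (E * M) := by
  have key : ∀ q ∈ Finset.HasAntidiagonal.antidiagonal k, (k.choose q.1 : ℝ) *
      (((N.descFactorial q.1 : ℝ) * r ^ (N - q.1)) * (h ^ q.2 * (q.2.factorial : ℝ) ^ σ * M)) ≤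
      (C * (N.factorial : ℝ) ^ s * (k.factorial : ℝ) ^ σ * (ε + H) ^ N * (E * M)) *
        ((k.choose q.1 : ℝ) * (ε ^ q.1 * h ^ q.2)) := by
    intro q hq
    rcases lt_or_ge N q.1 with hN | hN
    · rw [Nat.descFactorial_of_lt hN]; simp only [Nat.cast_zero, zero_mul, mul_zero]; positivity
    · obtain ⟨j, rfl⟩ := Nat.exists_eq_add_of_le hN
      have e1 := hfac q.1
      have e2 := hpow j
      have e3 := factorial_rpow_mul_le hσ hq
      have e4 : (q.1.factorial : ℝ) ^ s * (j.factorial : ℝ) ^ s ≤ ((q.1 + j).factorial : ℝ) ^ s :=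
        factorial_rpow_mul_le hs (p := (q.1, j)) (Finset.HasAntidiagonal.mem_antidiagonal.2 rfl)
      have e5 : ((q.1 + j).choose q.1 : ℝ) * (ε ^ q.1 * H ^ j) ≤ (ε + H) ^ (q.1 + j) := by
        rw [add_pow]
        refine le_trans (le_of_eq ?_) (Finset.single_le_sum (f := fun m =>
          ε ^ m * H ^ (q.1 + j - m) * ((q.1 + j).choose m : ℝ)) (fun m _ => by positivity)
          (Finset.mem_range.2 (show q.1 < q.1 + j + 1 by omega)))
        simp only [Nat.add_sub_cancel_left]; ring
      have e6 : ((q.1 + j).descFactorial q.1 : ℝ) = q.1.factorial * ((q.1 + j).choose q.1 : ℝ) := by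
        exact_mod_cast Nat.descFactorial_eq_factorial_mul_choose _ _
      rw [Nat.add_sub_cancel_left, e6]
      calc (k.choose q.1 : ℝ) * (q.1.factorial * ((q.1 + j).choose q.1 : ℝ) * r ^ j *
            (h ^ q.2 * (q.2.factorial : ℝ) ^ σ * M))
          ≤ (k.choose q.1 : ℝ) * ((C * (ε ^ q.1 * ε ^ q.1 *
              ((q.1.factorial : ℝ) ^ s * (q.1.factorial : ℝ) ^ σ))) * ((q.1 + j).choose q.1 : ℝ) *
              (H ^ j * (j.factorial : ℝ) ^ s * E) * (h ^ q.2 * (q.2.factorial : ℝ) ^ σ * M)) := by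
            gcongr
        _ = C * ((q.1.factorial : ℝ) ^ s * (j.factorial : ℝ) ^ s) *
              ((q.1.factorial : ℝ) ^ σ * (q.2.factorial : ℝ) ^ σ) *
              (((q.1 + j).choose q.1 : ℝ) * (ε ^ q.1 * H ^ j)) * (E * M) *
              ((k.choose q.1 : ℝ) * (ε ^ q.1 * h ^ q.2)) := by ring
        _ ≤ C * ((q.1 + j).factorial : ℝ) ^ s * (k.factorial : ℝ) ^ σ * (ε + H) ^ (q.1 + j) *
              (E * M) * ((k.choose q.1 : ℝ) * (ε ^ q.1 * h ^ q.2)) := by gcongr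
  refine (Finset.sum_le_sum key).trans (le_of_eq ?_)
  rw [← Finset.mul_sum, (Commute.all ε h).add_pow']
  simp only [nsmul_eq_mul]
  ring

end Polynomial

section FourierBound

variable {d₁ d₂ : ℕ} {f g : V d₁ × V d₂ → ℂ}

theorem fourierList_right (l : List (V d₂)) (f : V d₁ × V d₂ → ℂ) :
    fourierList (dirList [] l) f = Complex.I ^ l.length • mulList l f := by
  induction l with
  | nil => simp [fourierList, mulList]
  | cons w l ih =>
    have e1 : fourierList (dirList [] (w :: l)) f =
      fourierStep ((0, w) : V d₁ × V d₂) (fourierList (dirList [] l) f) := rfl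
    have e2 : mulList (w :: l) f = fun x => (sndInner d₁ w x : ℂ) * mulList l f x := rfl
    have e3 : dirDeriv ((0 : V d₁), (0 : V d₂)) (Complex.I ^ l.length • mulList l f) = 0 :=
      dirDeriv_zero_vec _
    rw [e1, ih, e2, fourierStep, e3]
    funext x
    simp [pow_succ]; ring

theorem fourierList_left (l : List (V d₁)) (f : V d₁ × V d₂ → ℂ) :
    fourierList (dirList l []) f = listDeriv (dirList l []) f := by
  induction l with
  | nil => rfl
  | cons v l ih =>
    have e1 : fourierList (dirList (v :: l) []) f =
      fourierStep ((v, 0) : V d₁ × V d₂) (fourierList (dirList l []) f) := rfl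
    rw [e1, ih, fourierStep]
    funext x
    simp [dirList_cons_left, sndInner_apply]

theorem Rapid.listDeriv_partialFourier_eq (hf : Rapid f) (l₁ : List (V d₁)) (l₂ : List (V d₂)) :
    listDeriv (dirList l₁ l₂) (partialFourier f) =
      partialFourier (Complex.I ^ l₂.length • mulList l₂ (listDeriv (dirList l₁ []) f)) := by
  have e : (dirList l₁ l₂).Perm (dirList [] l₂ ++ dirList l₁ []) := by
    simp only [dirList, List.map_nil, List.nil_append, List.append_nil]
    exact List.perm_append_comm
  rw [listDeriv_perm e hf.contDiff_partialFourier, hf.listDeriv_partialFourier, fourierList,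
    List.foldr_append]
  change partialFourier (fourierList (dirList [] l₂) (fourierList (dirList l₁ []) f)) = _
  rw [fourierList_left, fourierList_right]

theorem Rapid.partialFourier_iterate (hf : Rapid f) (e : V d₂) (k : ℕ) (p : V d₁ × V d₂) :
    partialFourier (listDeriv (dirList [] (List.replicate k e)) f) p =
      (-(Complex.I * ((inner ℝ e p.2 : ℝ) : ℂ))) ^ k * partialFourier f p := by
  induction k with
  | zero => simp [dirList]
  | succ k ih =>
    have e1 : listDeriv (dirList [] (List.replicate (k + 1) e)) f =
      dirDeriv (0, e) (listDeriv (dirList [] (List.replicate k e)) f) := rfl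
    rw [e1, (hf.list _).partialFourier_dirDeriv, ih, pow_succ']; ring

theorem norm_mul_partialFourier_le (hf : Rapid f) (p : V d₁ × V d₂) (k : ℕ) : ∃ e : V d₂,
    ‖e‖ ≤ 1 ∧ ‖p.2‖ ^ k * ‖partialFourier f p‖ ≤
      ∫ v, ‖listDeriv (dirList [] (List.replicate k e)) f (p.1, v)‖ := by
  obtain ⟨e, he, h⟩ : ∃ e : V d₂, ‖e‖ ≤ 1 ∧ inner ℝ e p.2 = ‖p.2‖ := by
    by_cases h0 : p.2 = 0
    · exact ⟨0, by simp, by simp [h0]⟩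
    · have h1 : ‖p.2‖ ≠ 0 := norm_ne_zero_iff.2 h0
      refine ⟨‖p.2‖⁻¹ • p.2, by simp [norm_smul, h1], ?_⟩
      rw [real_inner_smul_left, real_inner_self_eq_norm_sq]; field_simp
  refine ⟨e, he, ?_⟩
  refine le_trans (le_of_eq ?_) (norm_partialFourier_le _ p)
  rw [hf.partialFourier_iterate, norm_mul, norm_pow, h]
  simp

theorem GevreyBound.partialFourier {s₁ s₂ σ₁ σ₂ h R M ε C : ℝ} (hs₁ : 0 < s₁) (hs₂ : 0 < s₂)
    (hσ₂ : 0 < σ₂) (hh : 0 < h) (hR : 0 < R) (hM : 0 ≤ M) (hε : 0 < ε) (hC : 0 ≤ C)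
    (hfac : ∀ i : ℕ, (i.factorial : ℝ) ≤ C * (ε ^ i * ε ^ i *
      ((i.factorial : ℝ) ^ s₂ * (i.factorial : ℝ) ^ σ₂)))
    (hf : GevreyBound σ₁ σ₂ h (fun x => M * expWeight s₁ s₂ (-R) x) f) {h' R' : ℝ}
    (hh' : h ≤ h') (hh'' : ε + (s₂ / (R / 2)) ^ s₂ ≤ h') (hR' : R' ≤ R)
    (hR'' : R' ≤ σ₂ / 2 * (ε + h)⁻¹ ^ (1 / σ₂)) :
    GevreyBound σ₁ s₂ h' (fun x => 2 ^ σ₂ * C * (∫ v : V d₂, Real.exp (-(R / 2 * ‖v‖ ^ (1 / s₂)))) *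
      M * expWeight s₁ σ₂ (-R') x) (GelfandShilov.partialFourier f) := by
  have hr : Rapid f := GevreyBound.rapid hs₁ hs₂ hR hf
  refine ⟨hr.contDiff_partialFourier, fun l₁ l₂ u₁ u₂ p => ?_⟩
  set J := ∫ v : V d₂, Real.exp (-(R / 2 * ‖v‖ ^ (1 / s₂)))
  have hJ : 0 ≤ J := integral_nonneg fun v => (Real.exp_pos _).le
  set H := (s₂ / (R / 2)) ^ s₂
  have hH : 0 ≤ H := by positivity
  set G := listDeriv (dirList l₁ []) f with hG
  set m := l₁.length
  set N := l₂.length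
  have hGr : Rapid G := hr.list _
  have hPG : Rapid (mulList l₂ G) := hGr.mul_list _
  have e0 : ‖listDeriv (dirList l₁ l₂) (GelfandShilov.partialFourier f) p‖ =
      ‖GelfandShilov.partialFourier (mulList l₂ G) p‖ := by
    rw [hr.listDeriv_partialFourier_eq]
    have : GelfandShilov.partialFourier (Complex.I ^ N • mulList l₂ G) p =
        Complex.I ^ N * GelfandShilov.partialFourier (mulList l₂ G) p := by
      simp only [GelfandShilov.partialFourier, Pi.smul_apply, smul_eq_mul, mul_assoc]
      rw [integral_const_mul]
    rw [this, norm_mul]; simp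
  rw [e0]
  set A := h ^ m * (m.factorial : ℝ) ^ σ₁ * (h' ^ N * (N.factorial : ℝ) ^ s₂) *
    Real.exp (-(R * ‖p.1‖ ^ (1 / s₁))) * (C * J * M) with hA
  have main : ∀ k : ℕ, ‖GelfandShilov.partialFourier (mulList l₂ G) p‖ * ‖p.2‖ ^ k ≤
      A * (ε + h) ^ k * (k.factorial : ℝ) ^ σ₂ := by
    intro k
    obtain ⟨e, he, hek⟩ := norm_mul_partialFourier_le hPG p k
    rw [mul_comm]
    refine hek.trans ?_
    have hrep : UnitList (List.replicate k e) := fun w hw => by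
      rw [List.eq_of_mem_replicate hw]; exact he
    set B := h ^ m * (m.factorial : ℝ) ^ σ₁ * (C * (N.factorial : ℝ) ^ s₂ * (k.factorial : ℝ) ^ σ₂ *
      (ε + H) ^ N * (ε + h) ^ k) * M * Real.exp (-(R * ‖p.1‖ ^ (1 / s₁))) with hB
    have pw : ∀ v, ‖listDeriv (dirList [] (List.replicate k e)) (mulList l₂ G) (p.1, v)‖ ≤
        B * Real.exp (-(R / 2 * ‖v‖ ^ (1 / s₂))) := by
      intro v
      rw [mulList_eq_mul]
      refine (listDeriv_mul_le (p.1, v) [] _ .nil hrep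
        (fun _ n => (N.descFactorial n : ℝ) * ‖v‖ ^ (N - n))
        (fun i n => h ^ n * (n.factorial : ℝ) ^ σ₂ * (h ^ (m + i) * ((m + i).factorial : ℝ) ^ σ₁ *
          (M * expWeight s₁ s₂ (-R) (p.1, v)))) _ G (mulList_smooth _ contDiff_const)
        hGr.smooth (fun k₁ k₂ v₁ v₂ => listDeriv_mulList_one_le _ _ u₂ k₁ k₂ v₁ v₂)
        (fun k₁ k₂ v₁ v₂ => ?_)).trans ?_
      · have e1 : (dirList k₁ k₂ ++ dirList l₁ []).Perm (dirList (l₁ ++ k₁) k₂) := by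
          simp only [dirList, List.map_nil, List.append_nil, List.map_append]
          exact (List.perm_append_comm).trans (by rw [List.append_assoc])
        rw [hG, ← listDeriv_append, listDeriv_perm e1 hf.smooth]
        refine (hf.bound _ _ (fun w hw => ?_) v₂ _).trans (le_of_eq ?_)
        · rcases List.mem_append.1 hw with h | h
          · exact u₁ w h
          · exact v₁ w h
        · simp only [gevrey, List.length_append]; ring
      · have hs := sum_choose_descFactorial_le (M := h ^ m * (m.factorial : ℝ) ^ σ₁ *
          (M * expWeight s₁ s₂ (-R) (p.1, v))) hs₂.le hσ₂.le (norm_nonneg v) hε.le hC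
          (Real.exp_pos (R / 2 * ‖v‖ ^ (1 / s₂))).le hH hh.le
          (mul_nonneg (by positivity) (mul_nonneg hM (expWeight_pos _ _ _ _).le)) hfac
          (fun i => pow_le_exp_rpow hs₂ (half_pos hR) (norm_nonneg v) i) N k
        simp only [List.length_nil, List.length_replicate, Finset.Nat.antidiagonal_zero,
          Finset.sum_singleton, Nat.choose_self, Nat.cast_one, one_mul, add_zero]
        refine hs.trans (le_of_eq ?_)
        have e2 : Real.exp (-(R / 2 * ‖v‖ ^ (1 / s₂))) = Real.exp (R / 2 * ‖v‖ ^ (1 / s₂)) *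
            Real.exp (-(R * ‖v‖ ^ (1 / s₂))) := by
          rw [← Real.exp_add]; congr 1; ring
        rw [expWeight_neg_eq, hB, e2]
        ring
    have hint := integrable_exp_neg_rpow d₂ hs₂ (half_pos hR)
    calc _ ≤ ∫ v : V d₂, B * Real.exp (-(R / 2 * ‖v‖ ^ (1 / s₂))) :=
          integral_mono ((hPG.list _).integrable_right p.1).norm (hint.const_mul B) pw
      _ = B * J := integral_const_mul _ _
      _ ≤ A * (ε + h) ^ k * (k.factorial : ℝ) ^ σ₂ := by
          have e3 : (ε + H) ^ N ≤ h' ^ N := by gcongr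
          have e4 : B * J = h ^ m * (m.factorial : ℝ) ^ σ₁ * (C * (N.factorial : ℝ) ^ s₂ *
            (k.factorial : ℝ) ^ σ₂ * (ε + h) ^ k) * M * Real.exp (-(R * ‖p.1‖ ^ (1 / s₁))) * J *
            (ε + H) ^ N := by rw [hB]; ring
          rw [e4]
          refine (mul_le_mul_of_nonneg_left e3 (by positivity)).trans (le_of_eq ?_)
          rw [hA]; ring
  have hA0 : 0 ≤ A := by have : 0 < h' := hh.trans_le hh'; positivity
  refine (le_exp_of_forall_pow hσ₂ (by positivity) (norm_nonneg p.2) (norm_nonneg _) hA0 main).trans ?_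
  have e5 : h ^ m ≤ h' ^ m := by gcongr
  have e6 : Real.exp (-(R * ‖p.1‖ ^ (1 / s₁))) ≤ Real.exp (-(R' * ‖p.1‖ ^ (1 / s₁))) :=
    Real.exp_le_exp.2 (neg_le_neg (mul_le_mul_of_nonneg_right hR' (by positivity)))
  have e7 : Real.exp (-(σ₂ / 2 * (ε + h)⁻¹ ^ (1 / σ₂)) * ‖p.2‖ ^ (1 / σ₂)) ≤
      Real.exp (-(R' * ‖p.2‖ ^ (1 / σ₂))) := by
    refine Real.exp_le_exp.2 ?_
    rw [neg_mul]
    exact neg_le_neg (mul_le_mul_of_nonneg_right hR'' (by positivity))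
  have h'0 : 0 < h' := hh.trans_le hh'
  rw [expWeight_neg_eq, gevrey, hA]
  calc _ ≤ 2 ^ σ₂ * (h' ^ m * (m.factorial : ℝ) ^ σ₁ * (h' ^ N * (N.factorial : ℝ) ^ s₂) *
        Real.exp (-(R' * ‖p.1‖ ^ (1 / s₁))) * (C * J * M)) *
        Real.exp (-(R' * ‖p.2‖ ^ (1 / σ₂))) := by gcongr
    _ = _ := by rw [pow_add]; ring

end FourierBound

section Rates

theorem exists_rate_small {s a R : ℝ} (hs : 0 < s) (ha : 0 < a) (hR : 0 < R) :
    ∃ K₀ : ℝ, 0 < K₀ ∧ K₀ ≤ a ∧ ∀ K, 0 < K → K ≤ K₀ → R ≤ s / 2 * K⁻¹ ^ (1 / s) := by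
  refine ⟨min a ((s / (2 * R)) ^ s), lt_min ha (by positivity), min_le_left _ _, fun K hK hK' => ?_⟩
  have h1 : K ≤ (s / (2 * R)) ^ s := hK'.trans (min_le_right _ _)
  have h2 : ((2 * R) / s) ^ s ≤ K⁻¹ := by
    rw [← inv_div, Real.inv_rpow (by positivity)]
    exact inv_anti₀ hK h1
  have h3 := Real.rpow_le_rpow (by positivity) h2 (one_div_pos.2 hs).le
  rw [← Real.rpow_mul (by positivity), mul_one_div_cancel hs.ne', Real.rpow_one] at h3
  calc R = s / 2 * (2 * R / s) := by field_simp
    _ ≤ _ := by gcongr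

theorem exists_decay_large {s a : ℝ} (hs : 0 < s) (ha : 0 < a) :
    ∃ R₀ : ℝ, 0 < R₀ ∧ ∀ R, R₀ ≤ R → (s / R) ^ s ≤ a := by
  refine ⟨s / a ^ (1 / s), by positivity, fun R hR => ?_⟩
  have h0 : 0 < s / a ^ (1 / s) := by positivity
  have h1 : s / R ≤ a ^ (1 / s) := by
    rw [div_le_iff₀ (h0.trans_le hR), mul_comm]
    exact (div_le_iff₀ (by positivity)).1 hR
  calc (s / R) ^ s ≤ (a ^ (1 / s)) ^ s :=
        Real.rpow_le_rpow (div_nonneg hs.le (h0.trans_le hR).le) h1 hs.le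
    _ = a := by rw [← Real.rpow_mul ha.le, one_div_mul_cancel hs.ne', Real.rpow_one]

/-- Quantification over the parameters of source and target of a map, according to the kind of
the spaces. -/
def ParamRel (κ : Kind) (P : ℝ → ℝ → ℝ → ℝ → Prop) : Prop :=
  match κ with
  | .roumieu => ∀ h R : ℝ, 0 < h → 0 < R → ∃ h' R' : ℝ, 0 < h' ∧ 0 < R' ∧ P h R h' R'
  | .beurling => ∀ h' R' : ℝ, 0 < h' → 0 < R' → ∃ h R : ℝ, 0 < h ∧ 0 < R ∧ P h R h' R'

theorem ParamRel.comp {κ : Kind} {P Q S : ℝ → ℝ → ℝ → ℝ → Prop} (hP : ParamRel κ P)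
    (hQ : ParamRel κ Q) (hS : ∀ h R h' R' h'' R'', 0 < h → 0 < R → 0 < h' → 0 < R' → 0 < h'' →
      0 < R'' → P h R h' R' → Q h' R' h'' R'' → S h R h'' R'') : ParamRel κ S := by
  cases κ
  · intro h R hh hR
    obtain ⟨h', R', hh', hR', H⟩ := hP h R hh hR
    obtain ⟨h'', R'', hh'', hR'', H'⟩ := hQ h' R' hh' hR'
    exact ⟨h'', R'', hh'', hR'', hS _ _ _ _ _ _ hh hR hh' hR' hh'' hR'' H H'⟩
  · intro h'' R'' hh'' hR''
    obtain ⟨h', R', hh', hR', H'⟩ := hQ h'' R'' hh'' hR''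
    obtain ⟨h, R, hh, hR, H⟩ := hP h' R' hh' hR'
    exact ⟨h, R, hh, hR, hS _ _ _ _ _ _ hh hR hh' hR' hh'' hR'' H H'⟩

theorem ParamRel.mono {κ : Kind} {P Q : ℝ → ℝ → ℝ → ℝ → Prop} (hP : ParamRel κ P)
    (h : ∀ h R h' R', 0 < h → 0 < R → 0 < h' → 0 < R' → P h R h' R' → Q h R h' R') :
    ParamRel κ Q := by
  cases κ
  · intro h₀ R hh hR
    obtain ⟨h', R', hh', hR', H⟩ := hP h₀ R hh hR
    exact ⟨h', R', hh', hR', h _ _ _ _ hh hR hh' hR' H⟩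
  · intro h' R' hh' hR'
    obtain ⟨h₀, R, hh, hR, H⟩ := hP h' R' hh' hR'
    exact ⟨h₀, R, hh, hR, h _ _ _ _ hh hR hh' hR' H⟩

end Rates

section Spaces

variable {d₁ d₂ : ℕ} {s₁ s₂ σ₁ σ₂ : ℝ} {F G : V d₁ × V d₂ → ℂ}

/-- Gevrey bounds together with exponential decay. -/
abbrev GSBound (s₁ s₂ σ₁ σ₂ h R M : ℝ) (F : V d₁ × V d₂ → ℂ) : Prop :=
  GevreyBound σ₁ σ₂ h (fun x => M * expWeight s₁ s₂ (-R) x) F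

theorem GSBound.mono {h h' R R' M M' : ℝ} (H : GSBound s₁ s₂ σ₁ σ₂ h R M F) (hh : 0 < h)
    (h1 : h ≤ h') (h2 : R' ≤ R) (h3 : M ≤ M') (hM : 0 ≤ M) : GSBound s₁ s₂ σ₁ σ₂ h' R' M' F := by
  refine GevreyBound.mono_weight (hh.trans_le h1) (GevreyBound.mono_rate hh.le h1 H) fun x => ?_
  exact mul_le_mul h3 (expWeight_mono (neg_le_neg h2) x) (expWeight_pos _ _ _ _).le (hM.trans h3)

theorem GSBound.nonneg {h R M : ℝ} (H : GSBound s₁ s₂ σ₁ σ₂ h R M F) : 0 ≤ M :=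
  nonneg_of_mul_nonneg_left (GevreyBound.weight_nonneg H 0) (expWeight_pos _ _ _ _)

theorem GSBound.add {h R M N : ℝ} (hF : GSBound s₁ s₂ σ₁ σ₂ h R M F)
    (hG : GSBound s₁ s₂ σ₁ σ₂ h R N G) : GSBound s₁ s₂ σ₁ σ₂ h R (M + N) (F + G) :=
  (DerivBound.add hF hG).mono fun m n x => by rw [add_mul]

theorem GSBound.smul {h R M : ℝ} (c : ℂ) (hF : GSBound s₁ s₂ σ₁ σ₂ h R M F) :
    GSBound s₁ s₂ σ₁ σ₂ h R (‖c‖ * M) (c • F) :=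
  (DerivBound.smul c hF).mono fun m n x => by rw [mul_assoc]

theorem mem_GS₂_roumieu (hs₁ : 0 < s₁) (hs₂ : 0 < s₂) (hσ₁ : 0 ≤ σ₁) (hσ₂ : 0 ≤ σ₂) :
    F ∈ GS₂ .roumieu s₁ s₂ σ₁ σ₂ d₁ d₂ ↔
      ∃ h R M : ℝ, 0 < h ∧ 0 < R ∧ GSBound s₁ s₂ σ₁ σ₂ h R M F := by
  constructor
  · rintro ⟨hF, h, hh, hn⟩
    have hD := one_le_dimConst d₁ d₂
    have := gevreyBound_of_gsNorm₂ hs₁ hs₂ hσ₁ hσ₂ hh ENNReal.toReal_nonneg hF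
      (ENNReal.ofReal_toReal hn.ne).ge
    exact ⟨_, _, _, by positivity, decayRate_pos hs₁ hs₂ (by positivity), this⟩
  · rintro ⟨h, R, M, hh, hR, H⟩
    refine ⟨H.smooth, normRate d₁ d₂ s₁ s₂ σ₁ σ₂ h R, normRate_pos hh hs₁ hs₂ hR, ?_⟩
    exact (gsNorm₂_le_of_gevreyBound hs₁ hs₂ hσ₁ hσ₂ hh hR H.nonneg H).trans_lt
      ENNReal.ofReal_lt_top

theorem exists_norm_rate (d₁ d₂ : ℕ) (hs₁ : 0 < s₁) (hs₂ : 0 < s₂) {k : ℝ} (hk : 0 < k) :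
    ∃ h R : ℝ, 0 < h ∧ 0 < R ∧ normRate d₁ d₂ s₁ s₂ σ₁ σ₂ h R ≤ k := by
  have hD := one_le_dimConst d₁ d₂
  set D := dimConst d₁ d₂ ^ (s₁ + s₂ + σ₁ + σ₂) with hDD
  have hD0 : 0 < D := by positivity
  set a := k / (3 * D)
  have ha : 0 < a := by positivity
  obtain ⟨R₁, hR₁, H₁⟩ := exists_decay_large hs₁ ha
  obtain ⟨R₂, hR₂, H₂⟩ := exists_decay_large hs₂ ha
  refine ⟨a, max R₁ R₂, ha, lt_max_of_lt_left hR₁, ?_⟩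
  have e1 := H₁ _ (le_max_left R₁ R₂)
  have e2 := H₂ _ (le_max_right R₁ R₂)
  calc normRate d₁ d₂ s₁ s₂ σ₁ σ₂ a (max R₁ R₂) ≤ D * (a + a + a) := by
        unfold normRate; gcongr
    _ = k := by simp only [a]; field_simp; norm_num

theorem exists_bound_rate (d₁ d₂ : ℕ) (hs₁ : 0 < s₁) (hs₂ : 0 < s₂) {k R : ℝ} (hk : 0 < k)
    (hR : 0 < R) : ∃ h : ℝ, 0 < h ∧ dimConst d₁ d₂ * h ≤ k ∧
      R ≤ decayRate s₁ s₂ (dimConst d₁ d₂ * h) := by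
  have hD := one_le_dimConst d₁ d₂
  obtain ⟨K₁, hK₁, hk₁, H₁⟩ := exists_rate_small hs₁ hk hR
  obtain ⟨K₂, hK₂, hk₂, H₂⟩ := exists_rate_small hs₂ hk hR
  have e : dimConst d₁ d₂ * (min K₁ K₂ / dimConst d₁ d₂) = min K₁ K₂ := by field_simp
  refine ⟨min K₁ K₂ / dimConst d₁ d₂, by positivity, ?_, ?_⟩
  · rw [e]; exact (min_le_left _ _).trans hk₁
  · rw [e, decayRate]
    exact le_min (H₁ _ (by positivity) (min_le_left _ _)) (H₂ _ (by positivity) (min_le_right _ _))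

theorem mem_GS₂_beurling (hs₁ : 0 < s₁) (hs₂ : 0 < s₂) (hσ₁ : 0 ≤ σ₁) (hσ₂ : 0 ≤ σ₂) :
    F ∈ GS₂ .beurling s₁ s₂ σ₁ σ₂ d₁ d₂ ↔
      ∀ h R : ℝ, 0 < h → 0 < R → ∃ M : ℝ, GSBound s₁ s₂ σ₁ σ₂ h R M F := by
  constructor
  · rintro ⟨hF, hn⟩ k R hk hR
    have hD := one_le_dimConst d₁ d₂
    obtain ⟨h, hh, h1, h2⟩ := exists_bound_rate d₁ d₂ hs₁ hs₂ hk hR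
    have := gevreyBound_of_gsNorm₂ hs₁ hs₂ hσ₁ hσ₂ hh ENNReal.toReal_nonneg hF
      (ENNReal.ofReal_toReal (hn h hh).ne).ge
    exact ⟨_, GSBound.mono this (by positivity) h1 h2 le_rfl (GSBound.nonneg this)⟩
  · intro H
    refine ⟨(H 1 1 one_pos one_pos).choose_spec.smooth, fun k hk => ?_⟩
    obtain ⟨h, R, hh, hR, hk'⟩ := exists_norm_rate (σ₁ := σ₁) (σ₂ := σ₂) d₁ d₂ hs₁ hs₂ hk
    obtain ⟨M, HM⟩ := H h R hh hR
    refine (gsNorm₂_mono (normRate_pos hh hs₁ hs₂ hR) hk' F).trans_lt ?_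
    exact (gsNorm₂_le_of_gevreyBound hs₁ hs₂ hσ₁ hσ₂ hh hR HM.nonneg HM).trans_lt
      ENNReal.ofReal_lt_top

theorem GS₂_exists_bound {κ : Kind} (hs₁ : 0 < s₁) (hs₂ : 0 < s₂) (hσ₁ : 0 ≤ σ₁) (hσ₂ : 0 ≤ σ₂)
    (hF : F ∈ GS₂ κ s₁ s₂ σ₁ σ₂ d₁ d₂) :
    ∃ h R M : ℝ, 0 < h ∧ 0 < R ∧ GSBound s₁ s₂ σ₁ σ₂ h R M F := by
  cases κ
  · exact (mem_GS₂_roumieu hs₁ hs₂ hσ₁ hσ₂).1 hF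
  · obtain ⟨M, hM⟩ := (mem_GS₂_beurling hs₁ hs₂ hσ₁ hσ₂).1 hF 1 1 one_pos one_pos
    exact ⟨1, 1, M, one_pos, one_pos, hM⟩

theorem GS₂_rapid {κ : Kind} (hs₁ : 0 < s₁) (hs₂ : 0 < s₂) (hσ₁ : 0 ≤ σ₁) (hσ₂ : 0 ≤ σ₂)
    (hF : F ∈ GS₂ κ s₁ s₂ σ₁ σ₂ d₁ d₂) : Rapid F := by
  obtain ⟨h, R, M, hh, hR, H⟩ := GS₂_exists_bound hs₁ hs₂ hσ₁ hσ₂ hF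
  exact GevreyBound.rapid hs₁ hs₂ hR H

theorem isContinuousForm_roumieu (hs₁ : 0 < s₁) (hs₂ : 0 < s₂) (hσ₁ : 0 ≤ σ₁) (hσ₂ : 0 ≤ σ₂)
    (u : GS₂ .roumieu s₁ s₂ σ₁ σ₂ d₁ d₂ →ₗ[ℂ] ℂ) :
    IsContinuousForm .roumieu u ↔ ∀ h R : ℝ, 0 < h → 0 < R → ∃ K : ℝ, 0 ≤ K ∧
      ∀ (M : ℝ) (F : GS₂ .roumieu s₁ s₂ σ₁ σ₂ d₁ d₂), GSBound s₁ s₂ σ₁ σ₂ h R M F.1 →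
        ‖u F‖ ≤ K * M := by
  constructor
  · intro H h R hh hR
    obtain ⟨K, hK⟩ := H _ (normRate_pos (σ₁ := σ₁) (σ₂ := σ₂) (d₁ := d₁) (d₂ := d₂) hh hs₁ hs₂ hR)
    refine ⟨K, K.coe_nonneg, fun M F hF => ?_⟩
    have h1 := gsNorm₂_le_of_gevreyBound hs₁ hs₂ hσ₁ hσ₂ hh hR hF.nonneg hF
    have h2 := (hK F (h1.trans_lt ENNReal.ofReal_lt_top)).trans (mul_le_mul_right h1 _)
    rw [← ENNReal.ofReal_coe_nnreal, ← ENNReal.ofReal_mul K.coe_nonneg, ← ofReal_norm,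
      ENNReal.ofReal_le_ofReal_iff (mul_nonneg K.coe_nonneg hF.nonneg)] at h2
    exact h2
  · intro H h hh
    have hD := one_le_dimConst d₁ d₂
    obtain ⟨K, hK0, hK⟩ := H (dimConst d₁ d₂ * h) (decayRate s₁ s₂ (dimConst d₁ d₂ * h))
      (by positivity) (decayRate_pos hs₁ hs₂ (by positivity))
    refine ⟨Real.toNNReal (K * (2 ^ s₁ * 2 ^ s₂)), fun F hF => ?_⟩
    have h1 := hK _ F (gevreyBound_of_gsNorm₂ hs₁ hs₂ hσ₁ hσ₂ hh ENNReal.toReal_nonneg F.2.1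
      (ENNReal.ofReal_toReal hF.ne).ge)
    rw [← ENNReal.ofReal_coe_nnreal, Real.coe_toNNReal _ (by positivity),
      ← ENNReal.ofReal_toReal hF.ne, ← ENNReal.ofReal_mul (by positivity), ← ofReal_norm]
    refine ENNReal.ofReal_le_ofReal (h1.trans (le_of_eq ?_))
    ring

theorem isContinuousForm_beurling (hs₁ : 0 < s₁) (hs₂ : 0 < s₂) (hσ₁ : 0 ≤ σ₁) (hσ₂ : 0 ≤ σ₂)
    (u : GS₂ .beurling s₁ s₂ σ₁ σ₂ d₁ d₂ →ₗ[ℂ] ℂ) :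
    IsContinuousForm .beurling u ↔ ∃ h R : ℝ, 0 < h ∧ 0 < R ∧ ∃ K : ℝ, 0 ≤ K ∧
      ∀ (M : ℝ) (F : GS₂ .beurling s₁ s₂ σ₁ σ₂ d₁ d₂), GSBound s₁ s₂ σ₁ σ₂ h R M F.1 →
        ‖u F‖ ≤ K * M := by
  constructor
  · rintro ⟨k, hk, K, hK⟩
    obtain ⟨h, R, hh, hR, hk'⟩ := exists_norm_rate (σ₁ := σ₁) (σ₂ := σ₂) d₁ d₂ hs₁ hs₂ hk
    refine ⟨h, R, hh, hR, K, K.coe_nonneg, fun M F hF => ?_⟩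
    have h1 := (gsNorm₂_mono (normRate_pos hh hs₁ hs₂ hR) hk' F.1).trans
      (gsNorm₂_le_of_gevreyBound hs₁ hs₂ hσ₁ hσ₂ hh hR hF.nonneg hF)
    have h2 := (hK F).trans (mul_le_mul_right h1 _)
    rw [← ENNReal.ofReal_coe_nnreal, ← ENNReal.ofReal_mul K.coe_nonneg, ← ofReal_norm,
      ENNReal.ofReal_le_ofReal_iff (mul_nonneg K.coe_nonneg hF.nonneg)] at h2
    exact h2
  · rintro ⟨k, R, hk, hR, K, hK0, hK⟩
    have hD := one_le_dimConst d₁ d₂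
    obtain ⟨h, hh, h1, h2⟩ := exists_bound_rate d₁ d₂ hs₁ hs₂ hk hR
    refine ⟨h, hh, Real.toNNReal (K * (2 ^ s₁ * 2 ^ s₂)), fun F => ?_⟩
    have hF := F.2.2 h hh
    have h3 := gevreyBound_of_gsNorm₂ hs₁ hs₂ hσ₁ hσ₂ hh ENNReal.toReal_nonneg F.2.1
      (ENNReal.ofReal_toReal hF.ne).ge
    have h4 := hK _ F (GSBound.mono h3 (by positivity) h1 h2 le_rfl (GSBound.nonneg h3))
    rw [← ENNReal.ofReal_coe_nnreal, Real.coe_toNNReal _ (by positivity),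
      ← ENNReal.ofReal_toReal hF.ne, ← ENNReal.ofReal_mul (by positivity), ← ofReal_norm]
    refine ENNReal.ofReal_le_ofReal (h4.trans (le_of_eq ?_))
    ring

end Spaces

section Maps

variable {ι : Type*} {d₁ d₂ d₁' d₂' d₁'' d₂'' : ℕ} {κ : Kind}

/-- Boundedness of a map from functions with bounds of one type to functions with bounds of
another type. -/
def MapsBound (s₁ s₂ σ₁ σ₂ h R s₁' s₂' σ₁' σ₂' h' R' : ℝ)
    (T : ι → (V d₁ × V d₂ → ℂ) → (V d₁' × V d₂' → ℂ)) : Prop :=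
  ∃ K : ℝ, 0 < K ∧ ∀ (i : ι) (M : ℝ) (F : V d₁ × V d₂ → ℂ), GSBound s₁ s₂ σ₁ σ₂ h R M F →
    GSBound s₁' s₂' σ₁' σ₂' h' R' (K * M) (T i F)

/-- Uniform continuity of a family of maps between Gelfand-Shilov spaces. -/
def MapsGS (κ : Kind) (s₁ s₂ σ₁ σ₂ s₁' s₂' σ₁' σ₂' : ℝ)
    (T : ι → (V d₁ × V d₂ → ℂ) → (V d₁' × V d₂' → ℂ)) : Prop :=
  ParamRel κ fun h R h' R' => MapsBound s₁ s₂ σ₁ σ₂ h R s₁' s₂' σ₁' σ₂' h' R' T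

variable {s₁ s₂ σ₁ σ₂ s₁' s₂' σ₁' σ₂' s₁'' s₂'' σ₁'' σ₂'' : ℝ}

theorem MapsGS.comp {T : ι → (V d₁ × V d₂ → ℂ) → (V d₁' × V d₂' → ℂ)}
    {T' : ι → (V d₁' × V d₂' → ℂ) → (V d₁'' × V d₂'' → ℂ)}
    (hT' : MapsGS κ s₁' s₂' σ₁' σ₂' s₁'' s₂'' σ₁'' σ₂'' T')
    (hT : MapsGS κ s₁ s₂ σ₁ σ₂ s₁' s₂' σ₁' σ₂' T) :
    MapsGS κ s₁ s₂ σ₁ σ₂ s₁'' s₂'' σ₁'' σ₂'' (fun i F => T' i (T i F)) := by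
  refine ParamRel.comp hT hT' ?_
  rintro h R h' R' h'' R'' - - - - - - ⟨K, hK, H⟩ ⟨K', hK', H'⟩
  refine ⟨K' * K, by positivity, fun i M F hF => ?_⟩
  have := H' i _ _ (H i M F hF)
  rwa [← mul_assoc] at this

theorem MapsGS.smul (c : ℂ) {T : ι → (V d₁ × V d₂ → ℂ) → (V d₁' × V d₂' → ℂ)}
    (hT : MapsGS κ s₁ s₂ σ₁ σ₂ s₁' s₂' σ₁' σ₂' T) :
    MapsGS κ s₁ s₂ σ₁ σ₂ s₁' s₂' σ₁' σ₂' (fun i F => c • T i F) := by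
  refine ParamRel.mono hT ?_
  rintro h R h' R' - - hh' - ⟨K, hK, H⟩
  refine ⟨(‖c‖ + 1) * K, by positivity, fun i M F hF => ?_⟩
  have h1 := (H i M F hF).smul c
  refine GSBound.mono h1 hh' le_rfl le_rfl ?_ h1.nonneg
  have := hF.nonneg
  rw [mul_assoc]
  exact mul_le_mul_of_nonneg_right (by linarith) (by positivity)

theorem MapsGS.mem {T : ι → (V d₁ × V d₂ → ℂ) → (V d₁' × V d₂' → ℂ)}
    (hT : MapsGS κ s₁ s₂ σ₁ σ₂ s₁' s₂' σ₁' σ₂' T) (hs₁ : 0 < s₁) (hs₂ : 0 < s₂) (hσ₁ : 0 ≤ σ₁)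
    (hσ₂ : 0 ≤ σ₂) (hs₁' : 0 < s₁') (hs₂' : 0 < s₂') (hσ₁' : 0 ≤ σ₁') (hσ₂' : 0 ≤ σ₂') (i : ι)
    {F : V d₁ × V d₂ → ℂ} (hF : F ∈ GS₂ κ s₁ s₂ σ₁ σ₂ d₁ d₂) :
    T i F ∈ GS₂ κ s₁' s₂' σ₁' σ₂' d₁' d₂' := by
  cases κ
  · obtain ⟨h, R, M, hh, hR, H⟩ := (mem_GS₂_roumieu hs₁ hs₂ hσ₁ hσ₂).1 hF
    obtain ⟨h', R', hh', hR', K, hK, H'⟩ := hT h R hh hR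
    exact (mem_GS₂_roumieu hs₁' hs₂' hσ₁' hσ₂').2 ⟨h', R', _, hh', hR', H' i M F H⟩
  · refine (mem_GS₂_beurling hs₁' hs₂' hσ₁' hσ₂').2 fun h' R' hh' hR' => ?_
    obtain ⟨h, R, hh, hR, K, hK, H'⟩ := hT h' R' hh' hR'
    obtain ⟨M, H⟩ := (mem_GS₂_beurling hs₁ hs₂ hσ₁ hσ₂).1 hF h R hh hR
    exact ⟨_, H' i M F H⟩

theorem MapsGS.isContinuousForm {T : ι → (V d₁ × V d₂ → ℂ) → (V d₁' × V d₂' → ℂ)}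
    (hT : MapsGS κ s₁ s₂ σ₁ σ₂ s₁' s₂' σ₁' σ₂' T) (hs₁ : 0 < s₁) (hs₂ : 0 < s₂) (hσ₁ : 0 ≤ σ₁)
    (hσ₂ : 0 ≤ σ₂) (hs₁' : 0 < s₁') (hs₂' : 0 < s₂') (hσ₁' : 0 ≤ σ₁') (hσ₂' : 0 ≤ σ₂') (i : ι)
    {u : GS₂ κ s₁' s₂' σ₁' σ₂' d₁' d₂' →ₗ[ℂ] ℂ} (hu : IsContinuousForm κ u)
    {v : GS₂ κ s₁ s₂ σ₁ σ₂ d₁ d₂ →ₗ[ℂ] ℂ}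
    (huv : ∀ F : GS₂ κ s₁ s₂ σ₁ σ₂ d₁ d₂, ∃ G : GS₂ κ s₁' s₂' σ₁' σ₂' d₁' d₂',
      G.1 = T i F.1 ∧ v F = u G) : IsContinuousForm κ v := by
  cases κ
  · rw [isContinuousForm_roumieu hs₁' hs₂' hσ₁' hσ₂'] at hu
    rw [isContinuousForm_roumieu hs₁ hs₂ hσ₁ hσ₂]
    intro h R hh hR
    obtain ⟨h', R', hh', hR', K, hK, H⟩ := hT h R hh hR
    obtain ⟨K', hK', H'⟩ := hu h' R' hh' hR'
    refine ⟨K' * K, by positivity, fun M F hF => ?_⟩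
    obtain ⟨G, hG, hv⟩ := huv F
    have h1 := H i M F.1 hF
    rw [← hG] at h1
    rw [hv, mul_assoc]
    exact H' _ G h1
  · rw [isContinuousForm_beurling hs₁' hs₂' hσ₁' hσ₂'] at hu
    rw [isContinuousForm_beurling hs₁ hs₂ hσ₁ hσ₂]
    obtain ⟨h', R', hh', hR', K', hK', H'⟩ := hu
    obtain ⟨h, R, hh, hR, K, hK, H⟩ := hT h' R' hh' hR'
    refine ⟨h, R, hh, hR, K' * K, by positivity, fun M F hF => ?_⟩
    obtain ⟨G, hG, hv⟩ := huv F
    have h1 := H i M F.1 hF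
    rw [← hG] at h1
    rw [hv, mul_assoc]
    exact H' _ G h1

end Maps

section Taylor

variable {X : Type*} [NormedAddCommGroup X] [NormedSpace ℝ X]

theorem iteratedDeriv_eq_listDeriv (n : ℕ) (g : ℝ → ℂ) :
    iteratedDeriv n g = listDeriv (List.replicate n (1 : ℝ)) g := by
  induction n with
  | zero => simp
  | succ n ih => rw [iteratedDeriv_succ, ih]; rfl

theorem norm_le_of_taylor {F : X → ℂ} (hF : ContDiff ℝ ∞ F) (x z : X) {A B : ℝ}
    (hA : ∀ n : ℕ, ‖listDeriv (List.replicate n z) F x‖ ≤ A * (1 / 2) ^ n * n.factorial)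
    (hB : ∀ n : ℕ, ∀ t ∈ Set.Icc (0 : ℝ) 1,
      ‖listDeriv (List.replicate n z) F (t • z + x)‖ ≤ B * (1 / 2) ^ n * n.factorial) :
    ‖F (z + x)‖ ≤ 2 * A := by
  set g : ℝ → ℂ := fun t => F (t • z + x) with hg
  have hgs : ContDiff ℝ ∞ g := contDiff_comp_affine (ContinuousLinearMap.toSpanSingleton ℝ z) x hF
  have hgn : ∀ n t, iteratedDeriv n g t = listDeriv (List.replicate n z) F (t • z + x) := by
    intro n t
    have := listDeriv_comp_affine (ContinuousLinearMap.toSpanSingleton ℝ z) x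
      (List.replicate n (1 : ℝ)) hF
    simp only [ContinuousLinearMap.toSpanSingleton_apply, List.map_replicate, one_smul] at this
    rw [iteratedDeriv_eq_listDeriv, hg, this]
  have hw : ∀ n, ∀ t ∈ Set.Icc (0 : ℝ) 1, iteratedDerivWithin n g (Set.Icc 0 1) t =
      listDeriv (List.replicate n z) F (t • z + x) := fun n t ht => by
    rw [← hgn]
    exact iteratedDerivWithin_eq_iteratedDeriv (uniqueDiffOn_Icc one_pos)
      (hgs.of_le (by exact_mod_cast le_top)).contDiffAt ht
  have key : ∀ n : ℕ, ‖g 1‖ ≤ 2 * A + B * ((n + 1 : ℕ) : ℝ) * (1 / 2) ^ (n + 1) := by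
    intro n
    have h1 := taylor_mean_remainder_bound (f := g) (n := n) (a := 0) (b := 1) (x := 1)
      (C := B * (1 / 2) ^ (n + 1) * ((n + 1).factorial : ℝ)) zero_le_one
      (hgs.of_le (by exact_mod_cast le_top)).contDiffOn (Set.right_mem_Icc.2 zero_le_one)
      (fun t ht => by rw [hw _ t ht]; exact hB (n + 1) t ht)
    have hA0 : 0 ≤ A := by simpa using (norm_nonneg _).trans (hA 0)
    have h2 : ‖taylorWithinEval g n (Set.Icc 0 1) 0 1‖ ≤ 2 * A := by
      rw [taylor_within_apply]
      have h3 : ∀ k ∈ Finset.range (n + 1), ‖((k.factorial : ℝ)⁻¹ * (1 - 0) ^ k) •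
          iteratedDerivWithin k g (Set.Icc 0 1) 0‖ ≤ A * (1 / 2) ^ k := by
        intro k _
        have hk := hA k
        rw [hw k 0 (Set.left_mem_Icc.2 zero_le_one), zero_smul, zero_add, sub_zero, one_pow,
          mul_one, norm_smul, norm_inv, Real.norm_natCast, inv_mul_le_iff₀ (by positivity)]
        linarith
      refine (norm_sum_le_of_le _ h3).trans ?_
      rw [← Finset.mul_sum, mul_comm 2 A]
      refine mul_le_mul_of_nonneg_left ?_ hA0
      refine (Summable.sum_le_tsum _ (fun k _ => by positivity) summable_geometric_two).trans ?_
      rw [tsum_geometric_two]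
    have h4 : ‖g 1‖ ≤ ‖taylorWithinEval g n (Set.Icc 0 1) 0 1‖ +
        ‖g 1 - taylorWithinEval g n (Set.Icc 0 1) 0 1‖ := by
      have := norm_add_le (taylorWithinEval g n (Set.Icc 0 1) 0 1)
        (g 1 - taylorWithinEval g n (Set.Icc 0 1) 0 1)
      rwa [add_sub_cancel] at this
    refine h4.trans (add_le_add h2 (h1.trans (le_of_eq ?_)))
    rw [Nat.factorial_succ]
    have : (n.factorial : ℝ) ≠ 0 := by exact_mod_cast n.factorial_ne_zero
    push_cast
    field_simp
    ring
  have hlim : Filter.Tendsto (fun n : ℕ => 2 * A + B * (n : ℝ) * (1 / 2) ^ n)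
      Filter.atTop (nhds (2 * A + B * 0)) := by
    simp only [mul_assoc]
    exact tendsto_const_nhds.add ((tendsto_self_mul_const_pow_of_lt_one (by norm_num)
      (by norm_num)).const_mul B)
  rw [mul_zero, add_zero] at hlim
  have := ge_of_tendsto' (hlim.comp (Filter.tendsto_add_atTop_nat 1)) key
  simpa [hg] using this

end Taylor

section MixedBounds

variable {d₁ d₂ : ℕ} {F : V d₁ × V d₂ → ℂ} {a : ℕ → ℕ → ℝ} {W : V d₁ × V d₂ → ℝ}

theorem DerivBound.norm_replicate_right (H : DerivBound a W F) (w : V d₂) (n : ℕ)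
    (x : V d₁ × V d₂) :
    ‖listDeriv (List.replicate n ((0, w) : V d₁ × V d₂)) F x‖ ≤ ‖w‖ ^ n * (a 0 n * W x) := by
  obtain ⟨u, hu, hw⟩ := exists_unit_smul w
  have e : List.replicate n ((0, w) : V d₁ × V d₂) =
      (dirList [] (List.replicate n u)).map (‖w‖ • ·) := by
    simp only [dirList, List.map_nil, List.nil_append, List.map_replicate, Prod.smul_mk, smul_zero]
    rw [← hw]
  rw [e, listDeriv_smul_list _ _ H.smooth, Pi.smul_apply, norm_smul]
  have h1 := H.bound [] (List.replicate n u) .nil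
    (fun v hv => by rw [List.eq_of_mem_replicate hv]; exact hu) x
  simp only [List.length_nil, List.length_replicate] at h1
  simp only [dirList, List.map_nil, List.nil_append, List.map_replicate,
    List.length_replicate, norm_pow, Complex.norm_real, norm_norm] at h1 ⊢
  exact mul_le_mul_of_nonneg_left h1 (by positivity)

theorem DerivBound.norm_replicate_left (H : DerivBound a W F) (w : V d₁) (n : ℕ)
    (x : V d₁ × V d₂) :
    ‖listDeriv (List.replicate n ((w, 0) : V d₁ × V d₂)) F x‖ ≤ ‖w‖ ^ n * (a n 0 * W x) := by
  obtain ⟨u, hu, hw⟩ := exists_unit_smul w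
  have e : List.replicate n ((w, 0) : V d₁ × V d₂) =
      (dirList (List.replicate n u) []).map (‖w‖ • ·) := by
    simp only [dirList, List.map_nil, List.append_nil, List.map_replicate, Prod.smul_mk, smul_zero]
    rw [← hw]
  rw [e, listDeriv_smul_list _ _ H.smooth, Pi.smul_apply, norm_smul]
  have h1 := H.bound (List.replicate n u) []
    (fun v hv => by rw [List.eq_of_mem_replicate hv]; exact hu) .nil x
  simp only [List.length_nil, List.length_replicate] at h1
  simp only [dirList, List.map_nil, List.append_nil, List.map_replicate,
    List.length_replicate, norm_pow, Complex.norm_real, norm_norm] at h1 ⊢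
  exact mul_le_mul_of_nonneg_left h1 (by positivity)

theorem pow_mul_factorial_le {s σ r : ℝ} (hs : 0 < s) (hsσ : s + σ = 1) (hr : 0 ≤ r) (n : ℕ) :
    r ^ n * (n.factorial : ℝ) ^ σ ≤ Real.exp (s * (2 * r) ^ (1 / s)) * (1 / 2) ^ n *
      n.factorial := by
  have h1 := pow_le_exp_rpow hs hs (show 0 ≤ 2 * r by positivity) n
  rw [div_self hs.ne', Real.one_rpow, one_pow, one_mul, mul_pow] at h1
  have h2 : (n.factorial : ℝ) = (n.factorial : ℝ) ^ s * (n.factorial : ℝ) ^ σ := by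
    rw [← Real.rpow_add (by positivity), hsσ, Real.rpow_one]
  have h3 : r ^ n ≤ (1 / 2) ^ n * ((n.factorial : ℝ) ^ s * Real.exp (s * (2 * r) ^ (1 / s))) := by
    rw [one_div, inv_pow, ← div_eq_inv_mul, le_div_iff₀ (by positivity)]
    linarith
  calc r ^ n * (n.factorial : ℝ) ^ σ ≤ (1 / 2) ^ n * ((n.factorial : ℝ) ^ s *
        Real.exp (s * (2 * r) ^ (1 / s))) * (n.factorial : ℝ) ^ σ := by gcongr
    _ = Real.exp (s * (2 * r) ^ (1 / s)) * (1 / 2) ^ n *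
        ((n.factorial : ℝ) ^ s * (n.factorial : ℝ) ^ σ) := by ring
    _ = _ := by rw [← h2]

/-- Quasi-analyticity: in the critical case, a fast decaying function with small Gevrey rate is
zero. -/
theorem GSBound.eq_zero {s₁ s₂ σ₁ σ₂ h R M : ℝ} (hs₂ : 0 < s₂)
    (hsσ : s₂ + σ₂ = 1) (hh : 0 < h) (hR : s₂ * (4 * h) ^ (1 / s₂) + 1 ≤ R) (hd : d₂ ≠ 0)
    (hF : GSBound s₁ s₂ σ₁ σ₂ h R M F) : F = 0 := by
  have hR0 : 0 < R := by have : 0 < s₂ * (4 * h) ^ (1 / s₂) := by positivity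
                         linarith
  have hM := hF.nonneg
  funext p
  obtain ⟨x, v⟩ := p
  have : Nonempty (Fin d₂) := ⟨⟨0, Nat.pos_of_ne_zero hd⟩⟩
  obtain ⟨e, he⟩ : ∃ e : V d₂, ‖e‖ = 1 := exists_norm_eq (V d₂) zero_le_one
  have key : ∀ l : ℝ, ‖v‖ ≤ l → ‖F (x, v)‖ ≤ 2 * (M * Real.exp (-(l ^ (1 / s₂)))) := by
    intro l hl
    have hl0 : 0 ≤ l := (norm_nonneg v).trans hl
    have hz : ‖v - l • e‖ ≤ 2 * l := by
      refine (norm_sub_le _ _).trans ?_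
      rw [norm_smul, he, Real.norm_of_nonneg hl0]; linarith
    have h1 : ∀ (n : ℕ) (y : V d₁ × V d₂),
        ‖listDeriv (List.replicate n ((0, v - l • e) : V d₁ × V d₂)) F y‖ ≤
        Real.exp (s₂ * (4 * h) ^ (1 / s₂) * l ^ (1 / s₂)) * (1 / 2) ^ n * n.factorial *
          (M * expWeight s₁ s₂ (-R) y) := by
      intro n y
      have hW : 0 ≤ M * expWeight s₁ s₂ (-R) y := mul_nonneg hM (expWeight_pos _ _ _ _).le
      refine (DerivBound.norm_replicate_right hF _ n y).trans ?_
      rw [← mul_assoc]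
      refine mul_le_mul_of_nonneg_right ?_ hW
      have h2 := pow_mul_factorial_le hs₂ hsσ (show 0 ≤ (2 * l) * h by positivity) n
      have e1 : (2 * (2 * l * h)) ^ (1 / s₂) = (4 * h) ^ (1 / s₂) * l ^ (1 / s₂) := by
        rw [← Real.mul_rpow (by positivity) hl0]; ring_nf
      rw [e1, ← mul_assoc] at h2
      refine le_trans ?_ h2
      simp only [gevrey, Nat.factorial_zero, Nat.cast_one, Real.one_rpow, zero_add, mul_one]
      rw [← mul_assoc, mul_pow (2 * l)]
      gcongr
    have h3 := norm_le_of_taylor hF.smooth ((x, l • e) : V d₁ × V d₂) (0, v - l • e)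
      (A := M * Real.exp (-(l ^ (1 / s₂))))
      (B := M * Real.exp (s₂ * (4 * h) ^ (1 / s₂) * l ^ (1 / s₂)))
      (fun n => (h1 n _).trans ?_) (fun n t _ => (h1 n _).trans ?_)
    · simpa using h3
    · have h4 : Real.exp (s₂ * (4 * h) ^ (1 / s₂) * l ^ (1 / s₂)) *
          expWeight s₁ s₂ (-R) ((x, l • e) : V d₁ × V d₂) ≤ Real.exp (-(l ^ (1 / s₂))) := by
        rw [expWeight, ← Real.exp_add]
        refine Real.exp_le_exp.2 ?_
        simp only [norm_smul, he, mul_one, Real.norm_of_nonneg hl0]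
        have e1 : 0 ≤ R * ‖x‖ ^ (1 / s₁) := by positivity
        have e2 : 0 ≤ l ^ (1 / s₂) := by positivity
        nlinarith [mul_le_mul_of_nonneg_right hR e2]
      calc _ = (1 / 2) ^ n * n.factorial * M * (Real.exp (s₂ * (4 * h) ^ (1 / s₂) * l ^ (1 / s₂)) *
          expWeight s₁ s₂ (-R) ((x, l • e) : V d₁ × V d₂)) := by ring
        _ ≤ (1 / 2) ^ n * n.factorial * M * Real.exp (-(l ^ (1 / s₂))) := by gcongr
        _ = _ := by ring
    · have h4 : expWeight s₁ s₂ (-R) (t • ((0, v - l • e) : V d₁ × V d₂) + (x, l • e)) ≤ 1 := by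
        refine Real.exp_le_one_iff.2 ?_
        rw [neg_mul, neg_nonpos]; positivity
      calc _ ≤ Real.exp (s₂ * (4 * h) ^ (1 / s₂) * l ^ (1 / s₂)) * (1 / 2) ^ n * n.factorial *
          (M * 1) := by gcongr
        _ = _ := by ring
  have hlim : Filter.Tendsto (fun l : ℝ => 2 * (M * Real.exp (-(l ^ (1 / s₂))))) Filter.atTop
      (nhds (2 * (M * 0))) := by
    refine Filter.Tendsto.const_mul _ (Filter.Tendsto.const_mul _ ?_)
    exact Real.tendsto_exp_neg_atTop_nhds_zero.comp (tendsto_rpow_atTop (by positivity))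
  rw [mul_zero, mul_zero] at hlim
  have := ge_of_tendsto hlim ((Filter.eventually_ge_atTop ‖v‖).mono key)
  simpa using this

end MixedBounds

section FourierMaps

variable {ι : Type*} {d d₁ d₂ : ℕ} {s₁ s₂ σ₁ σ₂ : ℝ} {f g : V d₁ × V d₂ → ℂ}

theorem exists_factorial_le {p ε : ℝ} (hp : 1 < p) (hε : 0 < ε) : ∃ C : ℝ, 0 ≤ C ∧
    ∀ i : ℕ, (i.factorial : ℝ) ≤ C * (ε ^ i * ε ^ i * (i.factorial : ℝ) ^ p) := by
  have hs : 0 < p - 1 := by linarith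
  refine ⟨Real.exp ((p - 1) * ((ε * ε)⁻¹) ^ (1 / (p - 1))), (Real.exp_pos _).le, fun i => ?_⟩
  have h1 := pow_le_exp_rpow hs hs (show 0 ≤ (ε * ε)⁻¹ by positivity) i
  rw [div_self hs.ne', Real.one_rpow, one_pow, one_mul, inv_pow, inv_le_iff_one_le_mul₀'
    (by positivity)] at h1
  have h2 : (i.factorial : ℝ) ^ p = (i.factorial : ℝ) * (i.factorial : ℝ) ^ (p - 1) := by
    rw [Real.rpow_sub_one (by positivity)]; field_simp
  rw [h2, ← mul_pow]
  have h3 : (0 : ℝ) < i.factorial := by positivity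
  nlinarith [mul_le_mul_of_nonneg_left h1 h3.le]

theorem GSBound.partialFourier_of_isEmpty {h R M : ℝ} (hd : d₂ = 0) (hh : 0 < h) (hs₁ : 0 < s₁) (hs₂ : 0 < s₂)
    (hσ₂ : 0 < σ₂) (hR : 0 < R)
    (hf : GSBound s₁ s₂ σ₁ σ₂ h R M f) : GSBound s₁ σ₂ σ₁ s₂ h R
      ((∫ v : V d₂, Real.exp (-(1 * ‖v‖ ^ (1 / s₂)))) * M) (partialFourier f) := by
  subst hd
  have hr : Rapid f := GevreyBound.rapid hs₁ hs₂ hR hf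
  have e0 : ∀ v : V 0, v = 0 := fun v => Subsingleton.elim _ _
  have e1 : ∀ v : V 0, Real.exp (-(1 * ‖v‖ ^ (1 / s₂))) = 1 := fun v => by
    rw [e0 v, norm_zero, Real.zero_rpow (by positivity)]; simp
  have e2 : partialFourier f = ((∫ v : V 0, Real.exp (-(1 * ‖v‖ ^ (1 / s₂))) : ℝ) : ℂ) • f := by
    funext p
    obtain ⟨x, v⟩ := p
    simp only [e1, partialFourier, Pi.smul_apply, smul_eq_mul]
    have : ∀ w : V 0, f (x, w) * char w v = f (x, v) * 1 := fun w => by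
      rw [e0 w, e0 v]; simp [char]
    simp only [this]
    rw [integral_const_mul]
    simp [mul_comm]
  have hJ : 0 ≤ ∫ v : V 0, Real.exp (-(1 * ‖v‖ ^ (1 / s₂))) :=
    integral_nonneg fun v => (Real.exp_pos _).le
  have h3 := hf.smul ((∫ v : V 0, Real.exp (-(1 * ‖v‖ ^ (1 / s₂))) : ℝ) : ℂ)
  rw [← e2, Complex.norm_real, Real.norm_of_nonneg hJ] at h3
  refine ⟨h3.smooth, fun l₁ l₂ u₁ u₂ x => ?_⟩
  cases l₂ with
  | nil =>
    refine (h3.bound l₁ [] u₁ u₂ x).trans (le_of_eq ?_)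
    simp only [gevrey, expWeight, e0 x.2, norm_zero, Real.zero_rpow (one_div_pos.2 hs₂).ne',
      Real.zero_rpow (one_div_pos.2 hσ₂).ne', List.length_nil, Nat.factorial_zero, Nat.cast_one,
      Real.one_rpow]
  | cons w l₂ =>
    rw [listDeriv_perm (dirList_cons_right w l₁ l₂) h3.smooth, e0 w]
    have : listDeriv (((0, 0) : V d₁ × V 0) :: dirList l₁ l₂) (partialFourier f) = 0 :=
      dirDeriv_zero_vec _
    rw [this, Pi.zero_apply, norm_zero]
    exact mul_nonneg (gevrey_pos hh _ _).le
      (mul_nonneg h3.nonneg (expWeight_pos _ _ _ _).le)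

theorem mapsGS_partialFourier (κ : Kind) (hs₁ : 0 < s₁) (hs₂ : 0 < s₂) (hσ₂ : 0 < σ₂)
    (hsσ : 1 ≤ s₂ + σ₂) :
    MapsGS κ s₁ s₂ σ₁ σ₂ s₁ σ₂ σ₁ s₂
      (fun (_ : ι) (f : V d₁ × V d₂ → ℂ) => partialFourier f) := by
  have hJ : ∀ c : ℝ, 0 ≤ ∫ v : V d₂, Real.exp (-(c * ‖v‖ ^ (1 / s₂))) := fun c =>
    integral_nonneg fun v => (Real.exp_pos _).le
  cases κ
  · intro h R hh hR
    refine ⟨max h (1 + (s₂ / (R / 2)) ^ s₂), min R (σ₂ / 2 * (1 + h)⁻¹ ^ (1 / σ₂)),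
      lt_max_of_lt_left hh, lt_min hR (by positivity),
      2 ^ σ₂ * 1 * (∫ v : V d₂, Real.exp (-(R / 2 * ‖v‖ ^ (1 / s₂)))) + 1,
      by have := hJ (R / 2); positivity, fun _ M f hf => ?_⟩
    have h1 := GevreyBound.partialFourier hs₁ hs₂ hσ₂ hh hR hf.nonneg one_pos zero_le_one
      (fun i => by
        rw [one_pow, one_mul, one_mul, one_mul, ← Real.rpow_add (by positivity)]
        have : (1 : ℝ) ≤ i.factorial := by exact_mod_cast Nat.one_le_of_lt i.factorial_pos
        simpa using Real.rpow_le_rpow_of_exponent_le this hsσ) hf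
      (le_max_left h _) (le_max_right h _) (min_le_left R _) (min_le_right R _)
    refine GSBound.mono h1 (lt_max_of_lt_left hh) le_rfl le_rfl ?_ (GSBound.nonneg h1)
    exact mul_le_mul_of_nonneg_right (by linarith) hf.nonneg
  · intro h' R' hh' hR'
    rcases eq_or_lt_of_le hsσ with heq | hlt
    · rcases Nat.eq_zero_or_pos d₂ with hd | hd
      · refine ⟨h', R', hh', hR',
          (∫ v : V d₂, Real.exp (-(1 * ‖v‖ ^ (1 / s₂)))) + 1, by have := hJ 1; positivity,
          fun _ M f hf => ?_⟩
        have h1 := GSBound.partialFourier_of_isEmpty hd hh' hs₁ hs₂ hσ₂ hR' hf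
        refine GSBound.mono h1 hh' le_rfl le_rfl ?_ h1.nonneg
        exact mul_le_mul_of_nonneg_right (by linarith) hf.nonneg
      · refine ⟨1, s₂ * (4 * 1) ^ (1 / s₂) + 1, one_pos, by positivity, 1, one_pos,
          fun _ M f hf => ?_⟩
        have h0 := GSBound.eq_zero hs₂ heq.symm one_pos le_rfl hd.ne' hf
        have h1 : partialFourier f = 0 := by
          funext p; simp [h0, partialFourier]
        change GSBound s₁ σ₂ σ₁ s₂ h' R' (1 * M) (partialFourier f)
        rw [h1]
        exact DerivBound.zero fun m n x => mul_nonneg (gevrey_pos hh' _ _).le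
          (mul_nonneg (mul_nonneg zero_le_one hf.nonneg) (expWeight_pos _ _ _ _).le)
    · obtain ⟨K, hK, hK', H⟩ := exists_rate_small hσ₂ (half_pos hh') hR'
      obtain ⟨R₀, hR₀, H₀⟩ := exists_decay_large hs₂ (half_pos hh')
      obtain ⟨C, hC, hfac⟩ := exists_factorial_le hlt (half_pos hK)
      have hR1 : 0 < max R' (2 * R₀) := lt_max_of_lt_left hR'
      refine ⟨K / 2, max R' (2 * R₀), half_pos hK, hR1,
        2 ^ σ₂ * C * (∫ v : V d₂, Real.exp (-(max R' (2 * R₀) / 2 * ‖v‖ ^ (1 / s₂)))) + 1,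
        by have := hJ (max R' (2 * R₀) / 2); positivity, fun _ M f hf => ?_⟩
      have h2 := H₀ (max R' (2 * R₀) / 2) (by
        have := le_max_right R' (2 * R₀); linarith)
      have h1 := GevreyBound.partialFourier hs₁ hs₂ hσ₂ (half_pos hK) hR1 hf.nonneg (half_pos hK)
        hC (fun i => by rw [← Real.rpow_add (by positivity)]; exact hfac i) hf
        (h' := h') (R' := R') (by linarith) (by linarith) (le_max_left _ _)
        (by rw [add_halves]; exact H K hK le_rfl)
      refine GSBound.mono h1 hh' le_rfl le_rfl ?_ (GSBound.nonneg h1)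
      exact mul_le_mul_of_nonneg_right (by linarith) hf.nonneg

/-- The involution `(x, v) ↦ (x + C v, -v)`. -/
def twist (C : V d₂ →L[ℝ] V d₁) : (V d₁ × V d₂) →L[ℝ] (V d₁ × V d₂) :=
  (dilation 1 (-1)).comp (shear C)

@[simp] theorem twist_apply (C : V d₂ →L[ℝ] V d₁) (x : V d₁ × V d₂) :
    twist C x = (x.1 + C x.2, -x.2) := by simp [twist]

theorem twist_twist (C : V d₂ →L[ℝ] V d₁) (x : V d₁ × V d₂) : twist C (twist C x) = x := by
  simp

theorem expWeight_shear_le {c : ℝ} (hs₂ : 0 < s₂) (hs : s₂ ≤ s₁) (C : V d₂ →L[ℝ] V d₁)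
    (hC : ‖C‖ ≤ c) {R : ℝ} (hR : 0 < R) (x : V d₁ × V d₂) :
    expWeight s₁ s₂ (-(R * (2 ^ (1 / s₁) + 2 ^ (1 / s₁) * c ^ (1 / s₁) + 1))) (shear C x) ≤
      Real.exp (R * (2 ^ (1 / s₁) * c ^ (1 / s₁))) * expWeight s₁ s₂ (-R) x := by
  have hc : 0 ≤ c := (norm_nonneg _).trans hC
  have hs₁ : 0 < s₁ := hs₂.trans_le hs
  rw [expWeight, expWeight, ← Real.exp_add]
  refine Real.exp_le_exp.2 ?_
  rw [shear_apply]
  simp only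
  set p := 1 / s₁
  set q := 1 / s₂
  have hp : 0 < p := by positivity
  have hpq : p ≤ q := one_div_le_one_div_of_le hs₂ hs
  set a := ‖x.1 + C x.2‖
  set b := ‖x.2‖
  have ha : 0 ≤ a := norm_nonneg _
  have hb : 0 ≤ b := norm_nonneg _
  have h1 : ‖x.1‖ ≤ 2 * max a (c * b) := by
    have e1 : ‖x.1‖ ≤ a + ‖C x.2‖ := by
      have := norm_sub_le (x.1 + C x.2) (C x.2)
      rwa [add_sub_cancel_right] at this
    have e2 : ‖C x.2‖ ≤ c * b := (C.le_opNorm _).trans (mul_le_mul_of_nonneg_right hC hb)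
    have e3 := le_max_left a (c * b)
    have e4 := le_max_right a (c * b)
    linarith
  have h2 : ‖x.1‖ ^ p ≤ 2 ^ p * (a ^ p + (c ^ p * (1 + b ^ q))) := by
    refine (Real.rpow_le_rpow (norm_nonneg _) h1 hp.le).trans ?_
    rw [Real.mul_rpow (by norm_num) (le_max_of_le_left ha)]
    refine mul_le_mul_of_nonneg_left ?_ (by positivity)
    have e5 : b ^ p ≤ 1 + b ^ q := by
      rcases le_total b 1 with h | h
      · have := Real.rpow_le_one hb h hp.le
        have : 0 ≤ b ^ q := by positivity
        linarith
      · have := Real.rpow_le_rpow_of_exponent_le h hpq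
        linarith
    have e6 : 0 ≤ a ^ p := by positivity
    have e7 : 0 ≤ c ^ p * (1 + b ^ q) := by positivity
    rcases le_total a (c * b) with h | h
    · rw [max_eq_right h, Real.mul_rpow hc hb]
      have := mul_le_mul_of_nonneg_left e5 (show 0 ≤ c ^ p by positivity)
      linarith
    · rw [max_eq_left h]; linarith
  have h3 : 0 ≤ a ^ p := by positivity
  have h4 : 0 ≤ b ^ q := by positivity
  have h5 : 0 ≤ (2 : ℝ) ^ p := by positivity
  have h6 : 0 ≤ (2 : ℝ) ^ p * c ^ p := by positivity
  have h7 := mul_le_mul_of_nonneg_left h2 hR.le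
  have h8 : 0 ≤ R * ((2 ^ p * c ^ p + 1) * a ^ p) := by positivity
  have h9 : 0 ≤ R * (2 ^ p * b ^ q) := by positivity
  nlinarith

theorem mapsGS_twist (κ : Kind) (hs₂ : 0 < s₂) (hs : s₂ ≤ s₁) (hσ₁ : 0 ≤ σ₁) (hσ : σ₁ ≤ σ₂)
    {c : ℝ} (hc : 0 ≤ c) (C : ι → V d₂ →L[ℝ] V d₁) (hC : ∀ i, ‖C i‖ ≤ c) :
    MapsGS κ s₁ s₂ σ₁ σ₂ s₁ s₂ σ₁ σ₂
      (fun i (f : V d₁ × V d₂ → ℂ) x => f (twist (C i) x)) := by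
  have hL : 0 < (2 : ℝ) ^ (1 / s₁) + 2 ^ (1 / s₁) * c ^ (1 / s₁) + 1 := by positivity
  have hA : 0 < (1 + c) * 2 ^ σ₁ := by positivity
  have main : ∀ h R : ℝ, 0 < h → 0 < R → MapsBound s₁ s₂ σ₁ σ₂ h
      (R * (2 ^ (1 / s₁) + 2 ^ (1 / s₁) * c ^ (1 / s₁) + 1)) s₁ s₂ σ₁ σ₂ ((1 + c) * 2 ^ σ₁ * h) R
      (fun i (f : V d₁ × V d₂ → ℂ) x => f (twist (C i) x)) := by
    intro h R hh hR
    refine ⟨Real.exp (R * (2 ^ (1 / s₁) * c ^ (1 / s₁))), Real.exp_pos _, fun i M f hf => ?_⟩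
    have h1 : GevreyBound σ₁ σ₂ h (fun x => M * expWeight s₁ s₂
        (-(R * (2 ^ (1 / s₁) + 2 ^ (1 / s₁) * c ^ (1 / s₁) + 1))) x)
        (fun x => f (dilation 1 (-1) x)) :=
      (DerivBound.dilate hf 1 (-1)).mono fun m n x => by simp [expWeight]
    refine GevreyBound.mono_weight (by positivity)
      (GevreyBound.shear hσ₁ hσ hh h1 (C i) (hC i)) fun x => ?_
    have := mul_le_mul_of_nonneg_left (expWeight_shear_le hs₂ hs (C i) (hC i) hR x) hf.nonneg
    calc _ ≤ _ := this
      _ = _ := by ring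
  cases κ
  · intro h R hh hR
    refine ⟨_, _, ?_, ?_, by
      have := main h (R / (2 ^ (1 / s₁) + 2 ^ (1 / s₁) * c ^ (1 / s₁) + 1)) hh (by positivity)
      rw [div_mul_cancel₀ _ hL.ne'] at this
      exact this⟩
    · positivity
    · positivity
  · intro h' R' hh' hR'
    refine ⟨_, _, ?_, ?_, by
      have := main (h' / ((1 + c) * 2 ^ σ₁)) R' (by positivity) hR'
      rw [mul_div_cancel₀ _ hA.ne'] at this
      exact this⟩
    · positivity
    · positivity

/-- The map `f ↦ e^{i⟨C D_ξ, D_x⟩} f`, which relates the symbols of an operator in different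
quantizations. -/
def symbolShift (C : V d₂ →L[ℝ] V d₁) (f : V d₁ × V d₂ → ℂ) : V d₁ × V d₂ → ℂ :=
  (((2 * Real.pi : ℝ) : ℂ)⁻¹ ^ d₂) • partialFourier (fun x => partialFourier f (twist C x))

theorem mapsGS_symbolShift (κ : Kind) (hs₂ : 0 < s₂) (hs : s₂ ≤ s₁) (hσ₁ : 0 < σ₁) (hσ : σ₁ ≤ σ₂)
    (hsσ : 1 ≤ s₂ + σ₂) {c : ℝ} (hc : 0 ≤ c) (C : ι → V d₂ →L[ℝ] V d₁) (hC : ∀ i, ‖C i‖ ≤ c) :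
    MapsGS κ s₁ σ₂ σ₁ s₂ s₁ σ₂ σ₁ s₂ (fun i => symbolShift (C i)) := by
  have hs₁ := hs₂.trans_le hs
  have hσ₂ := hσ₁.trans_le hσ
  have h1 := mapsGS_partialFourier (ι := ι) (d₁ := d₁) (d₂ := d₂) (σ₁ := σ₁) κ hs₁ hσ₂ hs₂
    (by linarith)
  have h2 := mapsGS_twist κ hs₂ hs hσ₁.le hσ hc C hC
  have h3 := mapsGS_partialFourier (ι := ι) (d₁ := d₁) (d₂ := d₂) (σ₁ := σ₁) κ hs₁ hs₂ hσ₂ hsσ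
  exact (h3.comp (h2.comp h1)).smul _

end FourierMaps

section Inversion

variable {d₁ d₂ : ℕ} {f g : V d₁ × V d₂ → ℂ}

theorem Rapid.partialFourier_inversion (hf : Rapid f) (hf' : Rapid (partialFourier f)) :
    partialFourier (fun x => partialFourier f (dilation 1 (-1) x)) =
      (((2 * Real.pi : ℝ) : ℂ) ^ d₂) • f := by
  funext p
  obtain ⟨x, v⟩ := p
  have hpi : (0 : ℝ) < 2 * Real.pi := by positivity
  set g : V d₂ → ℂ := fun v => f (x, v) with hg
  have e1 : ∀ w : V d₂, FourierTransform.fourier g w =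
      partialFourier f (x, (-(2 * Real.pi)) • w) := by
    intro w
    rw [Real.fourier_eq']
    unfold partialFourier char
    congr 1
    funext u
    rw [smul_eq_mul, mul_comm]
    congr 2
    simp only [inner_smul_right]
    push_cast
    ring
  have hgc : Continuous g := hf.smooth.continuous.comp (Continuous.prodMk_right x)
  have hgi : Integrable g := hf.integrable_right x
  have hFi : Integrable (FourierTransform.fourier g) := by
    have h1 := (integrable_comp_smul_iff (volume : Measure (V d₂))
      (fun w => partialFourier f (x, w)) (neg_ne_zero.2 hpi.ne')).2 (hf'.integrable_right x)
    exact h1.congr (Filter.Eventually.of_forall fun w => (e1 w).symm)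
  have h2 := hgi.fourierInv_fourier_eq hFi (v := v) hgc.continuousAt
  rw [Real.fourierInv_eq'] at h2
  have h3 := Measure.integral_comp_smul (volume : Measure (V d₂))
    (fun w => partialFourier f (x, -w) * char w v) (2 * Real.pi)
  have e2 : ∀ w : V d₂, partialFourier f (x, -((2 * Real.pi) • w)) * char ((2 * Real.pi) • w) v =
      Complex.exp (((2 * Real.pi * inner ℝ w v : ℝ) : ℂ) * Complex.I) •
        FourierTransform.fourier g w := by
    intro w
    rw [e1, smul_eq_mul, mul_comm, char, neg_smul, real_inner_smul_left, mul_comm Complex.I]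
  simp only [e2] at h3
  rw [h2] at h3
  have e3 : (Module.finrank ℝ (V d₂)) = d₂ := by simp
  rw [e3, abs_of_pos (by positivity)] at h3
  have e4 : partialFourier (fun x => partialFourier f (dilation 1 (-1) x)) (x, v) =
      ∫ w : V d₂, partialFourier f (x, -w) * char w v := by
    simp [partialFourier]
  rw [e4, Pi.smul_apply, smul_eq_mul]
  change g v = _ at h3
  change _ = _ * g v
  rw [h3, Complex.real_smul]
  push_cast
  rw [← mul_assoc, mul_inv_cancel₀ (by simp [Real.pi_ne_zero]), one_mul]

theorem Rapid.integral_partialFourier_mul (hf : Rapid f) (hg : Rapid g) :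
    ∫ x, partialFourier f x * g x = ∫ x, f x * partialFourier g x := by
  have bdd : ∀ f : V d₁ × V d₂ → ℂ, Rapid f → ∃ C, ∀ p, ‖partialFourier f p‖ ≤ C := by
    intro f hf
    obtain ⟨C, hC, h⟩ := hf.exists_norm_le_right
    refine ⟨∫ v : V d₂, C * (1 + ‖v‖) ^ (-((d₂ : ℝ) + 1)), fun p =>
      (norm_partialFourier_le f p).trans ?_⟩
    exact integral_mono (hf.integrable_right p.1).norm ((integrable_decay d₂).const_mul C)
      fun v => h p.1 v
  have i1 : Integrable (fun x => partialFourier f x * g x) := by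
    obtain ⟨C, hC⟩ := bdd f hf
    exact hg.integrable.bdd_mul hf.contDiff_partialFourier.continuous.aestronglyMeasurable
      (Filter.Eventually.of_forall hC)
  have i2 : Integrable (fun x => f x * partialFourier g x) := by
    obtain ⟨C, hC⟩ := bdd g hg
    exact hf.integrable.mul_bdd hg.contDiff_partialFourier.continuous.aestronglyMeasurable
      (Filter.Eventually.of_forall hC)
  rw [Measure.volume_eq_prod] at i1 i2 ⊢
  rw [integral_prod _ i1, integral_prod _ i2]
  congr 1
  funext x
  simp only [partialFourier]
  have hint : Integrable (Function.uncurry fun (ξ v : V d₂) => f (x, v) * char v ξ * g (x, ξ))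
      ((volume : Measure (V d₂)).prod volume) := by
    have h1 := (hg.integrable_right x).norm.mul_prod (hf.integrable_right x).norm
    refine h1.mono' ?_ (Filter.Eventually.of_forall fun p => ?_)
    · have c1 : Continuous fun p : V d₂ × V d₂ => f (x, p.2) :=
        hf.smooth.continuous.comp (continuous_const.prodMk continuous_snd)
      have c2 : Continuous fun p : V d₂ × V d₂ => g (x, p.1) :=
        hg.smooth.continuous.comp (continuous_const.prodMk continuous_fst)
      have c3 : Continuous fun p : V d₂ × V d₂ => char p.2 p.1 :=
        continuous_char.comp continuous_swap
      exact ((c1.mul c3).mul c2).aestronglyMeasurable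
    · simp [Function.uncurry, norm_char, mul_comm]
  have h1 := integral_integral_swap hint
  calc ∫ ξ, (∫ v, f (x, v) * char v ξ) * g (x, ξ)
      = ∫ ξ, ∫ v, f (x, v) * char v ξ * g (x, ξ) := by
        congr 1; funext ξ; rw [integral_mul_const]
    _ = ∫ v, ∫ ξ, f (x, v) * char v ξ * g (x, ξ) := h1
    _ = _ := by
        congr 1; funext v
        rw [← integral_const_mul]
        congr 1; funext ξ
        simp only [char, real_inner_comm]
        ring

/-- The involution `(x, v) ↦ (x + C v, -v)` as a measurable equivalence. -/
def twistEquiv (C : V d₂ →L[ℝ] V d₁) : (V d₁ × V d₂) ≃ᵐ (V d₁ × V d₂) where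
  toFun := twist C
  invFun := twist C
  left_inv := twist_twist C
  right_inv := twist_twist C
  measurable_toFun := (twist C).continuous.measurable
  measurable_invFun := (twist C).continuous.measurable

theorem measurePreserving_twist (C : V d₂ →L[ℝ] V d₁) :
    MeasurePreserving (twist C) (volume : Measure (V d₁ × V d₂)) volume := by
  have h1 : MeasurePreserving (fun p : V d₂ × V d₁ => (-p.1, p.2 + C p.1))
      ((volume : Measure (V d₂)).prod volume) ((volume : Measure (V d₂)).prod volume) :=
    (Measure.measurePreserving_neg volume).skew_product (g := fun v x => x + C v)
      (by fun_prop) (Filter.Eventually.of_forall fun v =>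
        (measurePreserving_add_right volume (C v)).map_eq)
  have h2 := (Measure.measurePreserving_swap (μ := (volume : Measure (V d₂)))
    (ν := (volume : Measure (V d₁)))).comp (h1.comp (Measure.measurePreserving_swap))
  have e : (twist C : V d₁ × V d₂ → V d₁ × V d₂) =
      Prod.swap ∘ (fun p : V d₂ × V d₁ => (-p.1, p.2 + C p.1)) ∘ Prod.swap := by
    funext x; simp
  rw [e]
  exact h2

theorem integral_comp_twist_mul (C : V d₂ →L[ℝ] V d₁) (f g : V d₁ × V d₂ → ℂ) :
    ∫ x, f (twist C x) * g x = ∫ x, f x * g (twist C x) := by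
  have := (measurePreserving_twist C).integral_comp (twistEquiv C).measurableEmbedding
    (fun x => f x * g (twist C x))
  rw [← this]
  simp only [twist_twist]

end Inversion

section ShiftProperties

variable {d₁ d₂ : ℕ} {f g : V d₁ × V d₂ → ℂ}

theorem partialFourier_translate (f : V d₁ × V d₂ → ℂ) (y : V d₁ × V d₂) (p : V d₁ × V d₂) :
    partialFourier (fun x => f (x + y)) p =
      char (-y.2) p.2 * partialFourier f (p.1 + y.1, p.2) := by
  unfold partialFourier
  rw [← integral_const_mul]
  simp only [Prod.add_def]
  rw [← integral_add_right_eq_self (fun v => char (-y.2) p.2 * (f (p.1 + y.1, v) * char v p.2)) y.2]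
  congr 1
  funext v
  have : char v p.2 = char (-y.2) p.2 * char (v + y.2) p.2 := by
    unfold char
    rw [← Complex.exp_add, ← mul_add, ← Complex.ofReal_add, ← inner_add_left]
    congr 4; abel
  rw [this]; ring

theorem symbolShift_translate (C : V d₂ →L[ℝ] V d₁) (f : V d₁ × V d₂ → ℂ) (y : V d₁ × V d₂) :
    symbolShift C (fun x => f (x + y)) = fun x => symbolShift C f (x + y) := by
  unfold symbolShift
  funext p
  simp only [Pi.smul_apply]
  congr 1
  unfold partialFourier
  have h1 : ∀ v : V d₂, (∫ w : V d₂, f ((twist C (p.1, v)).1 + y.1, w + y.2) *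
      char w (twist C (p.1, v)).2) = char v y.2 *
        ∫ w : V d₂, f ((twist C (p.1 + y.1, v)).1, w) * char w (twist C (p.1 + y.1, v)).2 := by
    intro v
    have := partialFourier_translate f y (twist C (p.1, v))
    unfold partialFourier at this
    simp only [Prod.add_def] at this
    rw [this]
    congr 1
    · simp [char, real_inner_comm]
    · simp only [twist_apply, add_right_comm]
  simp only [Prod.add_def]
  congr 1
  funext v
  rw [h1, char, char, char]
  rw [inner_add_right, Complex.ofReal_add, mul_add, Complex.exp_add]
  ring

theorem symbolShift_dilate (C : V d₂ →L[ℝ] V d₁) (f : V d₁ × V d₂ → ℂ) {l : ℝ} (hl : 0 < l) :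
    symbolShift C (fun x => f (l • x)) = fun x => symbolShift ((l ^ 2) • C) f (l • x) := by
  have h1 : ∀ p : V d₁ × V d₂, partialFourier (fun x => f (l • x)) p =
      ((l ^ d₂)⁻¹ : ℝ) • partialFourier f (l • p.1, l⁻¹ • p.2) := by
    intro p
    unfold partialFourier
    have := Measure.integral_comp_smul (volume : Measure (V d₂))
      (fun v => f (l • p.1, v) * char v (l⁻¹ • p.2)) l
    rw [finrank_euclideanSpace_fin, abs_of_pos (by positivity)] at this
    rw [← this]
    congr 1
    funext v
    simp only [Prod.smul_mk, char, real_inner_smul_left, inner_smul_right]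
    congr 3
    rw [inv_mul_cancel_left₀ hl.ne']
  unfold symbolShift
  funext p
  simp only [Pi.smul_apply]
  congr 1
  have h2 := Measure.integral_comp_smul (volume : Measure (V d₂))
    (fun v => ((l ^ d₂)⁻¹ : ℝ) • partialFourier f (l • (p.1 + C v), -(l⁻¹ • v)) * char v p.2) l
  rw [finrank_euclideanSpace_fin, abs_of_pos (by positivity)] at h2
  have h3 : (∫ v : V d₂, ((l ^ d₂)⁻¹ : ℝ) • partialFourier f (l • (p.1 + C v), -(l⁻¹ • v)) *
      char v p.2) = (l ^ d₂) • ∫ v : V d₂, ((l ^ d₂)⁻¹ : ℝ) •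
        partialFourier f (l • (p.1 + C (l • v)), -(l⁻¹ • l • v)) * char (l • v) p.2 := by
    rw [h2, smul_smul, mul_inv_cancel₀ (by positivity), one_smul]
  have h4 : partialFourier (fun x => partialFourier (fun x => f (l • x)) (twist C x)) p =
      ∫ v : V d₂, ((l ^ d₂)⁻¹ : ℝ) • partialFourier f (l • (p.1 + C v), -(l⁻¹ • v)) *
        char v p.2 := by
    rw [partialFourier]
    congr 1
    funext v
    rw [h1]; simp
  rw [h4, h3, ← integral_smul, partialFourier]
  congr 1
  funext v
  rw [smul_mul_assoc, smul_smul, mul_inv_cancel₀ (by positivity), one_smul, smul_smul,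
    inv_mul_cancel₀ hl.ne', one_smul]
  simp only [twist_apply, Prod.smul_fst, Prod.smul_snd, char, real_inner_smul_left,
    inner_smul_right, smul_apply, map_smul, smul_add, smul_smul, pow_two]

theorem symbolShift_zero (hf : Rapid f) (hf' : Rapid (partialFourier f)) :
    symbolShift 0 f = f := by
  have h := hf.partialFourier_inversion hf'
  have e : ∀ x : V d₁ × V d₂, twist (0 : V d₂ →L[ℝ] V d₁) x = dilation 1 (-1) x := fun x => by
    simp
  unfold symbolShift
  simp only [e]
  rw [h, smul_smul, ← mul_pow, inv_mul_cancel₀ (by simp [Real.pi_ne_zero]), one_pow, one_smul]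

theorem integral_symbolShift_mul (C : V d₂ →L[ℝ] V d₁) (hf : Rapid f) (hg : Rapid g)
    (hf' : Rapid (fun x => partialFourier f (twist C x)))
    (hg' : Rapid (fun x => partialFourier g (twist C x))) :
    ∫ x, symbolShift C f x * g x = ∫ x, f x * symbolShift C g x := by
  unfold symbolShift
  simp only [Pi.smul_apply, smul_eq_mul, mul_left_comm (f _), mul_assoc]
  rw [integral_const_mul, integral_const_mul, hf'.integral_partialFourier_mul hg,
    integral_comp_twist_mul, hf.integral_partialFourier_mul hg']

/-- The conditions on the indices of a symbol space under which it is invariant under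
`symbolShift`. -/
structure Admissible (s₁ σ₂ σ₁ s₂ : ℝ) : Prop where
  pos_s : 0 < s₂
  le_s : s₂ ≤ s₁
  pos_σ : 0 < σ₁
  le_σ : σ₁ ≤ σ₂
  sum : 1 ≤ s₂ + σ₂

namespace Admissible

variable {s₁ σ₂ σ₁ s₂ : ℝ} (H : Admissible s₁ σ₂ σ₁ s₂)
include H

theorem pos_s₁ : 0 < s₁ := H.pos_s.trans_le H.le_s
theorem pos_σ₂ : 0 < σ₂ := H.pos_σ.trans_le H.le_σ

theorem rapid_partialFourier {h R M : ℝ} (hh : 0 < h) (hR : 0 < R)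
    (hf : GSBound s₁ σ₂ σ₁ s₂ h R M f) : Rapid (partialFourier f) := by
  obtain ⟨h', R', -, hR', K, -, hK⟩ := mapsGS_partialFourier (ι := Unit) (d₁ := d₁) (d₂ := d₂)
    (σ₁ := σ₁) .roumieu H.pos_s₁ H.pos_σ₂ H.pos_s (by linarith [H.sum]) h R hh hR
  exact GevreyBound.rapid H.pos_s₁ H.pos_s hR' (hK () M f hf)

theorem rapid_twist {h R M : ℝ} (hh : 0 < h) (hR : 0 < R)
    (hf : GSBound s₁ σ₂ σ₁ s₂ h R M f) (C : V d₂ →L[ℝ] V d₁) :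
    Rapid (fun x => partialFourier f (twist C x)) := by
  have h1 := mapsGS_partialFourier (ι := Unit) (d₁ := d₁) (d₂ := d₂)
    (σ₁ := σ₁) .roumieu H.pos_s₁ H.pos_σ₂ H.pos_s (by linarith [H.sum])
  have h2 := mapsGS_twist (ι := Unit) .roumieu H.pos_s H.le_s H.pos_σ.le H.le_σ (norm_nonneg C)
    (fun _ => C) (fun _ => le_rfl)
  obtain ⟨h', R', -, hR', K, -, hK⟩ := (h2.comp h1) h R hh hR
  exact GevreyBound.rapid H.pos_s₁ H.pos_s hR' (hK () M f hf)

theorem mapsGS {ι : Type*} (κ : Kind) {c : ℝ} (hc : 0 ≤ c) (C : ι → V d₂ →L[ℝ] V d₁)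
    (hC : ∀ i, ‖C i‖ ≤ c) : MapsGS κ s₁ σ₂ σ₁ s₂ s₁ σ₂ σ₁ s₂ (fun i => symbolShift (C i)) :=
  mapsGS_symbolShift κ H.pos_s H.le_s H.pos_σ H.le_σ H.sum hc C hC

theorem symbolShift_mem {κ : Kind} (C : V d₂ →L[ℝ] V d₁) (hf : f ∈ GS₂ κ s₁ σ₂ σ₁ s₂ d₁ d₂) :
    symbolShift C f ∈ GS₂ κ s₁ σ₂ σ₁ s₂ d₁ d₂ :=
  (H.mapsGS (ι := Unit) κ (norm_nonneg C) (fun _ => C) (fun _ => le_rfl)).mem H.pos_s₁ H.pos_σ₂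
    H.pos_σ.le H.pos_s.le H.pos_s₁ H.pos_σ₂ H.pos_σ.le H.pos_s.le () hf

theorem integral_symbolShift {s₁' σ₂' σ₁' s₂' : ℝ} (H' : Admissible s₁' σ₂' σ₁' s₂')
    {h R M h' R' M' : ℝ} (hh : 0 < h) (hR : 0 < R) (hh' : 0 < h') (hR' : 0 < R')
    (hf : GSBound s₁ σ₂ σ₁ s₂ h R M f) (hg : GSBound s₁' σ₂' σ₁' s₂' h' R' M' g)
    (C : V d₂ →L[ℝ] V d₁) : ∫ x, symbolShift C f x * g x = ∫ x, f x * symbolShift C g x :=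
  integral_symbolShift_mul C (GevreyBound.rapid H.pos_s₁ H.pos_σ₂ hR hf)
    (GevreyBound.rapid H'.pos_s₁ H'.pos_σ₂ hR' hg) (H.rapid_twist hh hR hf C)
    (H'.rapid_twist hh' hR' hg C)

end Admissible

end ShiftProperties

section WeightTriangle

variable {d₁ d₂ : ℕ} {s₁ s₂ : ℝ}

/-- A constant in the quasi-triangle inequality for the exponents of the weights. -/
def quasiConst (s₁ s₂ : ℝ) : ℝ := 2 ^ (1 / s₁) + 2 ^ (1 / s₂)

theorem one_le_quasiConst (hs₁ : 0 < s₁) (hs₂ : 0 < s₂) : 1 ≤ quasiConst s₁ s₂ := by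
  have h1 : (1 : ℝ) ≤ 2 ^ (1 / s₁) := Real.one_le_rpow (by norm_num) (by positivity)
  have h2 : (0 : ℝ) ≤ 2 ^ (1 / s₂) := by positivity
  unfold quasiConst; linarith

theorem norm_add_rpow_le {E : Type*} [NormedAddCommGroup E] {p : ℝ} (hp : 0 ≤ p) (x y : E) :
    ‖x + y‖ ^ p ≤ 2 ^ p * (‖x‖ ^ p + ‖y‖ ^ p) := by
  have h1 : ‖x + y‖ ≤ 2 * max ‖x‖ ‖y‖ := by
    refine (norm_add_le _ _).trans ?_
    have e3 := le_max_left ‖x‖ ‖y‖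
    have e4 := le_max_right ‖x‖ ‖y‖
    linarith
  refine (Real.rpow_le_rpow (norm_nonneg _) h1 hp).trans ?_
  rw [Real.mul_rpow (by norm_num) (le_max_of_le_left (norm_nonneg _))]
  refine mul_le_mul_of_nonneg_left ?_ (by positivity)
  have e1 : 0 ≤ ‖x‖ ^ p := by positivity
  have e2 : 0 ≤ ‖y‖ ^ p := by positivity
  rcases le_total ‖x‖ ‖y‖ with h | h
  · rw [max_eq_right h]; linarith
  · rw [max_eq_left h]; linarith

theorem expWeight_add_le (hs₁ : 0 < s₁) (hs₂ : 0 < s₂) {r : ℝ} (hr : 0 ≤ r)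
    (x y : V d₁ × V d₂) :
    expWeight s₁ s₂ r (x + y) ≤
      expWeight s₁ s₂ (quasiConst s₁ s₂ * r) x * expWeight s₁ s₂ (quasiConst s₁ s₂ * r) y := by
  simp only [expWeight, ← Real.exp_add, Prod.fst_add, Prod.snd_add]
  refine Real.exp_le_exp.2 ?_
  have h1 := norm_add_rpow_le (one_div_pos.2 hs₁).le x.1 y.1
  have h2 := norm_add_rpow_le (one_div_pos.2 hs₂).le x.2 y.2
  have a1 : 0 ≤ ‖x.1‖ ^ (1 / s₁) + ‖y.1‖ ^ (1 / s₁) := by positivity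
  have a2 : 0 ≤ ‖x.2‖ ^ (1 / s₂) + ‖y.2‖ ^ (1 / s₂) := by positivity
  have c1 : (2 : ℝ) ^ (1 / s₁) ≤ quasiConst s₁ s₂ := by
    have : (0 : ℝ) ≤ 2 ^ (1 / s₂) := by positivity
    unfold quasiConst; linarith
  have c2 : (2 : ℝ) ^ (1 / s₂) ≤ quasiConst s₁ s₂ := by
    have : (0 : ℝ) ≤ 2 ^ (1 / s₁) := by positivity
    unfold quasiConst; linarith
  have h3 := h1.trans (mul_le_mul_of_nonneg_right c1 a1)
  have h4 := h2.trans (mul_le_mul_of_nonneg_right c2 a2)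
  have := mul_le_mul_of_nonneg_left (add_le_add h3 h4) hr
  linarith

theorem expWeight_neg (r : ℝ) (x : V d₁ × V d₂) :
    expWeight s₁ s₂ r (-x) = expWeight s₁ s₂ r x := by simp [expWeight]

theorem expWeight_mul_neg (r : ℝ) (x : V d₁ × V d₂) :
    expWeight s₁ s₂ (-r) x * expWeight s₁ s₂ r x = 1 := by
  rw [← expWeight_add]; simp [expWeight]

theorem expWeight_neg_add_le (hs₁ : 0 < s₁) (hs₂ : 0 < s₂) {r : ℝ} (hr : 0 ≤ r)
    (x y : V d₁ × V d₂) :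
    expWeight s₁ s₂ (-(quasiConst s₁ s₂ * r)) (x + y) ≤
      expWeight s₁ s₂ (-r) x * expWeight s₁ s₂ (quasiConst s₁ s₂ * r) y := by
  have h1 := expWeight_add_le hs₁ hs₂ hr (x + y) (-y)
  rw [add_neg_cancel_right, expWeight_neg] at h1
  have e1 := expWeight_mul_neg (s₁ := s₁) (s₂ := s₂) r x
  have e2 := expWeight_mul_neg (s₁ := s₁) (s₂ := s₂) (quasiConst s₁ s₂ * r) (x + y)
  have p1 := expWeight_pos s₁ s₂ (-r) x
  have p2 := expWeight_pos s₁ s₂ (-(quasiConst s₁ s₂ * r)) (x + y)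
  calc expWeight s₁ s₂ (-(quasiConst s₁ s₂ * r)) (x + y)
      = expWeight s₁ s₂ (-(quasiConst s₁ s₂ * r)) (x + y) *
        (expWeight s₁ s₂ (-r) x * expWeight s₁ s₂ r x) := by rw [e1, mul_one]
    _ ≤ expWeight s₁ s₂ (-(quasiConst s₁ s₂ * r)) (x + y) * (expWeight s₁ s₂ (-r) x *
        (expWeight s₁ s₂ (quasiConst s₁ s₂ * r) (x + y) *
          expWeight s₁ s₂ (quasiConst s₁ s₂ * r) y)) := by gcongr
    _ = (expWeight s₁ s₂ (-(quasiConst s₁ s₂ * r)) (x + y) *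
        expWeight s₁ s₂ (quasiConst s₁ s₂ * r) (x + y)) * (expWeight s₁ s₂ (-r) x *
          expWeight s₁ s₂ (quasiConst s₁ s₂ * r) y) := by ring
    _ = _ := by rw [e2, one_mul]

theorem expWeight_neg_le_one {r : ℝ} (hr : 0 ≤ r) (x : V d₁ × V d₂) :
    expWeight s₁ s₂ (-r) x ≤ 1 := by
  refine Real.exp_le_one_iff.2 ?_
  rw [neg_mul, neg_nonpos]; positivity

end WeightTriangle

section IntegralFamilies

variable {d₁ d₂ : ℕ} {Z : Type*} [MeasurableSpace Z] {μ : Measure Z} {σ₁ σ₂ h : ℝ}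
  {G : Z → V d₁ × V d₂ → ℂ} {W : Z → V d₁ × V d₂ → ℝ}

theorem GevreyBound.dominatedFamily (hG : ∀ z, GevreyBound σ₁ σ₂ h (W z) (G z))
    (hm : ∀ x, AEStronglyMeasurable (fun z => G z x) μ)
    (hW : ∀ x₀, ∃ b : Z → ℝ, Integrable b μ ∧ ∀ z, ∀ x ∈ Metric.ball x₀ 1, W z x ≤ b z) :
    DominatedFamily μ G := by
  refine ⟨fun z => (hG z).smooth, hm, fun l x₀ => ?_⟩
  obtain ⟨c, hc⟩ := DerivBound.exists_listDeriv_le l (gevrey σ₁ σ₂ h)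
  obtain ⟨b, hb, hb'⟩ := hW x₀
  refine ⟨fun z => |c| * b z, hb.const_mul _, fun z x hx => (hc _ _ (hG z) x).trans ?_⟩
  refine (mul_le_mul_of_nonneg_right (le_abs_self c) ((hG z).weight_nonneg x)).trans ?_
  exact mul_le_mul_of_nonneg_left (hb' z x hx) (abs_nonneg c)

theorem GevreyBound.integral {W' : V d₁ × V d₂ → ℝ} (hh : 0 < h) (hD : DominatedFamily μ G)
    (hG : ∀ z, GevreyBound σ₁ σ₂ h (W z) (G z)) (hi : ∀ x, Integrable (fun z => W z x) μ)
    (hW' : ∀ x, ∫ z, W z x ∂μ ≤ W' x) :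
    GevreyBound σ₁ σ₂ h W' (fun x => ∫ z, G z x ∂μ) := by
  refine ⟨hD.contDiff, fun l₁ l₂ u₁ u₂ x => ?_⟩
  rw [hD.listDeriv_integral]
  refine (norm_integral_le_integral_norm _).trans ?_
  calc _ ≤ ∫ z, gevrey σ₁ σ₂ h l₁.length l₂.length * W z x ∂μ :=
        integral_mono ((hD.list _).integrable x).norm ((hi x).const_mul _)
          fun z => (hG z).bound l₁ l₂ u₁ u₂ x
    _ = gevrey σ₁ σ₂ h l₁.length l₂.length * ∫ z, W z x ∂μ := integral_const_mul _ _
    _ ≤ _ := mul_le_mul_of_nonneg_left (hW' x) (gevrey_pos hh _ _).le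

end IntegralFamilies

section Difference

variable {d₁ d₂ : ℕ} {s₁ s₂ σ₁ σ₂ h R M : ℝ} {F : V d₁ × V d₂ → ℂ}

theorem factorial_succ_rpow_le {σ : ℝ} (hσ : 0 ≤ σ) (m : ℕ) :
    ((m + 1).factorial : ℝ) ^ σ ≤ (2 ^ σ) ^ m * (m.factorial : ℝ) ^ σ := by
  rw [Nat.factorial_succ, Nat.cast_mul, Real.mul_rpow (by positivity) (by positivity)]
  refine mul_le_mul_of_nonneg_right ?_ (by positivity)
  rw [← Real.rpow_natCast, ← Real.rpow_mul (by norm_num), mul_comm σ, Real.rpow_mul (by norm_num),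
    Real.rpow_natCast]
  refine Real.rpow_le_rpow (by positivity) ?_ hσ
  exact_mod_cast Nat.succ_le_of_lt Nat.lt_two_pow_self

theorem gevrey_succ_left_le (hσ₁ : 0 ≤ σ₁) (hσ₂ : 0 ≤ σ₂) (hh : 0 < h) (m n : ℕ) :
    gevrey σ₁ σ₂ h (m + 1) n ≤ h * gevrey σ₁ σ₂ (2 ^ (σ₁ + σ₂) * h) m n := by
  have h1 := factorial_succ_rpow_le hσ₁ m
  have h2 : (2 : ℝ) ^ σ₁ ≤ 2 ^ (σ₁ + σ₂) :=
    Real.rpow_le_rpow_of_exponent_le (by norm_num) (by linarith)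
  have h3 : (1 : ℝ) ≤ 2 ^ (σ₁ + σ₂) := Real.one_le_rpow (by norm_num) (by linarith)
  unfold gevrey
  calc h ^ (m + 1 + n) * ((m + 1).factorial : ℝ) ^ σ₁ * (n.factorial : ℝ) ^ σ₂
      ≤ h ^ (m + 1 + n) * ((2 ^ (σ₁ + σ₂)) ^ m * (m.factorial : ℝ) ^ σ₁) *
          (n.factorial : ℝ) ^ σ₂ := by
        gcongr; exact h1.trans (by gcongr)
    _ ≤ h ^ (m + 1 + n) * ((2 ^ (σ₁ + σ₂)) ^ (m + n) * (m.factorial : ℝ) ^ σ₁) *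
          (n.factorial : ℝ) ^ σ₂ := by
        gcongr; omega
    _ = _ := by rw [mul_pow]; ring

theorem gevrey_succ_right_le (hσ₁ : 0 ≤ σ₁) (hσ₂ : 0 ≤ σ₂) (hh : 0 < h) (m n : ℕ) :
    gevrey σ₁ σ₂ h m (n + 1) ≤ h * gevrey σ₁ σ₂ (2 ^ (σ₁ + σ₂) * h) m n := by
  have := gevrey_succ_left_le hσ₂ hσ₁ hh n m
  rw [add_comm σ₂ σ₁] at this
  unfold gevrey at this ⊢
  calc _ = h ^ (n + 1 + m) * ((n + 1).factorial : ℝ) ^ σ₂ * (m.factorial : ℝ) ^ σ₁ := by ring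
    _ ≤ _ := this
    _ = _ := by ring

theorem GSBound.translate_sub (hs₁ : 0 < s₁) (hs₂ : 0 < s₂) (hσ₁ : 0 ≤ σ₁) (hσ₂ : 0 ≤ σ₂)
    (hh : 0 < h) (hR : 0 < R) (hF : GSBound s₁ s₂ σ₁ σ₂ h (quasiConst s₁ s₂ * R) M F)
    (z : V d₁ × V d₂) :
    GSBound s₁ s₂ σ₁ σ₂ (2 ^ (σ₁ + σ₂) * h) R
      (M * (2 * h * ‖z‖ * expWeight s₁ s₂ (quasiConst s₁ s₂ * R) z)) (fun x => F (x + z) - F x) := by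
  have hM := hF.nonneg
  have hq := one_le_quasiConst hs₁ hs₂
  have hz := contDiff_comp_affine (.id ℝ _) z hF.smooth
  have hz' : ContDiff ℝ ∞ (fun x => F (x + z)) := hz
  refine ⟨hz'.sub hF.smooth, fun l₁ l₂ u₁ u₂ x => ?_⟩
  set G := listDeriv (dirList l₁ l₂) F with hG
  have hGs : ContDiff ℝ ∞ G := listDeriv_smooth _ hF.smooth
  have e1 : listDeriv (dirList l₁ l₂) (fun x => F (x + z) - F x) x = G (x + z) - G x := by
    have h1 := listDeriv_comp_affine (.id ℝ _) z (dirList l₁ l₂) hF.smooth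
    simp only [ContinuousLinearMap.coe_id', id_eq, List.map_id_fun] at h1
    have h2 : (fun x => F (x + z) - F x) = (fun x => F (x + z)) + (-1 : ℂ) • F := by
      funext x; simp [sub_eq_add_neg]
    have hs : ContDiff ℝ ∞ ((-1 : ℂ) • F) := contDiff_const.smul hF.smooth
    rw [h2, listDeriv_add _ hz' hs, h1, listDeriv_smul _ _ hF.smooth]
    simp [sub_eq_add_neg, hG]
  rw [e1]
  set m := l₁.length
  set n := l₂.length
  have hd : ∀ t : ℝ, HasDerivAt (fun t : ℝ => G (x + t • z)) (dirDeriv z G (x + t • z)) t := by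
    intro t
    have h1 : HasDerivAt (fun t : ℝ => x + t • z) z t := by
      simpa using ((hasDerivAt_id t).smul_const z).const_add x
    exact ((hGs.differentiable (by simp) (x + t • z)).hasFDerivAt).comp_hasDerivAt t h1
  have hb : ∀ t ∈ Set.Ico (0 : ℝ) 1, ‖dirDeriv z G (x + t • z)‖ ≤
      gevrey σ₁ σ₂ (2 ^ (σ₁ + σ₂) * h) m n * (M * (2 * h * ‖z‖ *
        expWeight s₁ s₂ (quasiConst s₁ s₂ * R) z) * expWeight s₁ s₂ (-R) x) := by
    intro t ht
    set y := x + t • z with hy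
    have hW : expWeight s₁ s₂ (-(quasiConst s₁ s₂ * R)) y ≤
        expWeight s₁ s₂ (-R) x * expWeight s₁ s₂ (quasiConst s₁ s₂ * R) z := by
      refine (expWeight_neg_add_le hs₁ hs₂ hR.le x (t • z)).trans ?_
      refine mul_le_mul_of_nonneg_left ?_ (expWeight_pos _ _ _ _).le
      refine Real.exp_le_exp.2 ?_
      have a : ∀ {E : Type} [NormedAddCommGroup E] [NormedSpace ℝ E] (v : E),
          ‖t • v‖ ≤ ‖v‖ := fun v => by
        rw [norm_smul, Real.norm_of_nonneg ht.1]
        exact mul_le_of_le_one_left (norm_nonneg _) ht.2.le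
      have b1 := Real.rpow_le_rpow (norm_nonneg _) (a z.1) (one_div_pos.2 hs₁).le
      have b2 := Real.rpow_le_rpow (norm_nonneg _) (a z.2) (one_div_pos.2 hs₂).le
      exact mul_le_mul_of_nonneg_left (add_le_add b1 b2) (by positivity)
    have d1 : dirDeriv z G y = dirDeriv (z.1, 0) G y + dirDeriv (0, z.2) G y := by
      have : z = (z.1, 0) + (0, z.2) := by simp
      conv_lhs => rw [this, dirDeriv_add_vec]
      rfl
    have d2 : ‖dirDeriv (z.1, 0) G y‖ ≤ ‖z‖ * (gevrey σ₁ σ₂ h (m + 1) n *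
        (M * expWeight s₁ s₂ (-(quasiConst s₁ s₂ * R)) y)) := by
      obtain ⟨u, hu, hzu⟩ := exists_unit_smul z.1
      have e : ((z.1, 0) : V d₁ × V d₂) = ‖z.1‖ • (u, 0) := by
        rw [Prod.smul_mk, smul_zero, ← hzu]
      rw [e, dirDeriv_smul_vec, Pi.smul_apply, norm_smul, Complex.norm_real, norm_norm]
      refine mul_le_mul (norm_fst_le z) ?_ (norm_nonneg _) (norm_nonneg _)
      exact hF.bound (u :: l₁) l₂ (u₁.cons hu) u₂ y
    have d3 : ‖dirDeriv (0, z.2) G y‖ ≤ ‖z‖ * (gevrey σ₁ σ₂ h m (n + 1) *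
        (M * expWeight s₁ s₂ (-(quasiConst s₁ s₂ * R)) y)) := by
      obtain ⟨u, hu, hzu⟩ := exists_unit_smul z.2
      have e : ((0, z.2) : V d₁ × V d₂) = ‖z.2‖ • (0, u) := by
        rw [Prod.smul_mk, smul_zero, ← hzu]
      rw [e, dirDeriv_smul_vec, Pi.smul_apply, norm_smul, Complex.norm_real, norm_norm]
      refine mul_le_mul (norm_snd_le z) ?_ (norm_nonneg _) (norm_nonneg _)
      have := hF.bound l₁ (u :: l₂) u₁ (u₂.cons hu) y
      rwa [listDeriv_perm (dirList_cons_right u l₁ l₂) hF.smooth] at this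
    have g1 := gevrey_succ_left_le hσ₁ hσ₂ hh m n
    have g2 := gevrey_succ_right_le hσ₁ hσ₂ hh m n
    have g0 := gevrey_pos (σ₁ := σ₁) (σ₂ := σ₂) (h := 2 ^ (σ₁ + σ₂) * h) (by positivity) m n
    have w0 := expWeight_pos s₁ s₂ (-(quasiConst s₁ s₂ * R)) y
    rw [d1]
    calc _ ≤ ‖z‖ * (h * gevrey σ₁ σ₂ (2 ^ (σ₁ + σ₂) * h) m n * (M * (expWeight s₁ s₂ (-R) x *
            expWeight s₁ s₂ (quasiConst s₁ s₂ * R) z))) +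
          ‖z‖ * (h * gevrey σ₁ σ₂ (2 ^ (σ₁ + σ₂) * h) m n * (M * (expWeight s₁ s₂ (-R) x *
            expWeight s₁ s₂ (quasiConst s₁ s₂ * R) z))) := by
          refine (norm_add_le _ _).trans (add_le_add (d2.trans ?_) (d3.trans ?_)) <;> gcongr
      _ = _ := by ring
  have := norm_image_sub_le_of_norm_deriv_le_segment' (f := fun t : ℝ => G (x + t • z)) (a := 0)
    (b := 1) (fun t _ => (hd t).hasDerivWithinAt) hb 1 (Set.right_mem_Icc.2 zero_le_one)
  simpa using this

end Difference

section FormIntegral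

variable {d₁ d₂ : ℕ} {s₁ s₂ σ₁ σ₂ h R M N : ℝ} {F G : V d₁ × V d₂ → ℂ}

/-- The index set of the family of estimates which constitute a `GSBound`. -/
structure BoundIndex (d₁ d₂ : ℕ) where
  left : List (V d₁)
  right : List (V d₂)
  unit_left : UnitList left
  unit_right : UnitList right
  point : V d₁ × V d₂

instance : TopologicalSpace (BoundIndex d₁ d₂) := ⊥
instance : DiscreteTopology (BoundIndex d₁ d₂) := ⟨rfl⟩

/-- A derivative, normalized by the bound required of it. -/
def normalizedDeriv (s₁ s₂ σ₁ σ₂ h R : ℝ) (F : V d₁ × V d₂ → ℂ) (i : BoundIndex d₁ d₂) : ℂ :=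
  ((gevrey σ₁ σ₂ h i.left.length i.right.length * expWeight s₁ s₂ (-R) i.point : ℝ) : ℂ)⁻¹ *
    listDeriv (dirList i.left i.right) F i.point

theorem gsBound_iff (hh : 0 < h) (hF : ContDiff ℝ ∞ F) :
    GSBound s₁ s₂ σ₁ σ₂ h R M F ↔ ∀ i, ‖normalizedDeriv s₁ s₂ σ₁ σ₂ h R F i‖ ≤ M := by
  have key : ∀ i : BoundIndex d₁ d₂, ‖normalizedDeriv s₁ s₂ σ₁ σ₂ h R F i‖ ≤ M ↔
      ‖listDeriv (dirList i.left i.right) F i.point‖ ≤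
        gevrey σ₁ σ₂ h i.left.length i.right.length * (M * expWeight s₁ s₂ (-R) i.point) := by
    intro i
    have h1 := gevrey_pos (σ₁ := σ₁) (σ₂ := σ₂) hh i.left.length i.right.length
    have h2 := expWeight_pos s₁ s₂ (-R) i.point
    rw [normalizedDeriv, norm_mul, norm_inv, Complex.norm_real, Real.norm_of_nonneg (by positivity),
      inv_mul_le_iff₀ (by positivity)]
    constructor <;> intro h3 <;> linarith
  constructor
  · intro H i
    exact (key i).2 (H.bound _ _ i.unit_left i.unit_right _)
  · intro H
    exact ⟨hF, fun l₁ l₂ u₁ u₂ x => (key ⟨l₁, l₂, u₁, u₂, x⟩).1 (H _)⟩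

theorem normalizedDeriv_add (hF : ContDiff ℝ ∞ F) (hG : ContDiff ℝ ∞ G) (i : BoundIndex d₁ d₂) :
    normalizedDeriv s₁ s₂ σ₁ σ₂ h R (F + G) i =
      normalizedDeriv s₁ s₂ σ₁ σ₂ h R F i + normalizedDeriv s₁ s₂ σ₁ σ₂ h R G i := by
  rw [normalizedDeriv, listDeriv_add _ hF hG, Pi.add_apply, mul_add]; rfl

theorem normalizedDeriv_smul (c : ℂ) (hF : ContDiff ℝ ∞ F) (i : BoundIndex d₁ d₂) :
    normalizedDeriv s₁ s₂ σ₁ σ₂ h R (c • F) i =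
      c * normalizedDeriv s₁ s₂ σ₁ σ₂ h R F i := by
  rw [normalizedDeriv, listDeriv_smul _ _ hF, Pi.smul_apply, smul_eq_mul, normalizedDeriv]; ring

/-- The elements of `S` which satisfy a `GSBound` with fixed parameters. -/
def boundedPart (s₁ s₂ σ₁ σ₂ h R : ℝ) (S : Submodule ℂ (V d₁ × V d₂ → ℂ)) : Submodule ℂ S where
  carrier := {F | ∃ M, 0 ≤ M ∧ GSBound s₁ s₂ σ₁ σ₂ h R M F.1}
  zero_mem' := ⟨0, le_rfl, DerivBound.mono (a := fun _ _ => 0) (W := fun _ => 0)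
    (DerivBound.zero (by simp)) (by simp)⟩
  add_mem' := by
    rintro F G ⟨M, hM, hF⟩ ⟨N, hN, hG⟩
    exact ⟨M + N, by positivity, hF.add hG⟩
  smul_mem' := by
    rintro c F ⟨M, hM, hF⟩
    exact ⟨‖c‖ * M, by positivity, hF.smul c⟩

open BoundedContinuousFunction in
/-- The embedding of a space of functions with a `GSBound` into a space of bounded functions. -/
def boundEmbedding (s₁ s₂ σ₁ σ₂ R : ℝ) (hh : 0 < h) (S : Submodule ℂ (V d₁ × V d₂ → ℂ)) :
    boundedPart s₁ s₂ σ₁ σ₂ h R S →ₗ[ℂ] BoundIndex d₁ d₂ →ᵇ ℂ where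
  toFun F := ofNormedAddCommGroupDiscrete (normalizedDeriv s₁ s₂ σ₁ σ₂ h R F.1.1) F.2.choose
    ((gsBound_iff hh F.2.choose_spec.2.smooth).1 F.2.choose_spec.2)
  map_add' F G := by
    ext i
    exact normalizedDeriv_add F.2.choose_spec.2.smooth G.2.choose_spec.2.smooth i
  map_smul' c F := by
    ext i
    exact normalizedDeriv_smul c F.2.choose_spec.2.smooth i

theorem boundEmbedding_apply (hh : 0 < h) {S : Submodule ℂ (V d₁ × V d₂ → ℂ)}
    (F : boundedPart s₁ s₂ σ₁ σ₂ h R S) (i : BoundIndex d₁ d₂) :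
    boundEmbedding s₁ s₂ σ₁ σ₂ R hh S F i = normalizedDeriv s₁ s₂ σ₁ σ₂ h R F.1.1 i := rfl

theorem norm_boundEmbedding_le (hh : 0 < h) {S : Submodule ℂ (V d₁ × V d₂ → ℂ)}
    (F : boundedPart s₁ s₂ σ₁ σ₂ h R S) (hM : 0 ≤ M) :
    ‖boundEmbedding s₁ s₂ σ₁ σ₂ R hh S F‖ ≤ M ↔ GSBound s₁ s₂ σ₁ σ₂ h R M F.1.1 := by
  rw [BoundedContinuousFunction.norm_le hM, gsBound_iff hh F.2.choose_spec.2.smooth]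
  rfl

theorem boundEmbedding_injective (hh : 0 < h) (S : Submodule ℂ (V d₁ × V d₂ → ℂ)) :
    Function.Injective (boundEmbedding s₁ s₂ σ₁ σ₂ R hh S) := by
  refine (injective_iff_map_eq_zero _).2 fun F hF => ?_
  have h1 := (norm_boundEmbedding_le hh F le_rfl).1 (by rw [hF, norm_zero])
  ext x
  have := GevreyBound.norm_le h1 x
  rw [zero_mul] at this
  simpa using this

/-- A bounded linear form which vanishes on a continuous integrable family vanishes on its
integral. -/
theorem form_integral_eq_zero {S : Submodule ℂ (V d₁ × V d₂ → ℂ)} (hh : 0 < h) (u : S →ₗ[ℂ] ℂ)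
    {K : ℝ} (hu : ∀ (M : ℝ) (F : S), GSBound s₁ s₂ σ₁ σ₂ h R M F.1 → ‖u F‖ ≤ K * M)
    {Z : Type*} [TopologicalSpace Z] [SecondCountableTopology Z] [MeasurableSpace Z]
    [OpensMeasurableSpace Z] {μ : Measure Z} {G : Z → S} {b : Z → ℝ}
    (hG : ∀ z, GSBound s₁ s₂ σ₁ σ₂ h R (b z) (G z).1) (hb : Integrable b μ)
    (hc : ∀ z₀, ∀ ε > 0, ∀ᶠ z in nhds z₀, GSBound s₁ s₂ σ₁ σ₂ h R ε ((G z).1 - (G z₀).1))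
    {F : S} {M : ℝ} (hF : GSBound s₁ s₂ σ₁ σ₂ h R M F.1)
    (hint : ∀ l x, listDeriv l F.1 x = ∫ z, listDeriv l (G z).1 x ∂μ)
    (h0 : ∀ z, u (G z) = 0) : u F = 0 := by
  set J := boundEmbedding s₁ s₂ σ₁ σ₂ R hh S
  set e := LinearEquiv.ofInjective J (boundEmbedding_injective hh S)
  set f₀ : LinearMap.range J →ₗ[ℂ] ℂ :=
    (u ∘ₗ (boundedPart s₁ s₂ σ₁ σ₂ h R S).subtype) ∘ₗ e.symm.toLinearMap with hf₀
  have hf₀e : ∀ H, f₀ (e H) = u H.1 := fun H => by simp [hf₀]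
  have hfb : ∀ y, ‖f₀ y‖ ≤ K * ‖y‖ := by
    intro y
    obtain ⟨H, rfl⟩ := e.surjective y
    rw [hf₀e]
    exact hu _ _ ((norm_boundEmbedding_le hh H (norm_nonneg _)).1 le_rfl)
  obtain ⟨g, hg, -⟩ := exists_extension_norm_eq (LinearMap.range J) (f₀.mkContinuous K hfb)
  have hgJ : ∀ H, g (J H) = u H.1 := fun H => by
    have := hg (e H)
    rw [LinearMap.mkContinuous_apply, hf₀e] at this
    exact this
  set G' : Z → boundedPart s₁ s₂ σ₁ σ₂ h R S := fun z => ⟨G z, b z, (hG z).nonneg, hG z⟩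
  have hcont : Continuous fun z => J (G' z) := by
    refine continuous_iff_continuousAt.2 fun z₀ => Metric.tendsto_nhds.2 fun ε hε => ?_
    refine (hc z₀ (ε / 2) (half_pos hε)).mono fun z hz => ?_
    rw [dist_eq_norm, ← map_sub]
    exact ((norm_boundEmbedding_le hh (G' z - G' z₀) (half_pos hε).le).2 hz).trans_lt
      (half_lt_self hε)
  have hi : Integrable (fun z => J (G' z)) μ :=
    hb.mono' hcont.aestronglyMeasurable (Filter.Eventually.of_forall fun z =>
      (norm_boundEmbedding_le hh (G' z) (hG z).nonneg).2 (hG z))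
  set F' : boundedPart s₁ s₂ σ₁ σ₂ h R S := ⟨F, M, hF.nonneg, hF⟩
  have hJF : ∫ z, J (G' z) ∂μ = J F' := by
    ext i
    have h1 := (BoundedContinuousFunction.evalCLM ℂ i).integral_comp_comm hi
    have h2 : (∫ z, J (G' z) ∂μ) i = ∫ z, (J (G' z)) i ∂μ := h1.symm
    rw [h2, boundEmbedding_apply]
    simp only [J, boundEmbedding_apply, normalizedDeriv]
    rw [integral_const_mul, hint]
  have h3 : u F = g (J F') := (hgJ F').symm
  rw [h3, ← hJF, ← g.integral_comp_comm hi]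
  simp only [hgJ]
  simp [G', h0]

end FormIntegral

section Closure

variable {d₁ d₂ : ℕ} {κ : Kind} {s₁ s₂ σ₁ σ₂ h R M N : ℝ} {F G : V d₁ × V d₂ → ℂ}

theorem GSBound.translate (hs₁ : 0 < s₁) (hs₂ : 0 < s₂) (hh : 0 < h) (hR : 0 ≤ R)
    (hF : GSBound s₁ s₂ σ₁ σ₂ h (quasiConst s₁ s₂ * R) M F) (z : V d₁ × V d₂) :
    GSBound s₁ s₂ σ₁ σ₂ h R (M * expWeight s₁ s₂ (quasiConst s₁ s₂ * R) z)
      (fun x => F (x + z)) := by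
  refine GevreyBound.mono_weight hh (DerivBound.translate hF z) fun x => ?_
  calc _ ≤ M * (expWeight s₁ s₂ (-R) x * expWeight s₁ s₂ (quasiConst s₁ s₂ * R) z) :=
        mul_le_mul_of_nonneg_left (expWeight_neg_add_le hs₁ hs₂ hR x z) hF.nonneg
    _ = _ := by ring

theorem GSBound.dilate (hs₁ : 0 < s₁) (hs₂ : 0 < s₂) (hh : 0 < h) (hR : 0 ≤ R) {l : ℝ}
    (hl : 1 ≤ l) (hF : GSBound s₁ s₂ σ₁ σ₂ h R M F) :
    GSBound s₁ s₂ σ₁ σ₂ (l * h) R M (fun x => F (l • x)) := by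
  have h1 := DerivBound.dilate hF l l
  have e : ∀ x : V d₁ × V d₂, dilation l l x = l • x := fun x => rfl
  simp only [e] at h1
  refine h1.mono fun m n x => ?_
  have hl0 : 0 ≤ l := zero_le_one.trans hl
  have e1 : |l| ^ m * |l| ^ n * gevrey σ₁ σ₂ h m n = gevrey σ₁ σ₂ (l * h) m n := by
    rw [abs_of_nonneg hl0, gevrey, gevrey, mul_pow, pow_add]; ring
  rw [e1]
  refine mul_le_mul_of_nonneg_left (mul_le_mul_of_nonneg_left ?_ hF.nonneg)
    (gevrey_pos (by positivity) _ _).le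
  refine Real.exp_le_exp.2 ?_
  have a : ∀ {E : Type} [NormedAddCommGroup E] [NormedSpace ℝ E] (v : E),
      ‖v‖ ≤ ‖l • v‖ := fun v => by
    rw [norm_smul, Real.norm_of_nonneg hl0]
    exact le_mul_of_one_le_left (norm_nonneg _) hl
  have b1 := Real.rpow_le_rpow (norm_nonneg _) (a x.1) (one_div_pos.2 hs₁).le
  have b2 := Real.rpow_le_rpow (norm_nonneg _) (a x.2) (one_div_pos.2 hs₂).le
  have := mul_le_mul_of_nonneg_left (add_le_add b1 b2) hR
  simp only [Prod.smul_fst, Prod.smul_snd]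
  linarith

theorem GSBound.mul (hσ₁ : 0 ≤ σ₁) (hσ₂ : 0 ≤ σ₂) (hh : 0 < h) (hR : 0 ≤ R)
    (hF : GSBound s₁ s₂ σ₁ σ₂ h R M F) (hG : GSBound s₁ s₂ σ₁ σ₂ h R N G) :
    GSBound s₁ s₂ σ₁ σ₂ (2 * h) R (M * N) (F * G) := by
  have h1 := GevreyBound.mul hσ₁ hσ₂ hh.le hh.le hF hG
  rw [← two_mul] at h1
  refine GevreyBound.mono_weight (by positivity) h1 fun x => ?_
  have h2 := expWeight_neg_le_one (s₁ := s₁) (s₂ := s₂) hR x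
  have h3 := expWeight_pos s₁ s₂ (-R) x
  have h4 : 0 ≤ M * N := mul_nonneg hF.nonneg hG.nonneg
  calc _ = M * N * (expWeight s₁ s₂ (-R) x * expWeight s₁ s₂ (-R) x) := by ring
    _ ≤ M * N * (expWeight s₁ s₂ (-R) x * 1) := by gcongr
    _ = _ := by ring

/-- A criterion for the invariance of the Gelfand-Shilov spaces under an operation. -/
theorem GS₂_mem_of_bound (hs₁ : 0 < s₁) (hs₂ : 0 < s₂) (hσ₁ : 0 ≤ σ₁) (hσ₂ : 0 ≤ σ₂) {a b : ℝ}
    (ha : 0 < a) (hb : 0 < b) (hF : F ∈ GS₂ κ s₁ s₂ σ₁ σ₂ d₁ d₂)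
    (H : ∀ h R M, 0 < h → 0 < R → GSBound s₁ s₂ σ₁ σ₂ h (b * R) M F →
      ∃ N, GSBound s₁ s₂ σ₁ σ₂ (a * h) R N G) : G ∈ GS₂ κ s₁ s₂ σ₁ σ₂ d₁ d₂ := by
  cases κ
  · rw [mem_GS₂_roumieu hs₁ hs₂ hσ₁ hσ₂] at hF ⊢
    obtain ⟨h, R, M, hh, hR, hF⟩ := hF
    obtain ⟨N, hN⟩ := H h (R / b) M hh (by positivity) (by rwa [mul_div_cancel₀ _ hb.ne'])
    exact ⟨a * h, R / b, N, by positivity, by positivity, hN⟩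
  · rw [mem_GS₂_beurling hs₁ hs₂ hσ₁ hσ₂] at hF ⊢
    intro h R hh hR
    obtain ⟨M, hM⟩ := hF (h / a) (b * R) (by positivity) (by positivity)
    obtain ⟨N, hN⟩ := H (h / a) R M (by positivity) hR hM
    rw [mul_div_cancel₀ _ ha.ne'] at hN
    exact ⟨N, hN⟩

theorem GS₂_translate (hs₁ : 0 < s₁) (hs₂ : 0 < s₂) (hσ₁ : 0 ≤ σ₁) (hσ₂ : 0 ≤ σ₂)
    (hF : F ∈ GS₂ κ s₁ s₂ σ₁ σ₂ d₁ d₂) (z : V d₁ × V d₂) :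
    (fun x => F (x + z)) ∈ GS₂ κ s₁ s₂ σ₁ σ₂ d₁ d₂ :=
  GS₂_mem_of_bound hs₁ hs₂ hσ₁ hσ₂ one_pos
    (zero_lt_one.trans_le (one_le_quasiConst hs₁ hs₂)) hF fun h R M hh hR H =>
      ⟨_, by rw [one_mul]; exact H.translate hs₁ hs₂ hh hR.le z⟩

theorem GS₂_dilate (hs₁ : 0 < s₁) (hs₂ : 0 < s₂) (hσ₁ : 0 ≤ σ₁) (hσ₂ : 0 ≤ σ₂)
    (hF : F ∈ GS₂ κ s₁ s₂ σ₁ σ₂ d₁ d₂) {l : ℝ} (hl : 1 ≤ l) :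
    (fun x => F (l • x)) ∈ GS₂ κ s₁ s₂ σ₁ σ₂ d₁ d₂ :=
  GS₂_mem_of_bound hs₁ hs₂ hσ₁ hσ₂ (zero_lt_one.trans_le hl) one_pos hF fun h R M hh hR H =>
      ⟨_, GSBound.dilate hs₁ hs₂ hh hR.le hl (by rwa [one_mul] at H)⟩

/-- The function `|F|²`. -/
def sqNorm (F : V d₁ × V d₂ → ℂ) : V d₁ × V d₂ → ℂ := F * fun x => (starRingEnd ℂ) (F x)

theorem sqNorm_apply (F : V d₁ × V d₂ → ℂ) (x : V d₁ × V d₂) :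
    sqNorm F x = ((‖F x‖ ^ 2 : ℝ) : ℂ) := by
  simp [sqNorm, Complex.mul_conj, Complex.normSq_eq_norm_sq]

theorem GS₂_sqNorm (hs₁ : 0 < s₁) (hs₂ : 0 < s₂) (hσ₁ : 0 ≤ σ₁) (hσ₂ : 0 ≤ σ₂)
    (hF : F ∈ GS₂ κ s₁ s₂ σ₁ σ₂ d₁ d₂) : sqNorm F ∈ GS₂ κ s₁ s₂ σ₁ σ₂ d₁ d₂ :=
  GS₂_mem_of_bound hs₁ hs₂ hσ₁ hσ₂ two_pos one_pos hF fun h R M hh hR H => by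
    rw [one_mul] at H
    exact ⟨_, GSBound.mul hσ₁ hσ₂ hh hR.le H (DerivBound.conj H)⟩

/-- A form and two functions can be estimated with the same parameters. -/
theorem exists_common_bound (hs₁ : 0 < s₁) (hs₂ : 0 < s₂) (hσ₁ : 0 ≤ σ₁) (hσ₂ : 0 ≤ σ₂)
    {u : GS₂ κ s₁ s₂ σ₁ σ₂ d₁ d₂ →ₗ[ℂ] ℂ} (hu : IsContinuousForm κ u)
    (hF : F ∈ GS₂ κ s₁ s₂ σ₁ σ₂ d₁ d₂) (hG : G ∈ GS₂ κ s₁ s₂ σ₁ σ₂ d₁ d₂) {a b : ℝ} (ha : 0 < a)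
    (hb : 0 < b) : ∃ h R K M N : ℝ, 0 < h ∧ 0 < R ∧ 0 ≤ K ∧
      (∀ (M : ℝ) (F : GS₂ κ s₁ s₂ σ₁ σ₂ d₁ d₂), GSBound s₁ s₂ σ₁ σ₂ (a * h) R M F.1 →
        ‖u F‖ ≤ K * M) ∧ GSBound s₁ s₂ σ₁ σ₂ h (b * R) M F ∧
      GSBound s₁ s₂ σ₁ σ₂ h (b * R) N G := by
  cases κ
  · rw [mem_GS₂_roumieu hs₁ hs₂ hσ₁ hσ₂] at hF hG
    rw [isContinuousForm_roumieu hs₁ hs₂ hσ₁ hσ₂] at hu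
    obtain ⟨h₁, R₁, M, hh₁, hR₁, hF⟩ := hF
    obtain ⟨h₂, R₂, N, hh₂, hR₂, hG⟩ := hG
    have hh : 0 < max h₁ h₂ := lt_max_of_lt_left hh₁
    have hR : 0 < min R₁ R₂ / b := div_pos (lt_min hR₁ hR₂) hb
    obtain ⟨K, hK, H⟩ := hu (a * max h₁ h₂) (min R₁ R₂ / b) (by positivity) hR
    refine ⟨max h₁ h₂, min R₁ R₂ / b, K, M, N, hh, hR, hK, H, ?_, ?_⟩
    · rw [mul_div_cancel₀ _ hb.ne']
      exact hF.mono hh₁ (le_max_left _ _) (min_le_left _ _) le_rfl hF.nonneg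
    · rw [mul_div_cancel₀ _ hb.ne']
      exact hG.mono hh₂ (le_max_right _ _) (min_le_right _ _) le_rfl hG.nonneg
  · rw [mem_GS₂_beurling hs₁ hs₂ hσ₁ hσ₂] at hF hG
    rw [isContinuousForm_beurling hs₁ hs₂ hσ₁ hσ₂] at hu
    obtain ⟨h, R, hh, hR, K, hK, H⟩ := hu
    obtain ⟨M, hM⟩ := hF (h / a) (b * R) (by positivity) (by positivity)
    obtain ⟨N, hN⟩ := hG (h / a) (b * R) (by positivity) (by positivity)
    exact ⟨h / a, R, K, M, N, by positivity, hR, hK, by rwa [mul_div_cancel₀ _ ha.ne'], hM, hN⟩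

end Closure

section Convolution

variable {d₁ d₂ : ℕ} {κ : Kind} {s₁ s₂ σ₁ σ₂ h R M N : ℝ} {F ρ : V d₁ × V d₂ → ℂ}

/-- Convolution. -/
def convolve (F ρ : V d₁ × V d₂ → ℂ) : V d₁ × V d₂ → ℂ := fun x => ∫ y, F y * ρ (x - y)

theorem GSBound.convolve_family (hs₁ : 0 < s₁) (hs₂ : 0 < s₂) (hh : 0 < h) (hR : 0 < R)
    (hF : GSBound s₁ s₂ σ₁ σ₂ h (quasiConst s₁ s₂ * R + R) M F)
    (hρ : GSBound s₁ s₂ σ₁ σ₂ h (quasiConst s₁ s₂ * R) N ρ) (y : V d₁ × V d₂) :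
    GSBound s₁ s₂ σ₁ σ₂ h R (M * N * expWeight s₁ s₂ (-R) y) (F y • fun x => ρ (x - y)) := by
  have h1 := (hρ.translate hs₁ hs₂ hh hR.le (-y)).smul (F y)
  simp only [← sub_eq_add_neg] at h1
  refine GSBound.mono h1 hh le_rfl le_rfl ?_ h1.nonneg
  have h2 := GevreyBound.norm_le hF y
  have h3 := expWeight_mul_neg (s₁ := s₁) (s₂ := s₂) (quasiConst s₁ s₂ * R) y
  have h4 := expWeight_pos s₁ s₂ (quasiConst s₁ s₂ * R) y
  have hN := hρ.nonneg
  rw [expWeight_neg]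
  calc ‖F y‖ * (N * expWeight s₁ s₂ (quasiConst s₁ s₂ * R) y)
      ≤ M * expWeight s₁ s₂ (-(quasiConst s₁ s₂ * R + R)) y *
          (N * expWeight s₁ s₂ (quasiConst s₁ s₂ * R) y) := by gcongr
    _ = M * N * expWeight s₁ s₂ (-R) y * (expWeight s₁ s₂ (-(quasiConst s₁ s₂ * R)) y *
          expWeight s₁ s₂ (quasiConst s₁ s₂ * R) y) := by
        rw [neg_add, expWeight_add]; ring
    _ = _ := by rw [h3, mul_one]

theorem GSBound.convolve_dominated (hs₁ : 0 < s₁) (hs₂ : 0 < s₂) (hh : 0 < h) (hR : 0 < R)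
    (hF : GSBound s₁ s₂ σ₁ σ₂ h (quasiConst s₁ s₂ * R + R) M F)
    (hρ : GSBound s₁ s₂ σ₁ σ₂ h (quasiConst s₁ s₂ * R) N ρ) :
    DominatedFamily volume (fun y => F y • fun x => ρ (x - y)) := by
  refine GevreyBound.dominatedFamily (fun y => hF.convolve_family hs₁ hs₂ hh hR hρ y)
    (fun x => ?_) (fun x₀ => ⟨fun y => M * N * expWeight s₁ s₂ (-R) y,
      (integrable_expWeight hs₁ hs₂ hR).const_mul _, fun y x _ => ?_⟩)
  · exact (hF.smooth.continuous.mul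
      (hρ.smooth.continuous.comp (continuous_const.sub continuous_id))).aestronglyMeasurable
  · have := (hF.convolve_family hs₁ hs₂ hh hR hρ y).nonneg
    exact mul_le_of_le_one_right this (expWeight_neg_le_one hR.le x)

theorem GSBound.convolve (hs₁ : 0 < s₁) (hs₂ : 0 < s₂) (hh : 0 < h) (hR : 0 < R)
    (hF : GSBound s₁ s₂ σ₁ σ₂ h (quasiConst s₁ s₂ * R + R) M F)
    (hρ : GSBound s₁ s₂ σ₁ σ₂ h (quasiConst s₁ s₂ * R) N ρ) :
    GSBound s₁ s₂ σ₁ σ₂ h R (M * N * ∫ y : V d₁ × V d₂, expWeight s₁ s₂ (-R) y) (convolve F ρ) := by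
  have hi := integrable_expWeight (d₁ := d₁) (d₂ := d₂) hs₁ hs₂ hR
  exact GevreyBound.integral hh (hF.convolve_dominated hs₁ hs₂ hh hR hρ)
    (fun y => hF.convolve_family hs₁ hs₂ hh hR hρ y)
    (fun x => ((hi.const_mul _).mul_const _)) (fun x => by
      rw [integral_mul_const, integral_const_mul])

end Convolution

section Density

variable {d₁ d₂ : ℕ} {κ : Kind} {s₁ s₂ σ₁ σ₂ h R M N : ℝ} {F ρ : V d₁ × V d₂ → ℂ}

theorem GS₂_convolve (hs₁ : 0 < s₁) (hs₂ : 0 < s₂) (hσ₁ : 0 ≤ σ₁) (hσ₂ : 0 ≤ σ₂)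
    (hF : F ∈ GS₂ κ s₁ s₂ σ₁ σ₂ d₁ d₂) (hρ : ρ ∈ GS₂ κ s₁ s₂ σ₁ σ₂ d₁ d₂) :
    convolve F ρ ∈ GS₂ κ s₁ s₂ σ₁ σ₂ d₁ d₂ := by
  have hq := one_le_quasiConst hs₁ hs₂
  have e : ∀ R, quasiConst s₁ s₂ * R + R = (quasiConst s₁ s₂ + 1) * R := fun R => by ring
  cases κ
  · obtain ⟨h, R, K, M, N, hh, hR, -, -, h1, h2⟩ := exists_common_bound (u := 0) hs₁ hs₂ hσ₁ hσ₂
      ((isContinuousForm_roumieu hs₁ hs₂ hσ₁ hσ₂ _).2 fun h R _ _ => ⟨0, le_rfl, by simp⟩) hF hρ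
      one_pos (show 0 < quasiConst s₁ s₂ + 1 by positivity)
    exact (mem_GS₂_roumieu hs₁ hs₂ hσ₁ hσ₂).2 ⟨h, R, _, hh, hR, GSBound.convolve hs₁ hs₂ hh hR
      (by rwa [e]) (h2.mono hh le_rfl (by nlinarith) le_rfl h2.nonneg)⟩
  · rw [mem_GS₂_beurling hs₁ hs₂ hσ₁ hσ₂] at hF hρ ⊢
    intro h R hh hR
    obtain ⟨M, hM⟩ := hF h (quasiConst s₁ s₂ * R + R) hh (by positivity)
    obtain ⟨N, hN⟩ := hρ h (quasiConst s₁ s₂ * R) hh (by positivity)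
    exact ⟨_, GSBound.convolve hs₁ hs₂ hh hR hM hN⟩

theorem form_convolve_eq_zero (hs₁ : 0 < s₁) (hs₂ : 0 < s₂) (hσ₁ : 0 ≤ σ₁) (hσ₂ : 0 ≤ σ₂)
    {u : GS₂ κ s₁ s₂ σ₁ σ₂ d₁ d₂ →ₗ[ℂ] ℂ} (hu : IsContinuousForm κ u)
    (hF : F ∈ GS₂ κ s₁ s₂ σ₁ σ₂ d₁ d₂) (hρ : ρ ∈ GS₂ κ s₁ s₂ σ₁ σ₂ d₁ d₂)
    (h0 : ∀ (y : V d₁ × V d₂) (H : GS₂ κ s₁ s₂ σ₁ σ₂ d₁ d₂), H.1 = (fun x => ρ (x - y)) → u H = 0) :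
    u ⟨convolve F ρ, GS₂_convolve hs₁ hs₂ hσ₁ hσ₂ hF hρ⟩ = 0 := by
  have hq := one_le_quasiConst hs₁ hs₂
  set q := quasiConst s₁ s₂ with hqdef
  set A := (2 : ℝ) ^ (σ₁ + σ₂)
  have hA : 1 ≤ A := Real.one_le_rpow (by norm_num) (by linarith)
  obtain ⟨h, R, K, M, N, hh, hR, hK, hu', hFb, hρb⟩ := exists_common_bound hs₁ hs₂ hσ₁ hσ₂ hu hF hρ
    (show 0 < A by positivity) (show 0 < q * q + 1 by positivity)
  have hAh : h ≤ A * h := le_mul_of_one_le_left hh.le hA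
  have hAh0 : 0 < A * h := by positivity
  have hF1 : GSBound s₁ s₂ σ₁ σ₂ (A * h) (q * R + R) M F :=
    hFb.mono hh hAh (by nlinarith [mul_nonneg (sub_nonneg.2 hq) hR.le, mul_nonneg (sub_nonneg.2 hq) (mul_nonneg (sub_nonneg.2 hq) hR.le)]) le_rfl hFb.nonneg
  have hρ1 : GSBound s₁ s₂ σ₁ σ₂ (A * h) (q * R) N ρ :=
    hρb.mono hh hAh (by nlinarith [mul_nonneg (sub_nonneg.2 hq) hR.le]) le_rfl hρb.nonneg
  have hρ2 : GSBound s₁ s₂ σ₁ σ₂ h (q * (q * R)) N ρ :=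
    hρb.mono hh le_rfl (by nlinarith) le_rfl hρb.nonneg
  have hmem : ∀ y, (fun x => ρ (x - y)) ∈ GS₂ κ s₁ s₂ σ₁ σ₂ d₁ d₂ := fun y => by
    simpa only [← sub_eq_add_neg] using GS₂_translate hs₁ hs₂ hσ₁ hσ₂ hρ (-y)
  refine form_integral_eq_zero (G := fun y => F y • ⟨fun x => ρ (x - y), hmem y⟩)
    (b := fun y => M * N * expWeight s₁ s₂ (-R) y) hAh0 u hu'
    (fun y => hF1.convolve_family hs₁ hs₂ hAh0 hR hρ1 y)
    ((integrable_expWeight hs₁ hs₂ hR).const_mul _) (fun y₀ ε hε => ?_)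
    (hF1.convolve hs₁ hs₂ hAh0 hR hρ1) (fun l x => ?_) (fun y => ?_)
  · have hρ3 : ∀ y₀ : V d₁ × V d₂, GSBound s₁ s₂ σ₁ σ₂ h (q * R)
        (N * expWeight s₁ s₂ (q * (q * R)) (-y₀)) (fun x => ρ (x - y₀)) := fun y₀ => by
      simpa only [← sub_eq_add_neg] using hρ2.translate hs₁ hs₂ hh (by positivity) (-y₀)
    set N₀ := N * expWeight s₁ s₂ (q * (q * R)) (-y₀)
    have hρ4 := hρ3 y₀
    have key : ∀ y, GSBound s₁ s₂ σ₁ σ₂ (A * h) R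
        (‖F y‖ * (N₀ * (2 * h * ‖y₀ - y‖ * expWeight s₁ s₂ (q * R) (y₀ - y))) + ‖F y - F y₀‖ * N₀)
        ((F y • fun x => ρ (x - y)) - (F y₀ • fun x => ρ (x - y₀))) := by
      intro y
      have h1 := (GSBound.translate_sub hs₁ hs₂ hσ₁ hσ₂ hh hR hρ4 (y₀ - y)).smul (F y)
      have h2 := (hρ4.mono hh hAh (by nlinarith : R ≤ q * R) le_rfl hρ4.nonneg).smul (F y - F y₀)
      have h3 := h1.add h2
      have e : ((F y • fun x => ρ (x - y)) - (F y₀ • fun x => ρ (x - y₀))) =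
        (F y • fun x => ρ (x + (y₀ - y) - y₀) - ρ (x - y₀)) +
          (F y - F y₀) • fun x => ρ (x - y₀) := by
        funext x
        simp only [Pi.sub_apply, Pi.smul_apply, Pi.add_apply, smul_eq_mul]
        rw [show x + (y₀ - y) - y₀ = x - y by abel]
        ring
      rw [e]
      exact h3
    have hcont : Continuous fun y =>
        ‖F y‖ * (N₀ * (2 * h * ‖y₀ - y‖ * expWeight s₁ s₂ (q * R) (y₀ - y))) +
          ‖F y - F y₀‖ * N₀ := by
      have c1 := hFb.smooth.continuous
      have c2 : Continuous fun y => expWeight s₁ s₂ (q * R) (y₀ - y) :=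
        (continuous_expWeight hs₁ hs₂ _).comp (continuous_const.sub continuous_id)
      fun_prop
    have hlt := hcont.continuousAt (x := y₀)
    have := hlt.eventually_lt_const (u := ε) (by simpa using hε)
    exact this.mono fun y hy => (key y).mono hAh0 le_rfl le_rfl hy.le (key y).nonneg
  · have := (hF1.convolve_dominated hs₁ hs₂ hAh0 hR hρ1).listDeriv_integral l
    exact congrFun this x
  · rw [map_smul, h0 y _ rfl, smul_zero]

theorem exists_norm_mul_expWeight_le (hs₁ : 0 < s₁) (hs₂ : 0 < s₂) (hR : 0 < R) : ∃ C : ℝ, 0 ≤ C ∧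
    ∀ y : V d₁ × V d₂, ‖y‖ * expWeight s₁ s₂ (-R) y ≤ C * expWeight s₁ s₂ (-(R / 2)) y := by
  obtain ⟨C₁, hC₁, h₁⟩ := exists_pow_mul_exp_le hs₁ (half_pos hR) 1
  obtain ⟨C₂, hC₂, h₂⟩ := exists_pow_mul_exp_le hs₂ (half_pos hR) 1
  refine ⟨C₁ * C₂, by positivity, fun y => ?_⟩
  have e : expWeight s₁ s₂ (-R) y = expWeight s₁ s₂ (-(R / 2)) y * expWeight s₁ s₂ (-(R / 2)) y := by
    rw [← expWeight_add]; congr 1; ring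
  rw [e, ← mul_assoc]
  refine mul_le_mul_of_nonneg_right ?_ (expWeight_pos _ _ _ _).le
  have h3 : ‖y‖ ≤ (1 + ‖y.1‖) ^ 1 * (1 + ‖y.2‖) ^ 1 := by
    rw [Prod.norm_def]
    have e1 := norm_nonneg y.1
    have e2 := norm_nonneg y.2
    have : max ‖y.1‖ ‖y.2‖ ≤ ‖y.1‖ + ‖y.2‖ := max_le (by linarith) (by linarith)
    nlinarith
  calc ‖y‖ * expWeight s₁ s₂ (-(R / 2)) y ≤ ((1 + ‖y.1‖) ^ 1 * (1 + ‖y.2‖) ^ 1) *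
        expWeight s₁ s₂ (-(R / 2)) y := mul_le_mul_of_nonneg_right h3 (expWeight_pos _ _ _ _).le
    _ = ((1 + ‖y.1‖) ^ 1 * Real.exp (-(R / 2 * ‖y.1‖ ^ (1 / s₁)))) *
          ((1 + ‖y.2‖) ^ 1 * Real.exp (-(R / 2 * ‖y.2‖ ^ (1 / s₂)))) := by
        rw [expWeight_neg_eq]; ring
    _ ≤ _ := mul_le_mul (h₁ _ (norm_nonneg _)) (h₂ _ (norm_nonneg _)) (by positivity) hC₁

instance : (volume : Measure (V d₁ × V d₂)).IsNegInvariant :=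
  ⟨((Measure.measurePreserving_neg (volume : Measure (V d₁))).prod
    (Measure.measurePreserving_neg (volume : Measure (V d₂)))).map_eq⟩

theorem finrank_prod_eq : Module.finrank ℝ (V d₁ × V d₂) = d₁ + d₂ := by simp

theorem convolve_dilate (F ρ : V d₁ × V d₂ → ℂ) {l : ℝ} (hl : 0 < l) (x : V d₁ × V d₂) :
    ((l ^ (d₁ + d₂) : ℝ) : ℂ) * convolve F (fun x => ρ (l • x)) x =
      ∫ y, ρ y * F (x - l⁻¹ • y) := by
  have h1 := Measure.integral_comp_smul (volume : Measure (V d₁ × V d₂))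
    (fun y => ρ y * F (x - l⁻¹ • y)) l
  rw [finrank_prod_eq, abs_of_pos (by positivity)] at h1
  have h2 : convolve F (fun x => ρ (l • x)) x = ∫ y, ρ (l • y) * F (x - l⁻¹ • l • y) := by
    unfold convolve
    rw [← integral_sub_left_eq_self _ _ x]
    congr 1
    funext y
    rw [sub_sub_cancel, smul_smul, inv_mul_cancel₀ hl.ne', one_smul, mul_comm]
  rw [h2, h1, Complex.real_smul, ← mul_assoc]
  push_cast
  rw [mul_inv_cancel₀ (by exact_mod_cast (pow_pos hl _).ne'), one_mul]

theorem exists_mollify_bound (hs₁ : 0 < s₁) (hs₂ : 0 < s₂) (hσ₁ : 0 ≤ σ₁) (hσ₂ : 0 ≤ σ₂)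
    (hh : 0 < h) (hR : 0 < R) (hF : GSBound s₁ s₂ σ₁ σ₂ h (quasiConst s₁ s₂ * R) M F)
    (hρ : GSBound s₁ s₂ σ₁ σ₂ h (quasiConst s₁ s₂ * R + R) N ρ) : ∃ C : ℝ, ∀ l : ℝ, 1 ≤ l →
    GSBound s₁ s₂ σ₁ σ₂ (2 ^ (σ₁ + σ₂) * h) R (l⁻¹ * C)
      (((l ^ (d₁ + d₂) : ℝ) : ℂ) • convolve F (fun x => ρ (l • x)) - (∫ y, ρ y) • F) := by
  have hq := one_le_quasiConst hs₁ hs₂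
  set q := quasiConst s₁ s₂ with hqdef
  obtain ⟨C₀, hC₀, hC⟩ := exists_norm_mul_expWeight_le (d₁ := d₁) (d₂ := d₂) hs₁ hs₂ hR
  have hM := hF.nonneg
  have hN := hρ.nonneg
  set J := ∫ y : V d₁ × V d₂, expWeight s₁ s₂ (-(R / 2)) y
  have hJi := integrable_expWeight (d₁ := d₁) (d₂ := d₂) hs₁ hs₂ (half_pos hR)
  refine ⟨2 * h * M * N * C₀ * J, fun l hl => ?_⟩
  have hl0 : 0 < l := zero_lt_one.trans_le hl
  have hrho : Rapid ρ := GevreyBound.rapid hs₁ hs₂ (by positivity) hρ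
  have hFr : Rapid F := GevreyBound.rapid hs₁ hs₂ (by positivity) hF
  have hA : 0 < (2 : ℝ) ^ (σ₁ + σ₂) * h := by positivity
  set G : V d₁ × V d₂ → V d₁ × V d₂ → ℂ := fun y =>
    ρ y • fun x => F (x + -(l⁻¹ • y)) - F x
  have hG : ∀ y, GSBound s₁ s₂ σ₁ σ₂ (2 ^ (σ₁ + σ₂) * h) R
      (l⁻¹ * (2 * h * M * N * C₀) * expWeight s₁ s₂ (-(R / 2)) y) (G y) := by
    intro y
    have h1 := (GSBound.translate_sub hs₁ hs₂ hσ₁ hσ₂ hh hR hF (-(l⁻¹ • y))).smul (ρ y)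
    refine GSBound.mono h1 hA le_rfl le_rfl ?_ h1.nonneg
    have h2 := GevreyBound.norm_le hρ y
    have h3 : expWeight s₁ s₂ (q * R) (-(l⁻¹ • y)) ≤ expWeight s₁ s₂ (q * R) y := by
      rw [expWeight_neg]
      refine Real.exp_le_exp.2 ?_
      have a : ∀ {E : Type} [NormedAddCommGroup E] [NormedSpace ℝ E] (v : E),
          ‖l⁻¹ • v‖ ≤ ‖v‖ := fun v => by
        rw [norm_smul, Real.norm_of_nonneg (by positivity)]
        exact mul_le_of_le_one_left (norm_nonneg _) (inv_le_one_of_one_le₀ hl)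
      have b1 := Real.rpow_le_rpow (norm_nonneg _) (a y.1) (one_div_pos.2 hs₁).le
      have b2 := Real.rpow_le_rpow (norm_nonneg _) (a y.2) (one_div_pos.2 hs₂).le
      exact mul_le_mul_of_nonneg_left (add_le_add b1 b2) (by positivity)
    have h4 : ‖-(l⁻¹ • y)‖ = l⁻¹ * ‖y‖ := by
      rw [norm_neg, norm_smul, Real.norm_of_nonneg (by positivity)]
    have h5 := expWeight_mul_neg (s₁ := s₁) (s₂ := s₂) (q * R) y
    have h6 := expWeight_pos s₁ s₂ (-(q * R + R)) y
    rw [h4]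
    calc ‖ρ y‖ * (M * (2 * h * (l⁻¹ * ‖y‖) * expWeight s₁ s₂ (q * R) (-(l⁻¹ • y))))
        ≤ (N * expWeight s₁ s₂ (-(q * R + R)) y) *
            (M * (2 * h * (l⁻¹ * ‖y‖) * expWeight s₁ s₂ (q * R) y)) := by
          have h7 := expWeight_pos s₁ s₂ (q * R) (-(l⁻¹ • y))
          have h8 : 0 ≤ 2 * h * (l⁻¹ * ‖y‖) := by positivity
          exact mul_le_mul h2 (mul_le_mul_of_nonneg_left (mul_le_mul_of_nonneg_left h3 h8) hM)
            (mul_nonneg hM (mul_nonneg h8 h7.le)) (mul_nonneg hN h6.le)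
      _ = l⁻¹ * (2 * h * M * N) * (‖y‖ * expWeight s₁ s₂ (-R) y) *
            (expWeight s₁ s₂ (-(q * R)) y * expWeight s₁ s₂ (q * R) y) := by
          rw [neg_add, expWeight_add]; ring
      _ = l⁻¹ * (2 * h * M * N) * (‖y‖ * expWeight s₁ s₂ (-R) y) := by rw [h5, mul_one]
      _ ≤ l⁻¹ * (2 * h * M * N) * (C₀ * expWeight s₁ s₂ (-(R / 2)) y) := 
          mul_le_mul_of_nonneg_left (hC y) (by positivity)
      _ = _ := by ring
  have hdom : DominatedFamily volume G := by
    refine GevreyBound.dominatedFamily hG (fun x => ?_) (fun x₀ => ⟨fun y =>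
      l⁻¹ * (2 * h * M * N * C₀) * expWeight s₁ s₂ (-(R / 2)) y, hJi.const_mul _, fun y x _ => ?_⟩)
    · have c1 : Continuous fun y : V d₁ × V d₂ => F (x + -(l⁻¹ • y)) :=
        hFr.smooth.continuous.comp (by fun_prop)
      exact (hrho.smooth.continuous.mul (c1.sub continuous_const)).aestronglyMeasurable
    · exact mul_le_of_le_one_right (hG y).nonneg (expWeight_neg_le_one hR.le x)
  have main := GevreyBound.integral (W' := fun x => l⁻¹ * (2 * h * M * N * C₀ * J) *
    expWeight s₁ s₂ (-R) x) hA hdom hG (fun x => (hJi.const_mul _).mul_const _) (fun x => by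
      rw [integral_mul_const, integral_const_mul, mul_assoc l⁻¹])
  have e : (((l ^ (d₁ + d₂) : ℝ) : ℂ) • convolve F (fun x => ρ (l • x)) - (∫ y, ρ y) • F) =
      fun x => ∫ y, G y x := by
    funext x
    have c : Continuous fun y : V d₁ × V d₂ => F (x - l⁻¹ • y) :=
      hFr.smooth.continuous.comp (by fun_prop)
    have i1 : Integrable (fun y => ρ y * F (x - l⁻¹ • y)) :=
      hrho.integrable.mul_bdd (c := M) c.aestronglyMeasurable
        (Filter.Eventually.of_forall fun y => (GevreyBound.norm_le hF _).trans
          (mul_le_of_le_one_right hM (expWeight_neg_le_one (by positivity) _)))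
    have i2 : Integrable (fun y => ρ y * F x) := hrho.integrable.mul_const _
    have e1 : ∀ y, G y x = ρ y * F (x - l⁻¹ • y) - ρ y * F x := fun y => by
      simp only [G, Pi.smul_apply, smul_eq_mul]
      rw [← sub_eq_add_neg]; ring
    simp only [e1]
    rw [integral_sub i1 i2, integral_mul_const, ← convolve_dilate F ρ hl0 x]
    rfl
  rw [e]
  exact main

theorem form_eq_zero_of_window (hs₁ : 0 < s₁) (hs₂ : 0 < s₂) (hσ₁ : 0 ≤ σ₁) (hσ₂ : 0 ≤ σ₂)
    {u : GS₂ κ s₁ s₂ σ₁ σ₂ d₁ d₂ →ₗ[ℂ] ℂ} (hu : IsContinuousForm κ u)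
    (hρ : ρ ∈ GS₂ κ s₁ s₂ σ₁ σ₂ d₁ d₂) (hρ0 : ∫ y, ρ y ≠ 0)
    (h0 : ∀ (l : ℝ) (y : V d₁ × V d₂) (H : GS₂ κ s₁ s₂ σ₁ σ₂ d₁ d₂), 1 ≤ l →
      H.1 = (fun x => ρ (l • (x - y))) → u H = 0) (F : GS₂ κ s₁ s₂ σ₁ σ₂ d₁ d₂) : u F = 0 := by
  have hq := one_le_quasiConst hs₁ hs₂
  obtain ⟨h, R, K, M, N, hh, hR, hK, hu', hFb, hρb⟩ := exists_common_bound hs₁ hs₂ hσ₁ hσ₂ hu F.2 hρ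
    (show (0 : ℝ) < 2 ^ (σ₁ + σ₂) by positivity) (show 0 < quasiConst s₁ s₂ + 1 by positivity)
  obtain ⟨C, hC⟩ := exists_mollify_bound hs₁ hs₂ hσ₁ hσ₂ hh hR
    (hFb.mono hh le_rfl (by nlinarith) le_rfl hFb.nonneg)
    (hρb.mono hh le_rfl (by nlinarith) le_rfl hρb.nonneg)
  have key : ∀ l : ℝ, 1 ≤ l → ‖(∫ y, ρ y) * u F‖ ≤ K * (l⁻¹ * C) := by
    intro l hl
    have hρl := GS₂_dilate hs₁ hs₂ hσ₁ hσ₂ hρ hl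
    have h1 := form_convolve_eq_zero hs₁ hs₂ hσ₁ hσ₂ hu F.2 hρl (fun y H hH => h0 l y H hl hH)
    have h2 := hu' _ (((l ^ (d₁ + d₂) : ℝ) : ℂ) • ⟨convolve F.1 (fun x => ρ (l • x)),
      GS₂_convolve hs₁ hs₂ hσ₁ hσ₂ F.2 hρl⟩ - (∫ y, ρ y) • F) (hC l hl)
    rw [map_sub, map_smul, map_smul, h1, smul_zero, zero_sub, norm_neg, smul_eq_mul] at h2
    exact h2
  have hlim : Filter.Tendsto (fun l : ℝ => K * (l⁻¹ * C)) Filter.atTop (nhds (K * (0 * C))) :=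
    (tendsto_inv_atTop_zero.mul_const C).const_mul K
  rw [zero_mul, mul_zero] at hlim
  have h3 := ge_of_tendsto hlim ((Filter.eventually_ge_atTop 1).mono key)
  have h4 : (∫ y, ρ y) * u F = 0 := norm_le_zero_iff.1 h3
  exact (mul_eq_zero.1 h4).resolve_left hρ0

end Density

section Slices

variable {d₁ d₂ : ℕ} {κ : Kind} {s₁ s₂ σ₁ σ₂ : ℝ} {F : V d₁ × V d₂ → ℂ}

theorem deriv₁_slice_left (hF : ContDiff ℝ ∞ F) (β : Fin d₁ → ℕ) (x : V d₁) (y : V d₂) :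
    deriv₁ β (fun x => F (x, y)) x = deriv₂ β 0 F (x, y) := by
  have h := listDeriv_comp_affine (ContinuousLinearMap.inl ℝ (V d₁) (V d₂)) (0, y)
    (multiList stdVec β) hF
  have e : ∀ x : V d₁, ContinuousLinearMap.inl ℝ (V d₁) (V d₂) x + (0, y) = (x, y) := fun x => by
    simp
  simp only [e] at h
  rw [deriv₁, multiDeriv_eq_listDeriv, h, deriv₂_eq_listDeriv]
  have e0 : ∀ n, (List.finRange n).flatMap (fun _ => ([] : List (V n))) = [] := fun n => by
    simp [List.flatMap_eq_nil_iff]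
  simp only [dirList, multiList, Pi.zero_apply, List.replicate_zero, e0, List.map_nil,
    List.append_nil]
  rfl

theorem deriv₁_slice_right (hF : ContDiff ℝ ∞ F) (β : Fin d₂ → ℕ) (x : V d₁) (y : V d₂) :
    deriv₁ β (fun y => F (x, y)) y = deriv₂ 0 β F (x, y) := by
  have h := listDeriv_comp_affine (ContinuousLinearMap.inr ℝ (V d₁) (V d₂)) (x, 0)
    (multiList stdVec β) hF
  have e : ∀ y : V d₂, ContinuousLinearMap.inr ℝ (V d₁) (V d₂) y + (x, 0) = (x, y) := fun y => by
    simp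
  simp only [e] at h
  rw [deriv₁, multiDeriv_eq_listDeriv, h, deriv₂_eq_listDeriv]
  have e0 : ∀ n, (List.finRange n).flatMap (fun _ => ([] : List (V n))) = [] := fun n => by
    simp [List.flatMap_eq_nil_iff]
  simp only [dirList, multiList, Pi.zero_apply, List.replicate_zero, e0, List.map_nil,
    List.nil_append]
  rfl

theorem gsNorm₁_slice_left_le (hF : ContDiff ℝ ∞ F) (h : ℝ) (y : V d₂) :
    gsNorm₁ s₁ σ₁ h (fun x => F (x, y)) ≤ gsNorm₂ s₁ s₂ σ₁ σ₂ h F := by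
  refine iSup_le fun α => iSup_le fun β => iSup_le fun x => ?_
  refine le_iSup_of_le α (le_iSup_of_le 0 (le_iSup_of_le β (le_iSup_of_le 0
      (le_iSup_of_le (x, y) (le_of_eq ?_)))))
  rw [deriv₁_slice_left hF]
  simp [mpow, mlen, mfact]

theorem gsNorm₁_slice_right_le (hF : ContDiff ℝ ∞ F) (h : ℝ) (x : V d₁) :
    gsNorm₁ s₂ σ₂ h (fun y => F (x, y)) ≤ gsNorm₂ s₁ s₂ σ₁ σ₂ h F := by
  refine iSup_le fun α => iSup_le fun β => iSup_le fun y => ?_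
  refine le_iSup_of_le 0 (le_iSup_of_le α (le_iSup_of_le 0 (le_iSup_of_le β
      (le_iSup_of_le (x, y) (le_of_eq ?_)))))
  rw [deriv₁_slice_right hF]
  simp [mpow, mlen, mfact]

theorem GS₂_slice_left (hF : F ∈ GS₂ κ s₁ s₂ σ₁ σ₂ d₁ d₂) (y : V d₂) :
    (fun x => F (x, y)) ∈ GS₁ κ s₁ σ₁ d₁ := by
  have hs : ContDiff ℝ ∞ fun x => F (x, y) := hF.1.comp (contDiff_id.prodMk contDiff_const)
  cases κ
  · obtain ⟨h, hh, hn⟩ := hF.2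
    exact ⟨hs, h, hh, (gsNorm₁_slice_left_le hF.1 h y).trans_lt hn⟩
  · exact ⟨hs, fun h hh => (gsNorm₁_slice_left_le hF.1 h y).trans_lt (hF.2 h hh)⟩

theorem GS₂_slice_right (hF : F ∈ GS₂ κ s₁ s₂ σ₁ σ₂ d₁ d₂) (x : V d₁) :
    (fun y => F (x, y)) ∈ GS₁ κ s₂ σ₂ d₂ := by
  have hs : ContDiff ℝ ∞ fun y => F (x, y) := hF.1.comp (contDiff_const.prodMk contDiff_id)
  cases κ
  · obtain ⟨h, hh, hn⟩ := hF.2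
    exact ⟨hs, h, hh, (gsNorm₁_slice_right_le hF.1 h x).trans_lt hn⟩
  · exact ⟨hs, fun h hh => (gsNorm₁_slice_right_le hF.1 h x).trans_lt (hF.2 h hh)⟩

end Slices

section CoordinateChanges

variable {ι : Type*} {d₁ d₂ : ℕ} {κ : Kind} {s₁ s₂ σ₁ σ₂ s σ h R M : ℝ}

theorem MapsGS.of_isometric {d₁' d₂' : ℕ} {s₁' s₂' σ₁' σ₂' : ℝ}
    {T : ι → (V d₁ × V d₂ → ℂ) → (V d₁' × V d₂' → ℂ)}
    (hT : ∀ i h R M F, GSBound s₁ s₂ σ₁ σ₂ h R M F → GSBound s₁' s₂' σ₁' σ₂' h R M (T i F)) :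
    MapsGS κ s₁ s₂ σ₁ σ₂ s₁' s₂' σ₁' σ₂' T := by
  have H : ∀ h R, MapsBound s₁ s₂ σ₁ σ₂ h R s₁' s₂' σ₁' σ₂' h R T := fun h R =>
    ⟨1, one_pos, fun i M F hF => by rw [one_mul]; exact hT i h R M F hF⟩
  cases κ
  · exact fun h R hh hR => ⟨h, R, hh, hR, H h R⟩
  · exact fun h R hh hR => ⟨h, R, hh, hR, H h R⟩

theorem GSBound.reflect {F : V d₁ × V d₂ → ℂ} (hF : GSBound s₁ s₂ σ₁ σ₂ h R M F) {p q : ℝ}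
    (hp : |p| = 1) (hq : |q| = 1) :
    GSBound s₁ s₂ σ₁ σ₂ h R M (fun x => F (dilation p q x)) :=
  (DerivBound.dilate hF p q).mono fun m n x => by
    simp [hp, hq, expWeight, norm_smul]

theorem GSBound.swap {F : V d₁ × V d₂ → ℂ} (hF : GSBound s₁ s₂ σ₁ σ₂ h R M F) :
    GSBound s₂ s₁ σ₂ σ₁ h R M (fun x => F x.swap) := by
  set L : (V d₂ × V d₁) →L[ℝ] (V d₁ × V d₂) :=
    (ContinuousLinearMap.snd ℝ _ _).prod (ContinuousLinearMap.fst ℝ _ _)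
  have e0 : ∀ x, L x + 0 = x.swap := fun x => by rw [add_zero]; rfl
  have e1 := contDiff_comp_affine L 0 hF.smooth
  simp only [e0] at e1
  refine ⟨e1, fun l₁ l₂ h₁ h₂ x => ?_⟩
  have e2 := listDeriv_comp_affine L 0 (dirList l₁ l₂) hF.smooth
  simp only [e0] at e2
  have e3 : (dirList l₁ l₂).map L = l₁.map (fun w => (0, w)) ++ l₂.map (fun v => (v, 0)) := by
    simp only [dirList, List.map_append, List.map_map]
    rfl
  rw [e2, e3, listDeriv_perm List.perm_append_comm hF.smooth]
  refine (hF.bound l₂ l₁ h₂ h₁ x.swap).trans (le_of_eq ?_)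
  simp only [gevrey, expWeight, Prod.fst_swap, Prod.snd_swap]
  rw [add_comm l₁.length, add_comm (‖x.1‖ ^ (1 / s₂))]
  ring

theorem mapsGS_swap : MapsGS κ s₁ s₂ σ₁ σ₂ s₂ s₁ σ₂ σ₁
    (fun (_ : ι) (F : V d₁ × V d₂ → ℂ) x => F x.swap) :=
  .of_isometric fun _ _ _ _ _ hF => hF.swap

theorem mapsGS_reflect {p q : ℝ} (hp : |p| = 1) (hq : |q| = 1) : MapsGS κ s₁ s₂ σ₁ σ₂ s₁ s₂ σ₁ σ₂
    (fun (_ : ι) (F : V d₁ × V d₂ → ℂ) x => F (dilation p q x)) :=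
  .of_isometric fun _ _ _ _ _ hF => hF.reflect hp hq

theorem mapsGS_skew {d : ℕ} (hs : 0 < s) (hσ : 0 ≤ σ) : MapsGS κ s s σ σ s s σ σ
    (fun (_ : ι) (F : V d × V d → ℂ) x => F (x.1, x.1 + x.2)) := by
  have h1 := (mapsGS_twist (ι := ι) (d₁ := d) (d₂ := d) κ hs le_rfl hσ le_rfl
    (norm_nonneg (ContinuousLinearMap.id ℝ (V d))) (fun _ => .id ℝ _) (fun _ => le_rfl)).comp
    (mapsGS_swap.comp (mapsGS_reflect (p := -1) (q := 1) (by simp) (by simp)))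
  have h2 := (mapsGS_swap (κ := κ) (ι := ι) (s₁ := s) (s₂ := s) (σ₁ := σ) (σ₂ := σ) (d₁ := d) (d₂ := d)).comp h1
  have e : (fun (_ : ι) (F : V d × V d → ℂ) (x : V d × V d) => F (x.1, x.1 + x.2)) =
      fun (i : ι) F x => F (dilation (-1) 1
        (twist (ContinuousLinearMap.id ℝ (V d)) (Prod.swap x)).swap) := by
    funext i F x
    simp [add_comm]
  rw [e]
  exact h2

end CoordinateChanges

section Relation

variable {d : ℕ} {κ : Kind} {t τ : ℝ}

/-- The continuous linear map of a real matrix. -/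
def matrixMap (A : Matrix (Fin d) (Fin d) ℝ) : V d →L[ℝ] V d :=
  LinearMap.toContinuousLinearMap (Matrix.toEuclideanLin A)

theorem kernelTranspose_eq (A : Matrix (Fin d) (Fin d) ℝ) (Φ : V d × V d → ℂ) :
    kernelTranspose A Φ = (((2 * Real.pi : ℝ) : ℂ)⁻¹ ^ d) • partialFourier
      (fun x => (fun x : V d × V d => Φ (x.1, x.1 + x.2)) (twist (matrixMap A) x)) := by
  funext p
  simp [kernelTranspose, partialFourier, matrixMap, char, sub_eq_add_neg]

theorem mapsGS_kernelTranspose (ht : 0 < t) (hτ : 0 < τ) (htτ : 1 ≤ t + τ)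
    (A : Matrix (Fin d) (Fin d) ℝ) :
    MapsGS κ t t τ τ t τ τ t (fun _ : Unit => kernelTranspose A) := by
  have h1 := (mapsGS_twist (ι := Unit) (d₁ := d) (d₂ := d) κ ht le_rfl hτ.le le_rfl
    (norm_nonneg (matrixMap A)) (fun _ => matrixMap A) (fun _ => le_rfl)).comp
      (mapsGS_skew (κ := κ) ht hτ.le)
  have h2 := (mapsGS_partialFourier (ι := Unit) (d₁ := d) (d₂ := d) (σ₁ := τ) κ ht ht hτ htτ).comp h1
  have h3 := h2.smul (((2 * Real.pi : ℝ) : ℂ)⁻¹ ^ d)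
  have e : (fun _ : Unit => kernelTranspose A) = fun _ : Unit => fun Φ =>
      (((2 * Real.pi : ℝ) : ℂ)⁻¹ ^ d) • partialFourier
      (fun x => (fun x : V d × V d => Φ (x.1, x.1 + x.2)) (twist (matrixMap A) x)) := by
    funext _ Φ
    exact kernelTranspose_eq A Φ
  rw [e]
  exact h3

theorem Rapid.partialFourier_add {d₁ d₂ : ℕ} {f g : V d₁ × V d₂ → ℂ} (hf : Rapid f)
    (hg : Rapid g) : partialFourier (f + g) = partialFourier f + partialFourier g := by
  funext p
  simp only [partialFourier, Pi.add_apply, add_mul]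
  exact integral_add (hf.integrable_modulated p) (hg.integrable_modulated p)

theorem partialFourier_smul {d₁ d₂ : ℕ} (c : ℂ) (f : V d₁ × V d₂ → ℂ) :
    partialFourier (c • f) = c • partialFourier f := by
  funext p
  simp only [partialFourier, Pi.smul_apply, smul_eq_mul, mul_assoc]
  exact integral_const_mul _ _

/-- The pullback of a linear form under a map between Gelfand-Shilov spaces. -/
def pullbackForm {κ' : Kind} {d₁ d₂ d₁' d₂' : ℕ} {s₁ s₂ σ₁ σ₂ s₁' s₂' σ₁' σ₂' : ℝ}
    (u : GS₂ κ' s₁' s₂' σ₁' σ₂' d₁' d₂' →ₗ[ℂ] ℂ) (T : (V d₁ × V d₂ → ℂ) → V d₁' × V d₂' → ℂ)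
    (hT : ∀ F ∈ GS₂ κ s₁ s₂ σ₁ σ₂ d₁ d₂, T F ∈ GS₂ κ' s₁' s₂' σ₁' σ₂' d₁' d₂')
    (hadd : ∀ F ∈ GS₂ κ s₁ s₂ σ₁ σ₂ d₁ d₂, ∀ G ∈ GS₂ κ s₁ s₂ σ₁ σ₂ d₁ d₂, T (F + G) = T F + T G)
    (hsmul : ∀ (c : ℂ) (F), T (c • F) = c • T F) : GS₂ κ s₁ s₂ σ₁ σ₂ d₁ d₂ →ₗ[ℂ] ℂ where
  toFun F := u ⟨T F.1, hT F.1 F.2⟩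
  map_add' F G := by
    rw [← map_add]
    congr 1
    exact Subtype.ext (hadd F.1 F.2 G.1 G.2)
  map_smul' c F := by
    rw [RingHom.id_apply, ← map_smul]
    congr 1
    exact Subtype.ext (hsmul c F.1)

theorem kernelTranspose_add (ht : 0 < t) (hτ : 0 < τ) (A : Matrix (Fin d) (Fin d) ℝ)
    {F G : V d × V d → ℂ} (hF : F ∈ GS₂ κ t t τ τ d d) (hG : G ∈ GS₂ κ t t τ τ d d) :
    kernelTranspose A (F + G) = kernelTranspose A F + kernelTranspose A G := by
  have h1 := (mapsGS_twist (ι := Unit) (d₁ := d) (d₂ := d) κ ht le_rfl hτ.le le_rfl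
    (norm_nonneg (matrixMap A)) (fun _ => matrixMap A) (fun _ => le_rfl)).comp
      (mapsGS_skew (κ := κ) ht hτ.le)
  have h2 := fun {F} (hF : F ∈ GS₂ κ t t τ τ d d) =>
    GS₂_rapid ht ht hτ.le hτ.le (h1.mem ht ht hτ.le hτ.le ht ht hτ.le hτ.le () hF)
  rw [kernelTranspose_eq, kernelTranspose_eq A F, kernelTranspose_eq A G, ← smul_add,
    ← Rapid.partialFourier_add (h2 hF) (h2 hG)]
  rfl

theorem kernelTranspose_smul (A : Matrix (Fin d) (Fin d) ℝ) (c : ℂ) (F : V d × V d → ℂ) :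
    kernelTranspose A (c • F) = c • kernelTranspose A F := by
  have h := partialFourier_smul c
    (fun x => (fun x : V d × V d => F (x.1, x.1 + x.2)) (twist (matrixMap A) x))
  rw [kernelTranspose_eq, kernelTranspose_eq A F, smul_comm c, ← h]
  rfl

theorem kernelTranspose_mem (ht : 0 < t) (hτ : 0 < τ) (htτ : 1 ≤ t + τ)
    (A : Matrix (Fin d) (Fin d) ℝ) {F : V d × V d → ℂ} (hF : F ∈ GS₂ κ t t τ τ d d) :
    kernelTranspose A F ∈ GS₂ κ t τ τ t d d :=
  (mapsGS_kernelTranspose ht hτ htτ A).mem ht ht hτ.le hτ.le ht hτ hτ.le ht.le () hF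

/-- The kernel as a linear form. -/
def kernelForm (ht : 0 < t) (hτ : 0 < τ) (htτ : 1 ≤ t + τ) (A : Matrix (Fin d) (Fin d) ℝ)
    (a : GSDual κ t τ τ t d d) : GS₂ κ t t τ τ d d →ₗ[ℂ] ℂ :=
  pullbackForm a.1 (kernelTranspose A) (fun _ hF => kernelTranspose_mem ht hτ htτ A hF)
    (fun _ hF _ hG => kernelTranspose_add ht hτ A hF hG) (kernelTranspose_smul A)

theorem isContinuousForm_kernelForm (ht : 0 < t) (hτ : 0 < τ) (htτ : 1 ≤ t + τ)
    (A : Matrix (Fin d) (Fin d) ℝ) (a : GSDual κ t τ τ t d d) :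
    IsContinuousForm κ (kernelForm ht hτ htτ A a) :=
  (mapsGS_kernelTranspose ht hτ htτ A).isContinuousForm ht ht hτ.le hτ.le ht hτ hτ.le ht.le ()
    a.2 fun _ => ⟨_, rfl, rfl⟩

theorem kernelForm_apply (ht : 0 < t) (hτ : 0 < τ) (htτ : 1 ≤ t + τ)
    (A : Matrix (Fin d) (Fin d) ℝ) (a : GSDual κ t τ τ t d d) (F : GS₂ κ t t τ τ d d) :
    kernelForm ht hτ htτ A a F = kernel A a F.1 := by
  rw [kernel, GSDual.pair, dif_pos (kernelTranspose_mem ht hτ htτ A F.2)]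
  rfl

theorem IsContinuousForm.sub {s₁ s₂ σ₁ σ₂ : ℝ} {d₁ d₂ : ℕ} (hs₁ : 0 < s₁) (hs₂ : 0 < s₂)
    (hσ₁ : 0 ≤ σ₁) (hσ₂ : 0 ≤ σ₂) {u v : GS₂ κ s₁ s₂ σ₁ σ₂ d₁ d₂ →ₗ[ℂ] ℂ}
    (hu : IsContinuousForm κ u) (hv : IsContinuousForm κ v) : IsContinuousForm κ (u - v) := by
  cases κ
  · rw [isContinuousForm_roumieu hs₁ hs₂ hσ₁ hσ₂] at hu hv ⊢
    intro h R hh hR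
    obtain ⟨K, hK, H⟩ := hu h R hh hR
    obtain ⟨K', hK', H'⟩ := hv h R hh hR
    refine ⟨K + K', by positivity, fun M F hF => ?_⟩
    rw [LinearMap.sub_apply, add_mul]
    exact (norm_sub_le _ _).trans (add_le_add (H M F hF) (H' M F hF))
  · rw [isContinuousForm_beurling hs₁ hs₂ hσ₁ hσ₂] at hu hv ⊢
    obtain ⟨h, R, hh, hR, K, hK, H⟩ := hu
    obtain ⟨h', R', hh', hR', K', hK', H'⟩ := hv
    refine ⟨min h h', max R R', by positivity, by positivity, K + K', by positivity,
      fun M F hF => ?_⟩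
    rw [LinearMap.sub_apply, add_mul]
    have hm : 0 < min h h' := by positivity
    exact (norm_sub_le _ _).trans (add_le_add
      (H M F (hF.mono hm (min_le_left _ _) (le_max_left _ _) le_rfl hF.nonneg))
      (H' M F (hF.mono hm (min_le_right _ _) (le_max_right _ _) le_rfl hF.nonneg)))

theorem GS₂_tensor_slices {s₁ s₂ σ₁ σ₂ : ℝ} {d₁ d₂ : ℕ} (hs₁ : 0 < s₁) (hs₂ : 0 < s₂)
    (hσ₁ : 0 ≤ σ₁) (hσ₂ : 0 ≤ σ₂) {F : V d₁ × V d₂ → ℂ} (hF : F ∈ GS₂ κ s₁ s₂ σ₁ σ₂ d₁ d₂)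
    (z : V d₁ × V d₂) :
    (fun x => F (x.1, z.2) * F (z.1, x.2)) ∈ GS₂ κ s₁ s₂ σ₁ σ₂ d₁ d₂ := by
  have h1 := GS₂_translate hs₁ hs₂ hσ₁ hσ₂ hF (0, z.2)
  refine GS₂_mem_of_bound hs₁ hs₂ hσ₁ hσ₂ (a := 2) (b := quasiConst s₁ s₂) two_pos
    (zero_lt_one.trans_le (one_le_quasiConst hs₁ hs₂)) hF fun h R M hh hR H => ?_
  have aux : ∀ (w : V d₁ × V d₂) (p q : ℝ), |p| ≤ 1 → |q| ≤ 1 →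
      GevreyBound σ₁ σ₂ h (fun x => M * expWeight s₁ s₂ (quasiConst s₁ s₂ * R) w *
        expWeight s₁ s₂ (-R) (dilation p q x)) (fun x => F (dilation p q x + w)) := by
    intro w p q hp hq
    refine (DerivBound.dilate (H.translate hs₁ hs₂ hh hR.le w) p q).mono fun m n x => ?_
    have e1 : |p| ^ m * |q| ^ n ≤ 1 :=
      mul_le_one₀ (pow_le_one₀ (abs_nonneg _) hp) (by positivity) (pow_le_one₀ (abs_nonneg _) hq)
    have e2 := gevrey_pos (σ₁ := σ₁) (σ₂ := σ₂) hh m n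
    refine mul_le_mul_of_nonneg_right (mul_le_of_le_one_left e2.le e1) ?_
    exact GevreyBound.weight_nonneg (H.translate hs₁ hs₂ hh hR.le w) _
  have h2 := aux (0, z.2) 1 0 (by simp) (by simp)
  have h3 := aux (z.1, 0) 0 1 (by simp) (by simp)
  have h4 := GevreyBound.mul hσ₁ hσ₂ hh.le hh.le h2 h3
  rw [← two_mul] at h4
  have e : (fun x : V d₁ × V d₂ => F (x.1, z.2) * F (z.1, x.2)) =
      (fun x => F (dilation 1 0 x + (0, z.2))) * fun x => F (dilation 0 1 x + (z.1, 0)) := by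
    funext x; simp
  rw [e]
  refine ⟨(M * expWeight s₁ s₂ (quasiConst s₁ s₂ * R) ((0, z.2) : V d₁ × V d₂)) *
    (M * expWeight s₁ s₂ (quasiConst s₁ s₂ * R) ((z.1, 0) : V d₁ × V d₂)), ?_⟩
  refine GevreyBound.mono_weight (by positivity) h4 fun x => le_of_eq ?_
  have e5 : expWeight s₁ s₂ (-R) (dilation 1 0 x) * expWeight s₁ s₂ (-R) (dilation 0 1 x) =
      expWeight s₁ s₂ (-R) x := by
    have a1 : (0 : ℝ) ^ (1 / s₁) = 0 := Real.zero_rpow (by positivity)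
    have a2 : (0 : ℝ) ^ (1 / s₂) = 0 := Real.zero_rpow (by positivity)
    simp only [expWeight, dilation_apply, one_smul, zero_smul, norm_zero, a1, a2, ← Real.exp_add]
    ring_nf
  rw [← e5]; ring

theorem integral_pos_of_nonneg_real {X : Type*} [TopologicalSpace X] [MeasurableSpace X]
    {μ : Measure X} [μ.IsOpenPosMeasure] {f : X → ℂ} {r : X → ℝ} {x : X}
    (hfr : ∀ x, f x = (r x : ℂ)) (hc : Continuous f) (hi : Integrable f μ) (hr : 0 ≤ r)
    (hx : r x ≠ 0) : ∃ c : ℝ, 0 < c ∧ ∫ x, f x ∂μ = (c : ℂ) := by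
  have e : r = fun x => (f x).re := by funext x; simp [hfr]
  refine ⟨∫ x, r x ∂μ, integral_pos_of_integrable_nonneg_nonzero (x := x) ?_ ?_ hr hx, ?_⟩
  · rw [e]; exact Complex.continuous_re.comp hc
  · rw [e]; exact hi.re
  · simp only [hfr]
    exact integral_ofReal

theorem kernelForm_eq_of_op_eq (ht : 0 < t) (hτ : 0 < τ) (htτ : 1 ≤ t + τ)
    {A B : Matrix (Fin d) (Fin d) ℝ} {a b : GSDual κ t τ τ t d d} (hab : Op A a = Op B b)
    (F : GS₂ κ t t τ τ d d) : kernelForm ht hτ htτ A a F = kernelForm ht hτ htτ B b F := by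
  by_cases h0 : ∀ F : GS₂ κ t t τ τ d d, F = 0
  · rw [h0 F, map_zero, map_zero]
  push Not at h0
  obtain ⟨F₀, hF₀⟩ := h0
  have : ∃ z, F₀.1 z ≠ 0 := by
    by_contra hc
    push Not at hc
    exact hF₀ (Subtype.ext (funext hc))
  obtain ⟨z, hz⟩ := this
  have hΘ := GS₂_sqNorm ht ht hτ.le hτ.le F₀.2
  have hρ := GS₂_tensor_slices ht ht hτ.le hτ.le hΘ z
  have hr := GS₂_rapid ht ht hτ.le hτ.le hρ
  obtain ⟨c, hc, hc'⟩ := integral_pos_of_nonneg_real (x := z)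
    (r := fun x => ‖F₀.1 (x.1, z.2)‖ ^ 2 * ‖F₀.1 (z.1, x.2)‖ ^ 2)
    (fun x => by rw [sqNorm_apply, sqNorm_apply]; push_cast; ring) hr.smooth.continuous
    hr.integrable (fun x => by positivity) (by simpa using hz)
  have hU := (isContinuousForm_kernelForm ht hτ htτ A a).sub ht ht hτ.le hτ.le
    (isContinuousForm_kernelForm ht hτ htτ B b)
  have := form_eq_zero_of_window ht ht hτ.le hτ.le hU hρ
    (by rw [hc']; exact_mod_cast hc.ne') (fun l y H hl hH => ?_) F
  · rwa [LinearMap.sub_apply, sub_eq_zero] at this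
  have hm : ∀ w : V d × V d, (fun x => sqNorm F₀.1 (l • (x + w))) ∈ GS₂ κ t t τ τ d d :=
    fun w => GS₂_translate ht ht hτ.le hτ.le (GS₂_dilate ht ht hτ.le hτ.le hΘ hl) w
  have h1 := GS₂_slice_left (hm (-(y.1, 0))) (l⁻¹ • z.2)
  have h2 := GS₂_slice_right (hm (-(0, y.2))) (l⁻¹ • z.1)
  have h3 := congrFun (congrFun hab ⟨_, h2⟩) ⟨_, h1⟩
  have hl0 : l ≠ 0 := (zero_lt_one.trans_le hl).ne'
  have h4 : (fun p : V d × V d => sqNorm F₀.1 (l • ((p.1, l⁻¹ • z.2) + -(y.1, 0))) *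
      sqNorm F₀.1 (l • ((l⁻¹ • z.1, p.2) + -(0, y.2)))) = H.1 := by
    rw [hH]
    funext p
    simp [smul_smul, hl0, sub_eq_add_neg]
  rw [LinearMap.sub_apply, kernelForm_apply, kernelForm_apply, sub_eq_zero, ← h4]
  exact h3

theorem Admissible.of_one_le_add (ht : 0 < t) (hτ : 0 < τ) (htτ : 1 ≤ t + τ) : Admissible t τ τ t :=
  ⟨ht, le_rfl, hτ, le_rfl, htτ⟩

theorem symbol_eq_shift (H : Admissible t τ τ t)
    {A B : Matrix (Fin d) (Fin d) ℝ} {a b : GSDual κ t τ τ t d d} (hab : Op A a = Op B b)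
    (g : GS₂ κ t τ τ t d d) :
    b.1 g = a.1 ⟨symbolShift (matrixMap A - matrixMap B) g.1, H.symbolShift_mem _ g.2⟩ := by
  have ht := H.pos_s
  have hτ := H.pos_σ
  have h1 := (mapsGS_twist (ι := Unit) (d₁ := d) (d₂ := d) κ ht le_rfl hτ.le le_rfl
    (norm_nonneg (-matrixMap B)) (fun _ => -matrixMap B) (fun _ => le_rfl)).comp
      (mapsGS_partialFourier (σ₁ := τ) κ ht hτ ht (by linarith [H.sum]))
  have h2 := (mapsGS_reflect (κ := κ) (p := 1) (q := -1) (by simp) (by simp)).comp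
    ((mapsGS_skew (κ := κ) ht hτ.le).comp h1)
  have h3 := h2.mem ht hτ hτ.le ht.le ht ht hτ.le hτ.le () g.2
  have key := kernelForm_eq_of_op_eq ht hτ H.sum hab ⟨_, h3⟩
  have e : ∀ D : Matrix (Fin d) (Fin d) ℝ, kernelTranspose D (fun x => (fun x : V d × V d =>
      partialFourier g.1 (twist (-matrixMap B) (x.1, x.1 + x.2))) (dilation 1 (-1) x)) =
      symbolShift (matrixMap D - matrixMap B) g.1 := by
    intro D
    rw [kernelTranspose_eq, symbolShift]
    congr 2
    funext x
    simp [add_assoc, sub_eq_add_neg]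
  have e2 : ∀ (c : GSDual κ t τ τ t d d) (D : Matrix (Fin d) (Fin d) ℝ),
      kernelForm ht hτ H.sum D c ⟨_, h3⟩ =
        c.1 ⟨symbolShift (matrixMap D - matrixMap B) g.1, H.symbolShift_mem _ g.2⟩ := fun c D =>
    congrArg c.1 (Subtype.ext (e D))
  rw [e2, e2] at key
  rw [key]
  congr 1
  refine Subtype.ext ?_
  obtain ⟨h, R, M, hh, hR, hb⟩ := GS₂_exists_bound ht hτ hτ.le ht.le g.2
  change g.1 = symbolShift (matrixMap B - matrixMap B) g.1
  rw [sub_self, symbolShift_zero (GevreyBound.rapid ht hτ hR hb) (H.rapid_partialFourier hh hR hb)]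

end Relation

section FunctionsAndDuals

variable {d₁ d₂ : ℕ} {κ κ' : Kind} {t₁ t₂ τ₁ τ₂ s₁ σ₂ σ₁ s₂ : ℝ} {C : V d₂ →L[ℝ] V d₁}

theorem Rapid.integrable_mul {f g : V d₁ × V d₂ → ℂ} (hf : Rapid f) (hg : Rapid g) :
    Integrable (fun x => f x * g x) := by
  obtain ⟨K, hK⟩ := hg.decay [] 0
  exact hf.integrable.mul_bdd (c := K) hg.smooth.continuous.aestronglyMeasurable
    (Filter.Eventually.of_forall fun x => by simpa using hK x)

theorem symbolShift_smul (C : V d₂ →L[ℝ] V d₁) (c : ℂ) (f : V d₁ × V d₂ → ℂ) :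
    symbolShift C (c • f) = c • symbolShift C f := by
  have h := partialFourier_smul c (fun x => partialFourier f (twist C x))
  rw [symbolShift, symbolShift, smul_comm c, ← h, partialFourier_smul]
  rfl

namespace Admissible

variable (H : Admissible s₁ σ₂ σ₁ s₂)
include H

theorem gsRapid {f : V d₁ × V d₂ → ℂ} (hf : f ∈ GS₂ κ s₁ σ₂ σ₁ s₂ d₁ d₂) : Rapid f :=
  GS₂_rapid H.pos_s₁ H.pos_σ₂ H.pos_σ.le H.pos_s.le hf

theorem exists_bound {f : V d₁ × V d₂ → ℂ} (hf : f ∈ GS₂ κ s₁ σ₂ σ₁ s₂ d₁ d₂) :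
    ∃ h R M : ℝ, 0 < h ∧ 0 < R ∧ GSBound s₁ σ₂ σ₁ s₂ h R M f :=
  GS₂_exists_bound H.pos_s₁ H.pos_σ₂ H.pos_σ.le H.pos_s.le hf

theorem symbolShift_add (C : V d₂ →L[ℝ] V d₁) {f g : V d₁ × V d₂ → ℂ}
    (hf : f ∈ GS₂ κ s₁ σ₂ σ₁ s₂ d₁ d₂) (hg : g ∈ GS₂ κ s₁ σ₂ σ₁ s₂ d₁ d₂) :
    symbolShift C (f + g) = symbolShift C f + symbolShift C g := by
  obtain ⟨h, R, M, hh, hR, hfb⟩ := H.exists_bound hf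
  obtain ⟨h', R', M', hh', hR', hgb⟩ := H.exists_bound hg
  have h1 := (H.rapid_twist hh hR hfb C).partialFourier_add (H.rapid_twist hh' hR' hgb C)
  rw [symbolShift, symbolShift, symbolShift, ← smul_add, ← h1,
    (H.gsRapid hf).partialFourier_add (H.gsRapid hg)]
  rfl

end Admissible

/-- The distribution `b` is the image of `a` under the transpose of `symbolShift C`. -/
def IsShift (H : Admissible t₁ τ₂ τ₁ t₂) (C : V d₂ →L[ℝ] V d₁)
    (a b : GSDual κ t₁ τ₂ τ₁ t₂ d₁ d₂) : Prop :=
  ∀ g : GS₂ κ t₁ τ₂ τ₁ t₂ d₁ d₂, b.1 g = a.1 ⟨symbolShift C g.1, H.symbolShift_mem C g.2⟩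

variable {H : Admissible t₁ τ₂ τ₁ t₂} {a b : GSDual κ t₁ τ₂ τ₁ t₂ d₁ d₂}

theorem IsShift.memFun_GS (hab : IsShift H C a b) (H' : Admissible s₁ σ₂ σ₁ s₂)
    (ha : a.MemFun (GS₂ κ' s₁ σ₂ σ₁ s₂ d₁ d₂)) : b.MemFun (GS₂ κ' s₁ σ₂ σ₁ s₂ d₁ d₂) := by
  obtain ⟨f, hf, hfa⟩ := ha
  have hTf := H'.symbolShift_mem C hf
  refine ⟨_, hTf, fun g => ⟨(H'.gsRapid hTf).integrable_mul (H.gsRapid g.2), ?_⟩⟩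
  obtain ⟨h, R, M, hh, hR, hfb⟩ := H'.exists_bound hf
  obtain ⟨h', R', M', hh', hR', hgb⟩ := H.exists_bound g.2
  rw [hab g, (hfa _).2, H'.integral_symbolShift H hh hR hh' hR' hfb hgb C]

theorem IsShift.memDual (hab : IsShift H C a b) (H' : Admissible s₁ σ₂ σ₁ s₂)
    (ha : a.MemDual κ' s₁ σ₂ σ₁ s₂) : b.MemDual κ' s₁ σ₂ σ₁ s₂ := by
  obtain ⟨u, hu⟩ := ha
  refine ⟨⟨pullbackForm u.1 (symbolShift C) (fun _ hF => H'.symbolShift_mem C hF)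
    (fun _ hF _ hG => H'.symbolShift_add C hF hG) (symbolShift_smul C), ?_⟩, fun g hg hg' => ?_⟩
  · exact (H'.mapsGS (ι := Unit) κ' (norm_nonneg C) (fun _ => C) fun _ => le_rfl).isContinuousForm
      H'.pos_s₁ H'.pos_σ₂ H'.pos_σ.le H'.pos_s.le H'.pos_s₁ H'.pos_σ₂ H'.pos_σ.le H'.pos_s.le ()
      u.2 fun _ => ⟨_, rfl, rfl⟩
  · rw [hab ⟨g, hg⟩]
    exact hu _ _ _

end FunctionsAndDuals

section Superposition

variable {d₁ d₂ : ℕ} {s₁ s₂ σ₁ σ₂ h R r : ℝ} {W W' : V d₁ × V d₂ → ℝ}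
  {w : V d₁ × V d₂ → V d₁ × V d₂ → ℂ}

/-- The superposition of the translates by `y` of the functions `w y`. -/
def superpose (w : V d₁ × V d₂ → V d₁ × V d₂ → ℂ) : V d₁ × V d₂ → ℂ := fun x => ∫ y, w y (x - y)

theorem GSBound.superpose (hs₁ : 0 < s₁) (hs₂ : 0 < s₂) (hh : 0 < h) (hr : 0 ≤ r)
    (hrR : quasiConst s₁ s₂ * r < R) (hw : ∀ y, GSBound s₁ s₂ σ₁ σ₂ h R (W y) (w y))
    (hm : ∀ x, AEStronglyMeasurable (fun y => w y (x - y)) volume)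
    (hW : ∀ x y, W y ≤ W' x * expWeight s₁ s₂ r (x - y)) :
    GevreyBound σ₁ σ₂ h
      (fun x => (∫ y : V d₁ × V d₂, expWeight s₁ s₂ (-(R - r)) y) * W' x) (superpose w) := by
  have hq := one_le_quasiConst hs₁ hs₂
  have hR : 0 < R := lt_of_le_of_lt (by positivity) hrR
  have hrR' : 0 < R - r := by nlinarith
  have hRr : 0 < R / quasiConst s₁ s₂ - r := by
    rw [sub_pos, lt_div_iff₀ (by positivity)]; linarith
  have hW0 : ∀ y, 0 ≤ W y := fun y => (hw y).nonneg
  have hG : ∀ y, GevreyBound σ₁ σ₂ h (fun x => W y * expWeight s₁ s₂ (-R) (x - y))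
      (fun x => w y (x - y)) := fun y => by
    simpa only [← sub_eq_add_neg] using DerivBound.translate (hw y) (-y)
  have hint : ∀ (a : ℝ) (x : V d₁ × V d₂), 0 < a → Integrable fun y => expWeight s₁ s₂ (-a) (x - y) :=
    fun a x ha => (integrable_expWeight hs₁ hs₂ ha).comp_sub_left x
  have hdom : DominatedFamily volume fun y x => w y (x - y) := by
    refine GevreyBound.dominatedFamily hG hm fun x₀ => ⟨fun y => W' x₀ * Real.exp (R * 2) *
      expWeight s₁ s₂ (-(R / quasiConst s₁ s₂ - r)) (x₀ - y), (hint _ _ hRr).const_mul _,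
      fun y x hx => ?_⟩
    have h1 := expWeight_neg_add_le (r := R / quasiConst s₁ s₂) hs₁ hs₂ (by positivity) (x₀ - y) (x - x₀)
    rw [mul_div_cancel₀ _ (by positivity), sub_add_sub_comm, add_comm x₀ x, add_sub_add_right_eq_sub] at h1
    have h2 : expWeight s₁ s₂ R (x - x₀) ≤ Real.exp (R * 2) := by
      rw [Metric.mem_ball, dist_eq_norm] at hx
      refine Real.exp_le_exp.2 (mul_le_mul_of_nonneg_left ?_ hR.le)
      have a1 := Real.rpow_le_one (norm_nonneg _) ((norm_fst_le (x - x₀)).trans hx.le)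
        (one_div_pos.2 hs₁).le
      have a2 := Real.rpow_le_one (norm_nonneg _) ((norm_snd_le (x - x₀)).trans hx.le)
        (one_div_pos.2 hs₂).le
      linarith
    have p1 := expWeight_pos s₁ s₂ (-(R / quasiConst s₁ s₂)) (x₀ - y)
    have p2 := expWeight_pos s₁ s₂ (-R) (x - y)
    calc W y * expWeight s₁ s₂ (-R) (x - y) ≤ (W' x₀ * expWeight s₁ s₂ r (x₀ - y)) *
          (expWeight s₁ s₂ (-(R / quasiConst s₁ s₂)) (x₀ - y) * Real.exp (R * 2)) :=
          mul_le_mul (hW x₀ y) (h1.trans (mul_le_mul_of_nonneg_left h2 p1.le)) p2.le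
            ((hW0 y).trans (hW x₀ y))
      _ = W' x₀ * Real.exp (R * 2) * (expWeight s₁ s₂ r (x₀ - y) *
          expWeight s₁ s₂ (-(R / quasiConst s₁ s₂)) (x₀ - y)) := by ring
      _ = _ := by rw [← expWeight_add]; congr 2; ring
  refine GevreyBound.integral (W := fun y x => W' x * expWeight s₁ s₂ (-(R - r)) (x - y)) hh hdom
    (fun y => GevreyBound.mono_weight hh (hG y) fun x => ?_)
    (fun x => (hint _ x hrR').const_mul _) fun x => ?_
  · have p := expWeight_pos s₁ s₂ (-R) (x - y)
    calc _ ≤ (W' x * expWeight s₁ s₂ r (x - y)) * expWeight s₁ s₂ (-R) (x - y) :=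
          mul_le_mul_of_nonneg_right (hW x y) p.le
      _ = _ := by rw [mul_assoc, ← expWeight_add]; congr 2; ring
  · rw [integral_const_mul, mul_comm,
      integral_sub_left_eq_self (fun y => expWeight s₁ s₂ (-(R - r)) y) volume x]

theorem stronglyMeasurable_partialFourier {Z : Type*} [MeasurableSpace Z]
    {G : Z → V d₁ × V d₂ → ℂ} (hG : StronglyMeasurable fun p : Z × (V d₁ × V d₂) => G p.1 p.2) :
    StronglyMeasurable fun p : Z × (V d₁ × V d₂) => partialFourier (G p.1) p.2 := by
  have h1 : StronglyMeasurable (fun q : (Z × (V d₁ × V d₂)) × V d₂ =>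
      G q.1.1 (q.1.2.1, q.2) * char q.2 q.1.2.2) := by
    refine (hG.comp_measurable (g := fun q : (Z × (V d₁ × V d₂)) × V d₂ =>
      (q.1.1, (q.1.2.1, q.2))) (by fun_prop)).mul ?_
    exact continuous_char.stronglyMeasurable.comp_measurable
      (g := fun q : (Z × (V d₁ × V d₂)) × V d₂ => (q.2, q.1.2.2)) (by fun_prop)
  exact h1.integral_prod_right

theorem stronglyMeasurable_symbolShift {Z : Type*} [MeasurableSpace Z] (C : V d₂ →L[ℝ] V d₁)
    {G : Z → V d₁ × V d₂ → ℂ} (hG : StronglyMeasurable fun p : Z × (V d₁ × V d₂) => G p.1 p.2) :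
    StronglyMeasurable fun p : Z × (V d₁ × V d₂) => symbolShift C (G p.1) p.2 := by
  have h1 := (stronglyMeasurable_partialFourier hG).comp_measurable
    (g := fun p : Z × (V d₁ × V d₂) => (p.1, twist C p.2))
    (measurable_fst.prodMk ((twist C).continuous.measurable.comp measurable_snd))
  exact (stronglyMeasurable_partialFourier
    (G := fun z x => partialFourier (G z) (twist C x)) h1).const_smul _

end Superposition

section Windows

variable {d₁ d₂ : ℕ} {s₁ s₂ σ₁ σ₂ h k R r q M N B : ℝ} {V₀ : V d₁ × V d₂ → ℝ}
  {f φ g : V d₁ × V d₂ → ℂ}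

/-- The function `f` near `y`, seen through the window `φ`. -/
def windowed (f φ : V d₁ × V d₂ → ℂ) (y : V d₁ × V d₂) : V d₁ × V d₂ → ℂ :=
  fun x => f (x + y) * φ x

theorem GevreyBound.windowed (hσ₁ : 0 ≤ σ₁) (hσ₂ : 0 ≤ σ₂) (hh : 0 < h) (hk : 0 < k)
    (hf : GevreyBound σ₁ σ₂ h V₀ f) (hφ : GSBound s₁ s₂ σ₁ σ₂ k R N φ) {y : V d₁ × V d₂}
    (hV : ∀ x, V₀ (x + y) ≤ B * expWeight s₁ s₂ q x) :
    GSBound s₁ s₂ σ₁ σ₂ (h + k) (R - q) (N * B) (windowed f φ y) := by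
  have h1 := GevreyBound.mul hσ₁ hσ₂ hh.le hk.le (DerivBound.translate hf y) hφ
  refine GevreyBound.mono_weight (by positivity) h1 fun x => ?_
  have p := mul_nonneg hφ.nonneg (expWeight_pos s₁ s₂ (-R) x).le
  calc _ ≤ (B * expWeight s₁ s₂ q x) * (N * expWeight s₁ s₂ (-R) x) :=
        mul_le_mul_of_nonneg_right (hV x) p
    _ = N * B * (expWeight s₁ s₂ q x * expWeight s₁ s₂ (-R) x) := by ring
    _ = _ := by rw [← expWeight_add]; congr 2; ring

/-- The superposition of the images of the localizations of `f` under `symbolShift C`. -/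
def shiftSum (C : V d₂ →L[ℝ] V d₁) (φ f : V d₁ × V d₂ → ℂ) : V d₁ × V d₂ → ℂ :=
  superpose fun y => symbolShift C (windowed f φ y)

theorem stronglyMeasurable_shift_windowed (C : V d₂ →L[ℝ] V d₁) (hf : Continuous f)
    (hφ : Continuous φ) : StronglyMeasurable fun p : (V d₁ × V d₂) × (V d₁ × V d₂) =>
      symbolShift C (windowed f φ p.1) (p.2 - p.1) := by
  have c1 : Continuous fun p : (V d₁ × V d₂) × (V d₁ × V d₂) => windowed f φ p.1 p.2 :=
    (hf.comp (continuous_snd.add continuous_fst)).mul (hφ.comp continuous_snd)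
  exact (stronglyMeasurable_symbolShift C c1.stronglyMeasurable).comp_measurable
    (g := fun p : (V d₁ × V d₂) × (V d₁ × V d₂) => (p.1, p.2 - p.1))
    (measurable_fst.prodMk (measurable_snd.sub measurable_fst))

theorem Admissible.integral_shiftSum {s₁ σ₂ σ₁ s₂ h₀ R₀ h' R' h₁ R₁ : ℝ} {M₀ : V d₁ × V d₂ → ℝ}
    (H : Admissible s₁ σ₂ σ₁ s₂) {C : V d₂ →L[ℝ] V d₁} (hf : Continuous f) (hφ : Rapid φ)
    (hr : 0 ≤ r) (hh₀ : 0 < h₀) (hR₀ : 0 < R₀)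
    (hu : ∀ y, GSBound s₁ σ₂ σ₁ s₂ h₀ R₀ (M₀ y) (windowed f φ y))
    (hT : ∀ y, GSBound s₁ σ₂ σ₁ s₂ h' R' (M * expWeight s₁ σ₂ r y)
      (symbolShift C (windowed f φ y))) (hrR : quasiConst s₁ σ₂ * r < R')
    (hg : GSBound s₁ σ₂ σ₁ s₂ h₁ R₁ N g) (hh₁ : 0 < h₁) (hrR₁ : quasiConst s₁ σ₂ * r < R₁)
    (hi : Integrable fun x => f x * symbolShift C g x) :
    Integrable (fun x => shiftSum C φ f x * g x) ∧
      ∫ x, shiftSum C φ f x * g x = (∫ x, φ x) * ∫ x, f x * symbolShift C g x := by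
  have hq := one_le_quasiConst H.pos_s₁ H.pos_σ₂
  have hR₁ : 0 < R₁ := lt_of_le_of_lt (by positivity) hrR₁
  have hκ : 0 < quasiConst s₁ σ₂ := by positivity
  have hgc := hg.smooth.continuous
  set P : (V d₁ × V d₂) × (V d₁ × V d₂) → ℂ := fun p =>
    symbolShift C (windowed f φ p.1) (p.2 - p.1) * g p.2 with hP
  have hPm : AEStronglyMeasurable P (volume.prod volume) :=
    ((stronglyMeasurable_shift_windowed C hf hφ.smooth.continuous).mul
      (hgc.comp continuous_snd).stronglyMeasurable).aestronglyMeasurable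
  have hM : 0 ≤ M := nonneg_of_mul_nonneg_left (hT 0).nonneg (expWeight_pos _ _ _ _)
  have hN := hg.nonneg
  have hPi : Integrable P (volume.prod volume) := by
    have h1 := (integrable_expWeight (d₁ := d₁) (d₂ := d₂) (r := R₁ - quasiConst s₁ σ₂ * r) H.pos_s₁ H.pos_σ₂
      (by linarith)).convolution_integrand (ContinuousLinearMap.mul ℝ ℝ)
      (integrable_expWeight (d₁ := d₁) (d₂ := d₂) (r := R' - quasiConst s₁ σ₂ * r) H.pos_s₁ H.pos_σ₂ (by linarith))
    refine (h1.const_mul (M * N)).mono' hPm (Filter.Eventually.of_forall fun p => ?_)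
    obtain ⟨y, x⟩ := p
    have e1 := GevreyBound.norm_le (hT y) (x - y)
    have e2 := GevreyBound.norm_le hg x
    have e3 := expWeight_add_le H.pos_s₁ H.pos_σ₂ hr x (y - x)
    rw [add_sub_cancel] at e3
    have e4 := expWeight_neg (s₁ := s₁) (s₂ := σ₂) (-R') (y - x)
    rw [neg_sub] at e4
    simp only [hP, ContinuousLinearMap.mul_apply', norm_mul]
    have p1 := expWeight_pos s₁ σ₂ (-R') (y - x)
    have p2 := expWeight_pos s₁ σ₂ (-R₁) x
    calc _ ≤ (M * expWeight s₁ σ₂ r y * expWeight s₁ σ₂ (-R') (x - y)) *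
          (N * expWeight s₁ σ₂ (-R₁) x) := mul_le_mul e1 e2 (norm_nonneg _) ((norm_nonneg _).trans e1)
      _ ≤ (M * (expWeight s₁ σ₂ (quasiConst s₁ σ₂ * r) x *
          expWeight s₁ σ₂ (quasiConst s₁ σ₂ * r) (y - x)) * expWeight s₁ σ₂ (-R') (y - x)) *
          (N * expWeight s₁ σ₂ (-R₁) x) := by rw [e4]; gcongr
      _ = M * N * ((expWeight s₁ σ₂ (quasiConst s₁ σ₂ * r) x * expWeight s₁ σ₂ (-R₁) x) *
          (expWeight s₁ σ₂ (quasiConst s₁ σ₂ * r) (y - x) * expWeight s₁ σ₂ (-R') (y - x))) := by ring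
      _ = _ := by
        rw [← expWeight_add, ← expWeight_add]
        congr 3 <;> ring_nf
  have e0 : ∀ x, ∫ y, P (y, x) = shiftSum C φ f x * g x := fun x => by
    simp only [hP]
    rw [integral_mul_const]; rfl
  have i0 := hPi.integral_prod_right
  simp only [e0] at i0
  refine ⟨i0, ?_⟩
  have hTi : Integrable (fun p : (V d₁ × V d₂) × (V d₁ × V d₂) =>
      f p.2 * symbolShift C g p.2 * φ (p.2 - p.1)) (volume.prod volume) := by
    have := hi.convolution_integrand (ContinuousLinearMap.mul ℝ ℂ) hφ.integrable.comp_neg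
    simpa only [ContinuousLinearMap.mul_apply', neg_sub] using this
  have e1 : ∀ y, ∫ x, P (y, x) = ∫ x, f x * symbolShift C g x * φ (x - y) := by
    intro y
    have h1 := symbolShift_translate C (windowed f φ y) (-y)
    have hq0 : GSBound s₁ σ₂ σ₁ s₂ h₀ (R₀ / quasiConst s₁ σ₂) _ fun x => windowed f φ y (x + -y) :=
      GSBound.translate H.pos_s₁ H.pos_σ₂ hh₀ (by positivity)
        (by rw [mul_div_cancel₀ _ hκ.ne']; exact hu y) (-y)
    have h2 := H.integral_symbolShift H hh₀ (by positivity) hh₁ hR₁ hq0 hg C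
    rw [h1] at h2
    simp only [hP, sub_eq_add_neg] at h2 ⊢
    rw [h2]
    congr 1
    funext x
    simp only [windowed, neg_add_cancel_right]
    ring
  calc ∫ x, shiftSum C φ f x * g x = ∫ x, ∫ y, P (y, x) := by simp only [e0]
    _ = ∫ y, ∫ x, P (y, x) := (integral_integral_swap hPi).symm
    _ = ∫ y, ∫ x, f x * symbolShift C g x * φ (x - y) := by simp only [e1]
    _ = ∫ x, ∫ y, f x * symbolShift C g x * φ (x - y) := integral_integral_swap hTi
    _ = ∫ x, (f x * symbolShift C g x) * ∫ y, φ y := by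
      congr 1
      funext x
      rw [integral_const_mul, integral_sub_left_eq_self φ volume x]
    _ = _ := by rw [integral_mul_const, mul_comm]

theorem eq_of_integral_mul_eq {κ : Kind} {t₁ t₂ τ₁ τ₂ : ℝ} (ht₁ : 0 < t₁) (ht₂ : 0 < t₂)
    (hτ₁ : 0 ≤ τ₁) (hτ₂ : 0 ≤ τ₂) {F G θ : V d₁ × V d₂ → ℂ} (hs₁ : 0 < s₁) (hs₂ : 0 < s₂)
    (hF : Continuous F) (hG : Continuous G) (hr : 0 ≤ r)
    (hFb : ∀ x, ‖F x‖ ≤ M * expWeight s₁ s₂ r x) (hGb : ∀ x, ‖G x‖ ≤ N * expWeight s₁ s₂ r x)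
    (hθ : θ ∈ GS₂ κ t₁ t₂ τ₁ τ₂ d₁ d₂) (hθb : GSBound s₁ s₂ σ₁ σ₂ h R B θ)
    (hrR : quasiConst s₁ s₂ * r < R) (hθ0 : ∫ x, θ x ≠ 0)
    (hFG : ∀ g ∈ GS₂ κ t₁ t₂ τ₁ τ₂ d₁ d₂, Integrable (fun x => F x * g x) ∧
      Integrable (fun x => G x * g x) ∧ ∫ x, F x * g x = ∫ x, G x * g x) : F = G := by
  funext z
  set D : V d₁ × V d₂ → ℂ := fun x => F x - G x with hD
  have hDc : Continuous D := hF.sub hG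
  have hDb : ∀ x, ‖D x‖ ≤ (M + N) * expWeight s₁ s₂ r x := fun x => by
    rw [add_mul]; exact (norm_sub_le _ _).trans (add_le_add (hFb x) (hGb x))
  have hMN : 0 ≤ M + N := nonneg_of_mul_nonneg_left ((norm_nonneg _).trans (hDb 0)) (expWeight_pos _ _ _ _)
  have hB := hθb.nonneg
  have key : ∀ n : ℕ, ∫ y, D (((n : ℝ) + 1)⁻¹ • y + z) * θ y = 0 := by
    intro n
    have hl : (0 : ℝ) < n + 1 := by positivity
    have hm : (fun x => θ (((n : ℝ) + 1) • (x + -z))) ∈ GS₂ κ t₁ t₂ τ₁ τ₂ d₁ d₂ :=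
      GS₂_translate ht₁ ht₂ hτ₁ hτ₂ (GS₂_dilate ht₁ ht₂ hτ₁ hτ₂ hθ (by linarith)) (-z)
    obtain ⟨i1, i2, i3⟩ := hFG _ hm
    have h1 := Measure.integral_comp_smul (volume : Measure (V d₁ × V d₂))
      (fun y => D (((n : ℝ) + 1)⁻¹ • y + z) * θ y) ((n : ℝ) + 1)
    simp only [smul_smul, inv_mul_cancel₀ hl.ne', one_smul] at h1
    have h2 := integral_add_right_eq_self (μ := (volume : Measure (V d₁ × V d₂)))
      (fun y => D (y + z) * θ (((n : ℝ) + 1) • y)) (-z)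
    simp only [neg_add_cancel_right] at h2
    have h3 : ∫ x, D x * θ (((n : ℝ) + 1) • (x + -z)) = 0 := by
      simp only [hD, sub_mul]
      rw [integral_sub i1 i2, i3, sub_self]
    rw [← h2, h3] at h1
    rcases smul_eq_zero.1 h1.symm with h4 | h4
    · rw [finrank_prod_eq] at h4
      exact absurd h4 (by positivity)
    · exact h4
  have hlim : Filter.Tendsto (fun n : ℕ => ∫ y, D (((n : ℝ) + 1)⁻¹ • y + z) * θ y) Filter.atTop
      (nhds (∫ y, D ((0 : ℝ) • y + z) * θ y)) := by
    refine tendsto_integral_of_dominated_convergence (fun y => (M + N) * B *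
      expWeight s₁ s₂ (quasiConst s₁ s₂ * r) z * expWeight s₁ s₂ (-(R - quasiConst s₁ s₂ * r)) y)
      (fun n => ?_) ((integrable_expWeight hs₁ hs₂ (by linarith)).const_mul _) (fun n => ?_) ?_
    · have c : Continuous fun y : V d₁ × V d₂ => D (((n : ℝ) + 1)⁻¹ • y + z) :=
        hDc.comp ((continuous_const_smul _).add continuous_const)
      exact (c.mul hθb.smooth.continuous).aestronglyMeasurable
    · refine Filter.Eventually.of_forall fun y => ?_
      have a1 := hDb (((n : ℝ) + 1)⁻¹ • y + z)
      have a2 := GevreyBound.norm_le hθb y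
      have a3 := expWeight_add_le hs₁ hs₂ hr (((n : ℝ) + 1)⁻¹ • y) z
      have a4 : expWeight s₁ s₂ (quasiConst s₁ s₂ * r) (((n : ℝ) + 1)⁻¹ • y) ≤
          expWeight s₁ s₂ (quasiConst s₁ s₂ * r) y := by
        have hq := one_le_quasiConst hs₁ hs₂
        have a : ∀ {E : Type} [NormedAddCommGroup E] [NormedSpace ℝ E] (v : E),
            ‖((n : ℝ) + 1)⁻¹ • v‖ ≤ ‖v‖ := fun v => by
          rw [norm_smul, Real.norm_of_nonneg (by positivity)]
          exact mul_le_of_le_one_left (norm_nonneg _) (inv_le_one_of_one_le₀ (by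
            have : (0 : ℝ) ≤ n := by positivity
            linarith))
        have b1 := Real.rpow_le_rpow (norm_nonneg _) (a y.1) (one_div_pos.2 hs₁).le
        have b2 := Real.rpow_le_rpow (norm_nonneg _) (a y.2) (one_div_pos.2 hs₂).le
        exact Real.exp_le_exp.2 (mul_le_mul_of_nonneg_left (add_le_add b1 b2) (by positivity))
      have p1 := expWeight_pos s₁ s₂ (quasiConst s₁ s₂ * r) z
      have p2 := expWeight_pos s₁ s₂ (-R) y
      rw [norm_mul]
      calc _ ≤ ((M + N) * (expWeight s₁ s₂ (quasiConst s₁ s₂ * r) y *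
            expWeight s₁ s₂ (quasiConst s₁ s₂ * r) z)) * (B * expWeight s₁ s₂ (-R) y) := by
            refine mul_le_mul (a1.trans (mul_le_mul_of_nonneg_left (a3.trans ?_) hMN)) a2
              (norm_nonneg _) (by have := expWeight_pos s₁ s₂ (quasiConst s₁ s₂ * r) y; positivity)
            exact mul_le_mul_of_nonneg_right a4 p1.le
        _ = (M + N) * B * expWeight s₁ s₂ (quasiConst s₁ s₂ * r) z *
            (expWeight s₁ s₂ (quasiConst s₁ s₂ * r) y * expWeight s₁ s₂ (-R) y) := by ring
        _ = _ := by rw [← expWeight_add]; congr 2; ring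
    · refine Filter.Eventually.of_forall fun y => ?_
      have c : Continuous fun l : ℝ => D (l • y + z) :=
        hDc.comp ((continuous_id.smul continuous_const).add continuous_const)
      have l1 : Filter.Tendsto (fun n : ℕ => ((n : ℝ) + 1)⁻¹) Filter.atTop (nhds 0) := by
        simpa using tendsto_one_div_add_atTop_nhds_zero_nat (𝕜 := ℝ)
      exact ((c.tendsto 0).comp l1).mul_const _
  simp only [key, zero_smul, zero_add] at hlim
  rw [integral_const_mul] at hlim
  have h5 := tendsto_nhds_unique hlim tendsto_const_nhds
  exact sub_eq_zero.1 ((mul_eq_zero.1 h5).resolve_right hθ0)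

end Windows

section Dilation

variable {d₁ d₂ : ℕ} {s₁ s₂ σ₁ σ₂ h R r M l : ℝ} {F : V d₁ × V d₂ → ℂ}

/-- The factor by which the dilation with factor `l` changes the rate of exponential decay. -/
def dilationRate (s₁ s₂ l : ℝ) : ℝ := min (l ^ (1 / s₁)) (l ^ (1 / s₂))

theorem dilationRate_pos (hl : 0 < l) : 0 < dilationRate s₁ s₂ l :=
  lt_min (by positivity) (by positivity)

theorem expWeight_dilationRate_le (hl : 0 < l) (hr : 0 ≤ r) (x : V d₁ × V d₂) :
    expWeight s₁ s₂ (dilationRate s₁ s₂ l * r) x ≤ expWeight s₁ s₂ r (l • x) := by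
  simp only [expWeight, Prod.smul_fst, Prod.smul_snd, norm_smul, Real.norm_of_nonneg hl.le]
  rw [Real.mul_rpow hl.le (norm_nonneg _), Real.mul_rpow hl.le (norm_nonneg _),
    mul_comm (dilationRate s₁ s₂ l), mul_assoc]
  refine Real.exp_le_exp.2 (mul_le_mul_of_nonneg_left ?_ hr)
  rw [mul_add]
  exact add_le_add (mul_le_mul_of_nonneg_right (min_le_left _ _) (by positivity))
    (mul_le_mul_of_nonneg_right (min_le_right _ _) (by positivity))

theorem GSBound.dilate_rate (hl : 0 < l) (hh : 0 < h) (hR : 0 ≤ R)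
    (hF : GSBound s₁ s₂ σ₁ σ₂ h R M F) :
    GSBound s₁ s₂ σ₁ σ₂ (l * h) (dilationRate s₁ s₂ l * R) M (fun x => F (l • x)) := by
  refine (DerivBound.dilate hF l l).mono fun i j x => ?_
  have e1 : |l| ^ i * |l| ^ j * gevrey σ₁ σ₂ h i j = gevrey σ₁ σ₂ (l * h) i j := by
    rw [abs_of_nonneg hl.le, gevrey, gevrey, mul_pow, pow_add]; ring
  have e2 := expWeight_dilationRate_le (s₁ := s₁) (s₂ := s₂) hl hR x
  have e3 : expWeight s₁ s₂ (-R) (l • x) ≤ expWeight s₁ s₂ (-(dilationRate s₁ s₂ l * R)) x := by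
    rw [eq_inv_of_mul_eq_one_left (expWeight_mul_neg R (l • x)),
      eq_inv_of_mul_eq_one_left (expWeight_mul_neg (dilationRate s₁ s₂ l * R) x)]
    exact inv_anti₀ (expWeight_pos _ _ _ _) e2
  rw [e1]
  exact mul_le_mul_of_nonneg_left (mul_le_mul_of_nonneg_left e3 hF.nonneg)
    (gevrey_pos (by positivity) _ _).le

theorem GSBound.exists_narrow (hs₁ : 0 < s₁) (hs₂ : 0 < s₂) (hh : 0 < h) (hR : 0 < R)
    (hF : GSBound s₁ s₂ σ₁ σ₂ h R M F) (Q : ℝ) : ∃ l : ℝ, 0 < l ∧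
      GSBound s₁ s₂ σ₁ σ₂ (l * h) Q M (fun x => F (l • x)) := by
  set q := max (Q / R) 1
  have hq : 0 < q := by positivity
  have key : ∀ s l : ℝ, 0 < s → q ^ s ≤ l → q ≤ l ^ (1 / s) := fun s l hs hl => by
    calc q = (q ^ s) ^ (1 / s) := by
          rw [← Real.rpow_mul hq.le, mul_one_div_cancel hs.ne', Real.rpow_one]
      _ ≤ _ := Real.rpow_le_rpow (by positivity) hl (by positivity)
  set l := max (q ^ s₁) (q ^ s₂)
  have hl : 0 < l := by positivity
  refine ⟨l, hl, (hF.dilate_rate hl hh hR.le).mono (by positivity) le_rfl ?_ le_rfl hF.nonneg⟩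
  have h1 : q ≤ dilationRate s₁ s₂ l :=
    le_min (key s₁ l hs₁ (le_max_left _ _)) (key s₂ l hs₂ (le_max_right _ _))
  calc Q = Q / R * R := (div_mul_cancel₀ _ hR.ne').symm
    _ ≤ _ := mul_le_mul_of_nonneg_right ((le_max_left _ _).trans h1) hR.le

end Dilation

section WindowBounds

variable {d₁ d₂ : ℕ} {s₁ σ₂ σ₁ s₂ h k q h' R R' K N r M : ℝ} {C : V d₂ →L[ℝ] V d₁}
  {f φ F G : V d₁ × V d₂ → ℂ} {V₀ W W' : V d₁ × V d₂ → ℝ}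

/-- Uniform estimates for the images under `symbolShift C` of functions localized by `φ`. -/
def WindowBound (s₁ σ₂ σ₁ s₂ : ℝ) (C : V d₂ →L[ℝ] V d₁) (φ : V d₁ × V d₂ → ℂ)
    (h q h' R' K : ℝ) : Prop :=
  ∀ (f : V d₁ × V d₂ → ℂ) (V₀ : V d₁ × V d₂ → ℝ) (B : ℝ) (y : V d₁ × V d₂),
    GevreyBound σ₁ s₂ h V₀ f → (∀ x, V₀ (x + y) ≤ B * expWeight s₁ σ₂ q x) →
      GSBound s₁ σ₂ σ₁ s₂ h' R' (K * B) (symbolShift C (windowed f φ y))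

namespace Admissible

variable (H : Admissible s₁ σ₂ σ₁ s₂)
include H

theorem windowBound_of_roumieu (C : V d₂ →L[ℝ] V d₁) (hφ : GSBound s₁ σ₂ σ₁ s₂ k R N φ)
    (hk : 0 < k) (hh : 0 < h) (hq : q < R) :
    ∃ h' R' K : ℝ, 0 < h' ∧ 0 < R' ∧ 0 ≤ K ∧ WindowBound s₁ σ₂ σ₁ s₂ C φ h q h' R' K := by
  obtain ⟨h', R', hh', hR', K, hK, HK⟩ := H.mapsGS (ι := Unit) .roumieu (norm_nonneg C)
    (fun _ => C) (fun _ => le_rfl) (h + k) (R - q) (by positivity) (by linarith)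
  refine ⟨h', R', K * N, hh', hR', mul_nonneg hK.le hφ.nonneg, fun f V₀ B y hf hV => ?_⟩
  rw [mul_assoc]
  exact HK () _ _ (hf.windowed H.pos_σ.le H.pos_s.le hh hk hφ hV)

theorem exists_windowBound_of_beurling (C : V d₂ →L[ℝ] V d₁) (q : ℝ) (hh' : 0 < h')
    (hR' : 0 < R') : ∃ h R K : ℝ, 0 < h ∧ 0 < R ∧ 0 < K ∧ ∀ φ N,
      GSBound s₁ σ₂ σ₁ s₂ h (R + q) N φ → WindowBound s₁ σ₂ σ₁ s₂ C φ h q h' R' (K * N) := by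
  obtain ⟨h, R, hh, hR, K, hK, HK⟩ := H.mapsGS (ι := Unit) .beurling (norm_nonneg C)
    (fun _ => C) (fun _ => le_rfl) h' R' hh' hR'
  refine ⟨h / 2, R, K, by positivity, hR, hK, fun φ N hφ f V₀ B y hf hV => ?_⟩
  have h1 := hf.windowed H.pos_σ.le H.pos_s.le (half_pos hh) (half_pos hh) hφ hV
  rw [add_halves, add_sub_cancel_right] at h1
  rw [mul_assoc]
  exact HK () _ _ h1

theorem exists_windowBound_broad (C : V d₂ →L[ℝ] V d₁) (hφ : GSBound s₁ σ₂ σ₁ s₂ k R N φ)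
    (hk : 0 < k) (hR : 0 < R) (hh' : 0 < h') : ∃ l h q R' K : ℝ, 0 < l ∧ 0 < h ∧ 0 < q ∧
      0 < R' ∧ 0 ≤ K ∧ GSBound s₁ σ₂ σ₁ s₂ (l * k) q N (fun x => φ (l • x)) ∧
        WindowBound s₁ σ₂ σ₁ s₂ C (fun x => φ (l • x)) h q h' R' K := by
  have hs₁ := H.pos_s₁
  have hσ₂ := H.pos_σ₂
  obtain ⟨h₁, R₁, hh₁, hR₁, K, hK, HK⟩ := H.mapsGS (ι := Set.Icc (0 : ℝ) 1) .roumieu (norm_nonneg C)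
    (fun i => (i : ℝ) ^ 2 • C) (fun i => by
      rw [norm_smul, norm_pow, Real.norm_of_nonneg i.2.1]
      exact mul_le_of_le_one_left (norm_nonneg _) (pow_le_one₀ i.2.1 i.2.2)) (k + k) (R - R / 2)
    (by positivity) (by linarith)
  set l := min 1 (h' / h₁) with hl
  have hl0 : 0 < l := by positivity
  have hl1 : l ≤ 1 := min_le_left _ _
  have hlh : l * h₁ ≤ h' := by
    calc l * h₁ ≤ h' / h₁ * h₁ := by gcongr; exact min_le_right _ _
      _ = h' := div_mul_cancel₀ _ hh₁.ne'
  set m := dilationRate s₁ σ₂ l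
  have hm0 : 0 < m := dilationRate_pos hl0
  have hw := fun {r : ℝ} (hr : 0 ≤ r) x =>
    expWeight_dilationRate_le (d₁ := d₁) (d₂ := d₂) (s₁ := s₁) (s₂ := σ₂) hl0 hr x
  refine ⟨l, l * k, m * (R / 2), m * R₁, K * N, hl0, by positivity, by positivity, by positivity,
    mul_nonneg hK.le hφ.nonneg, (GSBound.dilate_rate hl0 hk hR.le hφ).mono (by positivity) le_rfl
      (mul_le_mul_of_nonneg_left (by linarith) hm0.le) le_rfl hφ.nonneg, fun f V₀ B y hf hV => ?_⟩
  have hf' : GevreyBound σ₁ s₂ k (fun x => V₀ (l⁻¹ • x + y)) (fun x => f (l⁻¹ • x + y)) := by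
    refine (DerivBound.dilate (DerivBound.translate hf y) l⁻¹ l⁻¹).mono fun i j x => le_of_eq ?_
    rw [abs_of_nonneg (by positivity), gevrey, gevrey, mul_pow, pow_add, inv_pow, inv_pow]
    change _ = k ^ (i + j) * _ * _ * V₀ (dilation l⁻¹ l⁻¹ x + y)
    rw [pow_add k]
    field_simp
  have h2 := hf'.windowed (q := R / 2) (B := B) H.pos_σ.le H.pos_s.le hk hk hφ (y := 0) fun x => by
    have e2 := hw (r := R / 2) (by positivity) (l⁻¹ • x)
    rw [smul_smul, mul_inv_cancel₀ hl0.ne', one_smul] at e2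
    have hB : 0 ≤ B := by
      have := (hf.weight_nonneg (0 + y)).trans (hV 0)
      exact nonneg_of_mul_nonneg_left this (expWeight_pos _ _ _ _)
    simp only [add_zero]
    exact (hV _).trans (mul_le_mul_of_nonneg_left e2 hB)
  have h3 := GSBound.dilate_rate hl0 hh₁ hR₁.le (HK ⟨l, hl0.le, hl1⟩ _ _ h2)
  have h4 := symbolShift_dilate C
    (windowed (fun x => f (l⁻¹ • x + y)) φ 0) hl0
  have h5 : (fun x => windowed (fun x => f (l⁻¹ • x + y)) φ 0 (l • x)) =
      windowed f (fun x => φ (l • x)) y := by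
    funext x
    simp only [windowed, add_zero, smul_smul, inv_mul_cancel₀ hl0.ne', one_smul]
  rw [h5] at h4
  rw [h4, mul_assoc]
  exact GSBound.mono h3 (by positivity) hlh le_rfl le_rfl h3.nonneg

theorem gevreyBound_shiftSum (hb : WindowBound s₁ σ₂ σ₁ s₂ C φ h q h' R' K) (hh' : 0 < h')
    (hK : 0 ≤ K) (hφ : Continuous φ) (hf : GevreyBound σ₁ s₂ h V₀ f)
    (hV : ∀ x y, V₀ (x + y) ≤ W y * expWeight s₁ σ₂ q x) (hr : 0 ≤ r)
    (hrR : quasiConst s₁ σ₂ * r < R') (hW : ∀ x y, W y ≤ W' x * expWeight s₁ σ₂ r (x - y)) :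
    GevreyBound σ₁ s₂ h' (fun x => (∫ y : V d₁ × V d₂, expWeight s₁ σ₂ (-(R' - r)) y) * (K * W' x))
      (shiftSum C φ f) := by
  refine GSBound.superpose H.pos_s₁ H.pos_σ₂ hh' hr hrR
    (fun y => hb f V₀ (W y) y hf fun x => hV x y) (fun x => ?_) fun x y => ?_
  · exact ((stronglyMeasurable_shift_windowed C hf.smooth.continuous hφ).comp_measurable
      (g := fun y => (y, x)) (measurable_id.prodMk measurable_const)).aestronglyMeasurable
  · rw [mul_assoc]
    exact mul_le_mul_of_nonneg_left (hW x y) hK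

end Admissible

/-- Gevrey bounds with a weight of arbitrarily slow exponential growth. -/
def SlowGrowth (s₁ σ₂ σ₁ s₂ h : ℝ) (f : V d₁ × V d₂ → ℂ) : Prop :=
  ∀ r : ℝ, 0 < r → ∃ M : ℝ, GevreyBound σ₁ s₂ h (fun x => M * expWeight s₁ σ₂ r x) f

variable {κ : Kind} {t₁ t₂ τ₁ τ₂ : ℝ} {H₀ : Admissible t₁ τ₂ τ₁ t₂}
  {a b : GSDual κ t₁ τ₂ τ₁ t₂ d₁ d₂}

/-- The function which represents the image of the distribution given by `f`. -/
def shiftFunction (C : V d₂ →L[ℝ] V d₁) (φ f : V d₁ × V d₂ → ℂ) : V d₁ × V d₂ → ℂ :=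
  (∫ x, φ x)⁻¹ • shiftSum C φ f

theorem IsShift.isGivenBy (hab : IsShift H₀ C a b) (H : Admissible s₁ σ₂ σ₁ s₂)
    (hfa : a.IsGivenBy f) (hφ : Rapid φ) (hφ0 : ∫ x, φ x ≠ 0)
    (hg : ∀ g ∈ GS₂ κ t₁ τ₂ τ₁ t₂ d₁ d₂, ∃ h₀ R₀ h' R' h₁ R₁ M N r : ℝ, 0 < h₀ ∧ 0 < R₀ ∧ 0 < h₁ ∧
      0 ≤ r ∧ quasiConst s₁ σ₂ * r < R' ∧ quasiConst s₁ σ₂ * r < R₁ ∧ Continuous f ∧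
      GSBound s₁ σ₂ σ₁ s₂ h₁ R₁ N g ∧ ∃ M₀ : V d₁ × V d₂ → ℝ, ∀ y,
      GSBound s₁ σ₂ σ₁ s₂ h₀ R₀ (M₀ y) (windowed f φ y) ∧
      GSBound s₁ σ₂ σ₁ s₂ h' R' (M * expWeight s₁ σ₂ r y) (symbolShift C (windowed f φ y))) :
    b.IsGivenBy (shiftFunction C φ f) := by
  intro g
  obtain ⟨h₀, R₀, h', R', h₁, R₁, M, N, r, hh₀, hR₀, hh₁, hr, hrR, hrR₁, hf, hgb, M₀, hu⟩ := hg g.1 g.2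
  obtain ⟨e1, e2⟩ := hfa ⟨symbolShift C g.1, H₀.symbolShift_mem C g.2⟩
  obtain ⟨h1, h2⟩ := H.integral_shiftSum hf hφ hr hh₀ hR₀ (fun y => (hu y).1) (fun y => (hu y).2)
    hrR hgb hh₁ hrR₁ e1
  simp only [shiftFunction, Pi.smul_apply, smul_eq_mul, mul_assoc]
  refine ⟨h1.const_mul _, ?_⟩
  rw [hab g, e2, integral_const_mul, h2, inv_mul_cancel_left₀ hφ0]

theorem IsShift.slowGrowth (hab : IsShift H₀ C a b) (H : Admissible s₁ σ₂ σ₁ s₂)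
    (hE : GS₂ κ t₁ τ₂ τ₁ t₂ d₁ d₂ ≤ GS₂ .roumieu s₁ σ₂ σ₁ s₂ d₁ d₂)
    (hfa : a.IsGivenBy f) (hf : SlowGrowth s₁ σ₂ σ₁ s₂ h f) (hh : 0 < h)
    (hφ : GSBound s₁ σ₂ σ₁ s₂ k R N φ) (hk : 0 < k) (hR : 0 < R) (hφ0 : ∫ x, φ x ≠ 0)
    (hb : WindowBound s₁ σ₂ σ₁ s₂ C φ h q h' R' K) (hq : 0 < q) (hh' : 0 < h') (hR' : 0 < R')
    (hK : 0 ≤ K) : b.IsGivenBy (shiftFunction C φ f) ∧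
      SlowGrowth s₁ σ₂ σ₁ s₂ h' (shiftFunction C φ f) := by
  have hc := one_le_quasiConst H.pos_s₁ H.pos_σ₂
  set c := quasiConst s₁ σ₂ with hcdef
  have hc0 : 0 < c := by positivity
  have hV : ∀ r M : ℝ, 0 ≤ r → 0 ≤ M → ∀ Q : ℝ, c * r ≤ Q → ∀ x y : V d₁ × V d₂,
      M * expWeight s₁ σ₂ r (x + y) ≤ M * expWeight s₁ σ₂ (c * r) y * expWeight s₁ σ₂ Q x := by
    intro r M hr hM Q hQ x y
    rw [mul_assoc, mul_comm (expWeight s₁ σ₂ (c * r) y)]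
    refine mul_le_mul_of_nonneg_left ((expWeight_add_le H.pos_s₁ H.pos_σ₂ hr x y).trans ?_) hM
    exact mul_le_mul_of_nonneg_right (expWeight_mono hQ x) (expWeight_pos _ _ _ _).le
  constructor
  · refine hab.isGivenBy H hfa (GevreyBound.rapid H.pos_s₁ H.pos_σ₂ hR hφ) hφ0 fun g hg => ?_
    obtain ⟨h₁, R₁, N₁, hh₁, hR₁, hgb⟩ := H.exists_bound (hE hg)
    obtain ⟨r, hr, hr1, hr2, hr3, hr4⟩ : ∃ r : ℝ, 0 < r ∧ c * (c * r) < R' ∧ c * (c * r) < R₁ ∧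
        c * r ≤ q ∧ c * r ≤ R / 2 := by
      obtain ⟨e, he, h1⟩ : ∃ e : ℝ, 0 < e ∧ e < min (min R' R₁) (min q (R / 2)) :=
        exists_between (by positivity)
      simp only [lt_min_iff] at h1
      have e1 : c * (e / (c * c)) = e / c := by field_simp
      have e2 : e / c ≤ e := div_le_self he.le hc
      refine ⟨e / (c * c), by positivity, ?_, ?_, ?_, ?_⟩ <;> rw [e1]
      · rw [mul_div_cancel₀ _ hc0.ne']; exact h1.1.1
      · rw [mul_div_cancel₀ _ hc0.ne']; exact h1.1.2
      · linarith [h1.2.1]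
      · linarith [h1.2.2]
    obtain ⟨M, hM⟩ := hf r hr
    have hM0 : 0 ≤ M := nonneg_of_mul_nonneg_left (hM.weight_nonneg 0) (expWeight_pos _ _ _ _)
    refine ⟨h + k, R - R / 2, h', R', h₁, R₁, K * M, N₁, c * r, by positivity, by linarith, hh₁,
      by positivity, hr1, hr2, hM.smooth.continuous, hgb, _, fun y => ⟨hM.windowed H.pos_σ.le
        H.pos_s.le hh hk hφ fun x => hV r M hr.le hM0 _ hr4 x y, ?_⟩⟩
    rw [mul_assoc]
    exact hb f _ _ y hM fun x => hV r M hr.le hM0 _ hr3 x y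
  · intro r hr
    obtain ⟨e, he, h1⟩ : ∃ e : ℝ, 0 < e ∧ e < min (min R' r) q := exists_between (by positivity)
    simp only [lt_min_iff] at h1
    set r₀ := e / (c * (c * c))
    have e0 : c * (c * (c * r₀)) = e := by simp only [r₀]; field_simp
    have hr₀ : 0 < r₀ := by positivity
    have e1 : c * (c * r₀) ≤ e := by rw [← e0]; exact le_mul_of_one_le_left (by positivity) hc
    have e2 : c * r₀ ≤ e := (le_mul_of_one_le_left (by positivity) hc).trans e1
    obtain ⟨M, hM⟩ := hf r₀ hr₀
    have hM0 : 0 ≤ M := nonneg_of_mul_nonneg_left (hM.weight_nonneg 0) (expWeight_pos _ _ _ _)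
    have h2 := H.gevreyBound_shiftSum hb hh' hK hφ.smooth.continuous hM (r := c * (c * r₀))
      (W' := fun x => M * expWeight s₁ σ₂ (c * (c * r₀)) x)
      (fun x y => hV r₀ M hr₀.le hM0 q (by linarith [h1.2]) x y) (by positivity)
      (by change c * _ < _; rw [e0]; exact h1.1.1) (fun x y => by
        have h3 := expWeight_add_le H.pos_s₁ H.pos_σ₂ (r := c * r₀) (by positivity) x (y - x)
        rw [add_sub_cancel, ← neg_sub x y, expWeight_neg] at h3
        rw [mul_assoc]
        exact mul_le_mul_of_nonneg_left h3 hM0)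
    refine ⟨‖(∫ x, φ x)⁻¹‖ * ((∫ y : V d₁ × V d₂, expWeight s₁ σ₂ (-(R' - c * (c * r₀))) y) *
      (K * M)), GevreyBound.mono_weight hh' (DerivBound.smul (∫ x, φ x)⁻¹ h2) fun x => ?_⟩
    have hJ : 0 ≤ ∫ y : V d₁ × V d₂, expWeight s₁ σ₂ (-(R' - c * (c * r₀))) y :=
      integral_nonneg fun y => (expWeight_pos _ _ _ _).le
    have h4 : expWeight s₁ σ₂ (c * (c * r₀)) x ≤ expWeight s₁ σ₂ r x :=
      expWeight_mono (by linarith [h1.1.2]) x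
    calc _ = ‖(∫ x, φ x)⁻¹‖ * ((∫ y : V d₁ × V d₂, expWeight s₁ σ₂ (-(R' - c * (c * r₀))) y) *
          (K * M)) * expWeight s₁ σ₂ (c * (c * r₀)) x := by ring
      _ ≤ _ := by gcongr

end WindowBounds

section SymbolClasses

variable {d₁ d₂ : ℕ} {s₁ s₂ σ₁ σ₂ h M : ℝ} {w : V d₁ × V d₂ → ℝ} {f : V d₁ × V d₂ → ℂ}

theorem GevreyBound.nonneg_of_pos (hw : ∀ x, 0 < w x)
    (hf : GevreyBound σ₁ σ₂ h (fun x => M * w x) f) : 0 ≤ M :=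
  nonneg_of_mul_nonneg_left (hf.weight_nonneg 0) (hw 0)

theorem exists_gevreyBound_of_symbolNorm (hw : ∀ x, 0 < w x) (hσ₁ : 0 ≤ σ₁) (hσ₂ : 0 ≤ σ₂)
    (hh : 0 < h) (hf : ContDiff ℝ ∞ f) (hn : symbolNorm σ₁ σ₂ h w f < ⊤) :
    ∃ M, GevreyBound σ₁ σ₂ (dimConst d₁ d₂ * h) (fun x => M * w x) f :=
  ⟨_, gevreyBound_of_symbolNorm hw hσ₁ hσ₂ hh ENNReal.toReal_nonneg hf
    (ENNReal.ofReal_toReal hn.ne).ge⟩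

theorem GevreyBound.symbolNorm_lt_top (hw : ∀ x, 0 < w x) (hσ₁ : 0 ≤ σ₁) (hσ₂ : 0 ≤ σ₂)
    (hh : 0 < h) (hf : GevreyBound σ₁ σ₂ h (fun x => M * w x) f) :
    symbolNorm σ₁ σ₂ (dimConst d₁ d₂ ^ (σ₁ + σ₂) * h) w f < ⊤ :=
  (symbolNorm_le_of_gevreyBound hw hσ₁ hσ₂ hh (hf.nonneg_of_pos hw) hf).trans_lt
    ENNReal.ofReal_lt_top

theorem forall_symbolNorm_lt_top_iff (hw : ∀ x, 0 < w x) (hσ₁ : 0 ≤ σ₁) (hσ₂ : 0 ≤ σ₂) :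
    (ContDiff ℝ ∞ f ∧ ∀ h : ℝ, 0 < h → symbolNorm σ₁ σ₂ h w f < ⊤) ↔
      ∀ h : ℝ, 0 < h → ∃ M, GevreyBound σ₁ σ₂ h (fun x => M * w x) f := by
  have hD := one_le_dimConst d₁ d₂
  constructor
  · rintro ⟨hf, H⟩ h hh
    have := exists_gevreyBound_of_symbolNorm hw hσ₁ hσ₂ (h := h / dimConst d₁ d₂) (by positivity)
      hf (H _ (by positivity))
    rwa [mul_div_cancel₀ _ (by positivity)] at this
  · refine fun H => ⟨(H 1 one_pos).choose_spec.smooth, fun h hh => ?_⟩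
    obtain ⟨M, hM⟩ := H (h / dimConst d₁ d₂ ^ (σ₁ + σ₂)) (by positivity)
    have := hM.symbolNorm_lt_top hw hσ₁ hσ₂ (by positivity)
    rwa [mul_div_cancel₀ _ (by positivity)] at this

theorem mem_GammaLow (hσ₁ : 0 ≤ σ₁) (hσ₂ : 0 ≤ σ₂) :
    f ∈ GammaLow s₁ s₂ σ₁ σ₂ d₁ d₂ ↔ ∃ h : ℝ, 0 < h ∧ SlowGrowth s₁ s₂ σ₁ σ₂ h f := by
  have hD := one_le_dimConst d₁ d₂
  constructor
  · rintro ⟨hf, h, hh, H⟩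
    exact ⟨_, by positivity, fun r hr => exists_gevreyBound_of_symbolNorm
      (expWeight_pos s₁ s₂ r) hσ₁ hσ₂ hh hf (H r hr)⟩
  · rintro ⟨h, hh, H⟩
    refine ⟨(H 1 one_pos).choose_spec.smooth, dimConst d₁ d₂ ^ (σ₁ + σ₂) * h, by positivity,
      fun r hr => ?_⟩
    obtain ⟨M, hM⟩ := H r hr
    exact hM.symbolNorm_lt_top (expWeight_pos s₁ s₂ r) hσ₁ hσ₂ hh

theorem mem_GammaUp (hσ₁ : 0 ≤ σ₁) (hσ₂ : 0 ≤ σ₂) :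
    f ∈ GammaUp s₁ s₂ σ₁ σ₂ d₁ d₂ ↔ ∃ r : ℝ, 0 < r ∧ ∀ h : ℝ, 0 < h → ∃ M : ℝ,
      GevreyBound σ₁ σ₂ h (fun x => M * expWeight s₁ s₂ r x) f := by
  constructor
  · rintro ⟨hf, r, hr, H⟩
    exact ⟨r, hr, (forall_symbolNorm_lt_top_iff (expWeight_pos s₁ s₂ r) hσ₁ hσ₂).1 ⟨hf, H⟩⟩
  · rintro ⟨r, hr, H⟩
    have := (forall_symbolNorm_lt_top_iff (expWeight_pos s₁ s₂ r) hσ₁ hσ₂).2 H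
    exact ⟨this.1, r, hr, this.2⟩

theorem mem_GammaLowUp (hσ₁ : 0 ≤ σ₁) (hσ₂ : 0 ≤ σ₂) :
    f ∈ GammaLowUp s₁ s₂ σ₁ σ₂ d₁ d₂ ↔ ∀ h : ℝ, 0 < h → SlowGrowth s₁ s₂ σ₁ σ₂ h f := by
  constructor
  · rintro ⟨hf, H⟩ h hh r hr
    exact (forall_symbolNorm_lt_top_iff (expWeight_pos s₁ s₂ r) hσ₁ hσ₂).1
      ⟨hf, fun h hh => H h hh r hr⟩ h hh
  · intro H
    exact ⟨(H 1 one_pos 1 one_pos).choose_spec.smooth, fun h hh r hr =>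
      ((forall_symbolNorm_lt_top_iff (expWeight_pos s₁ s₂ r) hσ₁ hσ₂).2
        fun h hh => H h hh r hr).2 h hh⟩

end SymbolClasses

section Representation

variable {d₁ d₂ : ℕ} {κ : Kind} {t₁ t₂ τ₁ τ₂ s₁ σ₂ σ₁ s₂ : ℝ} {C : V d₂ →L[ℝ] V d₁}
  {H₀ : Admissible t₁ τ₂ τ₁ t₂} {a b : GSDual κ t₁ τ₂ τ₁ t₂ d₁ d₂} {f F G φ : V d₁ × V d₂ → ℂ}

theorem GSDual.MemFun.of_trivial {S : Set (V d₁ × V d₂ → ℂ)} (ha : a.MemFun S)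
    (h : ∀ g ∈ GS₂ κ t₁ τ₂ τ₁ t₂ d₁ d₂, g = 0) : b.MemFun S := by
  obtain ⟨f, hf, -⟩ := ha
  refine ⟨f, hf, fun g => ?_⟩
  obtain rfl : g = 0 := Subtype.ext (h g.1 g.2)
  simp

/-- A nonnegative test function which does not vanish identically. -/
structure IsWindow (φ : V d₁ × V d₂ → ℂ) : Prop where
  rapid : Rapid φ
  nonneg : ∀ x, φ x = (‖φ x‖ : ℂ)
  ne_zero : φ ≠ 0

theorem IsWindow.integral_ne_zero (hφ : IsWindow φ) : ∫ x, φ x ≠ 0 := by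
  obtain ⟨z, hz⟩ : ∃ z, φ z ≠ 0 := by
    by_contra hc
    push Not at hc
    exact hφ.ne_zero (funext hc)
  obtain ⟨c, hc, h⟩ := integral_pos_of_nonneg_real hφ.nonneg hφ.rapid.smooth.continuous
    hφ.rapid.integrable (fun x => norm_nonneg _) (norm_ne_zero_iff.2 hz)
  rw [h]
  exact_mod_cast hc.ne'

theorem Admissible.exists_window (H : Admissible t₁ τ₂ τ₁ t₂)
    (h : ∃ g ∈ GS₂ κ t₁ τ₂ τ₁ t₂ d₁ d₂, g ≠ 0) :
    ∃ φ ∈ GS₂ κ t₁ τ₂ τ₁ t₂ d₁ d₂, IsWindow φ := by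
  obtain ⟨g, hg, hg0⟩ := h
  have hm := GS₂_sqNorm H.pos_s₁ H.pos_σ₂ H.pos_σ.le H.pos_s.le hg
  refine ⟨_, hm, H.gsRapid hm, fun x => ?_, fun h0 => hg0 (funext fun x => ?_)⟩
  · rw [sqNorm_apply, Complex.norm_real, Real.norm_of_nonneg (by positivity)]
  · have := congrFun h0 x
    rw [sqNorm_apply] at this
    simpa using this

theorem GSDual.IsGivenBy.unique (H₀ : Admissible t₁ τ₂ τ₁ t₂) (H : Admissible s₁ σ₂ σ₁ s₂)
    (hE : GS₂ κ t₁ τ₂ τ₁ t₂ d₁ d₂ ≤ GS₂ .roumieu s₁ σ₂ σ₁ s₂ d₁ d₂)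
    (hφ : φ ∈ GS₂ κ t₁ τ₂ τ₁ t₂ d₁ d₂) (hφ0 : ∫ x, φ x ≠ 0) (hF : b.IsGivenBy F)
    (hG : b.IsGivenBy G) {h k : ℝ} (hF' : SlowGrowth s₁ σ₂ σ₁ s₂ h F)
    (hG' : SlowGrowth s₁ σ₂ σ₁ s₂ k G) : F = G := by
  have hc := one_le_quasiConst H.pos_s₁ H.pos_σ₂
  obtain ⟨h₁, R, N, hh₁, hR, hb⟩ := H.exists_bound (hE hφ)
  have hr : 0 < R / (quasiConst s₁ σ₂ + 1) := by positivity
  obtain ⟨M, hM⟩ := hF' _ hr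
  obtain ⟨M', hM'⟩ := hG' _ hr
  refine eq_of_integral_mul_eq H₀.pos_s₁ H₀.pos_σ₂ H₀.pos_σ.le H₀.pos_s.le H.pos_s₁ H.pos_σ₂
    hM.smooth.continuous hM'.smooth.continuous hr.le (fun x => GevreyBound.norm_le hM x)
    (fun x => GevreyBound.norm_le hM' x) hφ hb ?_ hφ0 fun g hg => ?_
  · rw [← mul_div_assoc, div_lt_iff₀ (by positivity)]
    nlinarith
  · have h1 := hF ⟨g, hg⟩
    have h2 := hG ⟨g, hg⟩
    exact ⟨h1.1, h2.1, h1.2.symm.trans h2.2⟩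

theorem IsShift.exists_slowGrowth (hab : IsShift H₀ C a b) (H : Admissible s₁ σ₂ σ₁ s₂)
    (hE : GS₂ κ t₁ τ₂ τ₁ t₂ d₁ d₂ ≤ GS₂ .roumieu s₁ σ₂ σ₁ s₂ d₁ d₂)
    (hφ : φ ∈ GS₂ κ t₁ τ₂ τ₁ t₂ d₁ d₂) (hφ0 : ∫ x, φ x ≠ 0) {h : ℝ} (hh : 0 < h)
    (hfa : a.IsGivenBy f) (hf : SlowGrowth s₁ σ₂ σ₁ s₂ h f) :
    ∃ F, b.IsGivenBy F ∧ ∃ k : ℝ, 0 < k ∧ SlowGrowth s₁ σ₂ σ₁ s₂ k F := by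
  obtain ⟨k, R, N, hk, hR, hb⟩ := H.exists_bound (hE hφ)
  obtain ⟨h', R', K, hh', hR', hK, hw⟩ := H.windowBound_of_roumieu C hb hk hh
    (q := R / 2) (by linarith)
  obtain ⟨h1, h2⟩ := hab.slowGrowth H hE hfa hf hh hb hk hR hφ0 hw (by positivity) hh' hR' hK
  exact ⟨_, h1, h', hh', h2⟩

theorem IsShift.exists_slowGrowth_small (hab : IsShift H₀ C a b) (H : Admissible s₁ σ₂ σ₁ s₂)
    (hE : GS₂ κ t₁ τ₂ τ₁ t₂ d₁ d₂ ≤ GS₂ .roumieu s₁ σ₂ σ₁ s₂ d₁ d₂)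
    (hφ : φ ∈ GS₂ κ t₁ τ₂ τ₁ t₂ d₁ d₂) (hφ0 : ∫ x, φ x ≠ 0) (hfa : a.IsGivenBy f)
    (hf : ∀ h : ℝ, 0 < h → SlowGrowth s₁ σ₂ σ₁ s₂ h f) :
    ∃ F, b.IsGivenBy F ∧ ∀ h : ℝ, 0 < h → SlowGrowth s₁ σ₂ σ₁ s₂ h F := by
  obtain ⟨k, R, N, hk, hR, hb⟩ := H.exists_bound (hE hφ)
  have key : ∀ h : ℝ, 0 < h → ∃ F, b.IsGivenBy F ∧ SlowGrowth s₁ σ₂ σ₁ s₂ h F := by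
    intro h' hh'
    obtain ⟨l, h, q, R', K, hl, hh, hq, hR', hK, h1, hw⟩ :=
      H.exists_windowBound_broad C hb hk hR hh'
    refine ⟨_, hab.slowGrowth H hE hfa (hf h hh) hh h1 (by positivity) hq ?_ hw hq hh' hR' hK⟩
    rw [Measure.integral_comp_smul]
    exact smul_ne_zero (by positivity) hφ0
  obtain ⟨F, hF, hF'⟩ := key 1 one_pos
  refine ⟨F, hF, fun h hh => ?_⟩
  obtain ⟨G, hG, hG'⟩ := key h hh
  rwa [hF.unique H₀ H hE hφ hφ0 hG hF' hG']

/-- The weights `v`, `W`, `W'` vary moderately with respect to translations. -/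
structure IsModerate (s₁ σ₂ r : ℝ) (v W W' : V d₁ × V d₂ → ℝ) : Prop where
  nonneg : 0 ≤ r
  left : ∀ x y, v (x + y) ≤ W y * expWeight s₁ σ₂ r x
  right : ∀ x y, W y ≤ W' x * expWeight s₁ σ₂ r (x - y)

variable {v W W' : V d₁ × V d₂ → ℝ} {r : ℝ}

theorem Admissible.exists_gevreyBound_shiftFunction (H : Admissible s₁ σ₂ σ₁ s₂)
    (hv : IsModerate s₁ σ₂ r v W W') (hv0 : ∀ x, 0 < v x) {h q h' R' K : ℝ}
    (hb : WindowBound s₁ σ₂ σ₁ s₂ C φ h q h' R' K) (hq : r ≤ q) (hh' : 0 < h') (hK : 0 ≤ K)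
    (hR' : quasiConst s₁ σ₂ * r < R') (hφ : Continuous φ) {M : ℝ}
    (hf : GevreyBound σ₁ s₂ h (fun x => M * v x) f) :
    ∃ N, GevreyBound σ₁ s₂ h' (fun x => N * W' x) (shiftFunction C φ f) := by
  have hM := hf.nonneg_of_pos hv0
  have hW : ∀ y, 0 ≤ W y := fun y => nonneg_of_mul_nonneg_left ((hv0 (0 + y)).le.trans (hv.left 0 y))
    (expWeight_pos _ _ _ _)
  have h1 := H.gevreyBound_shiftSum hb hh' hK hφ hf (W := fun y => M * W y)
    (W' := fun x => M * W' x) (fun x y => by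
      rw [mul_assoc]
      exact mul_le_mul_of_nonneg_left ((hv.left x y).trans
        (mul_le_mul_of_nonneg_left (expWeight_mono hq x) (hW y))) hM) hv.nonneg hR' (fun x y => by
      rw [mul_assoc]
      exact mul_le_mul_of_nonneg_left (hv.right x y) hM)
  refine ⟨‖(∫ x, φ x)⁻¹‖ * ((∫ y : V d₁ × V d₂, expWeight s₁ σ₂ (-(R' - r)) y) * (K * M)),
    GevreyBound.mono_weight hh' (DerivBound.smul (∫ x, φ x)⁻¹ h1) fun x => le_of_eq ?_⟩
  ring

theorem IsShift.exists_moderate (hab : IsShift H₀ C a b) (H : Admissible s₁ σ₂ σ₁ s₂)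
    (hE : GS₂ κ t₁ τ₂ τ₁ t₂ d₁ d₂ ≤ GS₂ .beurling s₁ σ₂ σ₁ s₂ d₁ d₂)
    (hφ : φ ∈ GS₂ κ t₁ τ₂ τ₁ t₂ d₁ d₂) (hφ0 : ∫ x, φ x ≠ 0) (hv : IsModerate s₁ σ₂ r v W W')
    (hv0 : ∀ x, 0 < v x) (hfa : a.IsGivenBy f)
    (hf : ∀ h : ℝ, 0 < h → ∃ M, GevreyBound σ₁ s₂ h (fun x => M * v x) f) :
    ∃ F, b.IsGivenBy F ∧ ∀ h : ℝ, 0 < h → ∃ M, GevreyBound σ₁ s₂ h (fun x => M * W' x) F := by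
  have hc := one_le_quasiConst H.pos_s₁ H.pos_σ₂
  have hr := hv.nonneg
  have hbd := fun {g} (hg : g ∈ GS₂ κ t₁ τ₂ τ₁ t₂ d₁ d₂) =>
    (mem_GS₂_beurling H.pos_s₁ H.pos_σ₂ H.pos_σ.le H.pos_s.le).1 (hE hg)
  refine ⟨shiftFunction C φ f, hab.isGivenBy H hfa (H₀.gsRapid hφ) hφ0 fun g hg => ?_,
    fun h' hh' => ?_⟩
  · obtain ⟨h, R, K, hh, hR, hK, hw⟩ := H.exists_windowBound_of_beurling C r one_pos
      (show 0 < quasiConst s₁ σ₂ * r + 1 by positivity)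
    obtain ⟨N, hN⟩ := hbd hφ h (R + r) hh (by positivity)
    obtain ⟨M, hM⟩ := hf h hh
    obtain ⟨N', hN'⟩ := hbd hg 1 (quasiConst s₁ σ₂ * r + 1) one_pos (by positivity)
    have hM0 := hM.nonneg_of_pos hv0
    have hl : ∀ x y, M * v (x + y) ≤ (M * W' 0 * expWeight s₁ σ₂ r y) * expWeight s₁ σ₂ r x :=
      fun x y => by
        have h1 := hv.right 0 y
        rw [zero_sub, expWeight_neg] at h1
        rw [mul_assoc M, mul_assoc M]
        exact mul_le_mul_of_nonneg_left ((hv.left x y).trans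
          (mul_le_mul_of_nonneg_right h1 (expWeight_pos _ _ _ _).le)) hM0
    have hu : ∀ y, GSBound s₁ σ₂ σ₁ s₂ (h + h) R (N * (M * W' 0 * expWeight s₁ σ₂ r y))
        (windowed f φ y) := fun y => by
      have := hM.windowed H.pos_σ.le H.pos_s.le hh hh hN fun x => hl x y
      rwa [add_sub_cancel_right] at this
    refine ⟨h + h, R, 1, quasiConst s₁ σ₂ * r + 1, 1, quasiConst s₁ σ₂ * r + 1, K * N * (M * W' 0), N', r,
      by positivity, hR, one_pos, hr, by linarith, by linarith, hM.smooth.continuous, hN', _,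
      fun y => ⟨hu y, by rw [mul_assoc (K * N)]; exact hw φ N hN f _ _ y hM fun x => hl x y⟩⟩
  · obtain ⟨h, R, K, hh, hR, hK, hw⟩ := H.exists_windowBound_of_beurling C r hh'
      (show 0 < quasiConst s₁ σ₂ * r + 1 by positivity)
    obtain ⟨N, hN⟩ := hbd hφ h (R + r) hh (by positivity)
    obtain ⟨M, hM⟩ := hf h hh
    exact H.exists_gevreyBound_shiftFunction hv hv0 (hw φ N hN) le_rfl hh'
      (mul_nonneg hK.le hN.nonneg) (by linarith) hN.smooth.continuous hM

theorem isModerate_expWeight (hs₁ : 0 < s₁) (hσ₂ : 0 < σ₂) (hr : 0 ≤ r) :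
    IsModerate (d₁ := d₁) (d₂ := d₂) s₁ σ₂ (quasiConst s₁ σ₂ * (quasiConst s₁ σ₂ * r))
      (expWeight s₁ σ₂ r) (expWeight s₁ σ₂ (quasiConst s₁ σ₂ * r))
      (expWeight s₁ σ₂ (quasiConst s₁ σ₂ * (quasiConst s₁ σ₂ * r))) := by
  have hc := one_le_quasiConst hs₁ hσ₂
  refine ⟨by positivity, fun x y => ?_, fun x y => ?_⟩
  · rw [mul_comm]
    refine (expWeight_add_le hs₁ hσ₂ hr x y).trans (mul_le_mul_of_nonneg_right
      (expWeight_mono (le_mul_of_one_le_left (by positivity) hc) x) (expWeight_pos _ _ _ _).le)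
  · have h3 := expWeight_add_le hs₁ hσ₂ (r := quasiConst s₁ σ₂ * r) (by positivity) x (y - x)
    rwa [add_sub_cancel, ← neg_sub x y, expWeight_neg] at h3

theorem IsPWeight.isModerate {d : ℕ} {s σ : ℝ} {w : V d × V d → ℝ} (hw : IsPWeight s σ w) :
    ∃ r B : ℝ, 0 < r ∧ 0 < B ∧ IsModerate s σ r w (fun x => B * w x) (fun x => B * (B * w x)) := by
  obtain ⟨r, D, hr, hD, hb⟩ := hw.bounds
  obtain ⟨K, hK⟩ := hw.isSubmultiplicative.submul
  have hp := hw.isWeight.pos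
  have hK0 : 0 < K := pos_of_mul_pos_left ((hp _).trans_le (hK 0 0)) (mul_pos (hp 0) (hp 0)).le
  have h1 : ∀ x y, w (x + y) ≤ K * D * w y * expWeight s σ r x := fun x y => by
    have := hp y
    calc _ ≤ K * (w x * w y) := hK x y
      _ ≤ K * (D * expWeight s σ r x * w y) := by gcongr; exact (hb x).2
      _ = _ := by ring
  refine ⟨r, K * D, hr, by positivity, hr.le, h1, fun x y => ?_⟩
  have h2 := h1 (y - x) x
  rw [sub_add_cancel, ← neg_sub x y, expWeight_neg] at h2
  rw [mul_assoc (K * D) (K * D * w x)]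
  exact mul_le_mul_of_nonneg_left h2 (by positivity)

end Representation

section Interpolation

variable {d₁ d₂ : ℕ} {s₁ s₂ σ₁ σ₂ h k θ : ℝ} {W V₀ : V d₁ × V d₂ → ℝ}
  {f g F v : V d₁ × V d₂ → ℂ}

theorem exists_add_rpow_le {p δ : ℝ} (hp : 0 < p) (hδ : 0 < δ) : ∃ K : ℝ, 0 < K ∧
    ∀ a b : ℝ, 0 ≤ a → 0 ≤ b → (a + b) ^ p ≤ (1 + δ) * a ^ p + K * b ^ p := by
  set η := (1 + δ) ^ (1 / p) - 1 with hη
  have hη0 : 0 < η := by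
    have := Real.one_lt_rpow (show 1 < 1 + δ by linarith) (one_div_pos.2 hp)
    linarith
  refine ⟨(η⁻¹ + 1) ^ p, by positivity, fun a b ha hb => ?_⟩
  rcases le_total b (η * a) with hba | hba
  · have h1 : (a + b) ^ p ≤ ((1 + η) * a) ^ p :=
      Real.rpow_le_rpow (by positivity) (by linarith) hp.le
    have h2 : (1 + η) ^ p = 1 + δ := by
      rw [hη, add_sub_cancel, ← Real.rpow_mul (by positivity), one_div_mul_cancel hp.ne',
        Real.rpow_one]
    rw [Real.mul_rpow (by positivity) ha, h2] at h1
    have : 0 ≤ (η⁻¹ + 1) ^ p * b ^ p := by positivity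
    linarith
  · have h0 : a ≤ η⁻¹ * b := by
      rw [inv_mul_eq_div, le_div_iff₀ hη0]; linarith
    have h1 : (a + b) ^ p ≤ ((η⁻¹ + 1) * b) ^ p :=
      Real.rpow_le_rpow (by positivity) (by linarith) hp.le
    rw [Real.mul_rpow (by positivity) hb] at h1
    have : 0 ≤ (1 + δ) * a ^ p := by positivity
    linarith

theorem exists_expWeight_add_le (d₁ d₂ : ℕ) (hs₁ : 0 < s₁) (hs₂ : 0 < s₂) {δ : ℝ} (hδ : 0 < δ) :
    ∃ K : ℝ, 0 < K ∧ ∀ r : ℝ, 0 ≤ r → ∀ x y : V d₁ × V d₂,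
      expWeight s₁ s₂ r (x + y) ≤ expWeight s₁ s₂ ((1 + δ) * r) x * expWeight s₁ s₂ (K * r) y := by
  obtain ⟨K₁, hK₁, h₁⟩ := exists_add_rpow_le (one_div_pos.2 hs₁) hδ
  obtain ⟨K₂, hK₂, h₂⟩ := exists_add_rpow_le (one_div_pos.2 hs₂) hδ
  refine ⟨K₁ + K₂, by positivity, fun r hr x y => ?_⟩
  simp only [expWeight, ← Real.exp_add, Prod.fst_add, Prod.snd_add]
  refine Real.exp_le_exp.2 ?_
  have a1 := (Real.rpow_le_rpow (norm_nonneg _) (norm_add_le x.1 y.1) (one_div_pos.2 hs₁).le).trans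
    (h₁ _ _ (norm_nonneg _) (norm_nonneg _))
  have a2 := (Real.rpow_le_rpow (norm_nonneg _) (norm_add_le x.2 y.2) (one_div_pos.2 hs₂).le).trans
    (h₂ _ _ (norm_nonneg _) (norm_nonneg _))
  have p1 : 0 ≤ K₂ * ‖y.1‖ ^ (1 / s₁) := by positivity
  have p2 : 0 ≤ K₁ * ‖y.2‖ ^ (1 / s₂) := by positivity
  calc _ ≤ r * ((1 + δ) * ‖x.1‖ ^ (1 / s₁) + K₁ * ‖y.1‖ ^ (1 / s₁) +
        ((1 + δ) * ‖x.2‖ ^ (1 / s₂) + K₂ * ‖y.2‖ ^ (1 / s₂)) +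
        (K₂ * ‖y.1‖ ^ (1 / s₁) + K₁ * ‖y.2‖ ^ (1 / s₂))) :=
        mul_le_mul_of_nonneg_left (by linarith) hr
    _ = _ := by ring

theorem expWeight_rpow (r θ : ℝ) (x : V d₁ × V d₂) :
    expWeight s₁ s₂ r x ^ θ = expWeight s₁ s₂ (r * θ) x := by
  rw [expWeight, ← Real.exp_mul, expWeight]; congr 1; ring

theorem gevrey_rpow_mul (hh : 0 < h) (hk : 0 < k) (m n : ℕ) :
    gevrey σ₁ σ₂ h m n ^ (1 - θ) * gevrey σ₁ σ₂ k m n ^ θ =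
      gevrey σ₁ σ₂ (h ^ (1 - θ) * k ^ θ) m n := by
  have hm : 0 < (m.factorial : ℝ) := by exact_mod_cast m.factorial_pos
  have hn : 0 < (n.factorial : ℝ) := by exact_mod_cast n.factorial_pos
  have e : ∀ b : ℝ, 0 < b → b ^ (1 - θ) * b ^ θ = b := fun b hb => by
    rw [← Real.rpow_add hb, sub_add_cancel, Real.rpow_one]
  unfold gevrey
  rw [Real.mul_rpow (by positivity) (by positivity), Real.mul_rpow (by positivity) (by positivity),
    Real.mul_rpow (by positivity) (by positivity), Real.mul_rpow (by positivity) (by positivity),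
    mul_pow, ← Real.rpow_natCast, ← Real.rpow_natCast, ← Real.rpow_mul hh.le, ← Real.rpow_mul hk.le,
    ← Real.rpow_natCast, ← Real.rpow_natCast, ← Real.rpow_mul hh.le, ← Real.rpow_mul hk.le,
    mul_comm (1 - θ), mul_comm θ]
  calc _ = h ^ (((m + n : ℕ) : ℝ) * (1 - θ)) * k ^ (((m + n : ℕ) : ℝ) * θ) *
        (((m.factorial : ℝ) ^ σ₁) ^ (1 - θ) * ((m.factorial : ℝ) ^ σ₁) ^ θ) *
        (((n.factorial : ℝ) ^ σ₂) ^ (1 - θ) * ((n.factorial : ℝ) ^ σ₂) ^ θ) := by ring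
    _ = _ := by rw [e _ (by positivity), e _ (by positivity)]

/-- Geometric means of Gevrey bounds. -/
theorem GevreyBound.interpolate (hh : 0 < h) (hk : 0 < k) (hθ : 0 ≤ θ) (hθ1 : θ ≤ 1)
    (hF : GevreyBound σ₁ σ₂ h W F) (hF' : GevreyBound σ₁ σ₂ k V₀ F) :
    GevreyBound σ₁ σ₂ (h ^ (1 - θ) * k ^ θ) (fun x => W x ^ (1 - θ) * V₀ x ^ θ) F := by
  refine ⟨hF.smooth, fun l₁ l₂ h₁ h₂ x => ?_⟩
  have b1 := hF.bound l₁ l₂ h₁ h₂ x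
  have b2 := hF'.bound l₁ l₂ h₁ h₂ x
  have hN := norm_nonneg (listDeriv (dirList l₁ l₂) F x)
  have g1 := gevrey_pos (σ₁ := σ₁) (σ₂ := σ₂) hh l₁.length l₂.length
  have g2 := gevrey_pos (σ₁ := σ₁) (σ₂ := σ₂) hk l₁.length l₂.length
  have w1 := GevreyBound.weight_nonneg hF x
  have w2 := GevreyBound.weight_nonneg hF' x
  calc _ = ‖listDeriv (dirList l₁ l₂) F x‖ ^ (1 - θ) * ‖listDeriv (dirList l₁ l₂) F x‖ ^ θ := by
        rw [← Real.rpow_add_of_nonneg hN (by linarith) hθ, sub_add_cancel, Real.rpow_one]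
    _ ≤ (gevrey σ₁ σ₂ h l₁.length l₂.length * W x) ^ (1 - θ) *
        (gevrey σ₁ σ₂ k l₁.length l₂.length * V₀ x) ^ θ :=
      mul_le_mul (Real.rpow_le_rpow hN b1 (by linarith)) (Real.rpow_le_rpow hN b2 hθ)
        (by positivity) (by positivity)
    _ = (gevrey σ₁ σ₂ h l₁.length l₂.length ^ (1 - θ) *
        gevrey σ₁ σ₂ k l₁.length l₂.length ^ θ) * (W x ^ (1 - θ) * V₀ x ^ θ) := by
      rw [Real.mul_rpow g1.le w1, Real.mul_rpow g2.le w2]; ring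
    _ = _ := by rw [gevrey_rpow_mul hh hk]

theorem Rapid.integral_listDeriv_mul (l : List (V d₁ × V d₂)) : ∀ {f g : V d₁ × V d₂ → ℂ},
    Rapid f → Rapid g →
      ∫ x, listDeriv l f x * g x = (-1) ^ l.length * ∫ x, f x * listDeriv l g x := by
  induction l with
  | nil => intro f g _ _; simp
  | cons v l ih =>
    intro f g hf hg
    have hl := hf.list l
    have h1 := integral_mul_fderiv_eq_neg_fderiv_mul_of_integrable (μ := volume) (v := v)
      ((hl.dir v).integrable_mul hg) (hl.integrable_mul (hg.dir v)) (hl.integrable_mul hg)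
      (fun x _ => hl.smooth.differentiable (by simp) x)
      (fun x _ => hg.smooth.differentiable (by simp) x)
    rw [listDeriv_cons' _ _ hg.smooth, List.length_cons, pow_succ, mul_assoc, mul_comm (-1 : ℂ),
      mul_comm _ (-1 : ℂ), neg_one_mul, mul_neg, ← ih hf (hg.dir v)]
    exact (neg_eq_iff_eq_neg.2 h1).symm

theorem Rapid.conj (hf : Rapid f) : Rapid fun x => (starRingEnd ℂ) (f x) :=
  ⟨Complex.conjCLE.contDiff.comp hf.smooth, fun l n => by
    obtain ⟨c, hc⟩ := hf.decay l n
    exact ⟨c, fun x => by rw [listDeriv_conj l hf.smooth, RCLike.norm_conj]; exact hc x⟩⟩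

theorem Rapid.integral_norm_sq_le (hf : Rapid f) (l : List (V d₁ × V d₂)) {B : ℝ}
    (hB : ∀ x, ‖listDeriv (l ++ l) f x‖ ≤ B) :
    Integrable (fun x => ‖listDeriv l f x‖ ^ 2) ∧
      ∫ x, ‖listDeriv l f x‖ ^ 2 ≤ (∫ x, ‖f x‖) * B := by
  have hl := hf.list l
  have e : ∀ x, listDeriv l f x * (starRingEnd ℂ) (listDeriv l f x) =
      ((‖listDeriv l f x‖ ^ 2 : ℝ) : ℂ) := fun x => by
    rw [Complex.mul_conj, Complex.normSq_eq_norm_sq]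
  have hi := hl.integrable_mul hl.conj
  have h1 := Rapid.integral_listDeriv_mul l hf hl.conj
  simp only [e] at hi h1
  have e2 : ∀ x, ‖((‖listDeriv l f x‖ ^ 2 : ℝ) : ℂ)‖ = ‖listDeriv l f x‖ ^ 2 := fun x => by
    rw [Complex.norm_real, Real.norm_of_nonneg (by positivity)]
  refine ⟨hi.norm.congr (Filter.Eventually.of_forall e2), ?_⟩
  rw [listDeriv_conj l hl.smooth, ← listDeriv_append, integral_complex_ofReal] at h1
  calc ∫ x, ‖listDeriv l f x‖ ^ 2 = ‖((∫ x, ‖listDeriv l f x‖ ^ 2 : ℝ) : ℂ)‖ := by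
        rw [Complex.norm_real, Real.norm_of_nonneg (integral_nonneg fun x => by positivity)]
    _ ≤ ∫ x, ‖f x‖ * B := by
        rw [h1, norm_mul, norm_pow, norm_neg, norm_one, one_pow, one_mul]
        refine norm_integral_le_of_norm_le (hf.integrable.norm.mul_const B)
          (Filter.Eventually.of_forall fun x => ?_)
        rw [norm_mul, RCLike.norm_conj]
        exact mul_le_mul_of_nonneg_left (hB x) (norm_nonneg _)
    _ = _ := integral_mul_const _ _

theorem norm_pow_le_integral_sq {L : ℝ} (hL : 0 < L)
    (hv : ∀ x y, ‖v x - v y‖ ≤ L * ‖x - y‖) (hi : Integrable fun x => ‖v x‖ ^ 2)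
    (x₀ : V d₁ × V d₂) :
    ‖v x₀‖ ^ (d₁ + d₂ + 2) * volume.real (Metric.ball (0 : V d₁ × V d₂) 1) ≤
      4 * (2 * L) ^ (d₁ + d₂) * ∫ x, ‖v x‖ ^ 2 := by
  rcases (norm_nonneg (v x₀)).eq_or_lt with h0 | h0
  · rw [← h0, zero_pow (by simp), zero_mul]
    exact mul_nonneg (by positivity) (integral_nonneg fun x => by positivity)
  set a := ‖v x₀‖ with ha
  set ρ := a / (2 * L) with hρ
  have hρ0 : 0 < ρ := by positivity
  have hvol : volume.real (Metric.ball x₀ ρ) =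
      ρ ^ (d₁ + d₂) * volume.real (Metric.ball (0 : V d₁ × V d₂) 1) := by
    rw [measureReal_def, Measure.addHaar_ball_of_pos _ _ hρ0, ENNReal.toReal_mul,
      ENNReal.toReal_ofReal (by positivity), finrank_prod_eq, measureReal_def]
  have h1 : (a / 2) ^ 2 * volume.real (Metric.ball x₀ ρ) ≤ ∫ x, ‖v x‖ ^ 2 := by
    calc _ = ∫ _ in Metric.ball x₀ ρ, (a / 2) ^ 2 := by
          rw [setIntegral_const, smul_eq_mul, mul_comm]
      _ ≤ ∫ x in Metric.ball x₀ ρ, ‖v x‖ ^ 2 := by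
          refine setIntegral_mono_on (integrableOn_const (measure_ball_lt_top.ne)) hi.integrableOn
            measurableSet_ball fun x hx => pow_le_pow_left₀ (by positivity) ?_ 2
          have e1 := hv x₀ x
          have e2 : L * ‖x₀ - x‖ ≤ a / 2 := by
            rw [← dist_eq_norm, dist_comm]
            calc _ ≤ L * ρ := by gcongr; exact (Metric.mem_ball.1 hx).le
              _ = _ := by rw [hρ]; field_simp
          have e3 := norm_sub_norm_le (v x₀) (v x)
          linarith
      _ ≤ _ := setIntegral_le_integral hi (Filter.Eventually.of_forall fun x => by positivity)
  rw [hvol] at h1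
  calc _ = 4 * (2 * L) ^ (d₁ + d₂) * ((a / 2) ^ 2 * (ρ ^ (d₁ + d₂) *
        volume.real (Metric.ball (0 : V d₁ × V d₂) 1))) := by
        rw [hρ, div_pow, div_pow, pow_add]
        field_simp
        ring
    _ ≤ _ := mul_le_mul_of_nonneg_left h1 (by positivity)

theorem DerivBound.list {a : ℕ → ℕ → ℝ} (hF : DerivBound a V₀ F) {l₁ : List (V d₁)}
    {l₂ : List (V d₂)} (h₁ : UnitList l₁) (h₂ : UnitList l₂) :
    DerivBound (fun i j => a (i + l₁.length) (j + l₂.length)) V₀ (listDeriv (dirList l₁ l₂) F) := by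
  refine ⟨listDeriv_smooth _ hF.smooth, fun k₁ k₂ u₁ u₂ x => ?_⟩
  have p : (dirList k₁ k₂ ++ dirList l₁ l₂).Perm (dirList (k₁ ++ l₁) (k₂ ++ l₂)) := by
    simp only [dirList, List.map_append, List.append_assoc]
    refine List.Perm.append_left _ ?_
    rw [← List.append_assoc, ← List.append_assoc]
    exact List.Perm.append_right _ List.perm_append_comm
  have u : ∀ {d : ℕ} {l l' : List (V d)}, UnitList l → UnitList l' → UnitList (l ++ l') :=
    fun hl hl' v hv => (List.mem_append.1 hv).elim (hl v) (hl' v)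
  rw [← listDeriv_append, listDeriv_perm p hF.smooth]
  simpa using hF.bound _ _ (u u₁ h₁) (u u₂ h₂) x

theorem factorial_add_rpow_le {σ : ℝ} (hσ : 0 ≤ σ) (i m : ℕ) :
    ((i + m).factorial : ℝ) ^ σ ≤
      (2 ^ σ) ^ (i + m) * (i.factorial : ℝ) ^ σ * (m.factorial : ℝ) ^ σ := by
  have h1 : ((i + m).factorial : ℝ) ≤ 2 ^ (i + m) * i.factorial * m.factorial := by
    have h2 := Nat.add_choose_mul_factorial_mul_factorial i m
    rw [← h2]
    push_cast
    have h3 : ((i + m).choose m : ℝ) ≤ 2 ^ (i + m) := by exact_mod_cast Nat.choose_le_two_pow _ _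
    gcongr
  refine (Real.rpow_le_rpow (by positivity) h1 hσ).trans (le_of_eq ?_)
  rw [Real.mul_rpow (by positivity) (by positivity), Real.mul_rpow (by positivity) (by positivity),
    Real.rpow_pow_comm (by norm_num)]

theorem factorial_two_mul_rpow_le {σ : ℝ} (hσ : 0 ≤ σ) (m : ℕ) :
    ((m + m).factorial : ℝ) ^ σ ≤ ((2 ^ σ) ^ m * (m.factorial : ℝ) ^ σ) ^ 2 :=
  (factorial_add_rpow_le hσ m m).trans (le_of_eq (by ring))

theorem gevrey_add_self_le (hσ₁ : 0 ≤ σ₁) (hσ₂ : 0 ≤ σ₂) (hh : 0 < h) (m n : ℕ) :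
    gevrey σ₁ σ₂ h (m + m) (n + n) ≤ gevrey σ₁ σ₂ (2 ^ (σ₁ + σ₂) * h) m n ^ 2 := by
  have h1 := factorial_two_mul_rpow_le hσ₁ m
  have h2 := factorial_two_mul_rpow_le hσ₂ n
  have e1 : (2 : ℝ) ^ σ₁ ≤ 2 ^ (σ₁ + σ₂) :=
    Real.rpow_le_rpow_of_exponent_le (by norm_num) (by linarith)
  have e2 : (2 : ℝ) ^ σ₂ ≤ 2 ^ (σ₁ + σ₂) :=
    Real.rpow_le_rpow_of_exponent_le (by norm_num) (by linarith)
  unfold gevrey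
  calc _ ≤ h ^ (m + m + (n + n)) * ((2 ^ (σ₁ + σ₂)) ^ m * (m.factorial : ℝ) ^ σ₁) ^ 2 *
        ((2 ^ (σ₁ + σ₂)) ^ n * (n.factorial : ℝ) ^ σ₂) ^ 2 := by
        refine mul_le_mul (mul_le_mul_of_nonneg_left (h1.trans ?_) (by positivity)) (h2.trans ?_)
          (by positivity) (by positivity) <;> gcongr
    _ = _ := by
      generalize (2 : ℝ) ^ (σ₁ + σ₂) = c
      ring

/-- An interpolation inequality for functions with small mean value. -/
theorem GevreyBound.interpolate_integral (hσ₁ : 0 ≤ σ₁) (hσ₂ : 0 ≤ σ₂) (hh : 0 < h) {A a : ℝ}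
    (hA : 0 < A) (hF : GevreyBound σ₁ σ₂ h (fun _ => A) F) (hr : Rapid F) (ha : ∫ x, ‖F x‖ ≤ a) :
    GevreyBound σ₁ σ₂ (2 ^ (σ₁ + σ₂) * h) (fun _ => (4 * (4 * h) ^ (d₁ + d₂) /
      volume.real (Metric.ball (0 : V d₁ × V d₂) 1) * (A ^ (d₁ + d₂ + 1) * a)) ^
        (1 / ((d₁ : ℝ) + d₂ + 2))) F := by
  have hb : 0 < volume.real (Metric.ball (0 : V d₁ × V d₂) 1) := by
    rw [measureReal_def]
    exact ENNReal.toReal_pos (Metric.measure_ball_pos _ _ one_pos).ne' measure_ball_lt_top.ne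
  have ha0 : 0 ≤ a := (integral_nonneg fun x => norm_nonneg _).trans ha
  set b := volume.real (Metric.ball (0 : V d₁ × V d₂) 1)
  refine ⟨hF.smooth, fun l₁ l₂ h₁ h₂ x₀ => ?_⟩
  set m := l₁.length with hm
  set n := l₂.length with hn
  set γ := gevrey σ₁ σ₂ (2 ^ (σ₁ + σ₂) * h) m n with hγ
  have hγ0 : 0 < γ := gevrey_pos (by positivity) _ _
  set v := listDeriv (dirList l₁ l₂) F with hv
  have hvs : ContDiff ℝ ∞ v := listDeriv_smooth _ hF.smooth
  have hd : ∀ x z, ‖fderiv ℝ v x z‖ ≤ 2 * h * γ * A * ‖z‖ := by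
    intro x z
    obtain ⟨u₁, hu₁, e₁⟩ := exists_unit_smul z.1
    obtain ⟨u₂, hu₂, e₂⟩ := exists_unit_smul z.2
    have b1 : ‖dirDeriv (u₁, 0) v x‖ ≤ h * γ * A := by
      have := hF.bound (u₁ :: l₁) l₂ (h₁.cons hu₁) h₂ x
      rw [dirList_cons_left] at this
      exact this.trans (mul_le_mul_of_nonneg_right (gevrey_succ_left_le hσ₁ hσ₂ hh m n) hA.le)
    have b2 : ‖dirDeriv (0, u₂) v x‖ ≤ h * γ * A := by
      have := hF.bound l₁ (u₂ :: l₂) h₁ (h₂.cons hu₂) x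
      rw [listDeriv_perm (dirList_cons_right u₂ l₁ l₂) hF.smooth] at this
      exact this.trans (mul_le_mul_of_nonneg_right (gevrey_succ_right_le hσ₁ hσ₂ hh m n) hA.le)
    have ez : z = ‖z.1‖ • ((u₁, 0) : V d₁ × V d₂) + ‖z.2‖ • ((0, u₂) : V d₁ × V d₂) := by
      ext1
      · simpa using e₁
      · simpa using e₂
    have e3 : fderiv ℝ v x z = ‖z.1‖ • dirDeriv (u₁, 0) v x + ‖z.2‖ • dirDeriv (0, u₂) v x := by
      conv_lhs => rw [ez]
      rw [map_add, map_smul, map_smul]; rfl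
    rw [e3]
    refine (norm_add_le _ _).trans ?_
    rw [norm_smul, norm_smul, norm_norm, norm_norm]
    have c1 := mul_le_mul (norm_fst_le z) b1 (norm_nonneg _) (norm_nonneg _)
    have c2 := mul_le_mul (norm_snd_le z) b2 (norm_nonneg _) (norm_nonneg _)
    linarith
  have hlip : ∀ x y, ‖v x - v y‖ ≤ 2 * h * γ * A * ‖x - y‖ := fun x y =>
    convex_univ.norm_image_sub_le_of_norm_fderiv_le (𝕜 := ℝ)
      (fun x _ => hvs.differentiable (by simp) x)
      (fun x _ => ContinuousLinearMap.opNorm_le_bound _ (by positivity) (hd x))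
      (Set.mem_univ y) (Set.mem_univ x)
  have hB : ∀ x, ‖listDeriv (dirList l₁ l₂ ++ dirList l₁ l₂) F x‖ ≤ γ ^ 2 * A := by
    intro x
    rw [listDeriv_append]
    exact ((DerivBound.list hF h₁ h₂).bound _ _ h₁ h₂ x).trans
      (mul_le_mul_of_nonneg_right (gevrey_add_self_le hσ₁ hσ₂ hh m n) hA.le)
  obtain ⟨i1, i2⟩ := hr.integral_norm_sq_le (dirList l₁ l₂) hB
  have h3 := norm_pow_le_integral_sq (L := 2 * h * γ * A) (by positivity) hlip i1 x₀
  have h4 : ‖v x₀‖ ^ (d₁ + d₂ + 2) ≤ γ ^ (d₁ + d₂ + 2) *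
      (4 * (4 * h) ^ (d₁ + d₂) / b * (A ^ (d₁ + d₂ + 1) * a)) := by
    rw [← mul_le_mul_iff_left₀ hb]
    calc _ ≤ _ := h3
      _ ≤ 4 * (2 * (2 * h * γ * A)) ^ (d₁ + d₂) * (a * (γ ^ 2 * A)) := by
        refine mul_le_mul_of_nonneg_left (i2.trans ?_) (by positivity)
        exact mul_le_mul_of_nonneg_right ha (by positivity)
      _ = _ := by
        rw [show 2 * (2 * h * γ * A) = (4 * h) * γ * A by ring, mul_pow, mul_pow (4 * h)]
        field_simp
        ring
  set Z := 4 * (4 * h) ^ (d₁ + d₂) / b * (A ^ (d₁ + d₂ + 1) * a)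
  have hZ : 0 ≤ Z := by positivity
  have hD : (d₁ : ℝ) + d₂ + 2 = ((d₁ + d₂ + 2 : ℕ) : ℝ) := by push_cast; ring
  have h5 := Real.rpow_le_rpow (by positivity) h4 (show 0 ≤ 1 / ((d₁ : ℝ) + d₂ + 2) by positivity)
  rw [Real.mul_rpow (by positivity) hZ, hD, one_div,
    Real.pow_rpow_inv_natCast (norm_nonneg _) (by simp),
    Real.pow_rpow_inv_natCast hγ0.le (by simp)] at h5
  rw [hD, one_div]
  exact h5

end Interpolation

section Growth

variable {d₁ d₂ : ℕ} {s₁ s₂ σ₁ σ₂ k R N r ε : ℝ} {f φ : V d₁ × V d₂ → ℂ}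

theorem expWeight_neg_mul_le (hs₁ : 0 < s₁) (hs₂ : 0 < s₂) (hr : 0 ≤ r) (x y : V d₁ × V d₂) :
    expWeight s₁ s₂ (-(quasiConst s₁ s₂ * r)) x * expWeight s₁ s₂ (-(quasiConst s₁ s₂ * r)) y ≤
      expWeight s₁ s₂ (-r) (x + y) := by
  rw [eq_inv_of_mul_eq_one_left (expWeight_mul_neg (quasiConst s₁ s₂ * r) x),
    eq_inv_of_mul_eq_one_left (expWeight_mul_neg (quasiConst s₁ s₂ * r) y), ← mul_inv,
    eq_inv_of_mul_eq_one_left (expWeight_mul_neg r (x + y))]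
  exact inv_anti₀ (expWeight_pos _ _ _ _) (expWeight_add_le hs₁ hs₂ hr x y)

theorem IsWindow.exists_minorant (hw : IsWindow φ) (hs₁ : 0 < s₁) (hs₂ : 0 < s₂) (hk : 0 < k)
    (hR : 0 < R) (hφ : GSBound s₁ s₂ σ₁ σ₂ k R N φ) (hε : 0 < ε) :
    ∃ (ψ : V d₁ × V d₂ → ℂ) (δ M c : ℝ), 0 < δ ∧ 0 < c ∧ GSBound s₁ s₂ σ₁ σ₂ k δ M ψ ∧
      ∀ x, c * expWeight s₁ s₂ (-ε) x ≤ ‖ψ x‖ := by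
  have hq := one_le_quasiConst hs₁ hs₂
  set q := quasiConst s₁ s₂
  have hq0 : 0 < q := by positivity
  obtain ⟨η, hη, hη'⟩ : ∃ η : ℝ, 0 < η ∧ η < min R ε := exists_between (by positivity)
  rw [lt_min_iff] at hη'
  set δ := η / (q * q)
  have hδ : 0 < δ := by positivity
  have hδη : q * (q * δ) = η := by simp only [δ]; field_simp
  have hcont : ∀ a : ℝ, Continuous (expWeight s₁ s₂ a : V d₁ × V d₂ → ℝ) :=
    continuous_expWeight hs₁ hs₂
  have hφc := hw.rapid.smooth.continuous
  have hsup := GSBound.superpose (W := fun y => ‖(expWeight s₁ s₂ (-(q * δ)) y : ℂ)‖ * N)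
    (W' := fun x => N * expWeight s₁ s₂ (-δ) x)
    (w := fun y => (expWeight s₁ s₂ (-(q * δ)) y : ℂ) • φ) hs₁ hs₂ hk (r := q * δ) (by positivity)
    (by change q * _ < _; rw [hδη]; exact hη'.1) (fun y => hφ.smul _) (fun x => by
      have c1 : Continuous fun y : V d₁ × V d₂ => (expWeight s₁ s₂ (-(q * δ)) y : ℂ) * φ (x - y) :=
        (Complex.continuous_ofReal.comp (hcont _)).mul (hφc.comp (continuous_const.sub continuous_id))
      exact c1.aestronglyMeasurable) fun x y => by
      have h1 := expWeight_neg_add_le hs₁ hs₂ hδ.le x (y - x)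
      rw [add_sub_cancel, ← neg_sub x y, expWeight_neg] at h1
      rw [Complex.norm_real, Real.norm_of_nonneg (expWeight_pos _ _ _ _).le, mul_comm _ N, mul_assoc]
      exact mul_le_mul_of_nonneg_left h1 hφ.nonneg
  obtain ⟨z, hz⟩ : ∃ z, φ z ≠ 0 := by
    by_contra hc
    push Not at hc
    exact hw.ne_zero (funext hc)
  have hint : ∀ G : V d₁ × V d₂ → ℝ, Continuous G → (∀ y, |G y| ≤ 1) →
      Integrable fun y => G y * ‖φ y‖ := fun G hG hG1 =>
    hw.rapid.integrable.norm.bdd_mul (c := 1) hG.aestronglyMeasurable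
      (Filter.Eventually.of_forall hG1)
  have habs : ∀ {a : ℝ}, 0 ≤ a → ∀ y : V d₁ × V d₂, |expWeight s₁ s₂ (-a) y| ≤ 1 := fun ha y => by
    rw [abs_of_pos (expWeight_pos _ _ _ _)]; exact expWeight_neg_le_one ha y
  have hc0 : 0 < ∫ y, expWeight s₁ s₂ (-η) y * ‖φ y‖ :=
    integral_pos_of_integrable_nonneg_nonzero (x := z) ((hcont _).mul hφc.norm)
      (hint _ (hcont _) (habs hη.le)) (fun y => mul_nonneg (expWeight_pos _ _ _ _).le (norm_nonneg _))
      (mul_ne_zero (expWeight_pos _ _ _ _).ne' (norm_ne_zero_iff.2 hz))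
  refine ⟨superpose fun y => (expWeight s₁ s₂ (-(q * δ)) y : ℂ) • φ, δ, _, _, hδ, hc0,
    hsup.mono fun m n x => by rw [← mul_assoc (integral _ _)], fun x => ?_⟩
  set G : V d₁ × V d₂ → ℝ := fun y => expWeight s₁ s₂ (-(q * δ)) (x - y) * ‖φ y‖
  have e1 : superpose (fun y => (expWeight s₁ s₂ (-(q * δ)) y : ℂ) • φ) x = ((∫ y, G y : ℝ) : ℂ) := by
    rw [← integral_sub_left_eq_self G volume x, ← integral_complex_ofReal]
    simp only [superpose, G, sub_sub_cancel, Pi.smul_apply, smul_eq_mul]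
    congr 1
    funext y
    rw [hw.nonneg (x - y)]
    push_cast
    simp
  rw [e1, Complex.norm_real]
  refine le_trans ?_ (le_abs_self _)
  calc _ ≤ (∫ y, expWeight s₁ s₂ (-η) y * ‖φ y‖) * expWeight s₁ s₂ (-η) x :=
        mul_le_mul_of_nonneg_left (expWeight_mono (by linarith [hη'.2]) x) hc0.le
    _ = ∫ y, expWeight s₁ s₂ (-η) y * ‖φ y‖ * expWeight s₁ s₂ (-η) x := (integral_mul_const _ _).symm
    _ ≤ ∫ y, G y := by
      refine integral_mono ((hint _ (hcont _) (habs hη.le)).mul_const _)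
        (hint _ ((hcont _).comp (continuous_const.sub continuous_id))
          fun y => habs (by positivity) _) fun y => ?_
      have h1 := expWeight_neg_mul_le hs₁ hs₂ (r := q * δ) (by positivity) x (-y)
      change expWeight s₁ s₂ (-(q * (q * δ))) x * expWeight s₁ s₂ (-(q * (q * δ))) (-y) ≤ _ at h1
      rw [hδη, expWeight_neg, ← sub_eq_add_neg] at h1
      change expWeight s₁ s₂ (-η) y * ‖φ y‖ * expWeight s₁ s₂ (-η) x ≤ _
      calc _ = expWeight s₁ s₂ (-η) x * expWeight s₁ s₂ (-η) y * ‖φ y‖ := by ring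
        _ ≤ _ := mul_le_mul_of_nonneg_right h1 (norm_nonneg _)

theorem IsWindow.integrable_norm_mul (hw : IsWindow φ) (hs₁ : 0 < s₁) (hs₂ : 0 < s₂)
    (hσ₁ : 0 ≤ σ₁) (hσ₂ : 0 ≤ σ₂) (hk : 0 < k) (hR : 0 < R) (hφ : GSBound s₁ s₂ σ₁ σ₂ k R N φ)
    (hf : Continuous f)
    (hfg : ∀ g ∈ GS₂ .roumieu s₁ s₂ σ₁ σ₂ d₁ d₂, Integrable fun x => f x * g x) (hε : 0 < ε) :
    Integrable fun x => ‖f x‖ * expWeight s₁ s₂ (-ε) x := by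
  obtain ⟨ψ, δ, M, c, hδ, hc, hψ, hb⟩ := hw.exists_minorant hs₁ hs₂ hk hR hφ hε
  have h1 := hfg ψ ((mem_GS₂_roumieu hs₁ hs₂ hσ₁ hσ₂).2 ⟨k, δ, M, hk, hδ, hψ⟩)
  refine (h1.norm.const_mul c⁻¹).mono'
    (hf.norm.mul (continuous_expWeight hs₁ hs₂ _)).aestronglyMeasurable
    (Filter.Eventually.of_forall fun x => ?_)
  have p := expWeight_pos s₁ s₂ (-ε) x
  rw [Real.norm_of_nonneg (by positivity), norm_mul]
  calc _ = c⁻¹ * (‖f x‖ * (c * expWeight s₁ s₂ (-ε) x)) := by field_simp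
    _ ≤ _ := by gcongr; exact hb x

theorem superpose_windowed (x : V d₁ × V d₂) :
    superpose (windowed f φ) x = (∫ y, φ y) * f x := by
  have e : ∀ y, windowed f φ y (x - y) = f x * φ (x - y) := fun y => by simp [windowed]
  simp only [superpose, e]
  rw [integral_const_mul, integral_sub_left_eq_self φ volume x, mul_comm]

set_option maxHeartbeats 600000 in
/-- Improvement of the rate of growth, for one Gevrey rate. -/
theorem IsWindow.exists_rate_slower (hw : IsWindow φ) (hs₁ : 0 < s₁) (hs₂ : 0 < s₂)
    (hσ₁ : 0 ≤ σ₁) (hσ₂ : 0 ≤ σ₂) (hk : 0 < k) (hR : 0 < R) (hφ : GSBound s₁ s₂ σ₁ σ₂ k R N φ)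
    (hI : ∀ ε : ℝ, 0 < ε → Integrable fun x => ‖f x‖ * expWeight s₁ s₂ (-ε) x) (hr : 0 < r)
    (hf : ∀ h : ℝ, 0 < h → ∃ M, GevreyBound σ₁ σ₂ h (fun x => M * expWeight s₁ s₂ r x) f)
    {β : ℝ} (hβ : β = 1 / (9 * ((d₁ : ℝ) + d₂ + 2))) : ∃ k' M : ℝ, 0 < k' ∧
      GevreyBound σ₁ σ₂ k' (fun x => M * expWeight s₁ s₂ ((1 - 4 * β) * r) x) f := by
  have hq := one_le_quasiConst hs₁ hs₂
  set q := quasiConst s₁ s₂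
  have hq0 : 0 < q := by positivity
  have hβ0 : 0 < β := by rw [hβ]; positivity
  have hβ1 : β ≤ 1 / 18 := by
    rw [hβ]
    exact one_div_le_one_div_of_le (by norm_num) (by
      have : (0 : ℝ) ≤ d₁ := by positivity
      have : (0 : ℝ) ≤ d₂ := by positivity
      linarith)
  have hβd : 1 / ((d₁ : ℝ) + d₂ + 2) = 9 * β := by rw [hβ]; field_simp
  obtain ⟨K, hK, hadd⟩ := exists_expWeight_add_le d₁ d₂ hs₁ hs₂ hβ0
  set Q := (q * (K * r) + 1) / β + r with hQ
  have hQ0 : 0 < Q := by positivity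
  obtain ⟨l, hl, hψ⟩ := hφ.exists_narrow hs₁ hs₂ hk hR (K * r + Q)
  set ψ : V d₁ × V d₂ → ℂ := fun x => φ (l • x) with hψdef
  have hψ0 : ∫ x, ψ x ≠ 0 := by
    rw [hψdef, Measure.integral_comp_smul]
    exact smul_ne_zero (by positivity) hw.integral_ne_zero
  obtain ⟨M₀, hM₀⟩ := hf 1 one_pos
  have hM₀0 := hM₀.nonneg_of_pos (expWeight_pos s₁ s₂ r)
  have hN := hφ.nonneg
  set A := N * M₀ + 1 with hA
  have hA0 : 0 < A := by positivity
  set k' := 1 + l * k with hk'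
  have hk'0 : 0 < k' := by positivity
  have hu : ∀ y, GSBound s₁ s₂ σ₁ σ₂ k' Q (A * expWeight s₁ s₂ ((1 + β) * r) y)
      (windowed f ψ y) := by
    intro y
    have p := expWeight_pos s₁ s₂ ((1 + β) * r) y
    have h1 := hM₀.windowed (q := K * r) (B := M₀ * expWeight s₁ s₂ ((1 + β) * r) y)
      hσ₁ hσ₂ one_pos (by positivity) hψ (y := y) fun x => by
        rw [mul_assoc, add_comm x]
        exact mul_le_mul_of_nonneg_left (hadd r hr.le y x) hM₀0
    rw [add_sub_cancel_left] at h1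
    refine GSBound.mono h1 hk'0 le_rfl le_rfl ?_ h1.nonneg
    rw [← mul_assoc]
    exact mul_le_mul_of_nonneg_right (by linarith) p.le
  have hfc := hM₀.smooth.continuous
  set ε := r / (9 * q) with hε
  have hε0 : 0 < ε := by positivity
  have hqε : q * ε = r / 9 := by rw [hε]; field_simp
  set J := ∫ x, ‖f x‖ * expWeight s₁ s₂ (-ε) x with hJ
  have hJ0 : 0 ≤ J := integral_nonneg fun x => mul_nonneg (norm_nonneg _) (expWeight_pos _ _ _ _).le
  have ha : ∀ y, ∫ x, ‖windowed f ψ y x‖ ≤ N * J * expWeight s₁ s₂ (r / 9) y := by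
    intro y
    have e2 := integral_add_right_eq_self (μ := (volume : Measure (V d₁ × V d₂)))
      (fun x => ‖f x‖ * expWeight s₁ s₂ (-ε) x) y
    rw [hJ, ← e2, ← integral_const_mul, ← integral_mul_const]
    refine integral_mono (GevreyBound.rapid hs₁ hs₂ hQ0 (hu y)).integrable.norm
      ((((hI ε hε0).comp_add_right y).const_mul N).mul_const _) fun x => ?_
    have h1 := GevreyBound.norm_le hψ x
    have h2 := expWeight_neg_mul_le hs₁ hs₂ hε0.le (x + y) (-y)
    have h3 := expWeight_add_le hs₁ hs₂ hε0.le x y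
    change _ ≤ expWeight s₁ s₂ (q * ε) x * expWeight s₁ s₂ (q * ε) y at h3
    rw [hqε] at h3
    have p1 := expWeight_pos s₁ s₂ (-ε) (x + y)
    have p2 := expWeight_pos s₁ s₂ (r / 9) y
    have p3 := expWeight_pos s₁ s₂ (-(K * r + Q)) x
    have h4 : expWeight s₁ s₂ (r / 9) x * expWeight s₁ s₂ (-(K * r + Q)) x ≤ 1 := by
      rw [← expWeight_add]
      have h5 : 0 ≤ (q * (K * r) + 1) / β := by positivity
      have := expWeight_neg_le_one (s₁ := s₁) (s₂ := s₂) (r := K * r + Q - r / 9) (by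
        have : 0 ≤ K * r := by positivity
        linarith) x
      convert this using 2
      ring
    change ‖f (x + y) * ψ x‖ ≤ N * (‖f (x + y)‖ * expWeight s₁ s₂ (-ε) (x + y)) * expWeight s₁ s₂ (r / 9) y
    rw [norm_mul]
    calc ‖f (x + y)‖ * ‖ψ x‖ ≤ ‖f (x + y)‖ * (N * expWeight s₁ s₂ (-(K * r + Q)) x) := by gcongr
      _ = N * ‖f (x + y)‖ * (expWeight s₁ s₂ (-ε) (x + y) * expWeight s₁ s₂ ε (x + y)) *
          expWeight s₁ s₂ (-(K * r + Q)) x := by rw [expWeight_mul_neg]; ring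
      _ ≤ N * ‖f (x + y)‖ * (expWeight s₁ s₂ (-ε) (x + y) *
          (expWeight s₁ s₂ (r / 9) x * expWeight s₁ s₂ (r / 9) y)) *
          expWeight s₁ s₂ (-(K * r + Q)) x := by gcongr
      _ = N * (‖f (x + y)‖ * expWeight s₁ s₂ (-ε) (x + y)) * expWeight s₁ s₂ (r / 9) y *
          (expWeight s₁ s₂ (r / 9) x * expWeight s₁ s₂ (-(K * r + Q)) x) := by ring
      _ ≤ _ := mul_le_of_le_one_right (by positivity) h4
  set D : ℕ := d₁ + d₂ with hD
  set c₁ := 4 * (4 * k') ^ D / volume.real (Metric.ball (0 : V d₁ × V d₂) 1)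
  have hc₁ : 0 ≤ c₁ := div_nonneg (by positivity) measureReal_nonneg
  set k₂ := 2 ^ (σ₁ + σ₂) * k' with hk₂
  have hk₂0 : 0 < k₂ := by positivity
  set Z := c₁ * (A ^ (D + 1) * (N * J)) with hZ
  have hZ0 : 0 ≤ Z := by positivity
  have hpt : ∀ y, GevreyBound σ₁ σ₂ k₂
      (fun _ => Z ^ (9 * β) * expWeight s₁ s₂ ((1 - 7 * β) * r) y) (windowed f ψ y) := by
    intro y
    have p := expWeight_pos s₁ s₂ ((1 + β) * r) y
    have h1 : GevreyBound σ₁ σ₂ k' (fun _ => A * expWeight s₁ s₂ ((1 + β) * r) y) (windowed f ψ y) :=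
      GevreyBound.mono_weight hk'0 (hu y) fun x =>
        mul_le_of_le_one_right (by positivity) (expWeight_neg_le_one hQ0.le x)
    have h2 := GevreyBound.interpolate_integral hσ₁ hσ₂ hk'0 (by positivity) h1
      (GevreyBound.rapid hs₁ hs₂ hQ0 (hu y)) (ha y)
    refine GevreyBound.mono_weight hk₂0 h2 fun x => ?_
    rw [hβd]
    have e1 : expWeight s₁ s₂ ((1 + β) * r) y ^ (D + 1) * expWeight s₁ s₂ (r / 9) y =
        expWeight s₁ s₂ ((1 + β) * r * ((D + 1 : ℕ) : ℝ) + r / 9) y := by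
      rw [← Real.rpow_natCast, expWeight_rpow, ← expWeight_add]
    have e2 : c₁ * ((A * expWeight s₁ s₂ ((1 + β) * r) y) ^ (D + 1) *
        (N * J * expWeight s₁ s₂ (r / 9) y)) =
        Z * expWeight s₁ s₂ ((1 + β) * r * ((D + 1 : ℕ) : ℝ) + r / 9) y := by
      rw [← e1, hZ]; ring_nf
    change (c₁ * _) ^ (9 * β) ≤ _
    rw [e2, Real.mul_rpow hZ0 (expWeight_pos _ _ _ _).le, expWeight_rpow]
    refine mul_le_mul_of_nonneg_left (expWeight_mono ?_ y) (by positivity)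
    have e3 : ((D + 1 : ℕ) : ℝ) * (9 * β) = 1 - 9 * β := by
      rw [← hβd, hD]; push_cast; field_simp; ring
    have e4 : ((1 + β) * r * ((D + 1 : ℕ) : ℝ) + r / 9) * (9 * β) =
        ((1 + β) * (1 - 9 * β) + β) * r := by
      rw [← e3]; ring
    rw [e4]
    refine mul_le_mul_of_nonneg_right ?_ hr.le
    nlinarith
  set k₃ := k₂ ^ (1 - β) * k' ^ β with hk₃
  have hk₃0 : 0 < k₃ := by positivity
  set c₂ := (Z ^ (9 * β)) ^ (1 - β) * A ^ β with hc₂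
  have hc₂0 : 0 ≤ c₂ := by positivity
  have hv : ∀ y, GSBound s₁ s₂ σ₁ σ₂ k₃ (β * Q) (c₂ * expWeight s₁ s₂ ((1 - 5 * β) * r) y)
      (windowed f ψ y) := by
    intro y
    have h1 := GevreyBound.interpolate hk₂0 hk'0 hβ0.le (by linarith) (hpt y) (hu y)
    refine GevreyBound.mono_weight hk₃0 h1 fun x => ?_
    have p := expWeight_pos s₁ s₂ ((1 + β) * r) y
    have p' := expWeight_pos s₁ s₂ (-Q) x
    rw [Real.mul_rpow (by positivity) (expWeight_pos _ _ _ _).le, expWeight_rpow,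
      Real.mul_rpow (by positivity) p'.le, Real.mul_rpow hA0.le p.le, expWeight_rpow, expWeight_rpow]
    have e1 : -Q * β = -(β * Q) := by ring
    rw [e1]
    calc _ = c₂ * (expWeight s₁ s₂ ((1 - 7 * β) * r * (1 - β)) y *
          expWeight s₁ s₂ ((1 + β) * r * β) y) * expWeight s₁ s₂ (-(β * Q)) x := by rw [hc₂]; ring
      _ ≤ _ := by
        rw [← expWeight_add]
        refine mul_le_mul_of_nonneg_right (mul_le_mul_of_nonneg_left (expWeight_mono ?_ y) hc₂0)
          (expWeight_pos _ _ _ _).le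
        have e2 : (1 - 7 * β) * r * (1 - β) + (1 + β) * r * β =
          ((1 - 7 * β) * (1 - β) + (1 + β) * β) * r := by ring
        rw [e2]
        refine mul_le_mul_of_nonneg_right ?_ hr.le
        nlinarith
  set ρ := (1 - 5 * β) * r with hρ
  have hρ0 : 0 ≤ ρ := mul_nonneg (by linarith) hr.le
  have hρr : ρ ≤ r := mul_le_of_le_one_left hr.le (by linarith)
  have hsup := GSBound.superpose (W' := fun x => c₂ * expWeight s₁ s₂ ((1 + β) * ρ) x) hs₁ hs₂ hk₃0
    (r := K * ρ) (by positivity) (by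
      have e1 : β * Q = q * (K * r) + 1 + β * r := by rw [hQ]; field_simp
      have e2 : q * (K * ρ) ≤ q * (K * r) := by gcongr
      change q * _ < _
      have : 0 ≤ β * r := by positivity
      linarith) hv (fun x => by
      have c1 : Continuous fun y : V d₁ × V d₂ => f (x - y + y) * φ (l • (x - y)) :=
        (hfc.comp ((continuous_const.sub continuous_id).add continuous_id)).mul
          (hw.rapid.smooth.continuous.comp ((continuous_const.sub continuous_id).const_smul l))
      exact c1.aestronglyMeasurable) fun x y => by
      have h1 := hadd ρ hρ0 x (y - x)
      rw [add_sub_cancel, ← neg_sub x y, expWeight_neg] at h1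
      rw [mul_assoc c₂ (expWeight s₁ s₂ ((1 + β) * ρ) x)]
      exact mul_le_mul_of_nonneg_left h1 hc₂0
  have e3 : (∫ y, ψ y)⁻¹ • superpose (windowed f ψ) = f := by
    funext x
    rw [Pi.smul_apply, superpose_windowed, smul_eq_mul, inv_mul_cancel_left₀ hψ0]
  have hslow := DerivBound.smul (∫ y, ψ y)⁻¹ hsup
  rw [e3] at hslow
  set c₃ := ‖(∫ y, ψ y)⁻¹‖ * ((∫ y : V d₁ × V d₂, expWeight s₁ s₂ (-(β * Q - K * ρ)) y) * c₂)
  have hc₃ : 0 ≤ c₃ := mul_nonneg (norm_nonneg _) (mul_nonneg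
    (integral_nonneg fun y => (expWeight_pos _ _ _ _).le) hc₂0)
  refine ⟨k₃, c₃, hk₃0, GevreyBound.mono_weight hk₃0 hslow fun x => ?_⟩
  have h1 : expWeight s₁ s₂ ((1 + β) * ρ) x ≤ expWeight s₁ s₂ ((1 - 4 * β) * r) x := by
    refine expWeight_mono ?_ x
    rw [hρ, ← mul_assoc]
    exact mul_le_mul_of_nonneg_right (by nlinarith) hr.le
  calc _ = c₃ * expWeight s₁ s₂ ((1 + β) * ρ) x := by ring
    _ ≤ _ := mul_le_mul_of_nonneg_left h1 hc₃
/-- Improvement of the rate of growth. -/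
theorem IsWindow.exists_bound_slower (hw : IsWindow φ) (hs₁ : 0 < s₁) (hs₂ : 0 < s₂)
    (hσ₁ : 0 ≤ σ₁) (hσ₂ : 0 ≤ σ₂) (hk : 0 < k) (hR : 0 < R) (hφ : GSBound s₁ s₂ σ₁ σ₂ k R N φ)
    (hI : ∀ ε : ℝ, 0 < ε → Integrable fun x => ‖f x‖ * expWeight s₁ s₂ (-ε) x) (hr : 0 < r)
    (hf : ∀ h : ℝ, 0 < h → ∃ M, GevreyBound σ₁ σ₂ h (fun x => M * expWeight s₁ s₂ r x) f)
    {β : ℝ} (hβ : β = 1 / (9 * ((d₁ : ℝ) + d₂ + 2))) (hβ0 : 0 < β) (hβ1 : β ≤ 1 / 2) {h : ℝ}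
    (hh : 0 < h) : ∃ M, GevreyBound σ₁ σ₂ h (fun x => M * expWeight s₁ s₂ ((1 - β) * r) x) f := by
  obtain ⟨k₃, c₃, hk₃0, hslow⟩ :=
    hw.exists_rate_slower hs₁ hs₂ hσ₁ hσ₂ hk hR hφ hI hr hf hβ
  have hc₃ := hslow.nonneg_of_pos (expWeight_pos s₁ s₂ _)
  set h' := (h / k₃ ^ (1 - β)) ^ β⁻¹ with hh'
  have hh'0 : 0 < h' := by positivity
  obtain ⟨M, hM⟩ := hf h' hh'0
  have hM0 := hM.nonneg_of_pos (expWeight_pos s₁ s₂ r)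
  have hfin := GevreyBound.interpolate hk₃0 hh'0 hβ0.le (by linarith) hslow hM
  have e4 : k₃ ^ (1 - β) * h' ^ β = h := by
    rw [hh', ← Real.rpow_mul (by positivity), inv_mul_cancel₀ hβ0.ne', Real.rpow_one,
      mul_div_cancel₀ _ (by positivity)]
  rw [e4] at hfin
  refine ⟨c₃ ^ (1 - β) * M ^ β, GevreyBound.mono_weight hh hfin fun x => ?_⟩
  rw [Real.mul_rpow hc₃ (expWeight_pos _ _ _ _).le, Real.mul_rpow hM0 (expWeight_pos _ _ _ _).le,
    expWeight_rpow, expWeight_rpow]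
  calc _ = c₃ ^ (1 - β) * M ^ β * (expWeight s₁ s₂ ((1 - 4 * β) * r * (1 - β)) x *
        expWeight s₁ s₂ (r * β) x) := by ring
    _ ≤ _ := by
      rw [← expWeight_add]
      refine mul_le_mul_of_nonneg_left (expWeight_mono ?_ x) (by positivity)
      have e5 : (1 - 4 * β) * r * (1 - β) + r * β = ((1 - 4 * β) * (1 - β) + β) * r := by ring
      rw [e5]
      exact mul_le_mul_of_nonneg_right (by nlinarith) hr.le

theorem IsWindow.slowGrowth (hw : IsWindow φ) (hs₁ : 0 < s₁) (hs₂ : 0 < s₂)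
    (hσ₁ : 0 ≤ σ₁) (hσ₂ : 0 ≤ σ₂) (hφ : φ ∈ GS₂ .roumieu s₁ s₂ σ₁ σ₂ d₁ d₂)
    (hfg : ∀ g ∈ GS₂ .roumieu s₁ s₂ σ₁ σ₂ d₁ d₂, Integrable fun x => f x * g x) (hr : 0 < r)
    (hf : ∀ h : ℝ, 0 < h → ∃ M, GevreyBound σ₁ σ₂ h (fun x => M * expWeight s₁ s₂ r x) f)
    {h : ℝ} (hh : 0 < h) : SlowGrowth s₁ s₂ σ₁ σ₂ h f := by
  obtain ⟨k, R, N, hk, hR, hb⟩ := (mem_GS₂_roumieu hs₁ hs₂ hσ₁ hσ₂).1 hφ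
  obtain ⟨M, hM⟩ := hf 1 one_pos
  have hI := fun (ε : ℝ) (hε : 0 < ε) => hw.integrable_norm_mul hs₁ hs₂ hσ₁ hσ₂ hk hR hb
    hM.smooth.continuous hfg hε
  obtain ⟨β, hβ⟩ : ∃ β : ℝ, β = 1 / (9 * ((d₁ : ℝ) + d₂ + 2)) := ⟨_, rfl⟩
  have hβ0 : 0 < β := by rw [hβ]; positivity
  have hβ1 : β ≤ 1 / 2 := by
    rw [hβ]
    exact one_div_le_one_div_of_le (by norm_num) (by
      have : (0 : ℝ) ≤ d₁ := by positivity
      have : (0 : ℝ) ≤ d₂ := by positivity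
      linarith)
  have key : ∀ (n : ℕ) (h : ℝ), 0 < h → ∃ M, GevreyBound σ₁ σ₂ h
      (fun x => M * expWeight s₁ s₂ ((1 - β) ^ n * r) x) f := by
    intro n
    induction n with
    | zero => simpa using hf
    | succ n ih =>
      intro h hh
      have := hw.exists_bound_slower hs₁ hs₂ hσ₁ hσ₂ hk hR hb hI
        (mul_pos (pow_pos (by linarith) n) hr) ih hβ hβ0 hβ1 hh
      rwa [← mul_assoc, ← pow_succ'] at this
  intro r' hr'
  obtain ⟨n, hn⟩ := exists_pow_lt_of_lt_one (show 0 < r' / r by positivity)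
    (show 1 - β < 1 by linarith)
  obtain ⟨M', hM'⟩ := key n h hh
  refine ⟨M', GevreyBound.mono_weight hh hM' fun x => mul_le_mul_of_nonneg_left
    (expWeight_mono ?_ x) (hM'.nonneg_of_pos (expWeight_pos _ _ _))⟩
  rw [lt_div_iff₀ hr] at hn
  exact hn.le

end Growth

section Taylor

variable {d₁ d₂ : ℕ} {s₁ s₂ σ₁ σ₂ h : ℝ} {V₀ : V d₁ × V d₂ → ℝ} {F G : V d₁ × V d₂ → ℂ}

theorem gevrey_add_left_le (hσ₁ : 0 ≤ σ₁) (hσ₂ : 0 ≤ σ₂) (hh : 0 < h) (i m n : ℕ) :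
    gevrey σ₁ σ₂ h (i + m) n ≤
      gevrey σ₁ σ₂ (2 ^ (σ₁ + σ₂) * h) m n * ((2 ^ (σ₁ + σ₂) * h) ^ i * (i.factorial : ℝ) ^ σ₁) := by
  have e1 : (2 : ℝ) ^ σ₁ ≤ 2 ^ (σ₁ + σ₂) :=
    Real.rpow_le_rpow_of_exponent_le (by norm_num) (by linarith)
  have e2 : (1 : ℝ) ≤ 2 ^ (σ₁ + σ₂) := Real.one_le_rpow (by norm_num) (by linarith)
  have h1 := factorial_add_rpow_le hσ₁ i m
  unfold gevrey
  calc _ ≤ h ^ (i + m + n) * ((2 ^ (σ₁ + σ₂)) ^ (i + m) * (i.factorial : ℝ) ^ σ₁ *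
        (m.factorial : ℝ) ^ σ₁) * (n.factorial : ℝ) ^ σ₂ := by
        gcongr
        refine h1.trans ?_
        gcongr
    _ ≤ h ^ (i + m + n) * ((2 ^ (σ₁ + σ₂)) ^ (i + m) * (i.factorial : ℝ) ^ σ₁ *
        (m.factorial : ℝ) ^ σ₁) * (n.factorial : ℝ) ^ σ₂ * (2 ^ (σ₁ + σ₂)) ^ n :=
      le_mul_of_one_le_right (by positivity) (one_le_pow₀ e2)
    _ = _ := by
      generalize (2 : ℝ) ^ (σ₁ + σ₂) = c
      ring

theorem gevrey_add_right_le (hσ₁ : 0 ≤ σ₁) (hσ₂ : 0 ≤ σ₂) (hh : 0 < h) (j m n : ℕ) :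
    gevrey σ₁ σ₂ h m (j + n) ≤
      gevrey σ₁ σ₂ (2 ^ (σ₁ + σ₂) * h) m n * ((2 ^ (σ₁ + σ₂) * h) ^ j * (j.factorial : ℝ) ^ σ₂) := by
  have hsw : ∀ (k : ℝ) (a b : ℕ), gevrey σ₁ σ₂ k a b = gevrey σ₂ σ₁ k b a := fun k a b => by
    simp only [gevrey]; rw [add_comm a b]; ring
  rw [hsw, hsw, add_comm σ₁ σ₂]
  exact gevrey_add_left_le hσ₂ hσ₁ hh j n m

theorem norm_le_of_replicate {s σ k A : ℝ} (hs : 0 < s) (hsσ : s + σ = 1) (hk : 0 ≤ k)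
    (hA : 0 ≤ A) (hG : ContDiff ℝ ∞ G) (x z : V d₁ × V d₂)
    (hb : ∀ (i : ℕ) y, ‖listDeriv (List.replicate i z) G y‖ ≤
      A * (k ^ i * (i.factorial : ℝ) ^ σ) * V₀ y) (hV : ∀ y, 0 ≤ V₀ y)
    (hB : ∃ B, ∀ t ∈ Set.Icc (0 : ℝ) 1, V₀ (t • z + x) ≤ B) :
    ‖G (z + x)‖ ≤ A * (2 * Real.exp (s * (2 * k) ^ (1 / s)) * V₀ x) := by
  obtain ⟨B, hB⟩ := hB
  have h1 : ∀ (i : ℕ) y, ‖listDeriv (List.replicate i z) G y‖ ≤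
      A * Real.exp (s * (2 * k) ^ (1 / s)) * V₀ y * (1 / 2) ^ i * i.factorial := fun i y => by
    have := hV y
    calc _ ≤ _ := hb i y
      _ ≤ A * (Real.exp (s * (2 * k) ^ (1 / s)) * (1 / 2) ^ i * i.factorial) * V₀ y := by
        exact mul_le_mul_of_nonneg_right (mul_le_mul_of_nonneg_left
          (pow_mul_factorial_le hs hsσ hk i) hA) this
      _ = _ := by ring
  refine (norm_le_of_taylor hG x z (h1 · x) (B := A * Real.exp (s * (2 * k) ^ (1 / s)) * B)
    fun i t ht => (h1 i _).trans ?_).trans (le_of_eq (by ring))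
  gcongr
  exact hB t ht

theorem GevreyBound.taylor_left (hs₁ : 0 < s₁) (hsσ : s₁ + σ₁ = 1) (hσ₁ : 0 ≤ σ₁) (hσ₂ : 0 ≤ σ₂)
    (hh : 0 < h) (hF : GevreyBound σ₁ σ₂ h V₀ F)
    (hB : ∀ x z, ∃ B, ∀ t ∈ Set.Icc (0 : ℝ) 1, V₀ (t • z + x) ≤ B) (z : V d₁) :
    GevreyBound σ₁ σ₂ (2 ^ (σ₁ + σ₂) * h) (fun x => 2 * Real.exp (s₁ * (2 * (2 ^ (σ₁ + σ₂) * h)) ^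
      (1 / s₁) * ‖z‖ ^ (1 / s₁)) * V₀ (x - (z, 0))) F := by
  refine ⟨hF.smooth, fun l₁ l₂ h₁ h₂ x => ?_⟩
  have h3 := norm_le_of_replicate hs₁ hsσ (k := 2 ^ (σ₁ + σ₂) * h * ‖z‖) (by positivity)
    (gevrey_pos (by positivity) _ _).le (listDeriv_smooth _ hF.smooth) (x - (z, 0)) (z, 0)
    (fun i y => ?_) hF.weight_nonneg (hB _ _) (A := gevrey σ₁ σ₂ (2 ^ (σ₁ + σ₂) * h) l₁.length l₂.length)
    (G := listDeriv (dirList l₁ l₂) F)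
  · rwa [add_sub_cancel, ← mul_assoc 2 (2 ^ (σ₁ + σ₂) * h), Real.mul_rpow (by positivity) (norm_nonneg _),
      ← mul_assoc s₁] at h3
  · refine ((DerivBound.list hF h₁ h₂).norm_replicate_left z i y).trans ?_
    have h4 := gevrey_add_left_le hσ₁ hσ₂ hh i l₁.length l₂.length
    rw [zero_add, ← mul_assoc]
    refine mul_le_mul_of_nonneg_right ?_ (hF.weight_nonneg y)
    refine (mul_le_mul_of_nonneg_left h4 (by positivity)).trans (le_of_eq ?_)
    rw [mul_pow _ ‖z‖]; ring

theorem GevreyBound.taylor_right (hs₂ : 0 < s₂) (hsσ : s₂ + σ₂ = 1) (hσ₁ : 0 ≤ σ₁) (hσ₂ : 0 ≤ σ₂)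
    (hh : 0 < h) (hF : GevreyBound σ₁ σ₂ h V₀ F)
    (hB : ∀ x z, ∃ B, ∀ t ∈ Set.Icc (0 : ℝ) 1, V₀ (t • z + x) ≤ B) (z : V d₂) :
    GevreyBound σ₁ σ₂ (2 ^ (σ₁ + σ₂) * h) (fun x => 2 * Real.exp (s₂ * (2 * (2 ^ (σ₁ + σ₂) * h)) ^
      (1 / s₂) * ‖z‖ ^ (1 / s₂)) * V₀ (x - (0, z))) F := by
  refine ⟨hF.smooth, fun l₁ l₂ h₁ h₂ x => ?_⟩
  have h3 := norm_le_of_replicate hs₂ hsσ (k := 2 ^ (σ₁ + σ₂) * h * ‖z‖) (by positivity)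
    (gevrey_pos (by positivity) _ _).le (listDeriv_smooth _ hF.smooth) (x - (0, z)) (0, z)
    (fun i y => ?_) hF.weight_nonneg (hB _ _) (A := gevrey σ₁ σ₂ (2 ^ (σ₁ + σ₂) * h) l₁.length l₂.length)
    (G := listDeriv (dirList l₁ l₂) F)
  · rwa [add_sub_cancel, ← mul_assoc 2 (2 ^ (σ₁ + σ₂) * h), Real.mul_rpow (by positivity) (norm_nonneg _),
      ← mul_assoc s₂] at h3
  · refine ((DerivBound.list hF h₁ h₂).norm_replicate_right z i y).trans ?_
    have h4 := gevrey_add_right_le hσ₁ hσ₂ hh i l₁.length l₂.length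
    rw [zero_add, ← mul_assoc]
    refine mul_le_mul_of_nonneg_right ?_ (hF.weight_nonneg y)
    refine (mul_le_mul_of_nonneg_left h4 (by positivity)).trans (le_of_eq ?_)
    rw [mul_pow _ ‖z‖]; ring

theorem GevreyBound.exists_translate_bound (hs₁ : 0 < s₁) (hs₂ : 0 < s₂) (h₁ : s₁ + σ₁ = 1)
    (h₂ : s₂ + σ₂ = 1) (hσ₁ : 0 ≤ σ₁) (hσ₂ : 0 ≤ σ₂)
    (hF : ∀ h : ℝ, 0 < h → ∃ M, GevreyBound σ₁ σ₂ h (fun x => M * V₀ x) F) (hV : ∀ x, 0 < V₀ x)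
    (hB : ∀ x z, ∃ B, ∀ t ∈ Set.Icc (0 : ℝ) 1, V₀ (t • z + x) ≤ B) (hh : 0 < h) {ε : ℝ}
    (hε : 0 < ε) : ∃ M, ∀ z, GevreyBound σ₁ σ₂ h (fun x => M * V₀ (x - z) * expWeight s₁ s₂ ε z) F := by
  set c : ℝ := 2 ^ (σ₁ + σ₂) with hc
  have hc0 : 0 < c := by positivity
  obtain ⟨k, hk, hk1, hk2, hk3⟩ : ∃ k : ℝ, 0 < k ∧ k ≤ h ∧ s₁ * (2 * k) ^ (1 / s₁) ≤ ε ∧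
      s₂ * (2 * k) ^ (1 / s₂) ≤ ε := by
    have key : ∀ s k : ℝ, 0 < s → 0 < k → k ≤ (ε / s) ^ s / 2 → s * (2 * k) ^ (1 / s) ≤ ε := by
      intro s k hs hk hk'
      have h1 : (2 * k) ^ (1 / s) ≤ ((ε / s) ^ s) ^ (1 / s) :=
        Real.rpow_le_rpow (by positivity) (by linarith) (by positivity)
      rw [← Real.rpow_mul (by positivity), mul_one_div_cancel hs.ne', Real.rpow_one,
        le_div_iff₀ hs] at h1
      linarith
    have hm : 0 < min h (min ((ε / s₁) ^ s₁ / 2) ((ε / s₂) ^ s₂ / 2)) := by positivity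
    exact ⟨_, hm, min_le_left _ _, key s₁ _ hs₁ hm ((min_le_right _ _).trans (min_le_left _ _)),
      key s₂ _ hs₂ hm ((min_le_right _ _).trans (min_le_right _ _))⟩
  obtain ⟨M, hM⟩ := hF (k / c / c) (by positivity)
  have hM0 := hM.nonneg_of_pos hV
  refine ⟨4 * M, fun z => ?_⟩
  have e1 : c * (k / c / c) = k / c := mul_div_cancel₀ _ hc0.ne'
  have e2 : c * (k / c) = k := mul_div_cancel₀ _ hc0.ne'
  have hB1 : ∀ (a : ℝ) (y x z : V d₁ × V d₂), 0 ≤ a →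
      ∃ B, ∀ t ∈ Set.Icc (0 : ℝ) 1, a * V₀ (t • z + x - y) ≤ B := fun a y x z ha => by
    obtain ⟨B, hB⟩ := hB (x - y) z
    exact ⟨a * B, fun t ht => by rw [add_sub_assoc]; exact mul_le_mul_of_nonneg_left (hB t ht) ha⟩
  have b1 := GevreyBound.taylor_left hs₁ h₁ hσ₁ hσ₂ (by positivity) hM (fun x z => by
    simpa using hB1 M 0 x z hM0) z.1
  rw [← hc, e1] at b1
  have b2 := GevreyBound.taylor_right hs₂ h₂ hσ₁ hσ₂ (by positivity) b1 (fun x y => by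
    simp only [← mul_assoc]
    exact hB1 _ _ x y (by positivity)) z.2
  rw [← hc, e2] at b2
  refine GevreyBound.mono_weight hh (GevreyBound.mono_rate hk.le hk1 b2) fun x => ?_
  have e3 : x - (0, z.2) - (z.1, 0) = x - z := by
    ext1 <;> simp
  have hck : k / c ≤ k := div_le_self hk.le (Real.one_le_rpow (by norm_num) (by linarith))
  have i1 : s₁ * (2 * (k / c)) ^ (1 / s₁) ≤ ε := le_trans (by gcongr) hk2
  rw [e3, expWeight, mul_add, Real.exp_add]
  have hVp := hV (x - z)
  calc _ = 4 * M * V₀ (x - z) * (Real.exp (s₁ * (2 * (k / c)) ^ (1 / s₁) * ‖z.1‖ ^ (1 / s₁)) *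
        Real.exp (s₂ * (2 * k) ^ (1 / s₂) * ‖z.2‖ ^ (1 / s₂))) := by ring
    _ ≤ _ := by gcongr

end Taylor

section SmallWindows

variable {d₁ d₂ : ℕ} {s₁ s₂ σ₁ σ₂ h R N : ℝ} {W : V d₁ × V d₂ → ℝ} {F φ : V d₁ × V d₂ → ℂ}

theorem choose_mul_factorial_rpow_le {σ α : ℝ} (hα : 0 ≤ α) (hσ : 1 - σ ≤ α) {m : ℕ} {p : ℕ × ℕ}
    (hp : p ∈ Finset.HasAntidiagonal.antidiagonal m) :
    (m.choose p.1 : ℝ) * ((p.1.factorial : ℝ) ^ σ * (p.2.factorial : ℝ) ^ σ) ≤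
      (2 ^ α) ^ m * (m.factorial : ℝ) ^ σ := by
  obtain rfl := Finset.HasAntidiagonal.mem_antidiagonal.1 hp
  have h1 := Nat.add_choose_mul_factorial_mul_factorial p.1 p.2
  have h2 : ((p.1 + p.2).choose p.1 : ℝ) ≤ 2 ^ (p.1 + p.2) := by
    exact_mod_cast Nat.choose_le_two_pow _ _
  have h3 : (1 : ℝ) ≤ (p.1 + p.2).choose p.1 := by
    exact_mod_cast Nat.choose_pos (Nat.le_add_right _ _)
  rw [← Nat.choose_symm_add] at h1
  rw [← h1, Nat.cast_mul, Nat.cast_mul, Real.mul_rpow (by positivity) (by positivity),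
    Real.mul_rpow (by positivity) (by positivity), Real.rpow_pow_comm (by norm_num)]
  set b : ℝ := ((p.1 + p.2).choose p.1 : ℝ)
  have h4 : b = b ^ (1 - σ) * b ^ σ := by
    rw [← Real.rpow_add (by positivity), sub_add_cancel, Real.rpow_one]
  calc _ = b ^ (1 - σ) * (b ^ σ * (p.1.factorial : ℝ) ^ σ * (p.2.factorial : ℝ) ^ σ) := by
        conv_lhs => rw [h4]
        ring
    _ ≤ (2 ^ (p.1 + p.2)) ^ α * (b ^ σ * (p.1.factorial : ℝ) ^ σ * (p.2.factorial : ℝ) ^ σ) := by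
        refine mul_le_mul_of_nonneg_right ?_ (by positivity)
        exact (Real.rpow_le_rpow_of_exponent_le h3 hσ).trans
          (Real.rpow_le_rpow (by positivity) h2 hα)

theorem GevreyBound.sq {α β : ℝ} (hα : 0 ≤ α) (hα' : 1 - σ₁ ≤ α) (hβ : 0 ≤ β) (hβ' : 1 - σ₂ ≤ β)
    (hh : 0 < h) (hF : GevreyBound σ₁ σ₂ h W F) :
    DerivBound (fun m n => ((m : ℝ) + 1) * (2 ^ α) ^ m * (((n : ℝ) + 1) * (2 ^ β) ^ n) *
      gevrey σ₁ σ₂ h m n) (fun x => W x * W x) (F * F) := by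
  refine (DerivBound.mul hF hF).mono fun m n x =>
    mul_le_mul_of_nonneg_right ?_ (mul_self_nonneg _)
  calc _ ≤ ∑ p ∈ Finset.HasAntidiagonal.antidiagonal m,
        ∑ q ∈ Finset.HasAntidiagonal.antidiagonal n, h ^ (m + n) *
          ((2 ^ α) ^ m * (m.factorial : ℝ) ^ σ₁) * ((2 ^ β) ^ n * (n.factorial : ℝ) ^ σ₂) := by
        refine Finset.sum_le_sum fun p hp => ?_
        rw [Finset.mul_sum]
        refine Finset.sum_le_sum fun q hq => ?_
        have h1 := choose_mul_factorial_rpow_le hα hα' hp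
        have h2 := choose_mul_factorial_rpow_le hβ hβ' hq
        have e : h ^ (m + n) = h ^ (p.1 + q.1) * h ^ (p.2 + q.2) := by
          rw [← Finset.HasAntidiagonal.mem_antidiagonal.1 hp,
            ← Finset.HasAntidiagonal.mem_antidiagonal.1 hq]; ring
        rw [e]
        calc _ = h ^ (p.1 + q.1) * h ^ (p.2 + q.2) *
              ((m.choose p.1 : ℝ) * ((p.1.factorial : ℝ) ^ σ₁ * (p.2.factorial : ℝ) ^ σ₁)) *
              ((n.choose q.1 : ℝ) * ((q.1.factorial : ℝ) ^ σ₂ * (q.2.factorial : ℝ) ^ σ₂)) := by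
              unfold gevrey; ring
          _ ≤ _ := by gcongr
    _ = _ := by
        simp only [Finset.sum_const, Finset.Nat.card_antidiagonal, nsmul_eq_mul]
        unfold gevrey
        push_cast
        ring

theorem exists_succ_mul_pow_le {ρ : ℝ} (hρ : 0 < ρ) (hρ1 : ρ < 1) :
    ∃ C : ℝ, 0 < C ∧ ∀ m : ℕ, ((m : ℝ) + 1) * ρ ^ m ≤ C := by
  have h1 : 0 < ρ⁻¹ - 1 := sub_pos.2 ((one_lt_inv₀ hρ).2 hρ1)
  refine ⟨1 + (ρ⁻¹ - 1)⁻¹, by positivity, fun m => ?_⟩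
  have h2 := one_add_mul_le_pow (show -2 ≤ ρ⁻¹ - 1 by linarith) m
  rw [add_sub_cancel, inv_pow] at h2
  have h3 : (m : ℝ) ≤ (ρ⁻¹ - 1)⁻¹ * (ρ ^ m)⁻¹ := by
    rw [inv_mul_eq_div, le_div_iff₀ h1]; linarith
  have h4 : 1 ≤ (ρ ^ m)⁻¹ := (one_le_inv₀ (by positivity)).2 (pow_le_one₀ hρ.le hρ1.le)
  calc ((m : ℝ) + 1) * ρ ^ m ≤ ((ρ⁻¹ - 1)⁻¹ * (ρ ^ m)⁻¹ + (ρ ^ m)⁻¹) * ρ ^ m := by gcongr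
    _ = _ := by
      have : ρ ^ m ≠ 0 := by positivity
      field_simp
      ring

theorem exists_window_step (hs₁ : 0 < s₁) (hs₂ : 0 < s₂) (h₁ : 1 < s₁ + σ₁) (h₂ : 1 < s₂ + σ₂) :
    ∃ ρ μ C : ℝ, 0 < ρ ∧ ρ < 1 ∧ 1 < μ ∧ ∀ (φ : V d₁ × V d₂ → ℂ) (h R N : ℝ), IsWindow φ →
      0 < h → 0 < R → GSBound s₁ s₂ σ₁ σ₂ h R N φ →
        ∃ ψ : V d₁ × V d₂ → ℂ, IsWindow ψ ∧ GSBound s₁ s₂ σ₁ σ₂ (ρ * h) (μ * R) (C * (N * N)) ψ := by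
  have key : ∀ s σ : ℝ, 0 < s → 1 < s + σ → ∃ α p : ℝ, 0 ≤ α ∧ 1 - σ ≤ α ∧ α < p ∧ p < s := by
    intro s σ hs hsσ
    obtain ⟨p, hp, hp'⟩ := exists_between (show max (1 - σ) 0 < s from max_lt (by linarith) hs)
    exact ⟨_, p, le_max_right _ _, le_max_left _ _, hp, hp'⟩
  obtain ⟨α, p, hα, hα', hαp, hp⟩ := key s₁ σ₁ hs₁ h₁
  obtain ⟨β, q, hβ, hβ', hβq, hq⟩ := key s₂ σ₂ hs₂ h₂
  set ν := min (p - α) (q - β) / 2 with hν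
  have hν0 : 0 < ν := half_pos (lt_min (by linarith) (by linarith))
  set ρ : ℝ := 2 ^ (-ν) with hρ
  have hρ0 : 0 < ρ := by positivity
  have hρ1 : ρ < 1 := Real.rpow_lt_one_of_one_lt_of_neg (by norm_num) (by linarith)
  obtain ⟨C, hC, hCb⟩ := exists_succ_mul_pow_le hρ0 hρ1
  have hfac : ∀ a b : ℝ, 2 * ν ≤ b - a → ∀ m : ℕ,
      ((m : ℝ) + 1) * (2 ^ a) ^ m * (2 ^ (-b)) ^ m ≤ C * ρ ^ m := by
    intro a b hab m
    have e1 : (2 : ℝ) ^ a * 2 ^ (-b) ≤ ρ * ρ := by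
      rw [← Real.rpow_add (by norm_num), ← Real.rpow_add (by norm_num)]
      exact Real.rpow_le_rpow_of_exponent_le (by norm_num) (by linarith)
    calc _ = ((m : ℝ) + 1) * ((2 ^ a) * (2 ^ (-b))) ^ m := by rw [mul_pow]; ring
      _ ≤ ((m : ℝ) + 1) * (ρ * ρ) ^ m := by gcongr
      _ = ((m : ℝ) + 1) * ρ ^ m * ρ ^ m := by rw [mul_pow]; ring
      _ ≤ _ := mul_le_mul_of_nonneg_right (hCb m) (by positivity)
  have hpα : 2 * ν ≤ p - α := by rw [hν]; linarith [min_le_left (p - α) (q - β)]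
  have hqβ : 2 * ν ≤ q - β := by rw [hν]; linarith [min_le_right (p - α) (q - β)]
  set μ : ℝ := min (2 ^ (1 - p / s₁)) (2 ^ (1 - q / s₂)) with hμ
  have hμ1 : 1 < μ := lt_min
    (Real.one_lt_rpow (by norm_num) (sub_pos.2 ((div_lt_one hs₁).2 hp)))
    (Real.one_lt_rpow (by norm_num) (sub_pos.2 ((div_lt_one hs₂).2 hq)))
  refine ⟨ρ, μ, C * C, hρ0, hρ1, hμ1, fun φ h R N hw hh hR hφ => ?_⟩
  set P : ℝ := 2 ^ (-p) with hP
  set Q : ℝ := 2 ^ (-q) with hQ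
  have hP0 : 0 < P := by positivity
  have hQ0 : 0 < Q := by positivity
  have hd := (GevreyBound.sq hα hα' hβ hβ' hh hφ).dilate P Q
  have hwt : ∀ x : V d₁ × V d₂, expWeight s₁ s₂ (-R) (dilation P Q x) *
      expWeight s₁ s₂ (-R) (dilation P Q x) ≤ expWeight s₁ s₂ (-(μ * R)) x := by
    intro x
    have key2 : ∀ s p t : ℝ, 0 < s → 0 ≤ t → μ ≤ 2 ^ (1 - p / s) →
        μ * R * t ^ (1 / s) ≤ 2 * R * ((2 : ℝ) ^ (-p) * t) ^ (1 / s) := by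
      intro s p t hs ht hle
      rw [Real.mul_rpow (by positivity) ht, ← Real.rpow_mul (by norm_num), ← mul_assoc]
      refine mul_le_mul_of_nonneg_right ?_ (by positivity)
      have e : (2 : ℝ) * 2 ^ (-p * (1 / s)) = 2 ^ (1 - p / s) := by
        rw [show 1 - p / s = 1 + -p * (1 / s) by ring, Real.rpow_add (by norm_num), Real.rpow_one]
      calc _ ≤ 2 ^ (1 - p / s) * R := by gcongr
        _ = _ := by rw [← e]; ring
    rw [← expWeight_add, expWeight, expWeight]
    refine Real.exp_le_exp.2 ?_
    have a1 := key2 s₁ p ‖x.1‖ hs₁ (norm_nonneg _) (min_le_left _ _)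
    have a2 := key2 s₂ q ‖x.2‖ hs₂ (norm_nonneg _) (min_le_right _ _)
    simp only [dilation_apply, norm_smul, Real.norm_of_nonneg hP0.le, Real.norm_of_nonneg hQ0.le]
    change _ ≤ 2 * R * (P * _) ^ _ at a1
    change _ ≤ 2 * R * (Q * _) ^ _ at a2
    linarith
  have hb : GSBound s₁ s₂ σ₁ σ₂ (ρ * h) (μ * R) (C * C * (N * N))
      (fun x => (φ * φ) (dilation P Q x)) := by
    refine hd.mono fun m n x => ?_
    have f1 := hfac α p hpα m
    have f2 := hfac β q hqβ n
    have g := gevrey_pos (σ₁ := σ₁) (σ₂ := σ₂) hh m n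
    have hN := hφ.nonneg
    rw [abs_of_pos hP0, abs_of_pos hQ0]
    calc _ = (((m : ℝ) + 1) * (2 ^ α) ^ m * P ^ m) * (((n : ℝ) + 1) * (2 ^ β) ^ n * Q ^ n) *
          gevrey σ₁ σ₂ h m n * (N * N) * (expWeight s₁ s₂ (-R) (dilation P Q x) *
            expWeight s₁ s₂ (-R) (dilation P Q x)) := by ring
      _ ≤ (C * ρ ^ m) * (C * ρ ^ n) * gevrey σ₁ σ₂ h m n * (N * N) *
          expWeight s₁ s₂ (-(μ * R)) x := by
        have p1 := expWeight_pos s₁ s₂ (-R) (dilation P Q x)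
        gcongr
        exact hwt x
      _ = _ := by unfold gevrey; rw [mul_pow ρ, pow_add ρ]; ring
  obtain ⟨z, hz⟩ : ∃ z, φ z ≠ 0 := by
    by_contra hc
    push Not at hc
    exact hw.ne_zero (funext hc)
  refine ⟨_, ⟨GevreyBound.rapid hs₁ hs₂ (by positivity) hb, fun x => ?_, fun h0 => hz ?_⟩, hb⟩
  · simp only [Pi.mul_apply]
    rw [norm_mul, Complex.ofReal_mul, ← hw.nonneg]
  · have := congrFun h0 (P⁻¹ • z.1, Q⁻¹ • z.2)
    simpa [smul_smul, mul_inv_cancel₀ hP0.ne', mul_inv_cancel₀ hQ0.ne'] using this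

theorem IsWindow.exists_small (hw : IsWindow φ) (hs₁ : 0 < s₁) (hs₂ : 0 < s₂) (h₁ : 1 < s₁ + σ₁)
    (h₂ : 1 < s₂ + σ₂) (hh : 0 < h) (hR : 0 < R) (hφ : GSBound s₁ s₂ σ₁ σ₂ h R N φ) {h' R' : ℝ}
    (hh' : 0 < h') : ∃ (ψ : V d₁ × V d₂ → ℂ) (N' : ℝ), IsWindow ψ ∧ GSBound s₁ s₂ σ₁ σ₂ h' R' N' ψ := by
  obtain ⟨ρ, μ, C, hρ, hρ1, hμ, hstep⟩ := exists_window_step (d₁ := d₁) (d₂ := d₂) hs₁ hs₂ h₁ h₂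
  have key : ∀ n : ℕ, ∃ (ψ : V d₁ × V d₂ → ℂ) (N' : ℝ), IsWindow ψ ∧ GSBound s₁ s₂ σ₁ σ₂ (ρ ^ n * h) (μ ^ n * R) N' ψ := by
    intro n
    induction n with
    | zero => exact ⟨φ, N, hw, by simpa using hφ⟩
    | succ n ih =>
      obtain ⟨ψ, N', hψ, hb⟩ := ih
      obtain ⟨ψ', hψ', hb'⟩ := hstep ψ _ _ _ hψ (by positivity) (by positivity) hb
      rw [← mul_assoc, ← mul_assoc, ← pow_succ', ← pow_succ'] at hb'
      exact ⟨ψ', _, hψ', hb'⟩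
  obtain ⟨n₁, hn₁⟩ := exists_pow_lt_of_lt_one (show 0 < h' / h by positivity) hρ1
  obtain ⟨n₂, hn₂⟩ := pow_unbounded_of_one_lt (R' / R) hμ
  rw [lt_div_iff₀ hh] at hn₁
  rw [div_lt_iff₀ hR] at hn₂
  obtain ⟨ψ, N', hψ, hb⟩ := key (max n₁ n₂)
  refine ⟨ψ, N', hψ, hb.mono (by positivity) (le_trans ?_ hn₁.le) (hn₂.le.trans ?_) le_rfl hb.nonneg⟩
  · exact mul_le_mul_of_nonneg_right (pow_le_pow_of_le_one hρ.le hρ1.le (le_max_left _ _)) hh.le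
  · exact mul_le_mul_of_nonneg_right (pow_le_pow_right₀ hμ.le (le_max_right _ _)) hR.le

end SmallWindows

section WeightedClasses

variable {d₁ d₂ : ℕ} {κ : Kind} {t₁ t₂ τ₁ τ₂ s₁ σ₂ σ₁ s₂ r : ℝ} {C : V d₂ →L[ℝ] V d₁}
  {H₀ : Admissible t₁ τ₂ τ₁ t₂} {a b : GSDual κ t₁ τ₂ τ₁ t₂ d₁ d₂} {f φ : V d₁ × V d₂ → ℂ}
  {v W W' : V d₁ × V d₂ → ℝ}

/-- There is a window for which the image of `f` has Gevrey bounds at rate `h'` with weight `W'`. -/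
def HasWindow (s₁ σ₂ σ₁ s₂ : ℝ) (C : V d₂ →L[ℝ] V d₁) (f : V d₁ × V d₂ → ℂ) (W' : V d₁ × V d₂ → ℝ)
    (h' : ℝ) : Prop :=
  ∃ (ψ : V d₁ × V d₂ → ℂ) (k R N h q R' K M : ℝ), 0 < k ∧ 0 < R ∧ 0 < h ∧ 0 < q ∧ 0 < R' ∧ 0 ≤ K ∧
    GSBound s₁ σ₂ σ₁ s₂ k R N ψ ∧ ∫ x, ψ x ≠ 0 ∧ WindowBound s₁ σ₂ σ₁ s₂ C ψ h q h' R' K ∧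
      GevreyBound σ₁ s₂ h' (fun x => M * W' x) (shiftFunction C ψ f)

theorem IsShift.exists_of_windows (hab : IsShift H₀ C a b) (H : Admissible s₁ σ₂ σ₁ s₂)
    (hE : GS₂ κ t₁ τ₂ τ₁ t₂ d₁ d₂ ≤ GS₂ .roumieu s₁ σ₂ σ₁ s₂ d₁ d₂)
    (hφ : φ ∈ GS₂ κ t₁ τ₂ τ₁ t₂ d₁ d₂) (hφ0 : ∫ x, φ x ≠ 0) (hfa : a.IsGivenBy f)
    (hf : ∀ h : ℝ, 0 < h → SlowGrowth s₁ σ₂ σ₁ s₂ h f)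
    (hw : ∀ h : ℝ, 0 < h → HasWindow s₁ σ₂ σ₁ s₂ C f W' h) :
    ∃ F, b.IsGivenBy F ∧ ∀ h : ℝ, 0 < h → ∃ M, GevreyBound σ₁ s₂ h (fun x => M * W' x) F := by
  have key : ∀ h : ℝ, 0 < h → ∃ F, b.IsGivenBy F ∧ SlowGrowth s₁ σ₂ σ₁ s₂ h F ∧
      ∃ M, GevreyBound σ₁ s₂ h (fun x => M * W' x) F := by
    intro h' hh'
    obtain ⟨ψ, k, R, N, h, q, R', K, M, hk, hR, hh, hq, hR', hK, hψ, hψ0, hb, hM⟩ := hw h' hh'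
    obtain ⟨h1, h2⟩ := hab.slowGrowth H hE hfa (hf h hh) hh hψ hk hR hψ0 hb hq hh' hR' hK
    exact ⟨_, h1, h2, M, hM⟩
  obtain ⟨F, hF, hF', -⟩ := key 1 one_pos
  refine ⟨F, hF, fun h hh => ?_⟩
  obtain ⟨G, hG, hG', hGM⟩ := key h hh
  rwa [hF.unique H₀ H hE hφ hφ0 hG hF' hG']

theorem Admissible.hasWindow_of_one_lt (H : Admissible s₁ σ₂ σ₁ s₂) (h₁ : 1 < s₁ + σ₁)
    (h₂ : 1 < σ₂ + s₂) (hφ : φ ∈ GS₂ .roumieu s₁ σ₂ σ₁ s₂ d₁ d₂) (hw : IsWindow φ)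
    (hv : IsModerate s₁ σ₂ r v W W') (hr : 0 < r) (hv0 : ∀ x, 0 < v x)
    (hf : ∀ h : ℝ, 0 < h → ∃ M, GevreyBound σ₁ s₂ h (fun x => M * v x) f) {h' : ℝ} (hh' : 0 < h') :
    HasWindow s₁ σ₂ σ₁ s₂ C f W' h' := by
  have hc := one_le_quasiConst H.pos_s₁ H.pos_σ₂
  obtain ⟨h₀, R₀, N₀, hh₀, hR₀, hb₀⟩ := H.exists_bound hφ
  have hR' : 0 < quasiConst s₁ σ₂ * r + 1 := by positivity
  obtain ⟨h, R, K, hh, hR, hK, hb⟩ := H.exists_windowBound_of_beurling (d₁ := d₁) (d₂ := d₂) C r hh' hR'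
  obtain ⟨ψ, N, hψ, hψb⟩ := hw.exists_small H.pos_s₁ H.pos_σ₂ h₁ h₂ hh₀ hR₀ hb₀ (R' := R + r) hh
  obtain ⟨M, hM⟩ := hf h hh
  have hKN := mul_nonneg hK.le hψb.nonneg
  obtain ⟨M', hM'⟩ := H.exists_gevreyBound_shiftFunction hv hv0 (hb ψ N hψb) le_rfl hh' hKN
    (by linarith) hψb.smooth.continuous hM
  exact ⟨ψ, h, R + r, N, h, r, _, K * N, M', hh, by positivity, hh, hr, hR', hKN, hψb,
    hψ.integral_ne_zero, hb ψ N hψb, hM'⟩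

theorem Admissible.hasWindow_of_eq_one (H : Admissible s₁ σ₂ σ₁ s₂) (h₁ : s₁ + σ₁ = 1)
    (h₂ : σ₂ + s₂ = 1) (hφ : φ ∈ GS₂ .roumieu s₁ σ₂ σ₁ s₂ d₁ d₂) (hφ0 : ∫ x, φ x ≠ 0)
    (hv0 : ∀ x, 0 < v x) (hB : ∀ x z, ∃ B, ∀ t ∈ Set.Icc (0 : ℝ) 1, v (t • z + x) ≤ B)
    (hf : ∀ h : ℝ, 0 < h → ∃ M, GevreyBound σ₁ s₂ h (fun x => M * v x) f) {h' : ℝ} (hh' : 0 < h') :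
    HasWindow s₁ σ₂ σ₁ s₂ C f v h' := by
  have hc := one_le_quasiConst H.pos_s₁ H.pos_σ₂
  obtain ⟨k, R, N, hk, hR, hb⟩ := H.exists_bound hφ
  obtain ⟨l, h, q, R', K, hl, hh, hq, hR', hK, hψ, hw⟩ := H.exists_windowBound_broad C hb hk hR hh'
  set ψ : V d₁ × V d₂ → ℂ := fun x => φ (l • x) with hψdef
  set c := quasiConst s₁ σ₂ with hcdef
  have hc0 : 0 < c := by positivity
  obtain ⟨e, he, he'⟩ : ∃ e : ℝ, 0 < e ∧ e < min R' q := exists_between (by positivity)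
  rw [lt_min_iff] at he'
  set ε := e / (c * (c * c))
  have hε : 0 < ε := by positivity
  have e0 : c * (c * (c * ε)) = e := by simp only [ε]; field_simp
  have e1 : c * ε ≤ q := by
    have i1 : c * ε ≤ c * (c * ε) := le_mul_of_one_le_left (by positivity) hc
    have i2 : c * (c * ε) ≤ c * (c * (c * ε)) := le_mul_of_one_le_left (by positivity) hc
    linarith [he'.2]
  obtain ⟨M, hM⟩ := GevreyBound.exists_translate_bound H.pos_s₁ H.pos_σ₂ h₁ h₂ H.pos_σ.le H.pos_s.le
    hf hv0 hB hh hε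
  have hM0 : 0 ≤ M := nonneg_of_mul_nonneg_left (nonneg_of_mul_nonneg_left ((hM 0).weight_nonneg 0)
    (expWeight_pos _ _ _ _)) (hv0 _)
  have hs : ∀ z, GevreyBound σ₁ s₂ h (fun x => M * v z * expWeight s₁ σ₂ ε (x - z)) f := fun z =>
    ⟨(hM 0).smooth, fun l₁ l₂ u₁ u₂ x => by
      have := (hM (x - z)).bound l₁ l₂ u₁ u₂ x
      rwa [sub_sub_cancel] at this⟩
  set J := ∫ y : V d₁ × V d₂, expWeight s₁ σ₂ (-(R' - c * (c * ε))) y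
  have hshift : ∀ z, GevreyBound σ₁ s₂ h' (fun x => J * (K * (M * v z * expWeight s₁ σ₂
      (c * (c * ε)) (x - z)))) (shiftSum C ψ f) := by
    intro z
    have hMv : 0 ≤ M * v z := mul_nonneg hM0 (hv0 z).le
    refine H.gevreyBound_shiftSum hw hh' hK hψ.smooth.continuous (hs z)
      (W := fun y => M * v z * expWeight s₁ σ₂ (c * ε) (y - z))
      (W' := fun x => M * v z * expWeight s₁ σ₂ (c * (c * ε)) (x - z)) (fun x y => ?_)
      (by positivity) (by change c * _ < _; rw [e0]; exact he'.1) fun x y => ?_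
    · rw [mul_assoc (M * v z)]
      refine mul_le_mul_of_nonneg_left ?_ hMv
      have h3 := expWeight_add_le H.pos_s₁ H.pos_σ₂ hε.le (y - z) x
      rw [show y - z + x = x + y - z by abel] at h3
      exact h3.trans (mul_le_mul_of_nonneg_left (expWeight_mono e1 x) (expWeight_pos _ _ _ _).le)
    · rw [mul_assoc (M * v z)]
      refine mul_le_mul_of_nonneg_left ?_ hMv
      have h3 := expWeight_add_le H.pos_s₁ H.pos_σ₂ (r := c * ε) (by positivity) (x - z) (y - x)
      rwa [sub_add_sub_cancel', ← neg_sub x y, expWeight_neg] at h3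
  have hfin : GevreyBound σ₁ s₂ h' (fun x => J * (K * M) * v x) (shiftSum C ψ f) :=
    ⟨(hshift 0).smooth, fun l₁ l₂ u₁ u₂ x => by
      refine ((hshift x).bound l₁ l₂ u₁ u₂ x).trans (le_of_eq ?_)
      have e2 : expWeight s₁ σ₂ (c * (c * ε)) (x - x) = 1 := by
        simp [expWeight, Real.zero_rpow (inv_pos.2 H.pos_s₁).ne',
          Real.zero_rpow (inv_pos.2 H.pos_σ₂).ne']
      rw [e2]
      ring⟩
  have hψ0 : ∫ x, ψ x ≠ 0 := by
    rw [hψdef, Measure.integral_comp_smul]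
    exact smul_ne_zero (by positivity) hφ0
  refine ⟨ψ, l * k, q, N, h, q, R', K, ‖(∫ x, ψ x)⁻¹‖ * (J * (K * M)), by positivity, hq, hh, hq, hR',
    hK, hψ, hψ0, hw, ?_⟩
  exact (DerivBound.smul (∫ x, ψ x)⁻¹ hfin).mono fun m n x => le_of_eq (by ring)

end WeightedClasses

section Conclusions

variable {d : ℕ} {κ : Kind} {t τ s σ : ℝ} {C : V d →L[ℝ] V d} {H₀ : Admissible t τ τ t}
  {a b : GSDual κ t τ τ t d d} {S : Set (V d × V d → ℂ)}

theorem GSDual.MemFun.of_window (H₀ : Admissible t τ τ t) (ha : a.MemFun S)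
    (h : ∀ φ ∈ GS₂ κ t τ τ t d d, IsWindow φ → ∀ f ∈ S, a.IsGivenBy f → b.MemFun S) :
    b.MemFun S := by
  by_cases hE : ∃ g ∈ GS₂ κ t τ τ t d d, g ≠ 0
  · obtain ⟨φ, hφ, hw⟩ := H₀.exists_window hE
    obtain ⟨f, hf, hfa⟩ := ha
    exact h φ hφ hw f hf hfa
  · push Not at hE
    exact ha.of_trivial hE

namespace IsShift

variable (hab : IsShift H₀ C a b) (H : Admissible s σ σ s)
include hab H

theorem memFun_gammaLow (hE : GS₂ κ t τ τ t d d ≤ GS₂ .roumieu s σ σ s d d)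
    (ha : a.MemFun (GammaLow s σ σ s d d)) : b.MemFun (GammaLow s σ σ s d d) := by
  refine ha.of_window H₀ fun φ hφ hw f hf hfa => ?_
  obtain ⟨h, hh, hs⟩ := (mem_GammaLow H.pos_σ.le H.pos_s.le).1 hf
  obtain ⟨F, hF, k, hk, hFs⟩ := hab.exists_slowGrowth H hE hφ hw.integral_ne_zero hh hfa hs
  exact ⟨F, (mem_GammaLow H.pos_σ.le H.pos_s.le).2 ⟨k, hk, hFs⟩, hF⟩

theorem memFun_gammaLowUp (hE : GS₂ κ t τ τ t d d ≤ GS₂ .roumieu s σ σ s d d)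
    (ha : a.MemFun (GammaLowUp s σ σ s d d)) : b.MemFun (GammaLowUp s σ σ s d d) := by
  refine ha.of_window H₀ fun φ hφ hw f hf hfa => ?_
  obtain ⟨F, hF, hFs⟩ := hab.exists_slowGrowth_small H hE hφ hw.integral_ne_zero hfa
    ((mem_GammaLowUp H.pos_σ.le H.pos_s.le).1 hf)
  exact ⟨F, (mem_GammaLowUp H.pos_σ.le H.pos_s.le).2 hFs, hF⟩

theorem memFun_gammaUp (hE : GS₂ κ t τ τ t d d ≤ GS₂ .beurling s σ σ s d d ∨
      GS₂ κ t τ τ t d d = GS₂ .roumieu s σ σ s d d)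
    (ha : a.MemFun (GammaUp s σ σ s d d)) : b.MemFun (GammaUp s σ σ s d d) := by
  refine ha.of_window H₀ fun φ hφ hw f hf hfa => ?_
  obtain ⟨r, hr, hs⟩ := (mem_GammaUp H.pos_σ.le H.pos_s.le).1 hf
  rcases hE with hE | hE
  · have hc := one_le_quasiConst H.pos_s H.pos_σ
    obtain ⟨F, hF, hFs⟩ := hab.exists_moderate H hE hφ hw.integral_ne_zero
      (isModerate_expWeight H.pos_s H.pos_σ hr.le) (expWeight_pos s σ r) hfa hs
    exact ⟨F, (mem_GammaUp H.pos_σ.le H.pos_s.le).2 ⟨_, by positivity, hFs⟩, hF⟩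
  · have hslow := fun h (hh : 0 < h) => hw.slowGrowth H.pos_s H.pos_σ H.pos_σ.le H.pos_s.le
      (hE ▸ hφ) (fun g hg => (hfa ⟨g, hE ▸ hg⟩).1) hr hs hh
    obtain ⟨F, hF, hFs⟩ := hab.exists_slowGrowth_small H hE.le hφ hw.integral_ne_zero hfa hslow
    exact ⟨F, (mem_GammaUp H.pos_σ.le H.pos_s.le).2 ⟨1, one_pos, fun h hh => hFs h hh 1 one_pos⟩, hF⟩

theorem memFun_gammaWeight {w : V d × V d → ℝ} (hw : IsPWeight s σ w)
    (hE : GS₂ κ t τ τ t d d ≤ GS₂ .beurling s σ σ s d d ∨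
      GS₂ κ t τ τ t d d = GS₂ .roumieu s σ σ s d d)
    (ha : a.MemFun (GammaWeight w σ s)) : b.MemFun (GammaWeight w σ s) := by
  have hp := hw.isWeight.pos
  have hmem : ∀ f, f ∈ GammaWeight w σ s ↔ _ := fun f =>
    forall_symbolNorm_lt_top_iff (f := f) hp H.pos_σ.le H.pos_s.le
  refine ha.of_window H₀ fun φ hφ hφw f hf hfa => ?_
  have hs := (hmem f).1 hf
  obtain ⟨r, B, hr, hB, hv⟩ := hw.isModerate
  suffices ∃ F, b.IsGivenBy F ∧ ∀ h : ℝ, 0 < h → ∃ M, GevreyBound σ s h (fun x => M * w x) F by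
    obtain ⟨F, hF, hFs⟩ := this
    exact ⟨F, (hmem F).2 hFs, hF⟩
  have hconst : (∃ F, b.IsGivenBy F ∧ ∀ h : ℝ, 0 < h → ∃ M, GevreyBound σ s h
      (fun x => M * (B * (B * w x))) F) → ∃ F, b.IsGivenBy F ∧
        ∀ h : ℝ, 0 < h → ∃ M, GevreyBound σ s h (fun x => M * w x) F := by
    rintro ⟨F, hF, hFs⟩
    refine ⟨F, hF, fun h hh => ?_⟩
    obtain ⟨M, hM⟩ := hFs h hh
    exact ⟨M * B * B, GevreyBound.mono_weight hh hM fun x => le_of_eq (by ring)⟩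
  rcases hE with hE | hE
  · exact hconst (hab.exists_moderate H hE hφ hφw.integral_ne_zero hv hp hfa hs)
  have hφ' : φ ∈ GS₂ .roumieu s σ σ s d d := hE ▸ hφ
  have hslow : ∀ h : ℝ, 0 < h → SlowGrowth s σ σ s h f := by
    obtain ⟨r', D, hr', hD, hb⟩ := hw.bounds
    refine fun h hh => hφw.slowGrowth H.pos_s H.pos_σ H.pos_σ.le H.pos_s.le hφ'
      (fun g hg => (hfa ⟨g, hE ▸ hg⟩).1) hr' (fun h hh => ?_) hh
    obtain ⟨M, hM⟩ := hs h hh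
    refine ⟨M * D, GevreyBound.mono_weight hh hM fun x => ?_⟩
    rw [mul_assoc]
    exact mul_le_mul_of_nonneg_left (hb x).2 (hM.nonneg_of_pos hp)
  rcases H.sum.eq_or_lt with h1 | h1
  · refine hab.exists_of_windows H hE.le hφ hφw.integral_ne_zero hfa hslow fun h hh =>
      H.hasWindow_of_eq_one (by linarith) (by linarith) hφ' hφw.integral_ne_zero hp
        (fun x z => ⟨B * w x * expWeight s σ r z, fun u hu => ?_⟩) hs hh
    refine (hv.left (u • z) x).trans (mul_le_mul_of_nonneg_left ?_ (mul_pos hB (hp x)).le)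
    have hn : ∀ y : V d, ‖u • y‖ ≤ ‖y‖ := fun y => by
      rw [norm_smul, Real.norm_of_nonneg hu.1]
      exact mul_le_of_le_one_left (norm_nonneg _) hu.2
    exact Real.exp_le_exp.2 (mul_le_mul_of_nonneg_left (add_le_add
      (Real.rpow_le_rpow (norm_nonneg _) (hn z.1) (one_div_pos.2 H.pos_s).le)
      (Real.rpow_le_rpow (norm_nonneg _) (hn z.2) (one_div_pos.2 H.pos_σ).le)) hr.le)
  · exact hconst (hab.exists_of_windows H hE.le hφ hφw.integral_ne_zero hfa hslow fun h hh =>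
      H.hasWindow_of_one_lt (by linarith) (by linarith) hφ' hφw hv hr hp hs hh)

end IsShift

end Conclusions

end GelfandShilov

end

open GelfandShilov in
theorem mainTheorem5 (d : ℕ) (s s₁ s₂ σ σ₁ σ₂ : ℝ)
    (hs : 0 < s) (hs₁ : 0 < s₁) (hs₂ : 0 < s₂) (hσ : 0 < σ) (hσ₁ : 0 < σ₁) (hσ₂ : 0 < σ₂)
    (hsσ : 1 ≤ s + σ) (hsσ₁ : 1 ≤ s₁ + σ₁) (hsσ₂ : 1 ≤ s₂ + σ₂)
    (hs₂₁ : s₂ ≤ s₁) (hσ₁₂ : σ₁ ≤ σ₂)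
    (A B : Matrix (Fin d) (Fin d) ℝ)
    (w : V d × V d → ℝ) (hw : IsPWeight s σ w)
    (κ : Kind) (t τ : ℝ) (ht : 0 < t) (hτ : 0 < τ) (htτ : 1 ≤ t + τ)
    (a b : GSDual κ t τ τ t d d) (hab : Op A a = Op B b) :
    -- the spaces `𝒮` and their duals
    ((a.MemFun (GS₂ .roumieu s₁ σ₂ σ₁ s₂ d d) ↔ b.MemFun (GS₂ .roumieu s₁ σ₂ σ₁ s₂ d d)) ∧
      (a.MemDual .roumieu s₁ σ₂ σ₁ s₂ ↔ b.MemDual .roumieu s₁ σ₂ σ₁ s₂)) ∧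
    -- the spaces `Σ` and their duals
    ((a.MemFun (GS₂ .beurling s₁ σ₂ σ₁ s₂ d d) ↔ b.MemFun (GS₂ .beurling s₁ σ₂ σ₁ s₂ d d)) ∧
      (a.MemDual .beurling s₁ σ₂ σ₁ s₂ ↔ b.MemDual .beurling s₁ σ₂ σ₁ s₂)) ∧
    -- the classes with exponential weights
    ((GS₂ κ t τ τ t d d ≤ GS₂ .roumieu s σ σ s d d →
        (a.MemFun (GammaLow s σ σ s d d) ↔ b.MemFun (GammaLow s σ σ s d d))) ∧
      ((s, σ) ≠ (1 / 2, 1 / 2) →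
        ((GS₂ κ t τ τ t d d ≤ GS₂ .beurling s σ σ s d d ∨
            GS₂ κ t τ τ t d d = GS₂ .roumieu s σ σ s d d) →
          (a.MemFun (GammaUp s σ σ s d d) ↔ b.MemFun (GammaUp s σ σ s d d))) ∧
        (GS₂ κ t τ τ t d d ≤ GS₂ .roumieu s σ σ s d d →
          (a.MemFun (GammaLowUp s σ σ s d d) ↔ b.MemFun (GammaLowUp s σ σ s d d))))) ∧
    -- the classes with general weights
    ((GS₂ κ t τ τ t d d ≤ GS₂ .beurling s σ σ s d d ∨
        GS₂ κ t τ τ t d d = GS₂ .roumieu s σ σ s d d) →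
      (a.MemFun (GammaWeight w σ s) ↔ b.MemFun (GammaWeight w σ s))) := by
  have H₀ : Admissible t τ τ t := .of_one_le_add ht hτ htτ
  have H₁ : Admissible s₁ σ₂ σ₁ s₂ := ⟨hs₂, hs₂₁, hσ₁, hσ₁₂, hsσ₂⟩
  have H : Admissible s σ σ s := .of_one_le_add hs hσ hsσ
  have hAB : IsShift H₀ (matrixMap A - matrixMap B) a b := fun g => symbol_eq_shift H₀ hab g
  have hBA : IsShift H₀ (matrixMap B - matrixMap A) b a := fun g => symbol_eq_shift H₀ hab.symm g
  exact ⟨⟨⟨hAB.memFun_GS H₁, hBA.memFun_GS H₁⟩, hAB.memDual H₁, hBA.memDual H₁⟩,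
    ⟨⟨hAB.memFun_GS H₁, hBA.memFun_GS H₁⟩, hAB.memDual H₁, hBA.memDual H₁⟩,
    ⟨fun hE => ⟨hAB.memFun_gammaLow H hE, hBA.memFun_gammaLow H hE⟩, fun _ =>
      ⟨fun hE => ⟨hAB.memFun_gammaUp H hE, hBA.memFun_gammaUp H hE⟩,
        fun hE => ⟨hAB.memFun_gammaLowUp H hE, hBA.memFun_gammaLowUp H hE⟩⟩⟩,
    fun hE => ⟨hAB.memFun_gammaWeight H hw hE, hBA.memFun_gammaWeight H hw hE⟩⟩
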